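/- Let $k$ be a field, $f\in k[x]$ a monic irreducible separable polynomial of degree $N$, $K$ a splitting field of $f$ over $k$, and $\alpha_1,\dots,\alpha_N\in K$ the roots of $f$, so that $f=\prod_i (x-\alpha_i)$ in $K[x]$. Suppose that $\mathrm{Gal}(K/k)\cong S_N$; then $S_N=\mathrm{Gal}(K/k)$ acts on $K$ by permuting the roots. For a composition $\underline a=(a_1,\dots,a_m)$ of $N$ (with $a_i\ge 1$) let $S_{\underline a}=S_{a_1}\times\dots\times S_{a_m}\subset S_N$ be the parabolic subgroup preserving the consecutive blocks of sizes $a_1,\dots,a_m$, and $K^{S_{\underline a}}$ its fixed field. *Foams and state spaces.* A $\mathsf{GL}(N)$ foam is a compact two-dimensional complex, given by a decomposition into polygons, whose oriented facets have thicknesses in $\{1,\dots,N\}$; facets of thicknesses $a$ and $b$ merge into a facet of thickness $a+b$ along oriented seams, at which the three facets are cyclically ordered (as by an embedding in $\mathbb R^3$); at isolated singular vertices two ways of merging facets of thicknesses $a,b,c$ into one of thickness $a+b+c$ meet. A facet of thickness $a$ may carry dots labelled by symmetric polynomials over $\mathbb Z$ in $a$ variables. A coloring $c$ assigns to each facet of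 thickness $a$ a set of $a$ elements of $\{1,\dots,N\}$, additively at seams. A closed foam $F$ is evaluated by the Robert--Wagner formula at the roots of $f$: $$\langle F\rangle_\phi=\sum_c(-1)^{s(F,c)}\,\frac{P(F,c)}{\prod_{i<j}(\alpha_i-\alpha_j)^{\chi(F_{ij}(c))/2}},\qquad s(F,c)=\sum_i i\,\chi(F_i(c))/2+\sum_{i<j}\theta^+_{ij}(F,c),$$ where $F_i(c)$ (respectively $F_{ij}(c)$) is the union of the facets colored by a set containing $i$ (respectively exactly one of $i,j$), $P(F,c)$ is the product over all dots of their labels evaluated at the roots $\alpha_i$ with $i$ in the color of the facet, and $\theta_{ij}^+(F,c)$ counts the positive circles among those formed by the seams at which a facet with color $i$ and a facet with color $j$ merge; a circle is positive if the facet with $j$ follows the facet with $i$ in the cyclic order. (This is the image of the evaluation in $\mathbb Z[x_1,\dots,x_N]^{S_N}$ under the homomorphism $\phi$ sending the $i$-th elementary symmetric polynomial to $e_i(\alpha_1,\dots,\alpha_N)$.) The $\phi$-state space $\langle\Gamma\rangle_\phi$ of a web $\Gamma$ is the $k$-vector space spanned by all foams with boundary $\Gamma$, modulo those linear combinations $\sum_r\lambda_rF_r$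 for which $\sum_r\lambda_r\langle F_r\cup G\rangle_\phi=0$ for all foams $G$ that can be glued to $\Gamma$. A foam between two webs induces a linear map of state spaces by gluing. Let $\Gamma_{\underline a}$ be the web in which lines of weights $a_1,\dots,a_m$, from left to right, merge into a line of weight $N$, which goes around and splits off into the original lines, symmetrically with respect to an axis crossing all lines; the order of the merges is given by any binary tree with leaves $a_1,\dots,a_m$. The foam that rotates half of $\Gamma_{\underline a}$ about the axis defines an element $1\in\langle\Gamma_{\underline a}\rangle_\phi$, and the saddle foam (half a pair of pants times the tree) from two copies of $\Gamma_{\underline a}$ to one defines a multiplication on $\langle\Gamma_{\underline a}\rangle_\phi$. **Claim.** There are $k$-linear ring isomorphisms (for all $\underline a$ and all orders of merging) $$\Phi_{\underline a}:\ \langle\Gamma_{\underline a}\rangle_\phi\ \xrightarrow{\ \cong\ }\ K^{S_{\underline a}}$$ with the following property. Let $\underline b$ be the composition that arises from $\underline a$ by replacing consecutive parts $a_p,a_{p+1}$ by $a_p+a_{p+1}$, let the order of merging for $\underline a$ be that for $\underline b$, preceded by the merging of $a_p$ and $a_{p+1}$, and let $e=\prod_{i,j}(\alpha_j-\alpha_i)\in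 K^{S_{\underline a}}$, over $i$ in the $p$-th and $j$ in the $(p+1)$-st block of $\underline a$. Then $K^{S_{\underline b}}\subset K^{S_{\underline a}}$; the foam $\Gamma_{\underline b}\to\Gamma_{\underline a}$ that opens the line of weight $a_p+a_{p+1}$ into lines of weights $a_p$ and $a_{p+1}$ along one seam arc induces, under the isomorphisms $\Phi$, the inclusion $K^{S_{\underline b}}\subset K^{S_{\underline a}}$; and the reflected foam $\Gamma_{\underline a}\to\Gamma_{\underline b}$, that closes these two lines up, induces the map $y\mapsto\mathrm{Tr}_{K^{S_{\underline a}}/K^{S_{\underline b}}}(y/e)$. -/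

import Mathlib

namespace Foams

/-! ### Webs and foams

Foams are given by a decomposition of the underlying two-dimensional complex into oriented polygons.
The *sides* of these polygons are the elements of the type `Side`.  Every edge of the decomposition
is of one of the following kinds.
* A regular edge `r : R`, in the interior of a facet (or between two polygons of a facet).
  It has two sides `reg r true`, `reg r false`, which run in the direction of `r` and against it.
* A seam edge `s : S`, along which two thin facets merge into a thick one.  It has three sides:
  `thin s false` and `thin s true` run in the direction of `s`, and `thick s` runs against it.
  The cyclic order (`thin s false`, `thin s true`, `thick s`) of the three facets around the seam is
  the one which an embedding of the foam in three-space provides (counterclockwise, looking in the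
  direction of the seam).
* An edge `e` of the web at the bottom or at the top.  It has one side, `bot e` or `top e`;
  `top e` runs in the direction of `e`, and `bot e` runs against it.

The evaluation of a foam depends on an embedding in three-space through the cyclic orders at the seams
only; the foams here carry these cyclic orders, compatible at every vertex with a planar drawing of
its link, and no further embedding. -/

/-- Sides of the polygons of a foam. -/
inductive Side (R S E₀ E₁ : Type) : Type
  | reg (r : R) (b : Bool)
  | thin (s : S) (b : Bool)
  | thick (s : S)
  | bot (e : E₀)
  | top (e : E₁)

/-- Two sides of one edge that run in opposite directions. -/
inductive Side.Opp {R S E₀ E₁ : Type} : Side R S E₀ E₁ → Side R S E₀ E₁ → Prop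
  | reg (r : R) (b : Bool) : Side.Opp (.reg r b) (.reg r (!b))
  | thinThick (s : S) (b : Bool) : Side.Opp (.thin s b) (.thick s)
  | thickThin (s : S) (b : Bool) : Side.Opp (.thick s) (.thin s b)

/-- A web: oriented edges `E` with weights `wt`, and vertices of three kinds.
`pass e e'`: the edge `e` ends, and `e'` starts, at a bivalent vertex (a mere subdivision point).
`merge e₀ e₁ e`: the edges `e₀` (on the left) and `e₁` (on the right) merge into `e`.
`split e e₀ e₁`: the edge `e` splits into `e₀` (on the left) and `e₁` (on the right). -/
structure Web where
  E : Type
  finE : Finite E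
  wt : E → ℕ
  pass : E → E → Prop
  merge : E → E → E → Prop
  split : E → E → E → Prop

/-- The empty web. -/
abbrev Web.empty : Web where
  E := Empty
  finE := inferInstance
  wt := fun _ => 0
  pass := fun _ _ => False
  merge := fun _ _ _ => False
  split := fun _ _ _ => False

/-- The disjoint union of two webs. -/
abbrev Web.sum (Γ Γ' : Web) : Web where
  E := Γ.E ⊕ Γ'.E
  finE := by
    have := Γ.finE
    have := Γ'.finE
    infer_instance
  wt := Sum.elim Γ.wt Γ'.wt
  pass := fun e f =>
    (∃ e' f', e = .inl e' ∧ f = .inl f' ∧ Γ.pass e' f') ∨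
    (∃ e' f', e = .inr e' ∧ f = .inr f' ∧ Γ'.pass e' f')
  merge := fun e f g =>
    (∃ e' f' g', e = .inl e' ∧ f = .inl f' ∧ g = .inl g' ∧ Γ.merge e' f' g') ∨
    (∃ e' f' g', e = .inr e' ∧ f = .inr f' ∧ g = .inr g' ∧ Γ'.merge e' f' g')
  split := fun e f g =>
    (∃ e' f' g', e = .inl e' ∧ f = .inl f' ∧ g = .inl g' ∧ Γ.split e' f' g') ∨
    (∃ e' f' g', e = .inr e' ∧ f = .inr f' ∧ g = .inr g' ∧ Γ'.split e' f' g')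

/-- The data of a foam with bottom boundary `Γ₀` and top boundary `Γ₁`: the side `next d` follows
the side `d` in the boundary of the same polygon, in the direction of the orientation of the facet;
`wt d` is the thickness of the facet to which `d` belongs; `dot d` is a dot that floats on this
facet, labelled by a symmetric polynomial in `wt d` variables (the decoration of a facet is the
product of all its dots).  The conditions on these data are in `Foam.IsFoam`. -/
structure Foam (Γ₀ Γ₁ : Web) where
  R : Type
  S : Type
  finR : Finite R
  finS : Finite S
  next : Side R S Γ₀.E Γ₁.E → Side R S Γ₀.E Γ₁.E
  wt : Side R S Γ₀.E Γ₁.E → ℕ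
  dot : ∀ d, MvPolynomial.symmetricSubalgebra (Fin (wt d)) ℤ

namespace Foam

variable {Γ₀ Γ₁ Γ₂ Γ Γ' : Web}

/-- The sides of the polygons of `F`. -/
abbrev Sd (F : Foam Γ₀ Γ₁) : Type := Side F.R F.S Γ₀.E Γ₁.E

/-! The corner between `d` and `next d` is also denoted by `d`.  It is an arc of the link of a
vertex; it goes from the (end of the) edge of `d` to the (start of the) edge of `next d`. -/

/-- `d'` is the corner that follows the corner `d` in the link across a regular edge. -/
def Step (F : Foam Γ₀ Γ₁) (d d' : F.Sd) : Prop :=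
  ∃ r b, F.next d = .reg r b ∧ d' = .reg r (!b)

/-- The link of a vertex has a path, crossing regular edges only, from the side `x`, which runs
towards the vertex, to the side `y`, which runs away from it. -/
def Arc (F : Foam Γ₀ Γ₁) (x y : F.Sd) : Prop :=
  ∃ d, Relation.ReflTransGen F.Step x d ∧ F.next d = y

/-- The seam passes from `s` to `m` through a vertex, whose link is a theta graph. -/
def Theta (F : Foam Γ₀ Γ₁) (s m : F.S) : Prop :=
  (∀ b, F.Arc (.thin s b) (.thin m b)) ∧ F.Arc (.thick m) (.thick s)

/-- `s₁`, `s₂` end and `m₁`, `m₂` start at a singular vertex of the foam, whose link is the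
tetrahedral web
in which `a+b+c` splits into `a` and `b+c` at `s₁`, `b+c` splits into `b` and `c` at `s₂`,
`a` and `b` merge at `m₁`, and `a+b` and `c` merge into `a+b+c` at `m₂`.
The bit `b` tells whether `a`, `b`, `c` are ordered from left to right or from right to left. -/
def Tetra (F : Foam Γ₀ Γ₁) (b : Bool) (s₁ s₂ m₁ m₂ : F.S) : Prop :=
  F.Arc (.thin s₁ b) (.thin m₁ b) ∧ F.Arc (.thin s₁ (!b)) (.thick s₂) ∧
  F.Arc (.thin s₂ b) (.thin m₁ (!b)) ∧ F.Arc (.thin s₂ (!b)) (.thin m₂ (!b)) ∧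
  F.Arc (.thick m₁) (.thin m₂ b) ∧ F.Arc (.thick m₂) (.thick s₁)

/-- The seam edge `s` starts at the vertex of the top web where `e₀` and `e₁` merge into `e`. -/
def TopMerge (F : Foam Γ₀ Γ₁) (s : F.S) (e₀ e₁ e : Γ₁.E) : Prop :=
  F.Arc (.top e₀) (.thin s false) ∧ F.Arc (.top e₁) (.thin s true) ∧ F.Arc (.thick s) (.top e)

/-- The seam edge `s` ends at the vertex of the top web where `e` splits into `e₀` and `e₁`. -/
def TopSplit (F : Foam Γ₀ Γ₁) (s : F.S) (e e₀ e₁ : Γ₁.E) : Prop :=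
  F.Arc (.thin s false) (.top e₀) ∧ F.Arc (.thin s true) (.top e₁) ∧ F.Arc (.top e) (.thick s)

/-- The seam edge `s` ends at the vertex of the bottom web where `e₀` and `e₁` merge into `e`. -/
def BotMerge (F : Foam Γ₀ Γ₁) (s : F.S) (e₀ e₁ e : Γ₀.E) : Prop :=
  F.Arc (.thin s false) (.bot e₀) ∧ F.Arc (.thin s true) (.bot e₁) ∧ F.Arc (.bot e) (.thick s)

/-- The seam edge `s` starts at the vertex of the bottom web where `e` splits into `e₀`, `e₁`. -/
def BotSplit (F : Foam Γ₀ Γ₁) (s : F.S) (e e₀ e₁ : Γ₀.E) : Prop :=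
  F.Arc (.bot e₀) (.thin s false) ∧ F.Arc (.bot e₁) (.thin s true) ∧ F.Arc (.thick s) (.bot e)

/-- The conditions for `F` to be a `GL(N)` foam: `next` goes around polygons, thicknesses are
constant on facets, lie between `1` and `N`, and add up at seams, and the link of every vertex is a
circle, a theta graph or the tetrahedral web (for an interior vertex), an interval or a tripod
(for a vertex on the boundary). -/
structure IsFoam (N : ℕ) (F : Foam Γ₀ Γ₁) : Prop where
  bij : Function.Bijective F.next
  wt_pos : ∀ d, 0 < F.wt d
  wt_le : ∀ d, F.wt d ≤ N
  wt_next : ∀ d, F.wt (F.next d) = F.wt d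
  wt_reg : ∀ r, F.wt (.reg r true) = F.wt (.reg r false)
  wt_seam : ∀ s, F.wt (.thick s) = F.wt (.thin s false) + F.wt (.thin s true)
  wt_bot : ∀ e, F.wt (.bot e) = Γ₀.wt e
  wt_top : ∀ e, F.wt (.top e) = Γ₁.wt e
  seam_end : ∀ s : F.S, (∃ m, F.Theta s m) ∨
    (∃ b s' m₁ m₂, F.Tetra b s s' m₁ m₂ ∨ F.Tetra b s' s m₁ m₂) ∨
    (∃ e e₀ e₁, Γ₁.split e e₀ e₁ ∧ F.TopSplit s e e₀ e₁) ∨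
    (∃ e₀ e₁ e, Γ₀.merge e₀ e₁ e ∧ F.BotMerge s e₀ e₁ e)
  seam_start : ∀ m : F.S, (∃ s, F.Theta s m) ∨
    (∃ b s₁ s₂ m', F.Tetra b s₁ s₂ m m' ∨ F.Tetra b s₁ s₂ m' m) ∨
    (∃ e₀ e₁ e, Γ₁.merge e₀ e₁ e ∧ F.TopMerge m e₀ e₁ e) ∨
    (∃ e e₀ e₁, Γ₀.split e e₀ e₁ ∧ F.BotSplit m e e₀ e₁)
  top_pass : ∀ e e', Γ₁.pass e e' → F.Arc (.top e) (.top e')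
  top_merge : ∀ e₀ e₁ e, Γ₁.merge e₀ e₁ e → ∃ s, F.TopMerge s e₀ e₁ e
  top_split : ∀ e e₀ e₁, Γ₁.split e e₀ e₁ → ∃ s, F.TopSplit s e e₀ e₁
  bot_pass : ∀ e e', Γ₀.pass e e' → F.Arc (.bot e') (.bot e)
  bot_merge : ∀ e₀ e₁ e, Γ₀.merge e₀ e₁ e → ∃ s, F.BotMerge s e₀ e₁ e
  bot_split : ∀ e e₀ e₁, Γ₀.split e e₀ e₁ → ∃ s, F.BotSplit s e e₀ e₁

/-! ### Gluing and disjoint union -/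

/-- Gluing along the web with edges `E₁` turns its edges into regular edges. -/
def glueSide {R S R' S' E₀ E₁ E₂ : Type} :
    Side R S E₀ E₁ ⊕ Side R' S' E₁ E₂ → Side (R ⊕ R' ⊕ E₁) (S ⊕ S') E₀ E₂
  | .inl (.reg r b) => .reg (.inl r) b
  | .inl (.thin s b) => .thin (.inl s) b
  | .inl (.thick s) => .thick (.inl s)
  | .inl (.bot e) => .bot e
  | .inl (.top e) => .reg (.inr (.inr e)) true
  | .inr (.reg r b) => .reg (.inr (.inl r)) b
  | .inr (.thin s b) => .thin (.inr s) b
  | .inr (.thick s) => .thick (.inr s)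
  | .inr (.bot e) => .reg (.inr (.inr e)) false
  | .inr (.top e) => .top e

/-- The inverse of `glueSide`. -/
def cutSide {R S R' S' E₀ E₁ E₂ : Type} :
    Side (R ⊕ R' ⊕ E₁) (S ⊕ S') E₀ E₂ → Side R S E₀ E₁ ⊕ Side R' S' E₁ E₂
  | .reg (.inl r) b => .inl (.reg r b)
  | .reg (.inr (.inl r)) b => .inr (.reg r b)
  | .reg (.inr (.inr e)) true => .inl (.top e)
  | .reg (.inr (.inr e)) false => .inr (.bot e)
  | .thin (.inl s) b => .inl (.thin s b)
  | .thin (.inr s) b => .inr (.thin s b)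
  | .thick (.inl s) => .inl (.thick s)
  | .thick (.inr s) => .inr (.thick s)
  | .bot e => .inl (.bot e)
  | .top e => .inr (.top e)

/-- The dots of two foams, side by side. -/
def sumDot {Γ₃ : Web} (F : Foam Γ₀ Γ₁) (G : Foam Γ₂ Γ₃) :
    ∀ z : F.Sd ⊕ G.Sd,
      MvPolynomial.symmetricSubalgebra (Fin (Sum.elim F.wt G.wt z)) ℤ
  | .inl d => F.dot d
  | .inr d => G.dot d

/-- The composition of foams: `G` is glued on top of `F`. -/
def glue (F : Foam Γ₀ Γ₁) (G : Foam Γ₁ Γ₂) : Foam Γ₀ Γ₂ where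
  R := F.R ⊕ G.R ⊕ Γ₁.E
  S := F.S ⊕ G.S
  finR := by
    have := F.finR
    have := G.finR
    have := Γ₁.finE
    infer_instance
  finS := by
    have := F.finS
    have := G.finS
    infer_instance
  next := fun d => glueSide (Sum.map F.next G.next (cutSide d))
  wt := fun d => Sum.elim F.wt G.wt (cutSide d)
  dot := fun d => sumDot F G (cutSide d)

/-- Relabelling of sides for the disjoint union of two foams. -/
def unionSide {R S R' S' E E' : Type} :
    Side R S Empty E ⊕ Side R' S' Empty E' → Side (R ⊕ R') (S ⊕ S') Empty (E ⊕ E')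
  | .inl (.reg r b) => .reg (.inl r) b
  | .inl (.thin s b) => .thin (.inl s) b
  | .inl (.thick s) => .thick (.inl s)
  | .inl (.top e) => .top (.inl e)
  | .inr (.reg r b) => .reg (.inr r) b
  | .inr (.thin s b) => .thin (.inr s) b
  | .inr (.thick s) => .thick (.inr s)
  | .inr (.top e) => .top (.inr e)

/-- The inverse of `unionSide`. -/
def ununionSide {R S R' S' E E' : Type} :
    Side (R ⊕ R') (S ⊕ S') Empty (E ⊕ E') → Side R S Empty E ⊕ Side R' S' Empty E'
  | .reg (.inl r) b => .inl (.reg r b)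
  | .reg (.inr r) b => .inr (.reg r b)
  | .thin (.inl s) b => .inl (.thin s b)
  | .thin (.inr s) b => .inr (.thin s b)
  | .thick (.inl s) => .inl (.thick s)
  | .thick (.inr s) => .inr (.thick s)
  | .top (.inl e) => .inl (.top e)
  | .top (.inr e) => .inr (.top e)

/-- The disjoint union of two foams with boundary on the top. -/
def union (F : Foam Web.empty Γ) (G : Foam Web.empty Γ') : Foam Web.empty (Γ.sum Γ') where
  R := F.R ⊕ G.R
  S := F.S ⊕ G.S
  finR := by
    have := F.finR
    have := G.finR
    infer_instance
  finS := by
    have := F.finS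
    have := G.finS
    infer_instance
  next := fun d => unionSide (Sum.map F.next G.next (ununionSide d))
  wt := fun d => Sum.elim F.wt G.wt (ununionSide d)
  dot := fun d => sumDot F G (ununionSide d)

/-! ### Evaluation of closed foams (the Robert-Wagner formula) -/

/-- Vertices: components of the links, that is, corners up to crossing edges. -/
def Vertex (F : Foam Γ₀ Γ₁) : Type := Quot fun d d' : F.Sd => Side.Opp d (F.next d')

/-- Edges: sides up to passing to the other sides of the same edge. -/
def Edge (F : Foam Γ₀ Γ₁) : Type := Quot fun d d' : F.Sd => Side.Opp d d'

/-- Polygons: sides up to passing to the next side. -/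
def Face (F : Foam Γ₀ Γ₁) : Type := Quot fun d d' : F.Sd => F.next d = d'

/-- The vertex where the side `d` ends. -/
def vertex (F : Foam Γ₀ Γ₁) (d : F.Sd) : F.Vertex := Quot.mk _ d

/-- The edge along which the side `d` runs. -/
def edge (F : Foam Γ₀ Γ₁) (d : F.Sd) : F.Edge := Quot.mk _ d

/-- The polygon with the side `d`. -/
def face (F : Foam Γ₀ Γ₁) (d : F.Sd) : F.Face := Quot.mk _ d

/-- The Euler characteristic of the (closed) union of those polygons whose sides form `A`. -/
noncomputable def euler (F : Foam Γ₀ Γ₁) (A : Set F.Sd) : ℤ :=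
  ((F.vertex '' A).ncard : ℤ) - ((F.edge '' A).ncard : ℤ) + ((F.face '' A).ncard : ℤ)

/-- A coloring of a foam: every facet of thickness `a` gets a set of `a` pigments, and at a seam the
set of the thick facet is the disjoint union of the sets of the thin ones. -/
structure Coloring (N : ℕ) (F : Foam Γ₀ Γ₁) where
  c : F.Sd → Finset (Fin N)
  card : ∀ d, (c d).card = F.wt d
  next : ∀ d, c (F.next d) = c d
  reg : ∀ r, c (.reg r true) = c (.reg r false)
  disj : ∀ s, Disjoint (c (.thin s false)) (c (.thin s true))
  seam : ∀ s, c (.thick s) = c (.thin s false) ∪ c (.thin s true)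

namespace Coloring

variable {N : ℕ} {F : Foam Γ₀ Γ₁}

/-- The Euler characteristic of the surface formed by the facets with the pigment `i`. -/
noncomputable def mono (κ : Coloring N F) (i : Fin N) : ℤ :=
  F.euler {d | i ∈ κ.c d}

/-- The Euler characteristic of the surface formed by the facets with exactly one of the pigments
`i`, `j`. -/
noncomputable def bi (κ : Coloring N F) (i j : Fin N) : ℤ :=
  F.euler {d | Xor (i ∈ κ.c d) (j ∈ κ.c d)}

/-- For `i < j`: the number of positive circles among those formed by the seams where a facet with
`i` and a facet with `j` merge. A circle is positive if, in the cyclic order around its seams, the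
facet with `j` follows the facet with `i`. -/
noncomputable def theta (κ : Coloring N F) (i j : Fin N) : ℕ :=
  Nat.card (Quot fun s s' : {s : F.S // i ∈ κ.c (.thin s false) ∧ j ∈ κ.c (.thin s true)} =>
    F.vertex (.thin s.1 false) = F.vertex (.thick s'.1))

/-- The sign exponent of a colored foam (pigments are numbered from `1` to `N`). -/
noncomputable def sgn (κ : Coloring N F) : ℤ :=
  ∑ i : Fin N, ((i : ℤ) + 1) * (κ.mono i / 2) +
    ∑ i : Fin N, ∑ j ∈ Finset.Ioi i, (κ.theta i j : ℤ)

/-- The contribution of a coloring to the evaluation: `± P / Q`, where `P` is the product of the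
decorations, evaluated at the variables of the pigments of their facets, and `Q` is the product of
the `(x i - x j) ^ (χ / 2)` for `i < j` with `χ` the Euler characteristic of the `i`-`j`-surface. -/
noncomputable def value {L : Type*} [Field L] (x : Fin N → L) (κ : Coloring N F) : L :=
  (-1) ^ κ.sgn *
    (∏ᶠ d : F.Sd, MvPolynomial.aeval
      (fun t : Fin (F.wt d) => x ((κ.c d).orderEmbOfFin (κ.card d) t))
      (F.dot d : MvPolynomial (Fin (F.wt d)) ℤ)) /
    ∏ i : Fin N, ∏ j ∈ Finset.Ioi i, (x i - x j) ^ (κ.bi i j / 2)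

end Coloring

/-- The evaluation of a closed foam, with pairwise different elements `x i` of a field as values of
the `N` variables. It is the image of the evaluation in the ring of symmetric polynomials over `ℤ`
under the homomorphism that sends every elementary symmetric polynomial to its value at `x`. -/
noncomputable def eval {N : ℕ} {L : Type*} [Field L] (x : Fin N → L)
    (F : Foam Web.empty Web.empty) : L :=
  ∑ᶠ κ : Coloring N F, κ.value x

end Foam

/-! ### State spaces -/

/-- `GL(N)` foams with boundary `Γ` on the top. -/
def Below (N : ℕ) (Γ : Web) : Type 1 := {F : Foam Web.empty Γ // F.IsFoam N}

/-- `GL(N)` foams with boundary `Γ` at the bottom. -/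
def Above (N : ℕ) (Γ : Web) : Type 1 := {G : Foam Γ Web.empty // G.IsFoam N}

section StateSpace

variable (k : Type*) {K : Type*} [Field k] [Field K] [Algebra k K] {N : ℕ} (x : Fin N → K)

/-- The linear combinations of foams below `Γ` whose gluing with any foam above `Γ` evaluates
to zero. -/
noncomputable def stateKer (Γ : Web) : Submodule k (Below N Γ →₀ k) :=
  ⨅ G : Above N Γ, LinearMap.ker
    (Finsupp.linearCombination k fun F : Below N Γ => (F.1.glue G.1).eval x)

/-- The state space of the web `Γ` over `k` for the evaluation of foams at `x`: the vector space
spanned by all foams below `Γ`, modulo the kernel of the pairing with the foams above `Γ`. -/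
abbrev StateSpace (Γ : Web) : Type _ := (Below N Γ →₀ k) ⧸ stateKer k x Γ

/-- The class of a foam in the state space of its boundary. -/
noncomputable def cls {Γ : Web} (F : Foam Web.empty Γ) (h : F.IsFoam N) : StateSpace k x Γ :=
  (stateKer k x Γ).mkQ (Finsupp.single ⟨F, h⟩ 1)

/-- `T` is the map of state spaces which the foam `W` induces: glue `W` on top. -/
def Induces {Γ Γ' : Web} (W : Foam Γ Γ') (T : StateSpace k x Γ →ₗ[k] StateSpace k x Γ') : Prop :=
  ∀ (F : Foam Web.empty Γ) (h : F.IsFoam N),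
    ∃ h' : (F.glue W).IsFoam N, T (cls k x F h) = cls k x (F.glue W) h'

/-- `T` is the bilinear map of state spaces which the foam `W` induces. -/
def InducesMul {Γ Γ' Γ'' : Web} (W : Foam (Γ.sum Γ') Γ'')
    (T : StateSpace k x Γ →ₗ[k] StateSpace k x Γ' →ₗ[k] StateSpace k x Γ'') : Prop :=
  ∀ (F : Foam Web.empty Γ) (G : Foam Web.empty Γ') (hF : F.IsFoam N) (hG : G.IsFoam N),
    ∃ h : ((F.union G).glue W).IsFoam N,
      T (cls k x F hF) (cls k x G hG) = cls k x ((F.union G).glue W) h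

end StateSpace

/-! ### Theta webs -/

/-- A binary tree: an order in which lines of given weights merge into one line. -/
inductive MergeTree : Type
  | leaf (a : ℕ) : MergeTree
  | node (l r : MergeTree) : MergeTree

namespace MergeTree

/-- The weights of the lines, from left to right. -/
def leaves : MergeTree → List ℕ
  | leaf a => [a]
  | node l r => l.leaves ++ r.leaves

/-- The weight of the line into which all lines merge. -/
def size : MergeTree → ℕ
  | leaf a => a
  | node l r => l.size + r.size

/-- The inner nodes, where two lines merge; `none` is the root. -/
def Inner : MergeTree → Type
  | leaf _ => Empty
  | node l r => Option (l.Inner ⊕ r.Inner)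

theorem finite_inner : ∀ τ : MergeTree, Finite τ.Inner
  | leaf _ => inferInstanceAs (Finite Empty)
  | node l r => by
    have := finite_inner l
    have := finite_inner r
    exact inferInstanceAs (Finite (Option (l.Inner ⊕ r.Inner)))

instance (τ : MergeTree) : Finite τ.Inner := finite_inner τ

/-- The edges of a tree: `some (q, false)` and `some (q, true)` join the inner node `q` to its left
and right child, and `none` is the edge above the root. -/
abbrev Pos (τ : MergeTree) : Type := Option (τ.Inner × Bool)

/-- Edges of the left subtree as edges of the tree. -/
def posL {l r : MergeTree} : l.Pos → (node l r).Pos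
  | none => some (none, false)
  | some (q, b) => some (some (.inl q), b)

/-- Edges of the right subtree as edges of the tree. -/
def posR {l r : MergeTree} : r.Pos → (node l r).Pos
  | none => some (none, true)
  | some (q, b) => some (some (.inr q), b)

/-- The edge above an inner node. -/
def above : (τ : MergeTree) → τ.Inner → τ.Pos
  | leaf _, q => nomatch q
  | node _ _, none => none
  | node l _, some (.inl q) => posL (l.above q)
  | node _ r, some (.inr q) => posR (r.above q)

/-- The inner node below an edge, or `none` if there is a leaf below the edge. -/
def under : (τ : MergeTree) → τ.Pos → Option τ.Inner
  | leaf _, _ => none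
  | node _ _, none => some none
  | node l _, some (none, false) => (l.under none).map fun q => some (.inl q)
  | node _ r, some (none, true) => (r.under none).map fun q => some (.inr q)
  | node l _, some (some (.inl q), b) => (l.under (some (q, b))).map fun q => some (.inl q)
  | node _ r, some (some (.inr q), b) => (r.under (some (q, b))).map fun q => some (.inr q)

/-- The weight of an edge: the sum of the weights of the leaves below it. -/
def wt : (τ : MergeTree) → τ.Pos → ℕ
  | τ, none => τ.size
  | leaf _, some (q, _) => nomatch q
  | node l _, some (none, false) => l.size
  | node _ r, some (none, true) => r.size
  | node l _, some (some (.inl q), b) => l.wt (some (q, b))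
  | node _ r, some (some (.inr q), b) => r.wt (some (q, b))

/-- The web in which lines with the weights of the leaves merge, in the order given by the tree,
into a single line, which goes around and splits into the original lines, in the reversed order.
It is the union of the tree, drawn in the upper half plane with root on top, and of its mirror
image in the lower half plane, cut by the symmetry axis.
Every edge `p` of the tree gives an edge `(p, true)` in the upper half plane and its mirror image
`(p, false)` in the lower half plane, both oriented upwards, except `(none, false)`, the continuation
of `(none, true)` around the tree; the bivalent vertices lie on the axis. -/
abbrev web (τ : MergeTree) : Web where
  E := τ.Pos × Bool
  finE := inferInstance
  wt := fun e => τ.wt e.1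
  pass := fun e e' =>
    (∃ p, τ.under p = none ∧ e = (p, false) ∧ e' = (p, true)) ∨
    (e = (none, true) ∧ e' = (none, false))
  merge := fun e₀ e₁ e => ∃ q,
    e₀ = (some (q, false), true) ∧ e₁ = (some (q, true), true) ∧ e = (τ.above q, true)
  split := fun e e₀ e₁ => ∃ q,
    e = (τ.above q, false) ∧ e₀ = (some (q, false), false) ∧ e₁ = (some (q, true), false)

/-! For the foams below, think of the product of the tree with a surface: with a half disk, whose
boundary arc sweeps the rotation about the axis, for the unit, and with one half (a hexagon) of a
pair of pants, cut along the axes, for the multiplication. -/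

/-- The unit foam: the upper half of the web is rotated to the lower half about the axis. -/
noncomputable def unit (τ : MergeTree) : Foam Web.empty τ.web where
  R := Empty
  S := τ.Inner
  finR := inferInstance
  finS := inferInstance
  next
    | .top (none, true) => .top (none, false)
    | .top (some (q, b), true) => .thin q b
    | .top (p, false) =>
      match τ.under p with
      | none => .top (p, true)
      | some q => .thick q
    | .thin q b => .top (some (q, b), false)
    | .thick q => .top (τ.above q, true)
  wt
    | .top e => τ.wt e.1
    | .thin q b => τ.wt (some (q, b))
    | .thick q => τ.wt (τ.above q)
  dot := fun _ => 1

/-! In the multiplication foam, the three copies of the web are indexed by `Option Bool`: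
`some false` and `some true` are the two copies at the bottom, `none` is the one on the top.
A strip `j` joins half of the copy `j` to half of the copy `prv j`. -/

/-- The cyclic order of the three copies. -/
def nxt : Option Bool → Option Bool
  | some false => none
  | none => some true
  | some true => some false

/-- The inverse cyclic order of the three copies. -/
def prv : Option Bool → Option Bool
  | none => some false
  | some true => none
  | some false => some true

/-- The boundary side of the strip `j` over the tree edge `p`, in the copy `j`. -/
def upSide (τ : MergeTree) (j : Option Bool) (p : τ.Pos) :
    Side (Option Bool) (τ.Inner × Option Bool) (τ.web.sum τ.web).E τ.web.E :=
  match j with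
  | none => .top (p, true)
  | some false => .bot (.inl (p, false))
  | some true => .bot (.inr (p, false))

/-- The boundary side of the strip `nxt j` over the tree edge `p`, in the copy `j`. -/
def downSide (τ : MergeTree) (j : Option Bool) (p : τ.Pos) :
    Side (Option Bool) (τ.Inner × Option Bool) (τ.web.sum τ.web).E τ.web.E :=
  match j with
  | none => .top (p, false)
  | some false => .bot (.inl (p, true))
  | some true => .bot (.inr (p, true))

/-- The side that follows `upSide j p`. -/
def afterUp (τ : MergeTree) (j : Option Bool) :
    τ.Pos → Side (Option Bool) (τ.Inner × Option Bool) (τ.web.sum τ.web).E τ.web.E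
  | none => .reg j true
  | some (q, b) => .thin (q, j) b

/-- The side that follows `downSide j p`. -/
def afterDown (τ : MergeTree) (j : Option Bool) (p : τ.Pos) :
    Side (Option Bool) (τ.Inner × Option Bool) (τ.web.sum τ.web).E τ.web.E :=
  match τ.under p with
  | none => upSide τ j p
  | some q => .thick (q, nxt j)

/-- The multiplication foam, from two copies of the web to one: the upper half of the first copy
at the bottom is joined to the upper half of the top web, the lower half of the second copy
is joined to the lower half of the top web, and the other two halves are joined to each other. -/
noncomputable def mul (τ : MergeTree) : Foam (τ.web.sum τ.web) τ.web where
  R := Option Bool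
  S := τ.Inner × Option Bool
  finR := inferInstance
  finS := inferInstance
  next
    | .top (p, true) => afterUp τ none p
    | .top (p, false) => afterDown τ none p
    | .bot (.inl (p, false)) => afterUp τ (some false) p
    | .bot (.inl (p, true)) => afterDown τ (some false) p
    | .bot (.inr (p, false)) => afterUp τ (some true) p
    | .bot (.inr (p, true)) => afterDown τ (some true) p
    | .reg j true => downSide τ (prv j) none
    | .reg j false => .reg (nxt j) false
    | .thin (q, j) b => downSide τ (prv j) (some (q, b))
    | .thick (q, j) => upSide τ j (τ.above q)
  wt
    | .top e => τ.wt e.1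
    | .bot (.inl e) => τ.wt e.1
    | .bot (.inr e) => τ.wt e.1
    | .reg _ _ => τ.size
    | .thin (q, _) b => τ.wt (some (q, b))
    | .thick (q, _) => τ.wt (τ.above q)
  dot := fun _ => 1

/-- `Refine σ τ`: the tree `τ` arises from `σ` when one leaf of weight `a + b` is replaced by a node
with two leaves of weights `a` and `b`. -/
inductive Refine : MergeTree → MergeTree → Type
  | here (a b : ℕ) : Refine (leaf (a + b)) (node (leaf a) (leaf b))
  | left {l l' : MergeTree} (ρ : Refine l l') (r : MergeTree) : Refine (node l r) (node l' r)
  | right (l : MergeTree) {r r' : MergeTree} (ρ : Refine r r') : Refine (node l r) (node l r')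

namespace Refine

/-- The number of leaves to the left of the leaf that is replaced. -/
def idx : {σ τ : MergeTree} → Refine σ τ → ℕ
  | _, _, here _ _ => 0
  | _, _, left ρ _ => ρ.idx
  | _, _, right l ρ => l.leaves.length + ρ.idx

/-- The new inner node. -/
def new : {σ τ : MergeTree} → Refine σ τ → τ.Inner
  | _, _, here _ _ => (none : Option (Empty ⊕ Empty))
  | _, _, left ρ _ => some (.inl ρ.new)
  | _, _, right _ ρ => some (.inr ρ.new)

/-- The old inner nodes. -/
def old : {σ τ : MergeTree} → Refine σ τ → σ.Inner → τ.Inner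
  | _, _, here _ _, q => nomatch q
  | _, _, left _ _, none => none
  | _, _, left ρ _, some (.inl q) => some (.inl (ρ.old q))
  | _, _, left _ _, some (.inr q) => some (.inr q)
  | _, _, right _ _, none => none
  | _, _, right _ _, some (.inl q) => some (.inl q)
  | _, _, right _ ρ, some (.inr q) => some (.inr (ρ.old q))

/-- The inverse of `old`; the value `none` is taken at the new node. -/
def back : {σ τ : MergeTree} → Refine σ τ → τ.Inner → Option σ.Inner
  | _, _, here _ _, _ => none
  | _, _, left _ _, none => some none
  | _, _, left ρ _, some (.inl q) => (ρ.back q).map fun q => some (.inl q)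
  | _, _, left _ _, some (.inr q) => some (some (.inr q))
  | _, _, right _ _, none => some none
  | _, _, right _ _, some (.inl q) => some (some (.inl q))
  | _, _, right _ ρ, some (.inr q) => (ρ.back q).map fun q => some (.inr q)

variable {σ τ : MergeTree}

/-- The foam from the web of `σ` to the web of `τ` that is a cylinder except that the line of weight
`a + b` opens up into two lines of weights `a` and `b`, along a single seam arc `inr ()`. The seam
`inl (q, true)` or `inl (q, false)` is the track of the vertex where the lines at `q` merge or
split; the only regular edge is the track of the bivalent vertex at the root. -/
noncomputable def opening (ρ : Refine σ τ) : Foam σ.web τ.web where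
  R := Unit
  S := σ.Inner × Bool ⊕ Unit
  finR := inferInstance
  finS := inferInstance
  next
    | .top (none, true) => .reg () true
    | .top (some (q, b), true) =>
      match ρ.back q with
      | none => .thin (.inr ()) b
      | some q' => .thin (.inl (q', true)) b
    | .top (p, false) =>
      match τ.under p with
      | none => .top (p, true)
      | some q =>
        match ρ.back q with
        | none => .thick (.inr ())
        | some q' => .thick (.inl (q', false))
    | .bot (none, false) => .reg () false
    | .bot (some (q, b), false) => .thin (.inl (q, false)) b
    | .bot (p, true) =>
      match σ.under p with
      | none => .bot (p, false)
      | some q => .thick (.inl (q, true))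
    | .reg _ true => .bot (none, true)
    | .reg _ false => .top (none, false)
    | .thin (.inl (q, true)) b => .bot (some (q, b), true)
    | .thin (.inl (q, false)) b => .top (some (ρ.old q, b), false)
    | .thin (.inr _) b => .top (some (ρ.new, b), false)
    | .thick (.inl (q, true)) => .top (τ.above (ρ.old q), true)
    | .thick (.inl (q, false)) => .bot (σ.above q, false)
    | .thick (.inr _) => .top (τ.above ρ.new, true)
  wt
    | .top e => τ.wt e.1
    | .bot e => σ.wt e.1
    | .reg _ _ => σ.size
    | .thin (.inl (q, _)) b => σ.wt (some (q, b))
    | .thin (.inr _) b => τ.wt (some (ρ.new, b))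
    | .thick (.inl (q, _)) => σ.wt (σ.above q)
    | .thick (.inr _) => τ.wt (τ.above ρ.new)
  dot := fun _ => 1

/-- Rotation by 180 degrees about the symmetry axis, on sides. -/
def flipSide {R S A B : Type} : Side R S (A × Bool) (B × Bool) → Side R S (B × Bool) (A × Bool)
  | .reg r b => .reg r b
  | .thin s b => .thin s b
  | .thick s => .thick s
  | .bot (p, u) => .top (p, !u)
  | .top (p, u) => .bot (p, !u)

/-- The foam `opening` read backwards, rotated by 180 degrees about the symmetry axis of the webs:
the two lines of weights `a` and `b` close up to a line of weight `a + b`. -/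
noncomputable def closing (ρ : Refine σ τ) : Foam τ.web σ.web where
  R := ρ.opening.R
  S := ρ.opening.S
  finR := ρ.opening.finR
  finS := ρ.opening.finS
  next := fun d => flipSide (ρ.opening.next (flipSide d))
  wt := fun d => ρ.opening.wt (flipSide d)
  dot := fun d => ρ.opening.dot (flipSide d)

end Refine

end MergeTree

/-! ### Parabolic subgroups and their fixed fields -/

/-- The parabolic subgroup of the symmetric group that preserves the blocks of `a`. -/
def parabolic {N : ℕ} (a : Composition N) : Subgroup (Equiv.Perm (Fin N)) where
  carrier := {π | ∀ i, a.index (π i) = a.index i}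
  one_mem' := fun _ => rfl
  mul_mem' := fun {π π'} h h' i => (h (π' i)).trans (h' i)
  inv_mem' := fun {π} h i => by
    have := h (π⁻¹ i)
    simpa using this.symm

section Galois

variable (k : Type*) {K : Type*} [Field k] [Field K] [Algebra k K] {N : ℕ} (α : Fin N → K)

/-- The automorphisms that permute the roots `α i` by elements of the parabolic subgroup. -/
def parabolicGal (a : Composition N) : Subgroup (K ≃ₐ[k] K) where
  carrier := {g | ∃ π ∈ parabolic a, ∀ i, g (α i) = α (π i)}
  one_mem' := ⟨1, one_mem _, fun _ => rfl⟩
  mul_mem' := by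
    rintro g g' ⟨π, hπ, h⟩ ⟨π', hπ', h'⟩
    refine ⟨π * π', mul_mem hπ hπ', fun i => ?_⟩
    rw [AlgEquiv.mul_apply, h', h, Equiv.Perm.mul_apply]
  inv_mem' := by
    rintro g ⟨π, hπ, h⟩
    refine ⟨π⁻¹, inv_mem hπ, fun i => ?_⟩
    apply g.injective
    rw [h, ← AlgEquiv.mul_apply, mul_inv_cancel]
    simp

/-- The fixed field of the parabolic subgroup of the composition `a`. -/
def parabolicField (a : Composition N) : IntermediateField k K :=
  IntermediateField.fixedField (parabolicGal k α a)

/-- The product of the differences `α j - α i`, for `i` in the block number `p` (counted from `0`)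
and `j` in the next block. -/
noncomputable def eulerClass (a : Composition N) (p : ℕ) : K :=
  ∏ i : Fin N, ∏ j : Fin N,
    if (a.index i : ℕ) = p ∧ (a.index j : ℕ) = p + 1 then α j - α i else 1

end Galois

end Foams

noncomputable section

namespace Equiv.Perm

variable {D : Type*}

/-- The number of orbits of a permutation. -/
def numOrbits (π : Perm D) : ℕ := Nat.card (Quotient (SameCycle.setoid π))

theorem numOrbits_eq_ncard {X : Type*} (π : Perm D) (g : D → X)
    (h : ∀ x y, g x = g y ↔ π.SameCycle x y) : π.numOrbits = (Set.range g).ncard := by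
  rw [numOrbits, ← Nat.card_coe_set_eq]
  refine Nat.card_congr (Equiv.ofBijective
    (Quotient.lift (fun x => (⟨g x, x, rfl⟩ : Set.range g)) fun x y hxy =>
      Subtype.ext ((h x y).2 hxy)) ⟨?_, ?_⟩)
  · rintro ⟨x⟩ ⟨y⟩ hxy
    exact Quotient.sound ((h x y).1 (congrArg Subtype.val hxy))
  · rintro ⟨_, x, rfl⟩
    exact ⟨Quotient.mk _ x, rfl⟩

theorem numOrbits_eq_card_quot (π : Perm D) [Finite D] (r : D → D → Prop)
    (h : ∀ x y, r x y ↔ y = π x) : π.numOrbits = Nat.card (Quot r) := by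
  refine Nat.card_congr ⟨Quotient.lift (Quot.mk r) ?_, Quot.lift (Quotient.mk _) ?_, ?_, ?_⟩
  · rintro x y hxy
    obtain ⟨n, rfl⟩ := SameCycle.exists_nat_pow_eq (f := π) hxy
    clear hxy
    induction n with
    | zero => rfl
    | succ n ih =>
      rw [ih]
      apply Quot.sound
      rw [h, pow_succ', mul_apply]
  · intro x y hxy
    rw [h] at hxy
    subst hxy
    exact Quotient.sound (sameCycle_apply_right.2 (SameCycle.refl π x))
  · rintro ⟨x⟩; rfl
  · rintro ⟨x⟩; rfl

theorem numOrbits_sumCongr {D' : Type*} [Finite D] [Finite D'] (π : Perm D) (π' : Perm D') :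
    numOrbits (Equiv.sumCongr π π') = π.numOrbits + π'.numOrbits := by
  have e : numOrbits (Equiv.sumCongr π π') = (Set.range (Sum.map
      (Quotient.mk (SameCycle.setoid π)) (Quotient.mk (SameCycle.setoid π')))).ncard := by
    have hl : ∀ (n : ℤ) x, (Equiv.sumCongr π π' ^ n) (Sum.inl x) = Sum.inl ((π ^ n) x) := by
      intro n x
      rw [show (Equiv.sumCongr π π' : Perm (D ⊕ D')) = Perm.sumCongrHom D D' (π, π') from rfl,
        ← map_zpow]
      rfl
    have hr : ∀ (n : ℤ) x, (Equiv.sumCongr π π' ^ n) (Sum.inr x) = Sum.inr ((π' ^ n) x) := by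
      intro n x
      rw [show (Equiv.sumCongr π π' : Perm (D ⊕ D')) = Perm.sumCongrHom D D' (π, π') from rfl,
        ← map_zpow]
      rfl
    apply numOrbits_eq_ncard
    rintro (x | x) (y | y)
    · simp only [Sum.map_inl, Sum.inl.injEq, Quotient.eq]
      exact exists_congr fun n => by rw [hl, Sum.inl.injEq]
    · simp only [Sum.map_inl, Sum.map_inr, reduceCtorEq, false_iff]
      rintro ⟨n, hn⟩
      rw [hl] at hn
      cases hn
    · simp only [Sum.map_inl, Sum.map_inr, reduceCtorEq, false_iff]
      rintro ⟨n, hn⟩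
      rw [hr] at hn
      cases hn
    · simp only [Sum.map_inr, Sum.inr.injEq, Quotient.eq]
      exact exists_congr fun n => by rw [hr, Sum.inr.injEq]
  rw [e, Function.Surjective.range_eq, Set.ncard_univ, Nat.card_sum]
  · rfl
  · exact Sum.map_surjective.2 ⟨Quotient.mk_surjective, Quotient.mk_surjective⟩

theorem sign_eq_pow_numOrbits [Fintype D] [DecidableEq D] (π : Perm D) :
    (sign π : ℤ) = (-1) ^ (Fintype.card D + π.numOrbits) := by
  classical
  have e : π.numOrbits = (Finset.univ.filter fun x => π x = x).card + π.cycleType.card := by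
    let g : D → D ⊕ Perm D := fun x => if π x = x then .inl x else .inr (π.cycleOf x)
    rw [numOrbits_eq_ncard π g]
    · have : Set.range g = (Sum.inl '' ↑(Finset.univ.filter fun x => π x = x)) ∪
          (Sum.inr '' (↑π.cycleFactorsFinset : Set (Perm D))) := by
        ext z
        constructor
        · rintro ⟨x, rfl⟩
          by_cases hx : π x = x
          · simp [g, hx]
          · simp [g, hx, cycleOf_mem_cycleFactorsFinset_iff]
        · rintro (⟨x, hx, rfl⟩ | ⟨c, hc, rfl⟩)
          · exact ⟨x, by simp at hx; simp [g, hx]⟩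
          · have hc' : c ∈ π.cycleFactorsFinset := hc
            obtain ⟨x, hx⟩ := (mem_cycleFactorsFinset_iff.1 hc').1.nonempty_support
            refine ⟨x, ?_⟩
            have h1 := mem_cycleFactorsFinset_support_le hc' hx
            rw [mem_support] at h1
            simp only [g, h1, if_false]
            rw [cycle_is_cycleOf hx hc']
      rw [this, Set.ncard_union_eq, Set.ncard_image_of_injective _ Sum.inl_injective,
        Set.ncard_image_of_injective _ Sum.inr_injective, Set.ncard_coe_finset,
        Set.ncard_coe_finset, cycleType_def]
      · simp
      · rw [Set.disjoint_left]
        rintro _ ⟨x, _, rfl⟩ ⟨y, _, h⟩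
        cases h
    · intro x y
      have key : π.SameCycle x y → (π x = x ↔ π y = y) := fun h => h.apply_eq_self_iff
      by_cases hx : π x = x <;> by_cases hy : π y = y <;> simp only [g, hx, hy, if_true, if_false]
      · rw [Sum.inl.injEq]
        exact ⟨fun h => h ▸ SameCycle.refl _ _, fun h => (h.eq_of_left hx)⟩
      · simp only [reduceCtorEq, false_iff]
        exact fun h => hy ((key h).1 hx)
      · simp only [reduceCtorEq, false_iff]
        exact fun h => hx ((key h).2 hy)
      · rw [Sum.inr.injEq]
        constructor
        · intro h
          have : y ∈ (π.cycleOf x).support := by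
            rw [h, mem_support, cycleOf_apply_self]
            exact hy
          exact (mem_support_cycleOf_iff.1 this).1
        · exact fun h => h.cycleOf_eq
  have h2 : (Finset.univ.filter fun x => π x = x).card + π.support.card = Fintype.card D := by
    rw [← Finset.card_univ, ← Finset.card_filter_add_card_filter_not (s := Finset.univ)
      (fun x => π x = x)]
    rfl
  rw [sign_of_cycleType, sum_cycleType, e]
  push_cast
  have : Fintype.card D + ((Finset.univ.filter fun x => π x = x).card + π.cycleType.card) =
    2 * (Finset.univ.filter fun x => π x = x).card + (π.support.card + π.cycleType.card) := by omega
  rw [this, pow_add _ (2 * _), pow_mul]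
  simp

theorem even_numOrbits [Finite D] (φ α : Perm D) (h2 : ∀ x, α (α x) = x) (h0 : ∀ x, α x ≠ x) :
    Even (φ.numOrbits + α.numOrbits + (α * φ).numOrbits) := by
  classical
  have := Fintype.ofFinite D
  have hs : (sign (α * φ) : ℤ) = sign α * sign φ := by simp
  rw [sign_eq_pow_numOrbits, sign_eq_pow_numOrbits, sign_eq_pow_numOrbits, ← pow_add] at hs
  have hev : Even (Fintype.card D) := by
    let α' : Function.End D := ⇑α
    have h3 : α' ^ 2 ^ 1 = 1 := by
      funext x
      exact h2 x
    have := Equiv.Perm.card_fixedPoints_modEq (p := 2) (n := 1) h3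
    have h4 : Fintype.card (Function.fixedPoints α') = 0 := by
      rw [Fintype.card_eq_zero_iff]
      exact ⟨fun x => h0 x.1 x.2⟩
    rw [h4] at this
    exact (Nat.even_iff.2 this)
  have h5 := congrArg (fun z : ℤ => z * (-1) ^ (Fintype.card D + (α * φ).numOrbits)) hs
  simp only [← pow_add] at h5
  rw [Even.neg_one_pow ⟨_, rfl⟩] at h5
  have h6 := (neg_one_pow_eq_one_iff_even (by norm_num : (-1 : ℤ) ≠ 1)).1 h5.symm
  rw [Nat.even_iff] at *
  omega

end Equiv.Perm

namespace Foams

open Relation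

/-- The three kinds of vertices of a web, with the edges at the vertex. -/
inductive VertexKind (E : Type) : Type
  | pass (e e' : E)
  | merge (e₀ e₁ e : E)
  | split (e e₀ e₁ : E)

namespace VertexKind

variable {E : Type}

/-- The edges that end at the vertex. -/
def ins : VertexKind E → Set E
  | pass e _ => {e}
  | merge e₀ e₁ _ => {e₀, e₁}
  | split e _ _ => {e}

/-- The edges that start at the vertex. -/
def outs : VertexKind E → Set E
  | pass _ e' => {e'}
  | merge _ _ e => {e}
  | split _ e₀ e₁ => {e₀, e₁}

/-- An edge that ends at the vertex. -/
def anIn : VertexKind E → E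
  | pass e _ => e
  | merge e₀ _ _ => e₀
  | split e _ _ => e

theorem anIn_mem (v : VertexKind E) : v.anIn ∈ v.ins := by
  cases v <;> simp [anIn, ins]

/-- The same vertex with all orientations reversed. -/
def rev : VertexKind E → VertexKind E
  | pass e e' => pass e' e
  | merge e₀ e₁ e => split e e₀ e₁
  | split e e₀ e₁ => merge e₀ e₁ e

theorem ins_rev (v : VertexKind E) : v.rev.ins = v.outs := by cases v <;> rfl

theorem outs_rev (v : VertexKind E) : v.rev.outs = v.ins := by cases v <;> rfl

/-- The kind of a vertex after an identification of edges. -/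
def map {E' : Type} (f : E → E') : VertexKind E → VertexKind E'
  | pass e e' => pass (f e) (f e')
  | merge e₀ e₁ e => merge (f e₀) (f e₁) (f e)
  | split e e₀ e₁ => split (f e) (f e₀) (f e₁)

theorem ins_map {E' : Type} (f : E → E') (v : VertexKind E) : (v.map f).ins = f '' v.ins := by
  cases v <;> simp [map, ins, Set.image_pair]

theorem outs_map {E' : Type} (f : E → E') (v : VertexKind E) : (v.map f).outs = f '' v.outs := by
  cases v <;> simp [map, outs, Set.image_pair]

end VertexKind

/-- A set of vertices for a graph with edges `E` in which every edge has a start and an end. -/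
structure VertexModel (E : Type) where
  V : Type
  kind : V → VertexKind E
  src : E → V
  tgt : E → V
  mem_ins : ∀ e w, e ∈ (kind w).ins ↔ tgt e = w
  mem_outs : ∀ e w, e ∈ (kind w).outs ↔ src e = w

namespace VertexModel

variable {E : Type} (M : VertexModel E)

/-- All orientations reversed. -/
def rev : VertexModel E where
  V := M.V
  kind := fun w => (M.kind w).rev
  src := M.tgt
  tgt := M.src
  mem_ins := fun e w => by rw [VertexKind.ins_rev, M.mem_outs]
  mem_outs := fun e w => by rw [VertexKind.outs_rev, M.mem_ins]

/-- The disjoint union. -/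
def sum {E' : Type} (M' : VertexModel E') : VertexModel (E ⊕ E') where
  V := M.V ⊕ M'.V
  kind := Sum.elim (fun w => (M.kind w).map .inl) (fun w => (M'.kind w).map .inr)
  src := Sum.map M.src M'.src
  tgt := Sum.map M.tgt M'.tgt
  mem_ins := by
    rintro (e | e) (w | w) <;> simp [VertexKind.ins_map, mem_ins]
  mem_outs := by
    rintro (e | e) (w | w) <;> simp [VertexKind.outs_map, mem_outs]

/-- The empty model. -/
def empty : VertexModel Empty where
  V := Empty
  kind := fun w => nomatch w
  src := fun w => nomatch w
  tgt := fun w => nomatch w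
  mem_ins := fun w => nomatch w
  mem_outs := fun w => nomatch w

theorem finite [Finite E] : Finite M.V :=
  Finite.of_injective (fun w => (M.kind w).anIn) fun w w' h => by
    have h1 := (M.mem_ins _ w).1 (M.kind w).anIn_mem
    have h2 := (M.mem_ins _ w').1 (M.kind w').anIn_mem
    rw [← h1, ← h2]
    exact congrArg M.tgt h

/-- The vertices at the edges from `A`. -/
def touch (A : Set E) : Set M.V := {w | ∃ e ∈ A, M.tgt e = w ∨ M.src e = w}

end VertexModel

/-- The vertices of a model are the vertices of the web. -/
structure Web.Models (Γ : Web) (M : VertexModel Γ.E) : Prop where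
  kind : ∀ w, match M.kind w with
    | .pass e e' => Γ.pass e e'
    | .merge e₀ e₁ e => Γ.merge e₀ e₁ e
    | .split e e₀ e₁ => Γ.split e e₀ e₁
  pass : ∀ e e', Γ.pass e e' → ∃ w, M.kind w = .pass e e'
  merge : ∀ e₀ e₁ e, Γ.merge e₀ e₁ e → ∃ w, M.kind w = .merge e₀ e₁ e
  split : ∀ e e₀ e₁, Γ.split e e₀ e₁ → ∃ w, M.kind w = .split e e₀ e₁

namespace Side

variable {R S E₀ E₁ : Type}

/-- The edge along which a side runs. -/
def edgeId : Side R S E₀ E₁ → R ⊕ S ⊕ E₀ ⊕ E₁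
  | reg r _ => .inl r
  | thin s _ => .inr (.inl s)
  | thick s => .inr (.inl s)
  | bot e => .inr (.inr (.inl e))
  | top e => .inr (.inr (.inr e))

/-- Sides of regular edges. -/
def IsReg : Side R S E₀ E₁ → Prop
  | reg _ _ => True
  | _ => False

@[simp] theorem not_isReg_thin (s : S) (b : Bool) : ¬ (thin s b : Side R S E₀ E₁).IsReg := id
@[simp] theorem not_isReg_thick (s : S) : ¬ (thick s : Side R S E₀ E₁).IsReg := id

instance [Finite R] [Finite S] [Finite E₀] [Finite E₁] : Finite (Side R S E₀ E₁) := by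
  refine Finite.of_injective (β := (R × Bool) ⊕ (S × Bool) ⊕ S ⊕ E₀ ⊕ E₁) (fun
    | reg r b => .inl (r, b)
    | thin s b => .inr (.inl (s, b))
    | thick s => .inr (.inr (.inl s))
    | bot e => .inr (.inr (.inr (.inl e)))
    | top e => .inr (.inr (.inr (.inr e)))) ?_
  rintro (_ | _ | _ | _ | _) (_ | _ | _ | _ | _) h <;> simp_all

theorem opp_comm {d d' : Side R S E₀ E₁} : Opp d d' ↔ Opp d' d := by
  have h : ∀ {d d' : Side R S E₀ E₁}, Opp d d' → Opp d' d := by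
    rintro _ _ (⟨r, b⟩ | ⟨s, b⟩ | ⟨s, b⟩)
    exacts [by simpa using Opp.reg r (!b), .thickThin s b, .thinThick s b]
  exact ⟨h, h⟩

theorem opp_reg_iff {d : Side R S E₀ E₁} {r : R} {b : Bool} :
    Opp d (.reg r b) ↔ d = .reg r (!b) := by
  constructor
  · generalize hz : Side.reg r b = z
    rintro (⟨r', b'⟩ | _ | _) <;> simp_all
  · rintro rfl
    simpa using Opp.reg (S := S) (E₀ := E₀) (E₁ := E₁) r (!b)

theorem reg_opp_iff {d : Side R S E₀ E₁} {r : R} {b : Bool} :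
    Opp (.reg r b) d ↔ d = .reg r (!b) := opp_comm.trans opp_reg_iff

theorem opp_thin_iff {d : Side R S E₀ E₁} {s : S} {b : Bool} :
    Opp d (.thin s b) ↔ d = .thick s := by
  constructor
  · generalize hz : Side.thin s b = z
    rintro (_ | _ | _) <;> simp_all
  · rintro rfl
    exact Opp.thickThin s b

theorem thin_opp_iff {d : Side R S E₀ E₁} {s : S} {b : Bool} :
    Opp (.thin s b) d ↔ d = .thick s := opp_comm.trans opp_thin_iff

theorem opp_thick_iff {d : Side R S E₀ E₁} {s : S} :
    Opp d (.thick s) ↔ ∃ b, d = .thin s b := by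
  constructor
  · generalize hz : Side.thick s = z
    rintro (_ | _ | _) <;> simp_all
  · rintro ⟨b, rfl⟩
    exact Opp.thinThick s b

theorem thick_opp_iff {d : Side R S E₀ E₁} {s : S} :
    Opp (.thick s) d ↔ ∃ b, d = .thin s b := opp_comm.trans opp_thick_iff

theorem not_opp_top {d : Side R S E₀ E₁} {e : E₁} : ¬ Opp d (.top e) := by rintro ⟨⟩
theorem not_top_opp {d : Side R S E₀ E₁} {e : E₁} : ¬ Opp (.top e) d := by rintro ⟨⟩
theorem not_opp_bot {d : Side R S E₀ E₁} {e : E₀} : ¬ Opp d (.bot e) := by rintro ⟨⟩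
theorem not_bot_opp {d : Side R S E₀ E₁} {e : E₀} : ¬ Opp (.bot e) d := by rintro ⟨⟩

theorem Opp.edgeId_eq {d d' : Side R S E₀ E₁} (h : Opp d d') : d.edgeId = d'.edgeId := by
  cases h <;> rfl

end Side

namespace Foam

variable {Γ₀ Γ₁ : Web} {F : Foam Γ₀ Γ₁}

instance : Finite F.R := F.finR
instance : Finite F.S := F.finS
instance finite_edges (Γ : Web) : Finite Γ.E := Γ.finE
instance : Finite F.Vertex := Finite.of_surjective F.vertex Quot.mk_surjective
instance : Finite F.Edge := Finite.of_surjective F.edge Quot.mk_surjective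
instance : Finite F.Face := Finite.of_surjective F.face Quot.mk_surjective

theorem vertex_eq_of_opp {d d' : F.Sd} (h : Side.Opp d (F.next d')) : F.vertex d = F.vertex d' :=
  Quot.sound h

theorem iff_of_vertex_eq {p : F.Sd → Prop} {v : F.Vertex}
    (h : ∀ d d', Side.Opp d (F.next d') → F.vertex d' = v → (p d ↔ p d'))
    {d d' : F.Sd} (hd : F.vertex d = v) (hd' : F.vertex d' = v) : p d ↔ p d' := by
  have h1 : Relation.EqvGen (fun d d' : F.Sd => Side.Opp d (F.next d')) d d' :=
    Quot.eqvGen_exact (hd.trans hd'.symm)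
  induction h1 with
  | rel x y hxy => exact h x y hxy hd'
  | refl => rfl
  | symm x y _ ih => exact (ih hd' hd).symm
  | trans x y z hxy hyz ih1 ih2 =>
    have hy : F.vertex y = v := by
      rw [← hd']
      exact Quot.eqvGen_sound hyz
    exact (ih1 hd hy).trans (ih2 hy hd')

theorem step_right_unique : Relator.RightUnique F.Step := by
  rintro d d' d'' ⟨r, b, h, rfl⟩ ⟨r', b', h', rfl⟩
  rw [h] at h'
  cases h'
  rfl

theorem Step.opp {d d' : F.Sd} (h : F.Step d d') : Side.Opp d' (F.next d) := by
  obtain ⟨r, b, h, rfl⟩ := h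
  rw [h, Side.opp_reg_iff]

theorem vertex_eq_of_reach {d d' : F.Sd} (h : ReflTransGen F.Step d d') :
    F.vertex d = F.vertex d' := by
  induction h with
  | refl => rfl
  | tail _ h ih => rw [ih, vertex_eq_of_opp h.opp]

theorem eq_of_reach {x d : F.Sd} (h : ReflTransGen F.Step x d) (hd : ¬ d.IsReg) : d = x := by
  rcases h.cases_tail with h | ⟨_, _, r, b, _, rfl⟩
  exacts [h, absurd trivial hd]

theorem Arc.vertex_eq (hF : F.next.Injective) {x y d : F.Sd} (h : F.Arc x y) (hd : F.next d = y) :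
    F.vertex x = F.vertex d := by
  obtain ⟨d', h, h'⟩ := h
  rw [hF (hd.trans h'.symm), vertex_eq_of_reach h]

theorem Arc.exists_pred {x y : F.Sd} (h : F.Arc x y) :
    ∃ d, F.next d = y ∧ F.vertex d = F.vertex x := by
  obtain ⟨d', h, h'⟩ := h
  exact ⟨d', h', (vertex_eq_of_reach h).symm⟩

theorem Arc.vertex_eq_of_opp {x y z : F.Sd} (h : F.Arc x y) (hz : Side.Opp z y) :
    F.vertex z = F.vertex x := by
  obtain ⟨d, hd, hv⟩ := h.exists_pred
  rw [← hv]
  exact Foam.vertex_eq_of_opp (hd ▸ hz)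

/-- A set of arcs that make up the link of a vertex; an arc is given by its ends. -/
structure IsLink (F : Foam Γ₀ Γ₁) (P : Set (F.Sd × F.Sd)) : Prop where
  arc : ∀ p ∈ P, F.Arc p.1 p.2
  right : ∀ p ∈ P, ¬ p.2.IsReg
  opp_right : ∀ p ∈ P, ∀ z, Side.Opp z p.2 → ∃ y, (z, y) ∈ P
  opp_left : ∀ p ∈ P, ∀ z, Side.Opp p.1 z → ∃ x, (x, z) ∈ P

theorem IsLink.exists_reach (hF : F.next.Injective) {P : Set (F.Sd × F.Sd)} (hP : F.IsLink P)
    {p : F.Sd × F.Sd} (hp : p ∈ P) {d : F.Sd} (h : F.vertex d = F.vertex p.1) :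
    ∃ q ∈ P, ReflTransGen F.Step q.1 d := by
  refine (iff_of_vertex_eq (p := fun d => ∃ q ∈ P, ReflTransGen F.Step q.1 d) ?_ h rfl).2
    ⟨p, hp, .refl⟩
  intro d d' hdd' _
  constructor
  · rintro ⟨q, hq, hqd⟩
    rcases hqd.cases_tail with rfl | ⟨d'', hd'', r, b, hr, rfl⟩
    · obtain ⟨x, hx⟩ := hP.opp_left q hq _ hdd'
      obtain ⟨d'', h1, h2⟩ := hP.arc _ hx
      obtain rfl : d'' = d' := hF h2
      exact ⟨_, hx, h1⟩
    · rw [Side.reg_opp_iff, Bool.not_not] at hdd'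
      obtain rfl : d'' = d' := hF (hr.trans hdd'.symm)
      exact ⟨q, hq, hd''⟩
  · rintro ⟨q, hq, hqd⟩
    by_cases hr : (F.next d').IsReg
    · refine ⟨q, hq, hqd.tail ?_⟩
      generalize hn : F.next d' = n at *
      rcases n with ⟨r, b⟩ | _ | _ | _ | _ <;> try exact hr.elim
      rw [Side.opp_reg_iff] at hdd'
      exact ⟨r, b, hn, hdd'⟩
    · obtain ⟨d'', h1, h2⟩ := hP.arc q hq
      have h3 : d' = d'' := by
        rcases ReflTransGen.total_of_right_unique step_right_unique hqd h1 with h | h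
        · rcases h.cases_head with h | ⟨_, ⟨r, b, h, _⟩, _⟩
          · exact h
          · rw [h] at hr
            exact absurd trivial hr
        · rcases h.cases_head with h | ⟨_, ⟨r, b, h, _⟩, _⟩
          · exact h.symm
          · have := hP.right q hq
            rw [← h2, h] at this
            exact absurd trivial this
      rw [h3, h2] at hdd'
      obtain ⟨y, hy⟩ := hP.opp_right q hq _ hdd'
      exact ⟨_, hy, .refl⟩

theorem IsLink.mem_of_not_isReg (hF : F.next.Injective) {P : Set (F.Sd × F.Sd)} (hP : F.IsLink P)
    {p : F.Sd × F.Sd} (hp : p ∈ P) {d : F.Sd} (h : F.vertex d = F.vertex p.1) (hd : ¬ d.IsReg) :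
    ∃ y, (d, y) ∈ P := by
  obtain ⟨q, hq, h⟩ := hP.exists_reach hF hp h
  rw [eq_of_reach h hd]
  exact ⟨_, hq⟩

theorem Theta.isLink {s m : F.S} (h : F.Theta s m) :
    F.IsLink {(.thin s false, .thin m false), (.thin s true, .thin m true),
      (.thick m, .thick s)} := by
  have h0 := h.1 false
  have h1 := h.1 true
  have h2 := h.2
  constructor
  · simp [h0, h1, h2]
  · simp
  · simp [Side.opp_thin_iff, Side.opp_thick_iff]
  · simp [Side.thin_opp_iff, Side.thick_opp_iff]

theorem Tetra.isLink {b : Bool} {s₁ s₂ m₁ m₂ : F.S} (h : F.Tetra b s₁ s₂ m₁ m₂) :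
    F.IsLink {(.thin s₁ b, .thin m₁ b), (.thin s₁ (!b), .thick s₂), (.thin s₂ b, .thin m₁ (!b)),
      (.thin s₂ (!b), .thin m₂ (!b)), (.thick m₁, .thin m₂ b), (.thick m₂, .thick s₁)} := by
  obtain ⟨h1, h2, h3, h4, h5, h6⟩ := h
  constructor
  · simp [h1, h2, h3, h4, h5, h6]
  · simp
  · cases b <;> simp [Side.opp_thin_iff, Side.opp_thick_iff]
  · cases b <;> simp [Side.thin_opp_iff, Side.thick_opp_iff]

/-- A vertex of the boundary of a foam; `bd` are the boundary sides. -/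
def HasVertex (F : Foam Γ₀ Γ₁) {E : Type} (bd : E → F.Sd) : VertexKind E → Prop
  | .pass e e' => F.Arc (bd e) (bd e')
  | .merge e₀ e₁ e => ∃ s, F.Arc (bd e₀) (.thin s false) ∧ F.Arc (bd e₁) (.thin s true) ∧
      F.Arc (.thick s) (bd e)
  | .split e e₀ e₁ => ∃ s, F.Arc (.thin s false) (bd e₀) ∧ F.Arc (.thin s true) (bd e₁) ∧
      F.Arc (bd e) (.thick s)

/-- The sides `bd` form a part of the boundary of the foam, with vertices `M`. -/
structure IsBoundary (F : Foam Γ₀ Γ₁) {E : Type} (M : VertexModel E) (bd : E → F.Sd) :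
    Prop where
  not_reg : ∀ e, ¬ (bd e).IsReg
  not_opp : ∀ e z, ¬ Side.Opp z (bd e)
  opp_not : ∀ e z, ¬ Side.Opp (bd e) z
  inj : bd.Injective
  hasVertex : ∀ w, F.HasVertex bd (M.kind w)

theorem IsFoam.isBoundary_top {N : ℕ} (hF : F.IsFoam N) {M : VertexModel Γ₁.E}
    (hM : Γ₁.Models M) : F.IsBoundary M .top where
  not_reg := fun _ => id
  not_opp := fun _ _ => Side.not_opp_top
  opp_not := fun _ _ => Side.not_top_opp
  inj := fun _ _ h => by cases h; rfl
  hasVertex := fun w => by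
    have := hM.kind w
    generalize M.kind w = v at *
    cases v with
    | pass e e' => exact hF.top_pass _ _ this
    | merge e₀ e₁ e => exact hF.top_merge _ _ _ this
    | split e e₀ e₁ => exact hF.top_split _ _ _ this

theorem IsFoam.isBoundary_bot {N : ℕ} (hF : F.IsFoam N) {M : VertexModel Γ₀.E}
    (hM : Γ₀.Models M) : F.IsBoundary M.rev .bot where
  not_reg := fun _ => id
  not_opp := fun _ _ => Side.not_opp_bot
  opp_not := fun _ _ => Side.not_bot_opp
  inj := fun _ _ h => by cases h; rfl
  hasVertex := fun w => by
    have := hM.kind w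
    change F.HasVertex _ (M.kind w).rev
    generalize M.kind w = v at *
    cases v with
    | pass e e' => exact hF.bot_pass _ _ this
    | merge e₀ e₁ e => exact hF.bot_merge _ _ _ this
    | split e e₀ e₁ => exact hF.bot_split _ _ _ this

variable {E : Type} {M : VertexModel E} {bd : E → F.Sd}

/-- The vertex of the foam at a vertex of the boundary. -/
def bdVertex (F : Foam Γ₀ Γ₁) (M : VertexModel E) (bd : E → F.Sd) (w : M.V) : F.Vertex :=
  F.vertex (bd (M.kind w).anIn)

theorem IsBoundary.exists_link (h : F.IsBoundary M bd) (w : M.V) :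
    ∃ P : Set (F.Sd × F.Sd), F.IsLink P ∧
      (∀ p ∈ P, (∃ e, p.1 = bd e) ∨ ∃ e, p.2 = bd e) ∧
      (∀ e, (∃ y, (bd e, y) ∈ P) ↔ M.tgt e = w) ∧ (∀ e, (∃ x, (x, bd e) ∈ P) ↔ M.src e = w) ∧
      (∀ p ∈ P, ∀ s b, p.1 = .thin s b → ∃ e e₀ e₁, M.kind w = .split e e₀ e₁ ∧
        F.Arc (.thin s false) (bd e₀) ∧ F.Arc (.thin s true) (bd e₁) ∧
        F.Arc (bd e) (.thick s)) ∧
      (∀ p ∈ P, ∀ s, p.1 = .thick s → ∃ e₀ e₁ e, M.kind w = .merge e₀ e₁ e ∧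
        F.Arc (bd e₀) (.thin s false) ∧ F.Arc (bd e₁) (.thin s true) ∧
        F.Arc (.thick s) (bd e)) ∧
      (∀ p ∈ P, F.vertex p.1 = F.bdVertex M bd w) := by
  have hv := h.hasVertex w
  have hi := fun e => M.mem_ins e w
  have ho := fun e => M.mem_outs e w
  have n1 := h.not_reg
  have n2 := h.not_opp
  have n3 := h.opp_not
  have n4 : ∀ e s b, bd e ≠ .thin s b := fun e s b he => by
    have := n3 e (.thick s); rw [he] at this; exact this (.thinThick s b)
  have n5 : ∀ e s, bd e ≠ .thick s := fun e s he => by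
    have := n3 e (.thin s false); rw [he] at this; exact this (.thickThin s false)
  have n4' := fun e s b => (n4 e s b).symm
  have n5' := fun e s => (n5 e s).symm
  have n6 := fun e e' => h.inj.eq_iff (a := e) (b := e')
  unfold bdVertex
  generalize M.kind w = v at *
  cases v with
  | pass e e' =>
    simp only [VertexKind.ins, VertexKind.outs, Set.mem_singleton_iff] at hi ho
    refine ⟨{(bd e, bd e')}, ⟨?_, ?_, ?_, ?_⟩, ?_⟩
    all_goals simp_all [HasVertex, VertexKind.anIn]
  | merge e₀ e₁ e =>
    simp only [VertexKind.ins, VertexKind.outs, Set.mem_singleton_iff, Set.mem_insert_iff]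
      at hi ho
    obtain ⟨s, h0, h1, h2⟩ := hv
    refine ⟨{(bd e₀, .thin s false), (bd e₁, .thin s true), (.thick s, bd e)},
      ⟨?_, ?_, ?_, ?_⟩, ?_, ?_, ?_, ?_, ?_, ?_⟩
    · simp [h0, h1, h2]
    · simp [n1]
    · simp [Side.opp_thin_iff, n2, n5']
    · simp [Side.thick_opp_iff, n3]
    · simp
    · simp [← hi, n6, n5, exists_or]
    · simp [← ho, n4, n6]
    · simp [n4]
    · simp [n5, h0, h1, h2]
    · have a := h0.vertex_eq_of_opp (Side.Opp.thickThin s false)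
      have b := h1.vertex_eq_of_opp (Side.Opp.thickThin s true)
      simp [VertexKind.anIn, a, b.symm.trans a]
  | split e e₀ e₁ =>
    simp only [VertexKind.ins, VertexKind.outs, Set.mem_singleton_iff, Set.mem_insert_iff]
      at hi ho
    obtain ⟨s, h0, h1, h2⟩ := hv
    refine ⟨{(.thin s false, bd e₀), (.thin s true, bd e₁), (bd e, .thick s)},
      ⟨?_, ?_, ?_, ?_⟩, ?_, ?_, ?_, ?_, ?_, ?_⟩
    · simp [h0, h1, h2]
    · simp [n1]
    · simp [Side.opp_thick_iff, n2]
    · simp [Side.thin_opp_iff, n3, n5']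
    · simp
    · simp [← hi, n6, n4]
    · simp [← ho, n5, n6, exists_or]
    · simp [n4, h0, h1, h2]
    · simp [n5]
    · have a := h2.vertex_eq_of_opp (Side.Opp.thinThick s false)
      have b := h2.vertex_eq_of_opp (Side.Opp.thinThick s true)
      simp [VertexKind.anIn, a, b]

theorem IsBoundary.vertex_tgt (h : F.IsBoundary M bd) (e : E) :
    F.vertex (bd e) = F.bdVertex M bd (M.tgt e) := by
  obtain ⟨P, hP, -, h1, -, -, -, h2⟩ := h.exists_link (M.tgt e)
  obtain ⟨y, hy⟩ := (h1 e).2 rfl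
  exact h2 _ hy

theorem IsBoundary.vertex_src (h : F.IsBoundary M bd) (hF : F.next.Injective) {e : E} {d : F.Sd}
    (hd : F.next d = bd e) : F.vertex d = F.bdVertex M bd (M.src e) := by
  obtain ⟨P, hP, -, -, h1, -, -, h2⟩ := h.exists_link (M.src e)
  obtain ⟨x, hx⟩ := (h1 e).2 rfl
  rw [← h2 _ hx]
  exact ((hP.arc _ hx).vertex_eq hF hd).symm

theorem IsBoundary.tgt_eq (h : F.IsBoundary M bd) (hF : F.next.Injective) {e : E} {w : M.V}
    (he : F.vertex (bd e) = F.bdVertex M bd w) : M.tgt e = w := by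
  obtain ⟨P, hP, -, h1, -, -, -, h2⟩ := h.exists_link w
  obtain ⟨y, hy⟩ := (h1 _).2 ((M.mem_ins _ _).1 (M.kind w).anIn_mem)
  exact (h1 e).1 (hP.mem_of_not_isReg hF hy (he.trans (h2 _ hy).symm) (h.not_reg e))

theorem IsBoundary.injective (h : F.IsBoundary M bd) (hF : F.next.Injective) :
    (F.bdVertex M bd).Injective := fun w w' hw => by
  rw [← h.tgt_eq hF (show F.vertex (bd (M.kind w).anIn) = _ from hw)]
  exact ((M.mem_ins _ _).1 (M.kind w).anIn_mem).symm

theorem IsBoundary.exists_edge (h : F.IsBoundary M bd) (hF : F.next.Injective) {d : F.Sd}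
    {w : M.V} (hd : F.vertex d = F.bdVertex M bd w) :
    ∃ x y, F.Arc x y ∧ ReflTransGen F.Step x d ∧
      ((∃ e, M.tgt e = w ∧ x = bd e) ∨ ∃ e, M.src e = w ∧ y = bd e) := by
  obtain ⟨P, hP, h0, h1, h3, -, -, h2⟩ := h.exists_link w
  obtain ⟨y, hy⟩ := (h1 _).2 ((M.mem_ins _ _).1 (M.kind w).anIn_mem)
  obtain ⟨⟨x, y⟩, hq, hq'⟩ := hP.exists_reach hF hy (hd.trans (h2 _ hy).symm)
  refine ⟨x, y, hP.arc _ hq, hq', ?_⟩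
  rcases h0 _ hq with ⟨e, rfl⟩ | ⟨e, rfl⟩
  exacts [.inl ⟨e, (h1 e).1 ⟨_, hq⟩, rfl⟩, .inr ⟨e, (h3 e).1 ⟨_, hq⟩, rfl⟩]

theorem IsBoundary.seam_end (h : F.IsBoundary M bd) (hF : F.next.Injective) {s : F.S} {b : Bool}
    {w : M.V} (hd : F.vertex (.thin s b) = F.bdVertex M bd w) :
    ∃ e e₀ e₁, M.kind w = .split e e₀ e₁ ∧ F.Arc (.thin s false) (bd e₀) ∧
      F.Arc (.thin s true) (bd e₁) ∧ F.Arc (bd e) (.thick s) := by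
  obtain ⟨P, hP, h0, h1, -, h3, -, h2⟩ := h.exists_link w
  obtain ⟨y, hy⟩ := (h1 _).2 ((M.mem_ins _ _).1 (M.kind w).anIn_mem)
  obtain ⟨y, hq⟩ := hP.mem_of_not_isReg hF hy (hd.trans (h2 _ hy).symm) id
  exact h3 _ hq s b rfl

theorem IsBoundary.seam_start (h : F.IsBoundary M bd) (hF : F.next.Injective) {s : F.S}
    {w : M.V} (hd : F.vertex (.thick s) = F.bdVertex M bd w) :
    ∃ e₀ e₁ e, M.kind w = .merge e₀ e₁ e ∧ F.Arc (bd e₀) (.thin s false) ∧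
      F.Arc (bd e₁) (.thin s true) ∧ F.Arc (.thick s) (bd e) := by
  obtain ⟨P, hP, h0, h1, -, -, h3, h2⟩ := h.exists_link w
  obtain ⟨y, hy⟩ := (h1 _).2 ((M.mem_ins _ _).1 (M.kind w).anIn_mem)
  obtain ⟨y, hq⟩ := hP.mem_of_not_isReg hF hy (hd.trans (h2 _ hy).symm) id
  exact h3 _ hq s rfl

end Foam

namespace Foam

variable {Γ₀ Γ₁ : Web} {F : Foam Γ₀ Γ₁} {N : ℕ}

namespace Coloring

variable (κ : Coloring N F)

theorem reg_eq (r : F.R) (b b' : Bool) : κ.c (.reg r b) = κ.c (.reg r b') := by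
  cases b <;> cases b' <;> simp [κ.reg]

theorem reach {x d : F.Sd} (h : ReflTransGen F.Step x d) : κ.c d = κ.c x := by
  induction h with
  | refl => rfl
  | @tail y _ _ h ih =>
    obtain ⟨r, b, h, rfl⟩ := h
    rw [← ih, ← κ.next y, h, κ.reg_eq]

theorem arc {x y : F.Sd} (h : F.Arc x y) : κ.c y = κ.c x := by
  obtain ⟨d, h, rfl⟩ := h
  rw [κ.next, κ.reach h]

/-- At the seam `s`, a facet with `i` on the left and a facet with `j` on the right merge. -/
def Sep (i j : Fin N) (s : F.S) : Prop := i ∈ κ.c (.thin s false) ∧ j ∈ κ.c (.thin s true)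

theorem thin_subset (s : F.S) (b : Bool) : κ.c (.thin s b) ⊆ κ.c (.thick s) := by
  rw [κ.seam]
  cases b
  exacts [Finset.subset_union_left, Finset.subset_union_right]

theorem seam' (s : F.S) (b : Bool) : κ.c (.thick s) = κ.c (.thin s b) ∪ κ.c (.thin s (!b)) := by
  rw [κ.seam]
  cases b
  · rfl
  · exact Finset.union_comm _ _

theorem disj' (s : F.S) (b : Bool) : Disjoint (κ.c (.thin s b)) (κ.c (.thin s (!b))) := by
  cases b
  exacts [κ.disj s, (κ.disj s).symm]

theorem tetra {b : Bool} {s₁ s₂ m₁ m₂ : F.S} (h : F.Tetra b s₁ s₂ m₁ m₂) :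
    ∃ A B C : Finset (Fin N), Disjoint A B ∧ Disjoint A C ∧ Disjoint B C ∧
      κ.c (.thin s₁ b) = A ∧ κ.c (.thin s₁ (!b)) = B ∪ C ∧ κ.c (.thin s₂ b) = B ∧
      κ.c (.thin s₂ (!b)) = C ∧ κ.c (.thin m₁ b) = A ∧ κ.c (.thin m₁ (!b)) = B ∧
      κ.c (.thin m₂ b) = A ∪ B ∧ κ.c (.thin m₂ (!b)) = C := by
  obtain ⟨h1, h2, h3, h4, h5, h6⟩ := h
  have h1 := κ.arc h1
  have h2 := κ.arc h2
  have h3 := κ.arc h3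
  have h4 := κ.arc h4
  have h5 := κ.arc h5
  have d1 := κ.disj' s₁ b
  have d2 := κ.disj' s₂ b
  have e1 := κ.seam' s₂ b
  have e2 := κ.seam' m₁ b
  rw [← h2, e1, Finset.disjoint_union_right] at d1
  exact ⟨_, _, _, d1.1, d1.2, d2, rfl, by rw [← h2, e1], rfl, rfl, h1, h3,
    by rw [h5, e2, h1, h3], h4⟩

end Coloring

theorem vertex_thin (hF : F.next.Bijective) (s : F.S) (b : Bool) :
    F.vertex (.thin s b) = F.vertex (.thin s false) := by
  obtain ⟨d, hd⟩ := hF.2 (.thick s)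
  exact (vertex_eq_of_opp (d' := d) (hd ▸ Side.Opp.thinThick s b)).trans
    (vertex_eq_of_opp (d' := d) (hd ▸ Side.Opp.thinThick s false)).symm

theorem Theta.vertex_eq {s m : F.S} (h : F.Theta s m) :
    F.vertex (.thick m) = F.vertex (.thin s false) :=
  (h.1 false).vertex_eq_of_opp (.thickThin m false)

theorem Tetra.vertex_eq (hF : F.next.Bijective) {b : Bool} {s₁ s₂ m₁ m₂ : F.S}
    (h : F.Tetra b s₁ s₂ m₁ m₂) :
    F.vertex (.thin s₂ false) = F.vertex (.thin s₁ false) ∧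
    F.vertex (.thick m₁) = F.vertex (.thin s₁ false) ∧
    F.vertex (.thick m₂) = F.vertex (.thin s₁ false) := by
  obtain ⟨h1, h2, h3, h4, h5, h6⟩ := h
  have k1 := h1.vertex_eq_of_opp (.thickThin m₁ b)
  have k2 := h2.vertex_eq_of_opp (.thinThick s₂ b)
  have k5 := h5.vertex_eq_of_opp (.thickThin m₂ b)
  rw [vertex_thin hF] at k1 k2
  rw [vertex_thin hF s₁ (!b)] at k2
  exact ⟨k2, k1, k5.trans k1⟩

theorem Theta.eq_of_thin (hF : F.next.Injective) {s m s' : F.S} {b : Bool} (h : F.Theta s m)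
    (h' : F.vertex (.thin s' b) = F.vertex (.thin s false)) : s' = s := by
  obtain ⟨y, hy⟩ := h.isLink.mem_of_not_isReg hF (Set.mem_insert _ _) h' id
  simp at hy
  tauto

theorem Theta.eq_of_thick (hF : F.next.Injective) {s m m' : F.S} (h : F.Theta s m)
    (h' : F.vertex (.thick m') = F.vertex (.thin s false)) : m' = m := by
  obtain ⟨y, hy⟩ := h.isLink.mem_of_not_isReg hF (Set.mem_insert _ _) h' id
  simp at hy
  tauto

theorem Tetra.eq_of_thin (hF : F.next.Bijective) {b b' : Bool} {s₁ s₂ m₁ m₂ s' : F.S}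
    (h : F.Tetra b s₁ s₂ m₁ m₂)
    (h' : F.vertex (.thin s' b') = F.vertex (.thin s₁ false)) : s' = s₁ ∨ s' = s₂ := by
  rw [← vertex_thin hF s₁ b] at h'
  obtain ⟨y, hy⟩ := h.isLink.mem_of_not_isReg hF.1 (Set.mem_insert _ _) h' id
  simp at hy
  tauto

theorem Tetra.eq_of_thick (hF : F.next.Bijective) {b : Bool} {s₁ s₂ m₁ m₂ m' : F.S}
    (h : F.Tetra b s₁ s₂ m₁ m₂)
    (h' : F.vertex (.thick m') = F.vertex (.thin s₁ false)) : m' = m₁ ∨ m' = m₂ := by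
  rw [← vertex_thin hF s₁ b] at h'
  obtain ⟨y, hy⟩ := h.isLink.mem_of_not_isReg hF.1 (Set.mem_insert _ _) h' id
  simp at hy
  tauto

theorem TopSplit.isLink {s : F.S} {e e₀ e₁ : Γ₁.E} (h : F.TopSplit s e e₀ e₁) :
    F.IsLink {(.thin s false, .top e₀), (.thin s true, .top e₁), (.top e, .thick s)} := by
  obtain ⟨h0, h1, h2⟩ := h
  constructor
  · simp [h0, h1, h2]
  · simp [Side.IsReg]
  · simp [Side.not_opp_top, Side.opp_thick_iff]
  · simp [Side.thin_opp_iff, Side.not_top_opp]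

theorem BotMerge.isLink {s : F.S} {e₀ e₁ e : Γ₀.E} (h : F.BotMerge s e₀ e₁ e) :
    F.IsLink {(.thin s false, .bot e₀), (.thin s true, .bot e₁), (.bot e, .thick s)} := by
  obtain ⟨h0, h1, h2⟩ := h
  constructor
  · simp [h0, h1, h2]
  · simp [Side.IsReg]
  · simp [Side.not_opp_bot, Side.opp_thick_iff]
  · simp [Side.thin_opp_iff, Side.not_bot_opp]

namespace IsFoam

variable (κ : Coloring N F) {i j : Fin N}

theorem exists_next (hF : F.IsFoam N) {s : F.S} (h : κ.Sep i j s) :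
    (∃ m, κ.Sep i j m ∧ F.vertex (.thin s false) = F.vertex (.thick m)) ∨
    (∃ e e₀ e₁, Γ₁.split e e₀ e₁ ∧ F.TopSplit s e e₀ e₁) ∨
    (∃ e₀ e₁ e, Γ₀.merge e₀ e₁ e ∧ F.BotMerge s e₀ e₁ e) := by
  rcases hF.seam_end s with ⟨m, hm⟩ | ⟨b, s', m₁, m₂, hm | hm⟩ | h' | h'
  · refine .inl ⟨m, ?_, hm.vertex_eq.symm⟩
    unfold Coloring.Sep
    rwa [κ.arc (hm.1 false), κ.arc (hm.1 true)]
  · obtain ⟨A, B, C, -, -, -, h1, h2, h3, h4, h5, h6, h7, h8⟩ := κ.tetra hm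
    obtain ⟨v2, v3, v4⟩ := hm.vertex_eq hF.bij
    have : κ.Sep i j m₁ ∨ κ.Sep i j m₂ := by
      unfold Coloring.Sep at *
      cases b <;> simp_all
    rcases this with this | this
    exacts [.inl ⟨m₁, this, v3.symm⟩, .inl ⟨m₂, this, v4.symm⟩]
  · obtain ⟨A, B, C, -, -, -, h1, h2, h3, h4, h5, h6, h7, h8⟩ := κ.tetra hm
    obtain ⟨v2, v3, v4⟩ := hm.vertex_eq hF.bij
    refine .inl ⟨m₂, ?_, v2.trans v4.symm⟩
    unfold Coloring.Sep at *
    cases b <;> simp_all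
  exacts [.inr (.inl h'), .inr (.inr h')]

theorem prev_unique (hF : F.IsFoam N) {s s' : F.S} (h : κ.Sep i j s ∨ κ.Sep j i s) (h' : κ.Sep i j s' ∨ κ.Sep j i s')
    (hs : F.vertex (.thin s' false) = F.vertex (.thin s false)) : s' = s := by
  have key : ∀ {b s₁ s₂ m₁ m₂}, F.Tetra b s₁ s₂ m₁ m₂ →
      ¬ ((κ.Sep i j s₁ ∨ κ.Sep j i s₁) ∧ (κ.Sep i j s₂ ∨ κ.Sep j i s₂)) := by
    intro b s₁ s₂ m₁ m₂ hm
    obtain ⟨A, B, C, hAB, hAC, hBC, h1, h2, h3, h4, -⟩ := κ.tetra hm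
    rw [Finset.disjoint_left] at hAB hAC hBC
    unfold Coloring.Sep
    cases b <;> simp_all <;> grind
  rcases hF.seam_end s with ⟨m, hm⟩ | ⟨b, s₂, m₁, m₂, hm | hm⟩ | ⟨e, e₀, e₁, -, hm⟩ |
    ⟨e₀, e₁, e, -, hm⟩
  · exact hm.eq_of_thin hF.bij.1 hs
  · rcases hm.eq_of_thin hF.bij hs with rfl | rfl
    · rfl
    · exact absurd ⟨h, h'⟩ (key hm)
  · rcases hm.eq_of_thin hF.bij (hs.trans (hm.vertex_eq hF.bij).1) with rfl | rfl
    · exact absurd ⟨h', h⟩ (key hm)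
    · rfl
  · obtain ⟨y, hy⟩ := hm.isLink.mem_of_not_isReg hF.bij.1 (Set.mem_insert _ _) hs id
    simp at hy
    exact hy.1
  · obtain ⟨y, hy⟩ := hm.isLink.mem_of_not_isReg hF.bij.1 (Set.mem_insert _ _) hs id
    simp at hy
    exact hy.1

theorem next_unique (hF : F.IsFoam N) {s m m' : F.S} (h : κ.Sep i j m) (h' : κ.Sep i j m')
    (hs : F.vertex (.thin s false) = F.vertex (.thick m))
    (hs' : F.vertex (.thin s false) = F.vertex (.thick m')) : m' = m := by
  have key : ∀ {b s₁ s₂ m₁ m₂}, F.Tetra b s₁ s₂ m₁ m₂ → ¬ (κ.Sep i j m₁ ∧ κ.Sep i j m₂) := by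
    intro b s₁ s₂ m₁ m₂ hm
    obtain ⟨A, B, C, hAB, hAC, hBC, h1, h2, h3, h4, h5, h6, h7, h8⟩ := κ.tetra hm
    rw [Finset.disjoint_left] at hAB hAC hBC
    unfold Coloring.Sep
    cases b <;> simp_all
  have key' : ∀ {b s₁ s₂ m₁ m₂}, F.Tetra b s₁ s₂ m₁ m₂ →
      F.vertex (.thin s false) = F.vertex (.thin s₁ false) → m' = m := by
    intro b s₁ s₂ m₁ m₂ hm hv
    rcases hm.eq_of_thick hF.bij (hs.symm.trans hv) with rfl | rfl <;>
    rcases hm.eq_of_thick hF.bij (hs'.symm.trans hv) with rfl | rfl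
    · rfl
    · exact absurd ⟨h, h'⟩ (key hm)
    · exact absurd ⟨h', h⟩ (key hm)
    · rfl
  rcases hF.seam_end s with ⟨m, hm⟩ | ⟨b, s₂, m₁, m₂, hm | hm⟩ | ⟨e, e₀, e₁, -, hm⟩ |
    ⟨e₀, e₁, e, -, hm⟩
  · rw [hm.eq_of_thick hF.bij.1 hs.symm, hm.eq_of_thick hF.bij.1 hs'.symm]
  · exact key' hm rfl
  · exact key' hm (hm.vertex_eq hF.bij).1
  · obtain ⟨y, hy⟩ := hm.isLink.mem_of_not_isReg hF.bij.1 (Set.mem_insert _ _) hs.symm id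
    simp at hy
  · obtain ⟨y, hy⟩ := hm.isLink.mem_of_not_isReg hF.bij.1 (Set.mem_insert _ _) hs.symm id
    simp at hy

end IsFoam

/-! ### Euler characteristics by counting -/

theorem edge_eq_iff {d d' : F.Sd} : F.edge d = F.edge d' ↔ d.edgeId = d'.edgeId := by
  constructor
  · intro h
    exact congrArg (Quot.lift Side.edgeId fun _ _ (h : Side.Opp _ _) => h.edgeId_eq) h
  · intro h
    rcases d with ⟨r, b⟩ | ⟨s, b⟩ | s | e | e <;> rcases d' with ⟨r', b'⟩ | ⟨s', b'⟩ | s' | e' | e' <;>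
      simp only [Side.edgeId, reduceCtorEq, Sum.inl.injEq, Sum.inr.injEq] at h <;> subst h
    · cases b <;> cases b'
      · rfl
      · exact Quot.sound (Side.Opp.reg r false)
      · exact Quot.sound (Side.Opp.reg r true)
      · rfl
    · exact (Quot.sound (Side.Opp.thinThick s b)).trans (Quot.sound (Side.Opp.thickThin s b'))
    · exact Quot.sound (Side.Opp.thinThick s b)
    · exact Quot.sound (Side.Opp.thickThin s b')
    · rfl
    · rfl
    · rfl

theorem ncard_edge_image (A : Set F.Sd) : (F.edge '' A).ncard = (Side.edgeId '' A).ncard := by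
  let f : F.Edge → F.R ⊕ F.S ⊕ Γ₀.E ⊕ Γ₁.E := Quot.lift Side.edgeId fun _ _ h => h.edgeId_eq
  have hf : f.Injective := by
    rintro ⟨d⟩ ⟨d'⟩ h
    exact edge_eq_iff.2 h
  rw [← Set.ncard_image_of_injective _ hf, Set.image_image]
  rfl

theorem iff_of_face_eq {p : F.Sd → Prop} (h : ∀ d, p d ↔ p (F.next d)) {d d' : F.Sd}
    (hd : F.face d = F.face d') : p d ↔ p d' := by
  have := congrArg (Quot.lift p fun d d' (hn : F.next d = d') => by rw [← hn, ← h]) hd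
  exact iff_of_eq this

theorem face_next (d : F.Sd) : F.face (F.next d) = F.face d :=
  (Quot.sound (r := fun d d' : F.Sd => F.next d = d') rfl).symm

theorem Coloring.face_eq (κ : Coloring N F) {d d' : F.Sd} (h : F.face d = F.face d') :
    κ.c d = κ.c d' :=
  (iff_of_face_eq (p := fun x => κ.c d = κ.c x) (fun x => by rw [κ.next]) h).1 rfl

end Foam

namespace Foam

variable {N : ℕ} {F : Foam Web.empty Web.empty}

theorem tetra_separates {A B C X : Finset (Fin N)} {i j : Fin N} (hAB : Disjoint A B)
    (hAC : Disjoint A C) (hBC : Disjoint B C)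
    (hX : X = A ∨ X = B ∪ C ∨ X = B ∨ X = C ∨ X = A ∪ B ∨ X = A ∪ B ∪ C)
    (hi : i ∈ A ∪ B ∪ C) (hj : j ∈ A ∪ B ∪ C) (hiX : i ∈ X) (hjX : j ∉ X) :
    (i ∈ A ∧ j ∈ B ∪ C) ∨ (j ∈ A ∧ i ∈ B ∪ C) ∨ (i ∈ B ∧ j ∈ C) ∨ (j ∈ B ∧ i ∈ C) := by
  rw [Finset.disjoint_left] at hAB hAC hBC
  simp only [Finset.mem_union] at hi hj ⊢
  rcases hX with rfl | rfl | rfl | rfl | rfl | rfl <;>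
    (try simp only [Finset.mem_union] at hiX hjX) <;> tauto

namespace IsFoam

theorem color_eq_of_no_seam (hF : F.IsFoam N) (κ : Coloring N F) {v : F.Vertex}
    (hv : ∀ s, F.vertex (.thin s false) ≠ v) {d d' : F.Sd} (hd : F.vertex d = v)
    (hd' : F.vertex d' = v) : ∃ (_ : ∀ e e', Side.Opp e (F.next e') → F.vertex e' = v →
      F.Step e' e), κ.c d = κ.c d' := by
  have key : ∀ e e', Side.Opp e (F.next e') → F.vertex e' = v → F.Step e' e := by
    intro e e' h h'
    rw [← vertex_eq_of_opp h] at h'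
    generalize hn : F.next e' = n at h
    cases h with
    | reg r b => exact ⟨r, !b, by simpa using hn, by simp⟩
    | thinThick s b => exact absurd ((vertex_thin hF.bij s b).symm.trans h') (hv s)
    | thickThin s b =>
      rcases hF.seam_start s with ⟨s', hs⟩ | ⟨b, s₁, s₂, m', hs | hs⟩ | ⟨e, -⟩ | ⟨e, -⟩
      exacts [absurd (hs.vertex_eq.symm.trans h') (hv _),
        absurd ((hs.vertex_eq hF.bij).2.1.symm.trans h') (hv _),
        absurd ((hs.vertex_eq hF.bij).2.2.symm.trans h') (hv _), e.elim, e.elim]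
  refine ⟨key, ?_⟩
  refine (iff_of_vertex_eq (p := fun e => κ.c d = κ.c e) ?_ hd hd').1 rfl
  intro e e' h h'
  rw [κ.reach (.single (key e e' h h'))]

theorem exists_max (hF : F.IsFoam N) (κ : Coloring N F) (d₀ : F.Sd) :
    ∃ d₁, F.vertex d₁ = F.vertex d₀ ∧ (∀ d, F.vertex d = F.vertex d₀ → κ.c d ⊆ κ.c d₁) ∧
      ∀ i j d, i ∈ κ.c d₁ → j ∈ κ.c d₁ → F.vertex d = F.vertex d₀ → i ∈ κ.c d → j ∉ κ.c d →
        ∃ s, F.vertex (.thin s false) = F.vertex d₀ ∧ (κ.Sep i j s ∨ κ.Sep j i s) := by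
  by_cases hv : ∃ s, F.vertex (.thin s false) = F.vertex d₀
  · obtain ⟨s, hs⟩ := hv
    have tet : ∀ {b s₁ s₂ m₁ m₂}, F.Tetra b s₁ s₂ m₁ m₂ →
        F.vertex d₀ = F.vertex (.thin s₁ false) →
        ∃ d₁, F.vertex d₁ = F.vertex d₀ ∧ (∀ d, F.vertex d = F.vertex d₀ → κ.c d ⊆ κ.c d₁) ∧
        ∀ i j d, i ∈ κ.c d₁ → j ∈ κ.c d₁ → F.vertex d = F.vertex d₀ → i ∈ κ.c d → j ∉ κ.c d →
        ∃ s, F.vertex (.thin s false) = F.vertex d₀ ∧ (κ.Sep i j s ∨ κ.Sep j i s) := by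
      intro b s₁ s₂ m₁ m₂ hm h0
      obtain ⟨A, B, C, hAB, hAC, hBC, h1, h2, h3, h4, h5, h6, h7, h8⟩ := κ.tetra hm
      obtain ⟨v2, v3, v4⟩ := hm.vertex_eq hF.bij
      have e2 := κ.seam' m₂ b
      have e1 := κ.seam' m₁ b
      rw [h7, h8] at e2
      rw [h5, h6] at e1
      have cols : ∀ d, F.vertex d = F.vertex d₀ → κ.c d = A ∨ κ.c d = B ∪ C ∨ κ.c d = B ∨
          κ.c d = C ∨ κ.c d = A ∪ B ∨ κ.c d = A ∪ B ∪ C := by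
        intro d hd
        rw [h0, ← vertex_thin hF.bij s₁ b] at hd
        obtain ⟨q, hq, hr⟩ := hm.isLink.exists_reach hF.bij.1 (Set.mem_insert _ _) hd
        rw [κ.reach hr]
        simp only [Set.mem_insert_iff, Set.mem_singleton_iff] at hq
        rcases hq with rfl | rfl | rfl | rfl | rfl | rfl <;> simp_all
      refine ⟨_, v4.trans h0.symm, ?_, ?_⟩
      · intro d hd
        rw [e2]
        rcases cols d hd with h | h | h | h | h | h <;> rw [h] <;> intro x <;> simp <;> tauto
      · intro i j d hi hj hd hid hjd
        rw [e2] at hi hj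
        have : (κ.Sep i j s₁ ∨ κ.Sep j i s₁) ∨ (κ.Sep i j s₂ ∨ κ.Sep j i s₂) := by
          have := tetra_separates hAB hAC hBC (cols d hd) hi hj hid hjd
          unfold Coloring.Sep
          cases b <;> simp only [Bool.not_false, Bool.not_true] at h1 h2 h3 h4 <;>
            rw [h1, h2, h3, h4] <;> tauto
        rcases this with h | h
        exacts [⟨s₁, h0.symm, h⟩, ⟨s₂, v2.trans h0.symm, h⟩]
    rcases hF.seam_end s with ⟨m, hm⟩ | ⟨b, s', m₁, m₂, hm | hm⟩ | ⟨e, -⟩ | ⟨e, -⟩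
    · have cols : ∀ d, F.vertex d = F.vertex d₀ → κ.c d = κ.c (.thin s false) ∨
          κ.c d = κ.c (.thin s true) ∨ κ.c d = κ.c (.thick m) := by
        intro d hd
        obtain ⟨q, hq, hr⟩ := hm.isLink.exists_reach hF.bij.1 (Set.mem_insert _ _)
          (hd.trans hs.symm)
        rw [κ.reach hr]
        simp only [Set.mem_insert_iff, Set.mem_singleton_iff] at hq
        rcases hq with rfl | rfl | rfl <;> simp
      have e := κ.seam s
      rw [κ.arc hm.2] at e
      have hd := κ.disj s
      rw [Finset.disjoint_left] at hd
      refine ⟨.thick m, hm.vertex_eq.trans hs, ?_, ?_⟩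
      · intro d hd
        rw [e]
        rcases cols d hd with h | h | h <;> rw [h]
        · exact Finset.subset_union_left
        · exact Finset.subset_union_right
        · rw [e]
      · intro i j d hi hj hd hid hjd
        refine ⟨s, hs, ?_⟩
        rw [e] at hi hj
        unfold Coloring.Sep
        rcases cols d hd with h | h | h <;> rw [h] at hid hjd <;> grind
    exacts [tet hm hs.symm, tet hm (hs.symm.trans (hm.vertex_eq hF.bij).1), e.elim, e.elim]
  · push Not at hv
    refine ⟨d₀, rfl, ?_, ?_⟩
    · intro d hd
      rw [(hF.color_eq_of_no_seam κ hv hd rfl).2]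
    · intro i j d hi hj hd hid hjd
      rw [(hF.color_eq_of_no_seam κ hv hd rfl).2] at hjd
      exact absurd hj hjd

end IsFoam

theorem ncard_eq_sum_indicator {α : Type*} [Fintype α] (s : Set α) :
    open Classical in (s.ncard : ℤ) = ∑ x, if x ∈ s then 1 else 0 := by
  classical
  rw [Finset.sum_boole, Set.ncard_eq_toFinset_card']
  congr 2
  ext x
  simp

theorem ncard_inclusion_exclusion {X α : Type*} [Finite α] (f : X → α) (p q : X → Prop) (t : Set α)
    (h2 : ∀ x y, p x → q y → f y = f x → f x ∈ f '' {x | p x ∧ q x})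
    (h3 : ∀ x, p x → q x → (f x ∈ f '' {x | Xor (p x) (q x)} ↔ f x ∈ t))
    (h4 : t ⊆ f '' {x | p x ∧ q x}) :
    ((f '' {x | Xor (p x) (q x)}).ncard : ℤ) = (f '' {x | p x}).ncard + (f '' {x | q x}).ncard -
      2 * (f '' {x | p x ∧ q x}).ncard + t.ncard := by
  classical
  have := Fintype.ofFinite α
  simp only [ncard_eq_sum_indicator, Finset.mul_sum, ← Finset.sum_add_distrib,
    ← Finset.sum_sub_distrib]
  refine Finset.sum_congr rfl fun x _ => ?_
  by_cases hc : x ∈ f '' {x | p x ∧ q x}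
  · obtain ⟨x, ⟨hp, hq⟩, rfl⟩ := hc
    have := h3 x hp hq
    have h1 : f x ∈ f '' {x | p x} := ⟨x, hp, rfl⟩
    have h2 : f x ∈ f '' {x | q x} := ⟨x, hq, rfl⟩
    have h4 : f x ∈ f '' {x | p x ∧ q x} := ⟨x, ⟨hp, hq⟩, rfl⟩
    by_cases hd : f x ∈ f '' {x | Xor (p x) (q x)} <;> simp_all only [if_true, if_false] <;> simp
  · have ht := fun h => hc (h4 h)
    have hx : x ∈ f '' {x | Xor (p x) (q x)} ↔ x ∈ f '' {x | p x} ∨ x ∈ f '' {x | q x} := by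
      constructor
      · rintro ⟨d, hd | hd, rfl⟩
        exacts [.inl ⟨d, hd.1, rfl⟩, .inr ⟨d, hd.1, rfl⟩]
      · rintro (⟨d, hd, rfl⟩ | ⟨d, hd, rfl⟩)
        exacts [⟨d, .inl ⟨hd, fun h => hc ⟨d, ⟨hd, h⟩, rfl⟩⟩, rfl⟩,
          ⟨d, .inr ⟨hd, fun h => hc ⟨d, ⟨h, hd⟩, rfl⟩⟩, rfl⟩]
    have hab : ¬ (x ∈ f '' {x | p x} ∧ x ∈ f '' {x | q x}) := by
      rintro ⟨⟨d, hd, rfl⟩, d', hd', h⟩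
      exact hc (h2 d d' hd hd' h)
    rw [if_neg hc, if_neg ht]
    by_cases ha : x ∈ f '' {x | p x} <;> by_cases hb : x ∈ f '' {x | q x}
    · exact absurd ⟨ha, hb⟩ hab
    all_goals simp [hx, ha, hb]

namespace IsFoam

/-- The Euler characteristic of the surface formed by the facets with the pigments `i` and `j`. -/
def _root_.Foams.Foam.Coloring.inter {Γ₀ Γ₁ : Web} {F : Foam Γ₀ Γ₁}
    (κ : Coloring N F) (i j : Fin N) : ℤ :=
  F.euler {d | i ∈ κ.c d ∧ j ∈ κ.c d}

theorem bi_eq (hF : F.IsFoam N) (κ : Coloring N F) (i j : Fin N) :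
    κ.bi i j = κ.mono i + κ.mono j - 2 * κ.inter i j := by
  set T : Set F.S := {s | κ.Sep i j s ∨ κ.Sep j i s} with hT
  have hT' : ∀ s ∈ T, i ∈ κ.c (.thick s) ∧ j ∈ κ.c (.thick s) := by
    rintro s (hs | hs)
    exacts [⟨κ.thin_subset _ _ hs.1, κ.thin_subset _ _ hs.2⟩,
      ⟨κ.thin_subset _ _ hs.2, κ.thin_subset _ _ hs.1⟩]
  have hX : ∀ s ∈ T, Xor (i ∈ κ.c (.thin s false)) (j ∈ κ.c (.thin s false)) := by
    rintro s (hs | hs)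
    exacts [.inl ⟨hs.1, fun hj => Finset.disjoint_left.1 (κ.disj s) hj hs.2⟩,
      .inr ⟨hs.1, fun hj => Finset.disjoint_left.1 (κ.disj s) hj hs.2⟩]
  have hv := ncard_inclusion_exclusion F.vertex (i ∈ κ.c ·) (j ∈ κ.c ·)
    ((fun s => F.vertex (.thin s false)) '' T)
    (fun d d' h h' hd => by
      obtain ⟨d₁, h1, h2, -⟩ := hF.exists_max κ d
      exact ⟨d₁, ⟨h2 d rfl h, h2 d' hd h'⟩, h1⟩)
    (fun d h h' => by
      obtain ⟨d₁, h1, h2, h3⟩ := hF.exists_max κ d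
      constructor
      · rintro ⟨d', hd' | hd', hdd'⟩
        · obtain ⟨s, hs, hs'⟩ := h3 i j d' (h2 d rfl h) (h2 d rfl h') hdd' hd'.1 hd'.2
          exact ⟨s, hs', hs⟩
        · obtain ⟨s, hs, hs'⟩ := h3 j i d' (h2 d rfl h') (h2 d rfl h) hdd' hd'.1 hd'.2
          exact ⟨s, hs'.symm, hs⟩
      · exact fun ⟨s, hs, hs'⟩ => ⟨_, hX s hs, hs'⟩)
    (by
      rintro _ ⟨s, hs, rfl⟩
      rcases hF.bij.2 (.thick s) with ⟨d, hd⟩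
      refine ⟨d, ?_, (vertex_eq_of_opp (hd ▸ Side.Opp.thinThick s false)).symm⟩
      rw [Set.mem_ofPred_eq, ← κ.next, hd]
      exact hT' s hs)
  have he := ncard_inclusion_exclusion Side.edgeId (i ∈ κ.c ·) (j ∈ κ.c ·)
    ((fun s => (.inr (.inl s))) '' T)
    (fun d d' h h' hd => by
      rcases d with ⟨r, b⟩ | ⟨s, b⟩ | s | e | e <;>
      rcases d' with ⟨r', b'⟩ | ⟨s', b'⟩ | s' | e' | e' <;>
      simp only [Side.edgeId, reduceCtorEq, Sum.inl.injEq, Sum.inr.injEq] at hd <;> try subst hd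
      · rw [κ.reg_eq _ _ b] at h'
        exact ⟨_, ⟨h, h'⟩, rfl⟩
      exacts [⟨.thick _, ⟨κ.thin_subset _ _ h, κ.thin_subset _ _ h'⟩, rfl⟩,
        ⟨.thick _, ⟨κ.thin_subset _ _ h, h'⟩, rfl⟩, ⟨.thick _, ⟨h, κ.thin_subset _ _ h'⟩, rfl⟩,
        ⟨.thick _, ⟨h, h'⟩, rfl⟩, Empty.elim (by assumption), Empty.elim (by assumption)])
    (fun d h h' => by
      constructor
      · rintro ⟨d', hx, hd⟩
        rcases d with ⟨r, b⟩ | ⟨s, b⟩ | s | e | e <;>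
        rcases d' with ⟨r', b'⟩ | ⟨s', b'⟩ | s' | e' | e' <;>
        simp only [Side.edgeId, reduceCtorEq, Sum.inl.injEq, Sum.inr.injEq] at hd <;> try subst hd
        · rw [Set.mem_ofPred_eq, κ.reg_eq _ _ b] at hx
          simp [h, h', Xor] at hx
        · have h1 := κ.thin_subset _ _ h
          have h2 := κ.thin_subset _ _ h'
          refine ⟨s', ?_, rfl⟩
          have e := κ.disj s'
          rw [Finset.disjoint_left] at e
          rw [κ.seam, Finset.mem_union] at h1 h2
          simp only [Set.mem_ofPred_eq, hT, Coloring.Sep, Xor] at hx ⊢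
          cases b <;> cases b' <;> grind
        · simp [κ.thin_subset _ _ h, κ.thin_subset _ _ h', Xor] at hx
        · refine ⟨s', ?_, rfl⟩
          have e := κ.disj s'
          rw [Finset.disjoint_left] at e
          rw [κ.seam, Finset.mem_union] at h h'
          simp only [Set.mem_ofPred_eq, hT, Coloring.Sep, Xor] at hx ⊢
          cases b' <;> grind
        · simp [h, h', Xor] at hx
        exacts [Empty.elim (by assumption), Empty.elim (by assumption)]
      · exact fun ⟨s, hs, hs'⟩ => ⟨.thin s false, hX s hs, hs'⟩)
    (by
      rintro _ ⟨s, hs, rfl⟩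
      exact ⟨.thick s, hT' s hs, rfl⟩)
  have hf := ncard_inclusion_exclusion F.face (i ∈ κ.c ·) (j ∈ κ.c ·) ∅
    (fun d d' h h' hd => by
      rw [κ.face_eq hd] at h'
      exact ⟨d, ⟨h, h'⟩, rfl⟩)
    (fun d h h' => by
      simp only [Set.mem_empty_iff_false, iff_false]
      rintro ⟨d', hx, hd⟩
      rw [Set.mem_ofPred_eq, κ.face_eq hd] at hx
      simp [h, h', Xor] at hx)
    (Set.empty_subset _)
  have hinj : Set.InjOn (fun s => F.vertex (.thin s false)) T :=
    fun s hs s' hs' h => hF.prev_unique κ hs' hs h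
  rw [hinj.ncard_image] at hv
  rw [Set.ncard_image_of_injective T (f := fun s => Sum.inr (Sum.inl s))
    (Sum.inr_injective.comp Sum.inl_injective)] at he
  rw [Set.ncard_empty] at hf
  unfold Coloring.bi Coloring.mono Coloring.inter euler
  rw [ncard_edge_image, ncard_edge_image, ncard_edge_image, ncard_edge_image, hv, he, hf]
  push_cast
  ring

end IsFoam

end Foam

namespace Foam

open Relation Equiv Equiv.Perm

variable {N : ℕ} {F : Foam Web.empty Web.empty}

/-- Sides of the polygons with the pigments `i` and `j`, and boundary edges of their union. -/
abbrev Coloring.Flag (κ : Coloring N F) (i j : Fin N) : Type :=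
  {d : F.Sd // i ∈ κ.c d ∧ j ∈ κ.c d} ⊕ {s // κ.Sep i j s} ⊕ {s // κ.Sep j i s}

namespace Coloring

variable (κ : Coloring N F) (i j : Fin N)

theorem thick_mem {s : F.S} (h : κ.Sep i j s) : i ∈ κ.c (.thick s) ∧ j ∈ κ.c (.thick s) :=
  ⟨κ.thin_subset _ _ h.1, κ.thin_subset _ _ h.2⟩

open Classical in
/-- The other side of the edge of a flag. -/
def mate : κ.Flag i j → κ.Flag i j
  | .inl ⟨.reg r b, h⟩ => .inl ⟨.reg r (!b), by rwa [κ.reg_eq r _ b]⟩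
  | .inl ⟨.thin s b, h⟩ => .inl ⟨.thick s, κ.thin_subset _ _ h.1, κ.thin_subset _ _ h.2⟩
  | .inl ⟨.thick s, h⟩ =>
    if h0 : i ∈ κ.c (.thin s false) ∧ j ∈ κ.c (.thin s false) then .inl ⟨.thin s false, h0⟩
    else if h1 : i ∈ κ.c (.thin s true) ∧ j ∈ κ.c (.thin s true) then .inl ⟨.thin s true, h1⟩
    else if h2 : κ.Sep i j s then .inr (.inl ⟨s, h2⟩)
    else .inr (.inr ⟨s, by
      have h3 := κ.seam s
      rw [h3, Finset.mem_union, Finset.mem_union] at h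
      unfold Sep at *
      tauto⟩)
  | .inl ⟨.bot e, _⟩ => e.elim
  | .inl ⟨.top e, _⟩ => e.elim
  | .inr (.inl s) => .inl ⟨.thick s.1, κ.thick_mem i j s.2⟩
  | .inr (.inr s) => .inl ⟨.thick s.1, (κ.thick_mem j i s.2).symm⟩

theorem mate_mate (x : κ.Flag i j) : κ.mate i j (κ.mate i j x) = x := by
  rcases x with ⟨⟨r, b⟩ | ⟨s, b⟩ | s | e | e, h⟩ | ⟨s, h⟩ | ⟨s, h⟩
  · simp [mate]
  · have hd := κ.disj s
    rw [Finset.disjoint_left] at hd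
    cases b
    · simp [mate, h]
    · have h0 : i ∉ κ.c (.thin s false) := fun h0 => hd h0 h.1
      simp [mate, h, h0]
  · simp only [mate]
    split_ifs <;> simp
  · exact e.elim
  · exact e.elim
  · have hd := κ.disj s
    rw [Finset.disjoint_left] at hd
    have h0 : j ∉ κ.c (.thin s false) := fun h0 => hd h0 h.2
    have h1 := hd h.1
    simp [mate, h, h0, h1]
  · have hd := κ.disj s
    rw [Finset.disjoint_left] at hd
    have h0 : i ∉ κ.c (.thin s false) := fun h0 => hd h0 h.2
    have h1 := hd h.1
    have h2 : ¬ κ.Sep i j s := fun h' => h0 h'.1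
    simp [mate, h2, h0, h1]

theorem mate_ne (x : κ.Flag i j) : κ.mate i j x ≠ x := by
  rcases x with ⟨⟨r, b⟩ | ⟨s, b⟩ | s | e | e, h⟩ | ⟨s, h⟩ | ⟨s, h⟩ <;>
    first | exact e.elim | simp only [mate]
  on_goal 3 => split_ifs
  all_goals simp

/-- The involution of the flags that exchanges the two sides of every edge. -/
def mateP : Perm (κ.Flag i j) := ⟨κ.mate i j, κ.mate i j, κ.mate_mate i j, κ.mate_mate i j⟩

/-- The edge of a flag. -/
def flagEdge : κ.Flag i j → F.R ⊕ F.S ⊕ Empty ⊕ Empty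
  | .inl d => d.1.edgeId
  | .inr (.inl s) => .inr (.inl s.1)
  | .inr (.inr s) => .inr (.inl s.1)

theorem flagEdge_mate (x : κ.Flag i j) : κ.flagEdge i j (κ.mate i j x) = κ.flagEdge i j x := by
  rcases x with ⟨⟨r, b⟩ | ⟨s, b⟩ | s | e | e, h⟩ | ⟨s, h⟩ | ⟨s, h⟩
  on_goal 3 =>
    simp only [mate]
    split_ifs
  all_goals first | rfl | exact e.elim

theorem flagEdge_eq_iff (x y : κ.Flag i j) :
    κ.flagEdge i j x = κ.flagEdge i j y ↔ y = x ∨ y = κ.mate i j x := by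
  constructor
  · intro h
    have red : ∀ x : κ.Flag i j, (∃ r b h, x = .inl ⟨.reg r b, h⟩) ∨
        ∃ s h, κ.flagEdge i j x = .inr (.inl s) ∧ (x = .inl ⟨.thick s, h⟩ ∨
          κ.mate i j x = .inl ⟨.thick s, h⟩) := by
      intro x
      rcases x with ⟨⟨r, b⟩ | ⟨s, b⟩ | s | e | e, h⟩ | ⟨s, h⟩ | ⟨s, h⟩
      exacts [.inl ⟨r, b, h, rfl⟩, .inr ⟨s, _, rfl, .inr rfl⟩, .inr ⟨s, h, rfl, .inl rfl⟩, e.elim,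
        e.elim, .inr ⟨s, _, rfl, .inr rfl⟩, .inr ⟨s, _, rfl, .inr rfl⟩]
    rcases red x with ⟨r, b, hx, rfl⟩ | ⟨s, hs, hx, hx'⟩ <;>
      rcases red y with ⟨r', b', hy, rfl⟩ | ⟨s', hs', hy, hy'⟩
    · simp only [flagEdge, Side.edgeId, Sum.inl.injEq] at h
      subst h
      cases b <;> cases b' <;> simp [mate]
    · rw [hy] at h; simp [flagEdge, Side.edgeId] at h
    · rw [hx] at h; simp [flagEdge, Side.edgeId] at h
    · rw [hx, hy, Sum.inr.injEq, Sum.inl.injEq] at h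
      subst h
      rcases hx' with hx' | hx' <;> rcases hy' with hy' | hy'
      · exact .inl (hy'.trans hx'.symm)
      · right; rw [hx', ← hy', mate_mate]
      · right; rw [hx', hy']
      · left; rw [← mate_mate κ i j x, hx', ← hy', mate_mate]
  · rintro (rfl | rfl)
    · rfl
    · rw [flagEdge_mate]

theorem numOrbits_mateP : (κ.mateP i j).numOrbits =
    (F.edge '' {d | i ∈ κ.c d ∧ j ∈ κ.c d}).ncard := by
  rw [ncard_edge_image, numOrbits_eq_ncard _ (κ.flagEdge i j)]
  · congr 1
    ext z
    constructor
    · rintro ⟨⟨d, h⟩ | ⟨s, h⟩ | ⟨s, h⟩, rfl⟩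
      exacts [⟨d, h, rfl⟩, ⟨.thick s, κ.thick_mem i j h, rfl⟩,
        ⟨.thick s, (κ.thick_mem j i h).symm, rfl⟩]
    · rintro ⟨d, h, rfl⟩
      exact ⟨.inl ⟨d, h⟩, rfl⟩
  · intro x y
    rw [flagEdge_eq_iff]
    constructor
    · rintro (rfl | rfl)
      exacts [SameCycle.refl _ _, sameCycle_apply_right.2 (SameCycle.refl (κ.mateP i j) x)]
    · rintro ⟨n, rfl⟩
      have h2 : (κ.mateP i j) ^ 2 = 1 := by
        ext1 x
        exact κ.mate_mate i j x
      rcases Int.even_or_odd' n with ⟨m, rfl | rfl⟩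
      · left
        rw [zpow_mul, zpow_ofNat, h2, one_zpow, one_apply]
      · right
        rw [zpow_add, zpow_mul, zpow_ofNat, h2, one_zpow, one_mul, zpow_one]
        rfl

variable {i j}

theorem exists_nextSep (hF : F.IsFoam N) (s : {s // κ.Sep i j s}) :
    ∃ m, κ.Sep i j m ∧ F.vertex (.thin s.1 false) = F.vertex (.thick m) := by
  rcases hF.exists_next κ s.2 with h | ⟨e, -⟩ | ⟨e, -⟩
  exacts [h, e.elim, e.elim]

/-- The next seam along a circle where facets with `i` and `j` merge. -/
def nextSep (hF : F.IsFoam N) (i j : Fin N) (s : {s // κ.Sep i j s}) :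
    {s // κ.Sep i j s} :=
  ⟨(κ.exists_nextSep hF s).choose, (κ.exists_nextSep hF s).choose_spec.1⟩

theorem vertex_nextSep (hF : F.IsFoam N) (s : {s // κ.Sep i j s}) :
    F.vertex (.thin s.1 false) = F.vertex (.thick (κ.nextSep hF i j s).1) :=
  (κ.exists_nextSep hF s).choose_spec.2

theorem nextSep_eq (hF : F.IsFoam N) (s m : {s // κ.Sep i j s})
    (h : F.vertex (.thin s.1 false) = F.vertex (.thick m.1)) : m = κ.nextSep hF i j s :=
  Subtype.ext (hF.next_unique κ (κ.nextSep hF i j s).2 m.2 (κ.vertex_nextSep hF s) h)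

theorem nextSep_injective (hF : F.IsFoam N) : (κ.nextSep hF i j).Injective := by
  intro s s' h
  have h1 := κ.vertex_nextSep hF s
  have h2 := κ.vertex_nextSep hF s'
  rw [h] at h1
  exact (Subtype.ext (hF.prev_unique κ (.inl s.2) (.inl s'.2) (h2.trans h1.symm))).symm

/-- `nextSep` as a permutation. -/
def nextSepP (hF : F.IsFoam N) (i j : Fin N) : Perm {s // κ.Sep i j s} :=
  Equiv.ofBijective _ (Finite.injective_iff_bijective.1 (κ.nextSep_injective hF))

theorem numOrbits_nextSepP (hF : F.IsFoam N) (i j : Fin N) :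
    (κ.nextSepP hF i j).numOrbits = κ.theta i j := by
  refine numOrbits_eq_card_quot _ _ fun s m => ⟨κ.nextSep_eq hF s m, ?_⟩
  rintro rfl
  exact κ.vertex_nextSep hF s

/-- The side that follows, in the polygons with `i` and `j`. -/
def nextMem (hF : F.IsFoam N) (i j : Fin N) :
    Perm {d : F.Sd // i ∈ κ.c d ∧ j ∈ κ.c d} :=
  Equiv.ofBijective (fun d => ⟨F.next d.1, by rw [κ.next]; exact d.2⟩)
    (Finite.injective_iff_bijective.1 fun d d' h =>
      Subtype.ext (hF.bij.1 (congrArg Subtype.val h)))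

theorem numOrbits_nextMem (hF : F.IsFoam N) (i j : Fin N) : (κ.nextMem hF i j).numOrbits =
    (F.face '' {d | i ∈ κ.c d ∧ j ∈ κ.c d}).ncard := by
  rw [numOrbits_eq_ncard _ fun d => F.face d.1]
  · congr 1
    ext z
    constructor
    · rintro ⟨d, rfl⟩
      exact ⟨d.1, d.2, rfl⟩
    · rintro ⟨d, h, rfl⟩
      exact ⟨⟨d, h⟩, rfl⟩
  · intro x y
    constructor
    · intro h
      have := (iff_of_face_eq (p := fun d => ∃ h, SameCycle (κ.nextMem hF i j) x ⟨d, h⟩)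
        (fun d => ?_) h).1 ⟨x.2, SameCycle.refl _ _⟩
      · exact this.choose_spec
      · constructor
        · rintro ⟨h, h'⟩
          exact ⟨by rwa [κ.next], sameCycle_apply_right.2 h'⟩
        · rintro ⟨h, h'⟩
          exact ⟨by rwa [κ.next] at h, sameCycle_apply_right.1 h'⟩
    · rintro ⟨n, h⟩
      have key : ∀ z, F.face (κ.nextMem hF i j z).1 = F.face z.1 := fun z => face_next _
      obtain ⟨n, rfl⟩ := SameCycle.exists_nat_pow_eq ⟨n, h⟩
      clear h
      induction n with
      | zero => rfl
      | succ n ih => rw [ih, pow_succ', mul_apply, key]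

/-- The permutation that goes around the polygons with `i` and `j`, and around their boundary. -/
def around (hF : F.IsFoam N) (i j : Fin N) : Perm (κ.Flag i j) :=
  Equiv.sumCongr (κ.nextMem hF i j) (Equiv.sumCongr (κ.nextSepP hF i j) (κ.nextSepP hF j i))

/-- The permutation that goes around the vertices. -/
def turn (hF : F.IsFoam N) (i j : Fin N) : Perm (κ.Flag i j) :=
  κ.mateP i j * κ.around hF i j

/-- The vertex where a flag ends. -/
def flagVertex (i j : Fin N) : κ.Flag i j → F.Vertex
  | .inl d => F.vertex d.1
  | .inr (.inl s) => F.vertex (.thin s.1 false)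
  | .inr (.inr s) => F.vertex (.thin s.1 false)

theorem flagVertex_mate (x : F.Sd) (hx : i ∈ κ.c (F.next x) ∧ j ∈ κ.c (F.next x)) :
    κ.flagVertex i j (κ.mate i j (.inl ⟨F.next x, hx⟩)) = F.vertex x := by
  have h0 : ∀ d, Side.Opp d (F.next x) → F.vertex d = F.vertex x := fun d => vertex_eq_of_opp
  generalize F.next x = y at *
  rcases y with ⟨r, b⟩ | ⟨s, b⟩ | s | e | e
  · exact h0 _ (by rw [Side.opp_reg_iff])
  · exact h0 _ (.thickThin s b)
  · simp only [mate]
    split_ifs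
    exacts [h0 _ (.thinThick s false), h0 _ (.thinThick s true), h0 _ (.thinThick s false),
      h0 _ (.thinThick s false)]
  exacts [e.elim, e.elim]

theorem flagVertex_turn (hF : F.IsFoam N) (x : κ.Flag i j) :
    κ.flagVertex i j (κ.turn hF i j x) = κ.flagVertex i j x := by
  rcases x with ⟨d, h⟩ | s | s
  exacts [κ.flagVertex_mate d _, (κ.vertex_nextSep hF s).symm, (κ.vertex_nextSep hF s).symm]

variable (hF : F.IsFoam N)

theorem sameCycle_turn {x y : κ.Flag i j} (h : κ.turn hF i j x = y) :
    SameCycle (κ.turn hF i j) x y := h ▸ sameCycle_apply_right.2 (SameCycle.refl _ _)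

theorem sameCycle_step {d d' : F.Sd} (hs : F.Step d d') (h : i ∈ κ.c d ∧ j ∈ κ.c d)
    (h' : i ∈ κ.c d' ∧ j ∈ κ.c d') :
    SameCycle (κ.turn hF i j) (.inl ⟨d, h⟩) (.inl ⟨d', h'⟩) := by
  obtain ⟨r, b, hn, rfl⟩ := hs
  refine κ.sameCycle_turn hF ?_
  change κ.mate i j (.inl ⟨F.next d, by rw [κ.next]; exact h⟩) = _
  simp only [hn, mate]

theorem sameCycle_reach {d d' : F.Sd} (hs : ReflTransGen F.Step d d') (h : i ∈ κ.c d ∧ j ∈ κ.c d)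
    (h' : i ∈ κ.c d' ∧ j ∈ κ.c d') :
    SameCycle (κ.turn hF i j) (.inl ⟨d, h⟩) (.inl ⟨d', h'⟩) := by
  induction hs with
  | refl => exact SameCycle.refl _ _
  | tail h1 h2 ih =>
    have h3 := h
    rw [← κ.reach h1] at h3
    exact (ih h3).trans (κ.sameCycle_step hF h2 _ _)

theorem sameCycle_arc {x y : F.Sd} (hs : F.Arc x y) (h : i ∈ κ.c x ∧ j ∈ κ.c x)
    (h' : i ∈ κ.c y ∧ j ∈ κ.c y) :
    SameCycle (κ.turn hF i j) (.inl ⟨x, h⟩) (κ.mate i j (.inl ⟨y, h'⟩)) := by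
  obtain ⟨d, h1, rfl⟩ := hs
  exact (κ.sameCycle_reach hF h1 h (by rwa [κ.next] at h')).trans (κ.sameCycle_turn hF rfl)

theorem sameCycle_tetra {b : Bool} {s₁ s₂ m₁ m₂ : F.S} (hm : F.Tetra b s₁ s₂ m₁ m₂) {d : F.Sd}
    (hd : F.vertex d = F.vertex (.thin s₁ false)) (h : i ∈ κ.c d ∧ j ∈ κ.c d) :
    ∃ h', SameCycle (κ.turn hF i j) (.inl ⟨d, h⟩) (.inl ⟨.thick m₂, h'⟩) := by
  have v := hm.vertex_eq hF.bij
  obtain ⟨A, B, C, hAB, hAC, hBC, c1, c2, c3, c4, c5, c6, c7, c8⟩ := κ.tetra hm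
  have hmm := hm
  obtain ⟨h1, h2, h3, h4, h5, h6⟩ := hm
  have e1 := κ.arc h1
  have e2 := κ.arc h2
  have e3 := κ.arc h3
  let G : F.Sd → Prop := fun x => ∀ h : i ∈ κ.c x ∧ j ∈ κ.c x,
    ∃ h', SameCycle (κ.turn hF i j) (.inl ⟨x, h⟩) (.inl ⟨.thick m₂, h'⟩)
  have p6 : G (.thick m₂) := fun h => ⟨h, SameCycle.refl _ _⟩
  have p5 : G (.thick m₁) := fun h => ⟨_, κ.sameCycle_arc hF h5 h (by rwa [κ.arc h5])⟩
  have p4 : G (.thin s₂ (!b)) := fun h => ⟨_, κ.sameCycle_arc hF h4 h (by rwa [κ.arc h4])⟩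
  have p3 : G (.thin s₂ b) := fun h => by
    obtain ⟨h', p⟩ := p5 ⟨κ.thin_subset _ (!b) (by rw [e3]; exact h.1),
      κ.thin_subset _ (!b) (by rw [e3]; exact h.2)⟩
    exact ⟨h', (κ.sameCycle_arc hF h3 h (by rwa [e3])).trans p⟩
  have p1 : G (.thin s₁ b) := fun h => by
    obtain ⟨h', p⟩ := p5 ⟨κ.thin_subset _ b (by rw [e1]; exact h.1),
      κ.thin_subset _ b (by rw [e1]; exact h.2)⟩
    exact ⟨h', (κ.sameCycle_arc hF h1 h (by rwa [e1])).trans p⟩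
  have sep2 : ∀ {i j}, κ.Sep i j s₂ → κ.Sep i j m₂ := by
    unfold Sep
    cases b <;> simp_all
  have p2 : G (.thin s₁ (!b)) := fun h => by
    have hy : i ∈ κ.c (.thick s₂) ∧ j ∈ κ.c (.thick s₂) := by rwa [e2]
    have p := κ.sameCycle_arc hF h2 h hy
    have p34 : ∀ b', G (.thin s₂ b') := by
      cases b <;> rintro (_ | _)
      exacts [p3, p4, p4, p3]
    simp only [mate] at p
    split_ifs at p with k0 k1 k2
    · exact (p34 false k0).imp fun _ => p.trans
    · exact (p34 true k1).imp fun _ => p.trans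
    · have := κ.nextSep_eq hF ⟨s₂, k2⟩ ⟨m₂, sep2 k2⟩ (v.1.trans v.2.2.symm)
      exact ⟨_, p.trans (κ.sameCycle_turn hF
        (congrArg (fun m => κ.mate i j (.inr (.inl m))) this.symm))⟩
    · have k3 : κ.Sep j i s₂ := by
        rw [κ.seam s₂, Finset.mem_union, Finset.mem_union] at hy
        unfold Sep at *
        tauto
      have := κ.nextSep_eq hF ⟨s₂, k3⟩ ⟨m₂, sep2 k3⟩ (v.1.trans v.2.2.symm)
      exact ⟨_, p.trans (κ.sameCycle_turn hF
        (congrArg (fun m => κ.mate i j (.inr (.inr m))) this.symm))⟩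
  rw [← vertex_thin hF.bij s₁ b] at hd
  obtain ⟨q, hq, hr⟩ := hmm.isLink.exists_reach hF.bij.1 (Set.mem_insert _ _) hd
  have hq' : i ∈ κ.c q.1 ∧ j ∈ κ.c q.1 := by rwa [κ.reach hr] at h
  have start := (κ.sameCycle_reach hF hr hq' h).symm
  obtain ⟨x, y⟩ := q
  suffices ∃ h', SameCycle (κ.turn hF i j) (.inl ⟨x, hq'⟩) (.inl ⟨.thick m₂, h'⟩) by
    exact this.imp fun _ => start.trans
  simp only [Set.mem_insert_iff, Set.mem_singleton_iff, Prod.mk.injEq] at hq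
  rcases hq with ⟨rfl, -⟩ | ⟨rfl, -⟩ | ⟨rfl, -⟩ | ⟨rfl, -⟩ | ⟨rfl, -⟩ | ⟨rfl, -⟩
  exacts [p1 _, p2 _, p3 _, p4 _, p5 _, p6 _]

theorem sameCycle_theta {s m : F.S} (hm : F.Theta s m) {d : F.Sd}
    (hd : F.vertex d = F.vertex (.thin s false)) (h : i ∈ κ.c d ∧ j ∈ κ.c d) :
    ∃ h', SameCycle (κ.turn hF i j) (.inl ⟨d, h⟩) (.inl ⟨.thick m, h'⟩) := by
  have p : ∀ b h, ∃ h', SameCycle (κ.turn hF i j) (.inl ⟨.thin s b, h⟩)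
      (.inl ⟨.thick m, h'⟩) := fun b h =>
    ⟨_, κ.sameCycle_arc hF (hm.1 b) h (by rwa [κ.arc (hm.1 b)])⟩
  obtain ⟨q, hq, hr⟩ := hm.isLink.exists_reach hF.bij.1 (Set.mem_insert _ _) hd
  have hq' : i ∈ κ.c q.1 ∧ j ∈ κ.c q.1 := by rwa [κ.reach hr] at h
  have start := (κ.sameCycle_reach hF hr hq' h).symm
  obtain ⟨x, y⟩ := q
  suffices ∃ h', SameCycle (κ.turn hF i j) (.inl ⟨x, hq'⟩) (.inl ⟨.thick m, h'⟩) by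
    exact this.imp fun _ => start.trans
  simp only [Set.mem_insert_iff, Set.mem_singleton_iff, Prod.mk.injEq] at hq
  rcases hq with ⟨rfl, -⟩ | ⟨rfl, -⟩ | ⟨rfl, -⟩
  exacts [p _ _, p _ _, ⟨_, SameCycle.refl _ _⟩]

theorem sameCycle_of_vertex_eq {d d' : F.Sd} (hv : F.vertex d = F.vertex d')
    (h : i ∈ κ.c d ∧ j ∈ κ.c d) (h' : i ∈ κ.c d' ∧ j ∈ κ.c d') :
    SameCycle (κ.turn hF i j) (.inl ⟨d, h⟩) (.inl ⟨d', h'⟩) := by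
  by_cases hs : ∃ s, F.vertex (.thin s false) = F.vertex d'
  · obtain ⟨s, hs⟩ := hs
    obtain ⟨z, hz⟩ : ∃ z, ∀ e, F.vertex e = F.vertex d' → ∀ h,
        ∃ h', SameCycle (κ.turn hF i j) (.inl ⟨e, h⟩) (.inl ⟨z, h'⟩) := by
      rcases hF.seam_end s with ⟨m, hm⟩ | ⟨b, s', m₁, m₂, hm | hm⟩ | ⟨e, -⟩ | ⟨e, -⟩
      exacts [⟨_, fun e he h => κ.sameCycle_theta hF hm (he.trans hs.symm) h⟩,
        ⟨_, fun e he h => κ.sameCycle_tetra hF hm (he.trans hs.symm) h⟩,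
        ⟨_, fun e he h => κ.sameCycle_tetra hF hm
          (he.trans (hs.symm.trans (hm.vertex_eq hF.bij).1)) h⟩, e.elim, e.elim]
    obtain ⟨_, p⟩ := hz d hv h
    obtain ⟨_, p'⟩ := hz d' rfl h'
    exact p.trans p'.symm
  · push Not at hs
    obtain ⟨hst, -⟩ := hF.color_eq_of_no_seam κ hs hv rfl
    have := (iff_of_vertex_eq (p := fun e => ∃ he, SameCycle (κ.turn hF i j) (.inl ⟨d, h⟩)
      (.inl ⟨e, he⟩)) (v := F.vertex d') ?_ hv rfl).1 ⟨h, SameCycle.refl _ _⟩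
    · exact this.choose_spec
    · intro e e' hee hv'
      have st := hst e e' hee hv'
      have hc := κ.reach (.single st)
      constructor
      · rintro ⟨he, p⟩
        have he' : i ∈ κ.c e' ∧ j ∈ κ.c e' := by rwa [hc] at he
        exact ⟨he', p.trans (κ.sameCycle_step hF st he' he).symm⟩
      · rintro ⟨he, p⟩
        have he' : i ∈ κ.c e ∧ j ∈ κ.c e := by rwa [hc]
        exact ⟨he', p.trans (κ.sameCycle_step hF st he he')⟩

theorem sameCycle_turn_iff (x y : κ.Flag i j) :
    κ.flagVertex i j x = κ.flagVertex i j y ↔ SameCycle (κ.turn hF i j) x y := by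
  have inv : ∀ {x y}, SameCycle (κ.turn hF i j) x y →
      κ.flagVertex i j x = κ.flagVertex i j y := by
    intro x y h
    obtain ⟨n, rfl⟩ := SameCycle.exists_nat_pow_eq h
    clear h
    induction n with
    | zero => rfl
    | succ n ih => rw [pow_succ', mul_apply, flagVertex_turn, ih]
  refine ⟨fun h => ?_, inv⟩
  have red : ∀ x, ∃ d h, SameCycle (κ.turn hF i j) x (.inl ⟨d, h⟩) := by
    rintro (⟨d, h⟩ | s | s)
    exacts [⟨d, h, SameCycle.refl _ _⟩, ⟨_, _, κ.sameCycle_turn hF rfl⟩,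
      ⟨_, _, κ.sameCycle_turn hF rfl⟩]
  obtain ⟨d, hd, p⟩ := red x
  obtain ⟨d', hd', p'⟩ := red y
  exact p.trans (SameCycle.trans (κ.sameCycle_of_vertex_eq hF
    ((inv p).symm.trans (h.trans (inv p'))) hd hd') p'.symm)

theorem numOrbits_turn : (κ.turn hF i j).numOrbits =
    (F.vertex '' {d | i ∈ κ.c d ∧ j ∈ κ.c d}).ncard := by
  rw [numOrbits_eq_ncard _ (κ.flagVertex i j) (κ.sameCycle_turn_iff hF)]
  congr 1
  ext v
  constructor
  · rintro ⟨⟨d, h⟩ | s | s, rfl⟩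
    exacts [⟨d, h, rfl⟩, ⟨_, κ.thick_mem i j (κ.nextSep hF i j s).2, (κ.vertex_nextSep hF s).symm⟩,
      ⟨_, (κ.thick_mem j i (κ.nextSep hF j i s).2).symm, (κ.vertex_nextSep hF s).symm⟩]
  · rintro ⟨d, h, rfl⟩
    exact ⟨.inl ⟨d, h⟩, rfl⟩

end Coloring

theorem IsFoam.even_inter_add_theta (hF : F.IsFoam N) (κ : Coloring N F) (i j : Fin N) :
    Even (κ.inter i j + κ.theta i j + κ.theta j i) := by
  have h := even_numOrbits (κ.around hF i j) (κ.mateP i j) (κ.mate_mate i j) (κ.mate_ne i j)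
  rw [show κ.mateP i j * κ.around hF i j = κ.turn hF i j from rfl, κ.numOrbits_turn,
    κ.numOrbits_mateP, Coloring.around, numOrbits_sumCongr, numOrbits_sumCongr,
    κ.numOrbits_nextMem, κ.numOrbits_nextSepP, κ.numOrbits_nextSepP] at h
  unfold Coloring.inter euler
  rw [Nat.even_iff] at h
  rw [Int.even_iff]
  omega

theorem IsFoam.even_mono (hF : F.IsFoam N) (κ : Coloring N F) (i : Fin N) : Even (κ.mono i) := by
  have h := hF.even_inter_add_theta κ i i
  have h0 : κ.theta i i = 0 := by
    have : IsEmpty {s : F.S // i ∈ κ.c (.thin s false) ∧ i ∈ κ.c (.thin s true)} :=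
      ⟨fun s => Finset.disjoint_left.1 (κ.disj s.1) s.2.1 s.2.2⟩
    unfold Coloring.theta
    rw [Nat.card_eq_zero]
    left
    exact ⟨fun q => q.exists_rep.elim fun s _ => isEmptyElim s⟩
  rw [h0] at h
  simpa [Coloring.inter, Coloring.mono] using h

end Foam

theorem VertexModel.touch_rev {E : Type} (M : VertexModel E) (A : Set E) :
    M.rev.touch A = M.touch A := by
  ext w
  exact exists_congr fun e => and_congr_right fun _ => or_comm

theorem ncard_pushout {X Y Z W : Type*} [Finite X] [Finite Y] {f : X → Z} {g : Y → Z}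
    {t : W → X} {u : W → Y} (hf : f.Injective) (hg : g.Injective) (ht : t.Injective)
    (h : ∀ x y, f x = g y ↔ ∃ w, x = t w ∧ y = u w) {A : Set X} {B : Set Y} {C : Set W}
    (hA : ∀ w, t w ∈ A ↔ w ∈ C) (hB : ∀ w, u w ∈ B ↔ w ∈ C) :
    (f '' A ∪ g '' B).ncard + C.ncard = A.ncard + B.ncard := by
  have e : f '' A ∩ g '' B = (f ∘ t) '' C := by
    ext z
    constructor
    · rintro ⟨⟨x, hx, rfl⟩, ⟨y, hy, hxy⟩⟩
      obtain ⟨w, rfl, rfl⟩ := (h x y).1 hxy.symm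
      exact ⟨w, (hA w).1 hx, rfl⟩
    · rintro ⟨w, hw, rfl⟩
      exact ⟨⟨_, (hA w).2 hw, rfl⟩, ⟨u w, (hB w).2 hw, ((h _ _).2 ⟨w, rfl, rfl⟩).symm⟩⟩
  rw [← Set.ncard_image_of_injective C (hf.comp ht), ← e, Set.ncard_union_add_ncard_inter _ _ ((Set.toFinite A).image f) ((Set.toFinite B).image g),
    Set.ncard_image_of_injective _ hf, Set.ncard_image_of_injective _ hg]

namespace Foam

variable {Γ₀ Γ₁ Γ₂ Γ₃ Γ₄ Γ₅ : Web} {N : ℕ}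

/-- Symmetric polynomials in `w` variables. -/
abbrev SymPoly (w : ℕ) := MvPolynomial.symmetricSubalgebra (Fin w) ℤ

/-- The decoration of one side, evaluated at the variables of a set of pigments. -/
def decoration {L : Type*} [Field L] (x : Fin N → L) {w : ℕ}
    (p : SymPoly w) (s : Finset (Fin N)) (hs : s.card = w) : L :=
  MvPolynomial.aeval (fun t : Fin w => x (s.orderEmbOfFin hs t)) (p : MvPolynomial (Fin w) ℤ)

theorem decoration_congr {L : Type*} [Field L] (x : Fin N → L) {w w' : ℕ} (hw : w = w')
    {p : SymPoly w}
    {p' : SymPoly w'} (hp : HEq p p')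
    {s s' : Finset (Fin N)} (hs : s = s') {h h'} :
    decoration x p s h = decoration x p' s' h' := by
  subst hw hs
  cases hp
  rfl

namespace Coloring

/-- The product of all decorations. -/
def decor {F : Foam Γ₀ Γ₁} {L : Type*} [Field L] (x : Fin N → L)
    (κ : Coloring N F) : L :=
  ∏ᶠ d : F.Sd, decoration x (F.dot d) (κ.c d) (κ.card d)

/-- The Euler characteristic of the union of the facets with colors in `p`. -/
def chi {F : Foam Γ₀ Γ₁} (κ : Coloring N F) (p : Finset (Fin N) → Prop) : ℤ :=
  F.euler {d | p (κ.c d)}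

theorem mono_eq_chi {F : Foam Γ₀ Γ₁} (κ : Coloring N F) (i : Fin N) :
    κ.mono i = κ.chi (fun s => i ∈ s) := rfl

theorem bi_eq_chi {F : Foam Γ₀ Γ₁} (κ : Coloring N F) (i j : Fin N) :
    κ.bi i j = κ.chi (fun s => Xor (i ∈ s) (j ∈ s)) := rfl

/-- The number of circles and arcs at which `i` and `j` merge, without those that contain a seam
from `T`. -/
def thetaFree {F : Foam Γ₀ Γ₁} (κ : Coloring N F) (i j : Fin N)
    (T : F.S → Prop) : ℕ :=
  Nat.card (Quot fun s s' : {s : F.S // κ.Sep i j s ∧ ¬ T s} =>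
    F.vertex (.thin s.1 false) = F.vertex (.thick s'.1))

end Coloring

/-- `H` arises from `F` and `G` by identification of edges `bF e` of `F` with edges `bG e`
of `G`. -/
structure Pasting (F : Foam Γ₀ Γ₁) (G : Foam Γ₂ Γ₃) (H : Foam Γ₄ Γ₅) where
  E : Type
  bF : E → F.Sd
  bG : E → G.Sd
  side : F.Sd ⊕ G.Sd ≃ H.Sd
  seam : F.S ⊕ G.S ≃ H.S
  next_inl : ∀ d, H.next (side (.inl d)) = side (.inl (F.next d))
  next_inr : ∀ d, H.next (side (.inr d)) = side (.inr (G.next d))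
  opp_inl_inl : ∀ d d', Side.Opp (side (.inl d)) (side (.inl d')) ↔ Side.Opp d d'
  opp_inr_inr : ∀ d d', Side.Opp (side (.inr d)) (side (.inr d')) ↔ Side.Opp d d'
  opp_inl_inr : ∀ d d', Side.Opp (side (.inl d)) (side (.inr d')) ↔ ∃ e, d = bF e ∧ d' = bG e
  opp_inr_inl : ∀ d d', Side.Opp (side (.inr d)) (side (.inl d')) ↔ ∃ e, d = bG e ∧ d' = bF e
  thin_inl : ∀ s b, side (.inl (.thin s b)) = .thin (seam (.inl s)) b
  thin_inr : ∀ s b, side (.inr (.thin s b)) = .thin (seam (.inr s)) b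
  thick_inl : ∀ s, side (.inl (.thick s)) = .thick (seam (.inl s))
  thick_inr : ∀ s, side (.inr (.thick s)) = .thick (seam (.inr s))
  reg_inl : ∀ r b, ∃ r', side (.inl (.reg r b)) = .reg r' b
  reg_inr : ∀ r b, ∃ r', side (.inr (.reg r b)) = .reg r' b
  wt_inl : ∀ d, H.wt (side (.inl d)) = F.wt d
  wt_inr : ∀ d, H.wt (side (.inr d)) = G.wt d
  dot_inl : ∀ d, HEq (H.dot (side (.inl d))) (F.dot d)
  dot_inr : ∀ d, HEq (H.dot (side (.inr d))) (G.dot d)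

namespace Pasting

variable {F : Foam Γ₀ Γ₁} {G : Foam Γ₂ Γ₃} {H : Foam Γ₄ Γ₅} (P : Pasting F G H)

/-- A pasting with the two foams exchanged. -/
def symm : Pasting G F H where
  E := P.E
  bF := P.bG
  bG := P.bF
  side := (Equiv.sumComm _ _).trans P.side
  seam := (Equiv.sumComm _ _).trans P.seam
  next_inl := P.next_inr
  next_inr := P.next_inl
  opp_inl_inl := P.opp_inr_inr
  opp_inr_inr := P.opp_inl_inl
  opp_inl_inr := P.opp_inr_inl
  opp_inr_inl := P.opp_inl_inr
  thin_inl := P.thin_inr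
  thin_inr := P.thin_inl
  thick_inl := P.thick_inr
  thick_inr := P.thick_inl
  reg_inl := P.reg_inr
  reg_inr := P.reg_inl
  wt_inl := P.wt_inr
  wt_inr := P.wt_inl
  dot_inl := P.dot_inr
  dot_inr := P.dot_inl

theorem reg_inl_eq (κ : Coloring N H) (r : F.R) :
    κ.c (P.side (.inl (.reg r true))) = κ.c (P.side (.inl (.reg r false))) := by
  have h := (P.opp_inl_inl (.reg r true) (.reg r false)).2 (by rw [Side.opp_reg_iff]; rfl)
  obtain ⟨r', h'⟩ := P.reg_inl r true
  rw [h', Side.reg_opp_iff] at h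
  rw [h, h', κ.reg]
  rfl

/-- Restriction of a coloring to the first foam. -/
def left (κ : Coloring N H) : Coloring N F where
  c := fun d => κ.c (P.side (.inl d))
  card := fun d => by rw [κ.card, P.wt_inl]
  next := fun d => by rw [← P.next_inl, κ.next]
  reg := P.reg_inl_eq κ
  disj := fun s => by rw [P.thin_inl, P.thin_inl]; exact κ.disj _
  seam := fun s => by rw [P.thin_inl, P.thin_inl, P.thick_inl]; exact κ.seam _

/-- Restriction of a coloring to the second foam. -/
def right (κ : Coloring N H) : Coloring N G := P.symm.left κ

theorem compat (κ : Coloring N H) (e : P.E) :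
    (P.left κ).c (P.bF e) = (P.right κ).c (P.bG e) := by
  have h := (P.opp_inl_inr (P.bF e) (P.bG e)).2 ⟨e, rfl, rfl⟩
  change κ.c (P.side (.inl (P.bF e))) = κ.c (P.side (.inr (P.bG e)))
  generalize hx : P.side (.inl (P.bF e)) = x at *
  generalize hy : P.side (.inr (P.bG e)) = y at *
  cases h with
  | reg r b => exact κ.reg_eq _ _ _
  | thinThick s b =>
    exfalso
    obtain ⟨s', rfl⟩ := P.seam.surjective s
    rcases s' with s' | s'
    · rw [← P.thick_inl] at hy
      cases P.side.injective hy
    · rw [← P.thin_inr] at hx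
      cases P.side.injective hx
  | thickThin s b =>
    exfalso
    obtain ⟨s', rfl⟩ := P.seam.surjective s
    rcases s' with s' | s'
    · rw [← P.thin_inl] at hy
      cases P.side.injective hy
    · rw [← P.thick_inr] at hx
      cases P.side.injective hx

theorem step_inl {d d' : F.Sd} (h : F.Step d d') :
    H.Step (P.side (.inl d)) (P.side (.inl d')) := by
  obtain ⟨r, b, h, rfl⟩ := h
  obtain ⟨r', hr⟩ := P.reg_inl r b
  refine ⟨r', b, by rw [P.next_inl, h, hr], ?_⟩
  have := (P.opp_inl_inl (.reg r (!b)) (.reg r b)).2 (by rw [Side.opp_reg_iff])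
  rwa [hr, Side.opp_reg_iff] at this

theorem arc_inl {x y : F.Sd} (h : F.Arc x y) : H.Arc (P.side (.inl x)) (P.side (.inl y)) := by
  obtain ⟨d, h, rfl⟩ := h
  exact ⟨_, h.lift (fun d => P.side (.inl d)) fun _ _ => P.step_inl, P.next_inl d⟩

theorem arc_inr {x y : G.Sd} (h : G.Arc x y) : H.Arc (P.side (.inr x)) (P.side (.inr y)) :=
  P.symm.arc_inl h

theorem bijective_next (P : Pasting F G H) (hF : F.next.Bijective) (hG : G.next.Bijective) : H.next.Bijective := by
  have : H.next = P.side ∘ Sum.map F.next G.next ∘ P.side.symm := by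
    funext d
    obtain ⟨d | d, rfl⟩ := P.side.surjective d
    · simp [P.next_inl]
    · simp [P.next_inr]
  rw [this]
  exact P.side.bijective.comp ((Sum.map_bijective.2 ⟨hF, hG⟩).comp P.side.symm.bijective)

theorem side_image (A : Set H.Sd) {Z : Type*} (f : H.Sd → Z) :
    f '' A = (fun d => f (P.side (.inl d))) '' {d | P.side (.inl d) ∈ A} ∪
      (fun d => f (P.side (.inr d))) '' {d | P.side (.inr d) ∈ A} := by
  ext z
  constructor
  · rintro ⟨d, hd, rfl⟩
    obtain ⟨d | d, rfl⟩ := P.side.surjective d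
    exacts [.inl ⟨d, hd, rfl⟩, .inr ⟨d, hd, rfl⟩]
  · rintro (⟨d, hd, rfl⟩ | ⟨d, hd, rfl⟩)
    exacts [⟨_, hd, rfl⟩, ⟨_, hd, rfl⟩]

/-! ### Faces -/

/-- Polygons of the first foam as polygons of the pasted foam. -/
def faceL : F.Face → H.Face :=
  Quot.map (fun d => P.side (.inl d)) fun d d' h => by rw [← h, P.next_inl]

/-- Polygons of the second foam as polygons of the pasted foam. -/
def faceR : G.Face → H.Face :=
  Quot.map (fun d => P.side (.inr d)) fun d d' h => by rw [← h, P.next_inr]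

/-- The polygons of the pasted foam are those of the two foams. -/
def splitFace : H.Face → F.Face ⊕ G.Face :=
  Quot.lift (fun d => Sum.map F.face G.face (P.side.symm d)) fun d d' h => by
    subst h
    obtain ⟨d | d, rfl⟩ := P.side.surjective d
    · simp [P.next_inl, face_next]
    · simp [P.next_inr, face_next]

theorem splitFace_faceL (x : F.Face) : P.splitFace (P.faceL x) = .inl x := by
  obtain ⟨d⟩ := x
  simp [faceL, splitFace, Quot.map, face]

theorem splitFace_faceR (x : G.Face) : P.splitFace (P.faceR x) = .inr x := by
  obtain ⟨d⟩ := x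
  simp [faceR, splitFace, Quot.map, face]

theorem ncard_face (A : Set H.Sd) : (H.face '' A).ncard =
    (F.face '' {d | P.side (.inl d) ∈ A}).ncard + (G.face '' {d | P.side (.inr d) ∈ A}).ncard := by
  have := ncard_pushout (f := P.faceL) (g := P.faceR) (t := Empty.elim) (u := Empty.elim) (C := ∅)
    (A := F.face '' {d | P.side (.inl d) ∈ A}) (B := G.face '' {d | P.side (.inr d) ∈ A})
    (fun x y h => by
      have := congrArg P.splitFace h
      simpa [splitFace_faceL] using this)
    (fun x y h => by
      have := congrArg P.splitFace h
      simpa [splitFace_faceR] using this) (fun x => x.elim)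
    (fun x y => by
      constructor
      · intro h
        have := congrArg P.splitFace h
        simp [splitFace_faceR, splitFace_faceL] at this
      · rintro ⟨e, -⟩
        exact e.elim) (fun w => w.elim) (fun w => w.elim)
  rw [Set.ncard_empty, add_zero] at this
  rw [← this, P.side_image A, Set.image_image, Set.image_image]
  rfl

/-! ### Edges -/

/-- The edges `bF e` and `bG e` lie on the boundary. -/
structure Free : Prop where
  injF : P.bF.Injective
  injG : P.bG.Injective
  not_opp_bF : ∀ e z, ¬ Side.Opp z (P.bF e)
  bF_not_opp : ∀ e z, ¬ Side.Opp (P.bF e) z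
  not_opp_bG : ∀ e z, ¬ Side.Opp z (P.bG e)
  bG_not_opp : ∀ e z, ¬ Side.Opp (P.bG e) z

theorem edge_singleton {F : Foam Γ₀ Γ₁} {x : F.Sd} (h1 : ∀ z, ¬ Side.Opp z x)
    (h2 : ∀ z, ¬ Side.Opp x z) {d : F.Sd} (h : F.edge d = F.edge x) : d = x := by
  have := congrArg (Quot.lift (fun d => d = x) fun d d' (hd : Side.Opp d d') => by
    apply propext
    constructor
    · rintro rfl
      exact absurd hd (h2 _)
    · rintro rfl
      exact absurd hd (h1 _)) h
  exact (iff_of_eq this).2 rfl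

variable {P}

/-- Edges of the first foam as edges of the pasted foam. -/
def edgeL (P : Pasting F G H) : F.Edge → H.Edge :=
  Quot.map (fun d => P.side (.inl d)) fun d d' h => (P.opp_inl_inl d d').2 h

/-- Edges of the second foam as edges of the pasted foam. -/
def edgeR (P : Pasting F G H) : G.Edge → H.Edge :=
  Quot.map (fun d => P.side (.inr d)) fun d d' h => (P.opp_inr_inr d d').2 h

open Classical in
/-- An auxiliary retraction. -/
def splitEdge (P : Pasting F G H) (hP : P.Free) : H.Edge → F.Edge ⊕ G.Edge :=
  Quot.lift (fun d => Sum.elim (fun d => if h : ∃ e, d = P.bF e then .inr (G.edge (P.bG h.choose))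
    else .inl (F.edge d)) (fun d => .inr (G.edge d)) (P.side.symm d)) fun d d' h => by
    have key : ∀ e (h : ∃ e', P.bF e = P.bF e'), h.choose = e := fun e h =>
      (hP.injF h.choose_spec).symm
    obtain ⟨d | d, rfl⟩ := P.side.surjective d <;> obtain ⟨d' | d', rfl⟩ := P.side.surjective d' <;>
      simp only [Equiv.symm_apply_apply, Sum.elim_inl, Sum.elim_inr]
    · rw [P.opp_inl_inl] at h
      have h1 : ¬ ∃ e, d = P.bF e := by
        rintro ⟨e, rfl⟩
        exact hP.bF_not_opp _ _ h
      have h2 : ¬ ∃ e, d' = P.bF e := by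
        rintro ⟨e, rfl⟩
        exact hP.not_opp_bF _ _ h
      rw [dif_neg h1, dif_neg h2]
      exact congrArg _ (Quot.sound h)
    · rw [P.opp_inl_inr] at h
      obtain ⟨e, rfl, rfl⟩ := h
      rw [dif_pos ⟨e, rfl⟩, key]
    · rw [P.opp_inr_inl] at h
      obtain ⟨e, rfl, rfl⟩ := h
      rw [dif_pos ⟨e, rfl⟩, key]
    · rw [P.opp_inr_inr] at h
      exact congrArg _ (Quot.sound h)

theorem edgeL_eq_edgeR (hP : P.Free) (x : F.Edge) (y : G.Edge) :
    P.edgeL x = P.edgeR y ↔ ∃ e, x = F.edge (P.bF e) ∧ y = G.edge (P.bG e) := by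
  classical
  constructor
  · obtain ⟨d⟩ := x
    obtain ⟨d'⟩ := y
    intro h
    have := congrArg (P.splitEdge hP) h
    simp only [edgeL, edgeR, Quot.map, splitEdge, Equiv.symm_apply_apply, Sum.elim_inl,
      Sum.elim_inr] at this
    split_ifs at this with h1
    refine ⟨h1.choose, congrArg _ h1.choose_spec, (Sum.inr_injective this).symm⟩
  · rintro ⟨e, rfl, rfl⟩
    exact Quot.sound ((P.opp_inl_inr _ _).2 ⟨e, rfl, rfl⟩)

theorem edgeR_injective (hP : P.Free) : P.edgeR.Injective := by
  rintro ⟨d⟩ ⟨d'⟩ h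
  have := congrArg (P.splitEdge hP) h
  simp only [edgeR, Quot.map, splitEdge, Equiv.symm_apply_apply, Sum.elim_inr,
    Sum.inr.injEq] at this
  exact this

theorem edgeL_injective (hP : P.Free) : P.edgeL.Injective := by
  classical
  rintro ⟨d⟩ ⟨d'⟩ h
  have := congrArg (P.splitEdge hP) h
  simp only [edgeL, Quot.map, splitEdge, Equiv.symm_apply_apply, Sum.elim_inl] at this
  split_ifs at this with h1 h2
  · have h3 := edge_singleton (hP.not_opp_bG _) (hP.bG_not_opp _) (Sum.inr_injective this)
    have h4 := hP.injG h3
    have h5 := h1.choose_spec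
    rw [h4, ← h2.choose_spec] at h5
    rw [h5]
  · exact Sum.inl_injective this

theorem ncard_edge (hP : P.Free) (A : Set H.Sd) {C : Set P.E}
    (hl : ∀ e, P.side (.inl (P.bF e)) ∈ A ↔ e ∈ C) (hr : ∀ e, P.side (.inr (P.bG e)) ∈ A ↔ e ∈ C) :
    (H.edge '' A).ncard + C.ncard =
    (F.edge '' {d | P.side (.inl d) ∈ A}).ncard + (G.edge '' {d | P.side (.inr d) ∈ A}).ncard := by
  have := ncard_pushout (f := P.edgeL) (g := P.edgeR) (t := fun e => F.edge (P.bF e))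
    (u := fun e => G.edge (P.bG e)) (C := C)
    (A := F.edge '' {d | P.side (.inl d) ∈ A}) (B := G.edge '' {d | P.side (.inr d) ∈ A})
    (edgeL_injective hP) (edgeR_injective hP)
    (fun e e' h => hP.injF (edge_singleton (hP.not_opp_bF _) (hP.bF_not_opp _) h))
    (edgeL_eq_edgeR hP)
    (fun e => by
      rw [← hl]
      constructor
      · rintro ⟨d, hd, h⟩
        rwa [edge_singleton (hP.not_opp_bF _) (hP.bF_not_opp _) h] at hd
      · exact fun h => ⟨_, h, rfl⟩)
    (fun e => by
      rw [← hr]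
      constructor
      · rintro ⟨d, hd, h⟩
        rwa [edge_singleton (hP.not_opp_bG _) (hP.bG_not_opp _) h] at hd
      · exact fun h => ⟨_, h, rfl⟩)
  rw [← this, P.side_image A, Set.image_image, Set.image_image]
  rfl

/-! ### Vertices -/

/-- The common boundary, with its vertices. -/
structure Along (P : Pasting F G H) (M : VertexModel P.E) : Prop where
  left : F.IsBoundary M P.bF
  right : G.IsBoundary M.rev P.bG
  bijF : F.next.Bijective
  bijG : G.next.Bijective

variable {M : VertexModel P.E}

theorem Along.free (hP : P.Along M) : P.Free where
  injF := hP.left.inj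
  injG := hP.right.inj
  not_opp_bF := hP.left.not_opp
  bF_not_opp := hP.left.opp_not
  not_opp_bG := hP.right.not_opp
  bG_not_opp := hP.right.opp_not

/-- Vertices of the first foam as vertices of the pasted foam. -/
def vertexL (P : Pasting F G H) : F.Vertex → H.Vertex :=
  Quot.map (fun d => P.side (.inl d)) fun d d' h => by
    rw [P.next_inl]; exact (P.opp_inl_inl _ _).2 h

/-- Vertices of the second foam as vertices of the pasted foam. -/
def vertexR (P : Pasting F G H) : G.Vertex → H.Vertex :=
  Quot.map (fun d => P.side (.inr d)) fun d d' h => by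
    rw [P.next_inr]; exact (P.opp_inr_inr _ _).2 h

open Classical in
/-- An auxiliary retraction. -/
def splitVertex (P : Pasting F G H) {M : VertexModel P.E} (hP : P.Along M) :
    H.Vertex → F.Vertex ⊕ G.Vertex :=
  Quot.lift (fun d => Sum.elim (fun d => if h : ∃ w, F.vertex d = F.bdVertex M P.bF w then
      .inr (G.bdVertex M.rev P.bG h.choose) else .inl (F.vertex d))
      (fun d => .inr (G.vertex d)) (P.side.symm d)) fun d d' h => by
    have key : ∀ w (h : ∃ w', F.bdVertex M P.bF w = F.bdVertex M P.bF w'), h.choose = w :=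
      fun e h => (hP.left.injective hP.bijF.1 h.choose_spec).symm
    obtain ⟨d | d, rfl⟩ := P.side.surjective d <;> obtain ⟨d' | d', rfl⟩ := P.side.surjective d' <;>
      simp only [Equiv.symm_apply_apply, Sum.elim_inl, Sum.elim_inr]
    · rw [P.next_inl, P.opp_inl_inl] at h
      simp only [vertex_eq_of_opp h]
    · rw [P.next_inr, P.opp_inl_inr] at h
      obtain ⟨e, rfl, h⟩ := h
      simp only [hP.right.vertex_src hP.bijG.1 h, hP.left.vertex_tgt]
      rw [dif_pos ⟨_, rfl⟩, key]
      rfl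
    · rw [P.next_inl, P.opp_inr_inl] at h
      obtain ⟨e, rfl, h⟩ := h
      simp only [hP.left.vertex_src hP.bijF.1 h, hP.right.vertex_tgt]
      rw [dif_pos ⟨_, rfl⟩, key]
      rfl
    · rw [P.next_inr, P.opp_inr_inr] at h
      rw [vertex_eq_of_opp h]

theorem vertexL_bdVertex (hP : P.Along M) (w : M.V) :
    P.vertexL (F.bdVertex M P.bF w) = P.vertexR (G.bdVertex M.rev P.bG w) := by
  obtain ⟨d, hd⟩ := hP.bijG.2 (P.bG (M.kind w).anIn)
  have h1 := hP.right.vertex_src hP.bijG.1 hd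
  have h2 : M.rev.src (M.kind w).anIn = w := (M.mem_ins _ _).1 (M.kind w).anIn_mem
  rw [h2] at h1
  rw [← h1]
  refine vertex_eq_of_opp (F := H) (d := P.side (.inl _)) (d' := P.side (.inr _)) ?_
  rw [P.next_inr, hd, P.opp_inl_inr]
  exact ⟨_, rfl, rfl⟩

theorem vertexL_eq_vertexR (hP : P.Along M) (x : F.Vertex) (y : G.Vertex) :
    P.vertexL x = P.vertexR y ↔
      ∃ w, x = F.bdVertex M P.bF w ∧ y = G.bdVertex M.rev P.bG w := by
  classical
  constructor
  · obtain ⟨d⟩ := x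
    obtain ⟨d'⟩ := y
    intro h
    have := congrArg (P.splitVertex hP) h
    simp only [vertexL, vertexR, Quot.map, splitVertex, Equiv.symm_apply_apply, Sum.elim_inl,
      Sum.elim_inr] at this
    split_ifs at this with h1
    exact ⟨h1.choose, h1.choose_spec, (Sum.inr_injective this).symm⟩
  · rintro ⟨w, rfl, rfl⟩
    exact vertexL_bdVertex hP w

theorem vertexR_injective (hP : P.Along M) : P.vertexR.Injective := by
  rintro ⟨d⟩ ⟨d'⟩ h
  have := congrArg (P.splitVertex hP) h
  simp only [vertexR, Quot.map, splitVertex, Equiv.symm_apply_apply, Sum.elim_inr,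
    Sum.inr.injEq] at this
  exact this

theorem vertexL_injective (hP : P.Along M) : P.vertexL.Injective := by
  classical
  rintro ⟨d⟩ ⟨d'⟩ h
  have := congrArg (P.splitVertex hP) h
  simp only [vertexL, Quot.map, splitVertex, Equiv.symm_apply_apply, Sum.elim_inl] at this
  split_ifs at this with h1 h2
  · have h3 := hP.right.injective hP.bijG.1 (Sum.inr_injective this)
    have h5 := h1.choose_spec
    rw [h3, ← h2.choose_spec] at h5
    exact h5
  · exact Sum.inl_injective this

end Pasting

theorem IsBoundary.mem_image_iff {F : Foam Γ₀ Γ₁} {E : Type} {M : VertexModel E} {bd : E → F.Sd}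
    (h : F.IsBoundary M bd) (hF : F.next.Bijective) (κ : Coloring N F)
    (p : Finset (Fin N) → Prop) (w : M.V) :
    F.bdVertex M bd w ∈ F.vertex '' {d | p (κ.c d)} ↔ w ∈ M.touch {e | p (κ.c (bd e))} := by
  constructor
  · rintro ⟨d, hd, hw⟩
    obtain ⟨x, y, h1, h2, ⟨e, he, rfl⟩ | ⟨e, he, rfl⟩⟩ := h.exists_edge hF.1 hw
    exacts [⟨e, by rwa [Set.mem_ofPred_eq, ← κ.reach h2], .inl he⟩,
      ⟨e, by rwa [Set.mem_ofPred_eq, κ.arc h1, ← κ.reach h2], .inr he⟩]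
  · rintro ⟨e, he, rfl | rfl⟩
    · exact ⟨bd e, he, h.vertex_tgt e⟩
    · obtain ⟨d, hd⟩ := hF.2 (bd e)
      refine ⟨d, ?_, h.vertex_src hF.1 hd⟩
      rwa [Set.mem_ofPred_eq, ← κ.next, hd]

namespace Pasting

variable {F : Foam Γ₀ Γ₁} {G : Foam Γ₂ Γ₃} {H : Foam Γ₄ Γ₅} {P : Pasting F G H}
  {M : VertexModel P.E}

theorem chi_eq (hP : P.Along M) (κ : Coloring N H) (p : Finset (Fin N) → Prop) :
    κ.chi p = (P.left κ).chi p + (P.right κ).chi p -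
      ((M.touch {e | p ((P.left κ).c (P.bF e))}).ncard -
        {e | p ((P.left κ).c (P.bF e))}.ncard) := by
  have hv := ncard_pushout (f := P.vertexL) (g := P.vertexR) (t := F.bdVertex M P.bF)
    (u := G.bdVertex M.rev P.bG) (C := M.touch {e | p ((P.left κ).c (P.bF e))})
    (A := F.vertex '' {d | p ((P.left κ).c d)}) (B := G.vertex '' {d | p ((P.right κ).c d)})
    (vertexL_injective hP) (vertexR_injective hP) (hP.left.injective hP.bijF.1)
    (vertexL_eq_vertexR hP)
    (hP.left.mem_image_iff hP.bijF _ p)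
    (fun w => by
      refine (hP.right.mem_image_iff hP.bijG (P.right κ) p w).trans ?_
      rw [M.touch_rev]
      simp only [P.compat]
      exact Iff.rfl)
  have e1 := P.side_image {d | p (κ.c d)} H.vertex
  have e2 : P.vertexL '' (F.vertex '' {d | p ((P.left κ).c d)}) ∪
      P.vertexR '' (G.vertex '' {d | p ((P.right κ).c d)}) = H.vertex '' {d | p (κ.c d)} := by
    rw [e1, Set.image_image, Set.image_image]
    rfl
  rw [e2] at hv
  have he := ncard_edge hP.free {d | p (κ.c d)} (C := {e | p ((P.left κ).c (P.bF e))})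
    (fun e => Iff.rfl) (fun e => by
      change p ((P.right κ).c _) ↔ _
      rw [← P.compat]
      rfl)
  have hf := P.ncard_face {d | p (κ.c d)}
  unfold Coloring.chi euler
  change _ = ((F.face '' {d | p ((P.left κ).c d)}).ncard +
    (G.face '' {d | p ((P.right κ).c d)}).ncard) at hf
  change _ = ((F.edge '' {d | p ((P.left κ).c d)}).ncard +
    (G.edge '' {d | p ((P.right κ).c d)}).ncard) at he
  omega

theorem decor_eq {L : Type*} [Field L] (P : Pasting F G H) (x : Fin N → L) (κ : Coloring N H) :
    κ.decor x = (P.left κ).decor x * (P.right κ).decor x := by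
  classical
  unfold Coloring.decor
  have := Fintype.ofFinite F.Sd
  have := Fintype.ofFinite G.Sd
  rw [← finprod_comp_equiv P.side, finprod_eq_prod_of_fintype, Fintype.prod_sum_type,
    finprod_eq_prod_of_fintype, finprod_eq_prod_of_fintype]
  congr 1
  exacts [Finset.prod_congr rfl fun d _ => decoration_congr x (P.wt_inl d) (P.dot_inl d) rfl,
    Finset.prod_congr rfl fun d _ => decoration_congr x (P.wt_inr d) (P.dot_inr d) rfl]

end Pasting

end Foam

theorem card_quot_sum {X Y Z : Type*} [Finite X] [Finite Y] (e : X ⊕ Y ≃ Z)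
    {r : Z → Z → Prop} {rX : X → X → Prop} {rY : Y → Y → Prop}
    (hll : ∀ a b, r (e (.inl a)) (e (.inl b)) ↔ rX a b)
    (hrr : ∀ a b, r (e (.inr a)) (e (.inr b)) ↔ rY a b)
    (hlr : ∀ a b, ¬ r (e (.inl a)) (e (.inr b))) (hrl : ∀ a b, ¬ r (e (.inr a)) (e (.inl b))) :
    Nat.card (Quot r) = Nat.card (Quot rX) + Nat.card (Quot rY) := by
  rw [← Nat.card_sum]
  refine Nat.card_congr ⟨Quot.lift (fun z => Sum.map (Quot.mk rX) (Quot.mk rY) (e.symm z)) ?_,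
    Sum.elim (Quot.map (fun a => e (.inl a)) fun a b h => (hll a b).2 h)
      (Quot.map (fun a => e (.inr a)) fun a b h => (hrr a b).2 h), ?_, ?_⟩
  · intro z z' h
    obtain ⟨a | a, rfl⟩ := e.surjective z <;> obtain ⟨b | b, rfl⟩ := e.surjective z'
    · simpa using Quot.sound ((hll a b).1 h)
    · exact absurd h (hlr a b)
    · exact absurd h (hrl a b)
    · simpa using Quot.sound ((hrr a b).1 h)
  · rintro ⟨z⟩
    obtain ⟨a | a, rfl⟩ := e.surjective z <;> simp [Quot.map]
  · rintro (a | a) <;> induction a using Quot.ind <;> simp [Quot.map]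

theorem reflTransGen_of_unique_ends {X : Type*} [Finite X] {r : X → X → Prop} {s t : X}
    (hpred : ∀ x x' m, r x m → r x' m → x = x') (hsucc : ∀ x, x ≠ t → ∃ m, r x m)
    (hs : ∀ x, ¬ r x s) : Relation.ReflTransGen r s t := by
  by_contra hn
  have h : ∀ x : {x // Relation.ReflTransGen r s x}, ∃ m : {x // Relation.ReflTransGen r s x},
      r x.1 m.1 := by
    rintro ⟨x, hx⟩
    obtain ⟨m, hm⟩ := hsucc x (by rintro rfl; exact hn hx)
    exact ⟨⟨m, hx.tail hm⟩, hm⟩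
  choose f hf using h
  have hinj : f.Injective := fun x x' hxx => Subtype.ext (hpred _ _ _ (hf x) (hxx ▸ hf x'))
  obtain ⟨x, hx⟩ := Finite.surjective_of_injective hinj ⟨s, .refl⟩
  have := hf x
  rw [hx] at this
  exact hs _ this

theorem quot_mk_eq_of_reflTransGen {X : Type*} {r : X → X → Prop} {s t : X}
    (h : Relation.ReflTransGen r s t) : Quot.mk r s = Quot.mk r t := by
  induction h with
  | refl => rfl
  | tail _ h ih => exact ih.trans (Quot.sound h)

namespace Foam

variable {Γ₀ Γ₁ Γ₂ Γ₃ Γ₄ Γ₅ : Web} {N : ℕ}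

namespace Coloring

variable {F : Foam Γ₀ Γ₁} (κ : Coloring N F) {i j : Fin N}

/-- Consecutive seams at which `i` and `j` merge. -/
def sepRel (i j : Fin N) (s s' : {s : F.S // κ.Sep i j s}) : Prop :=
  F.vertex (.thin s.1 false) = F.vertex (.thick s'.1)

theorem theta_eq_thetaFree {T : F.S → Prop} (hT : ∀ s, κ.Sep i j s → ¬ T s) :
    κ.theta i j = κ.thetaFree i j T :=
  Nat.card_congr (Quot.congr (Equiv.subtypeEquivRight fun s => ⟨fun h => ⟨h, hT s h⟩, fun h => h.1⟩)
    fun _ _ => Iff.rfl)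

theorem thetaFree_eq_zero {T : F.S → Prop} (hT : ∀ s, κ.Sep i j s → T s) :
    κ.thetaFree i j T = 0 := by
  have : IsEmpty {s : F.S // κ.Sep i j s ∧ ¬ T s} := ⟨fun s => s.2.2 (hT s.1 s.2.1)⟩
  unfold thetaFree
  rw [Nat.card_eq_zero]
  left
  exact ⟨fun q => q.exists_rep.elim fun s _ => isEmptyElim s⟩

theorem theta_eq_thetaFree_add_one {T : F.S → Prop} {s₀ : F.S} (h₀ : κ.Sep i j s₀) (hT₀ : T s₀)
    (hsat : ∀ s s', κ.Sep i j s → κ.Sep i j s' →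
      F.vertex (.thin s false) = F.vertex (.thick s') → (T s ↔ T s'))
    (hconn : ∀ s hs, T s → Quot.mk (κ.sepRel i j) ⟨s, hs⟩ = Quot.mk _ ⟨s₀, h₀⟩) :
    κ.theta i j = κ.thetaFree i j T + 1 := by
  classical
  have : κ.thetaFree i j T + 1 = Nat.card (Option (Quot
    fun s s' : {s : F.S // κ.Sep i j s ∧ ¬ T s} =>
      F.vertex (.thin s.1 false) = F.vertex (.thick s'.1))) := by
    rw [Finite.card_option]
    rfl
  rw [this]
  refine Nat.card_congr (α := Quot (κ.sepRel i j)) ⟨Quot.lift (fun s => if h : T s.1 then none else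
    some (Quot.mk _ ⟨s.1, s.2, h⟩)) ?_, fun o => o.elim (Quot.mk _ ⟨s₀, h₀⟩)
    (Quot.map (fun s => ⟨s.1, s.2.1⟩) fun _ _ h => h), ?_, ?_⟩
  · intro s s' h
    have := hsat _ _ s.2 s'.2 h
    by_cases hs : T s.1
    · simp only [hs, this.1 hs, dite_true]
    · have hs' := fun h => hs (this.2 h)
      rw [dif_neg hs, dif_neg hs']
      exact congrArg some (Quot.sound h)
  · rintro ⟨s⟩
    by_cases hs : T s.1
    · simp only [hs, dite_true]
      exact (hconn _ s.2 hs).symm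
    · simp only [hs, dite_false]
      rfl
  · rintro (_ | s)
    · simp [hT₀]
    · induction s using Quot.ind with | mk s => ?_
      simp only [Option.elim_some, Quot.map]
      simp [s.2.2]

end Coloring

/-- The seam edge `s` ends at an interior vertex. -/
def InnerEnd (F : Foam Γ₀ Γ₁) (s : F.S) : Prop :=
  (∃ m, F.Theta s m) ∨ ∃ b s' m₁ m₂, F.Tetra b s s' m₁ m₂ ∨ F.Tetra b s' s m₁ m₂

/-- The seam edge `m` starts at an interior vertex. -/
def InnerStart (F : Foam Γ₀ Γ₁) (m : F.S) : Prop :=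
  (∃ s, F.Theta s m) ∨ ∃ b s₁ s₂ m', F.Tetra b s₁ s₂ m m' ∨ F.Tetra b s₁ s₂ m' m

namespace Pasting

variable {F : Foam Γ₀ Γ₁} {G : Foam Γ₂ Γ₃} {H : Foam Γ₄ Γ₅} (P : Pasting F G H)

theorem sep_inl (κ : Coloring N H) {i j : Fin N} {s : F.S} :
    κ.Sep i j (P.seam (.inl s)) ↔ (P.left κ).Sep i j s := by
  unfold Coloring.Sep
  rw [← P.thin_inl, ← P.thin_inl]
  rfl

theorem sep_inr (κ : Coloring N H) {i j : Fin N} {s : G.S} :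
    κ.Sep i j (P.seam (.inr s)) ↔ (P.right κ).Sep i j s := P.symm.sep_inl κ

theorem vertex_thin_inl (s : F.S) (b : Bool) :
    H.vertex (.thin (P.seam (.inl s)) b) = P.vertexL (F.vertex (.thin s b)) := by
  rw [← P.thin_inl]; rfl

theorem vertex_thin_inr (s : G.S) (b : Bool) :
    H.vertex (.thin (P.seam (.inr s)) b) = P.vertexR (G.vertex (.thin s b)) := P.symm.vertex_thin_inl s b

theorem vertex_thick_inl (s : F.S) :
    H.vertex (.thick (P.seam (.inl s))) = P.vertexL (F.vertex (.thick s)) := by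
  rw [← P.thick_inl]; rfl

theorem vertex_thick_inr (s : G.S) :
    H.vertex (.thick (P.seam (.inr s))) = P.vertexR (G.vertex (.thick s)) := P.symm.vertex_thick_inl s

theorem arcs_inl {x y z x' y' z' : F.Sd} (h : F.Arc x x' ∧ F.Arc y y' ∧ F.Arc z z') :
    H.Arc (P.side (.inl x)) (P.side (.inl x')) ∧ H.Arc (P.side (.inl y)) (P.side (.inl y')) ∧
      H.Arc (P.side (.inl z)) (P.side (.inl z')) :=
  h.imp P.arc_inl (.imp P.arc_inl P.arc_inl)

theorem theta_inl {s m : F.S} (h : F.Theta s m) :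
    H.Theta (P.seam (.inl s)) (P.seam (.inl m)) := by
  simp only [Theta, ← P.thin_inl, ← P.thick_inl]
  exact h.imp (fun h b => P.arc_inl (h b)) P.arc_inl

theorem tetra_inl {b : Bool} {s₁ s₂ m₁ m₂ : F.S} (h : F.Tetra b s₁ s₂ m₁ m₂) :
    H.Tetra b (P.seam (.inl s₁)) (P.seam (.inl s₂)) (P.seam (.inl m₁)) (P.seam (.inl m₂)) := by
  simp only [Tetra, ← P.thin_inl, ← P.thick_inl]
  exact ⟨P.arc_inl h.1, P.arc_inl h.2.1, P.arc_inl h.2.2.1, P.arcs_inl h.2.2.2⟩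

theorem innerEnd_inl {s : F.S} (h : F.InnerEnd s) : H.InnerEnd (P.seam (.inl s)) :=
  h.imp (fun ⟨_, h⟩ => ⟨_, P.theta_inl h⟩) fun ⟨_, _, _, _, h⟩ =>
    ⟨_, _, _, _, h.imp P.tetra_inl P.tetra_inl⟩

theorem innerStart_inl {s : F.S} (h : F.InnerStart s) : H.InnerStart (P.seam (.inl s)) :=
  h.imp (fun ⟨_, h⟩ => ⟨_, P.theta_inl h⟩) fun ⟨_, _, _, _, h⟩ =>
    ⟨_, _, _, _, h.imp P.tetra_inl P.tetra_inl⟩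

theorem arcs_inr {x y z x' y' z' : G.Sd} (h : G.Arc x x' ∧ G.Arc y y' ∧ G.Arc z z') :
    H.Arc (P.side (.inr x)) (P.side (.inr x')) ∧ H.Arc (P.side (.inr y)) (P.side (.inr y')) ∧
      H.Arc (P.side (.inr z)) (P.side (.inr z')) :=
  P.symm.arcs_inl h

theorem innerEnd_inr {s : G.S} (h : G.InnerEnd s) : H.InnerEnd (P.seam (.inr s)) :=
  P.symm.innerEnd_inl h

theorem innerStart_inr {s : G.S} (h : G.InnerStart s) : H.InnerStart (P.seam (.inr s)) :=
  P.symm.innerStart_inl h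

variable {P} {M : VertexModel P.E}

theorem thetaFree_add (hP : P.Along M) (κ : Coloring N H) {i j : Fin N} {TF : F.S → Prop}
    {TG : G.S → Prop}
    (h1 : ∀ w s s', (P.left κ).Sep i j s → (P.right κ).Sep i j s' →
      F.vertex (.thin s false) = F.bdVertex M P.bF w →
      G.vertex (.thick s') = G.bdVertex M.rev P.bG w → TF s ∨ TG s')
    (h2 : ∀ w s s', (P.left κ).Sep i j s → (P.right κ).Sep i j s' →
      G.vertex (.thin s' false) = G.bdVertex M.rev P.bG w →
      F.vertex (.thick s) = F.bdVertex M P.bF w → TF s ∨ TG s') :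
    κ.thetaFree i j (fun s => Sum.elim TF TG (P.seam.symm s)) =
      (P.left κ).thetaFree i j TF + (P.right κ).thetaFree i j TG := by
  let p : F.S ⊕ G.S → Prop := fun s =>
    κ.Sep i j (P.seam s) ∧ ¬ Sum.elim TF TG s
  let e : {s : F.S // (P.left κ).Sep i j s ∧ ¬ TF s} ⊕
      {s : G.S // (P.right κ).Sep i j s ∧ ¬ TG s} ≃
      {s : H.S // κ.Sep i j s ∧ ¬ Sum.elim TF TG (P.seam.symm s)} :=
    (Equiv.sumCongr (Equiv.subtypeEquivRight fun s => by
        change _ ↔ κ.Sep i j (P.seam (.inl s)) ∧ ¬ TF s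
        rw [P.sep_inl])
      (Equiv.subtypeEquivRight fun s => by
        change _ ↔ κ.Sep i j (P.seam (.inr s)) ∧ ¬ TG s
        rw [P.sep_inr])).trans
    ((Equiv.subtypeSum (p := p)).symm.trans (Equiv.subtypeEquiv P.seam fun s => by simp [p]))
  have hl : ∀ s, (e (.inl s)).1 = P.seam (.inl s.1) := fun _ => rfl
  have hr : ∀ s, (e (.inr s)).1 = P.seam (.inr s.1) := fun _ => rfl
  refine card_quot_sum e ?_ ?_ ?_ ?_
  · intro a b
    rw [hl, hl, P.vertex_thin_inl, P.vertex_thick_inl, (vertexL_injective hP).eq_iff]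
  · intro a b
    rw [hr, hr, P.vertex_thin_inr, P.vertex_thick_inr, (vertexR_injective hP).eq_iff]
  · intro a b
    rw [hl, hr, P.vertex_thin_inl, P.vertex_thick_inr, vertexL_eq_vertexR hP]
    rintro ⟨w, ha, hb⟩
    rcases h1 w _ _ a.2.1 b.2.1 ha hb with h | h
    exacts [a.2.2 h, b.2.2 h]
  · intro b a
    rw [hl, hr, P.vertex_thin_inr, P.vertex_thick_inl, eq_comm, vertexL_eq_vertexR hP]
    rintro ⟨w, ha, hb⟩
    rcases h2 w _ _ a.2.1 b.2.1 hb ha with h | h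
    exacts [a.2.2 h, b.2.2 h]

theorem mk_inl_eq (κ : Coloring N H) {i j : Fin N} {s s' : {s // (P.left κ).Sep i j s}}
    (h : Quot.mk ((P.left κ).sepRel i j) s = Quot.mk _ s') :
    Quot.mk (κ.sepRel i j) ⟨P.seam (.inl s.1), (P.sep_inl κ).2 s.2⟩ =
      Quot.mk _ ⟨P.seam (.inl s'.1), (P.sep_inl κ).2 s'.2⟩ :=
  congrArg (Quot.map (ra := (P.left κ).sepRel i j) (rb := κ.sepRel i j)
    (fun s => ⟨P.seam (.inl s.1), (P.sep_inl κ).2 s.2⟩) fun a b hab => by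
      change H.vertex _ = H.vertex _
      rw [P.vertex_thin_inl, P.vertex_thick_inl]
      exact congrArg _ hab) h

theorem mk_inr_eq (κ : Coloring N H) {i j : Fin N} {s s' : {s // (P.right κ).Sep i j s}}
    (h : Quot.mk ((P.right κ).sepRel i j) s = Quot.mk _ s') :
    Quot.mk (κ.sepRel i j) ⟨P.seam (.inr s.1), (P.sep_inr κ).2 s.2⟩ =
      Quot.mk _ ⟨P.seam (.inr s'.1), (P.sep_inr κ).2 s'.2⟩ :=
  P.symm.mk_inl_eq κ h

theorem mk_inl_eq_inr (hP : P.Along M) (κ : Coloring N H) {i j : Fin N}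
    {s : {s // (P.left κ).Sep i j s}} {s' : {s // (P.right κ).Sep i j s}} {w : M.V}
    (h : F.vertex (.thin s.1 false) = F.bdVertex M P.bF w)
    (h' : G.vertex (.thick s'.1) = G.bdVertex M.rev P.bG w) :
    Quot.mk (κ.sepRel i j) ⟨P.seam (.inl s.1), (P.sep_inl κ).2 s.2⟩ =
      Quot.mk _ ⟨P.seam (.inr s'.1), (P.sep_inr κ).2 s'.2⟩ := by
  apply Quot.sound
  change H.vertex _ = H.vertex _
  rw [P.vertex_thin_inl, P.vertex_thick_inr, h, h', vertexL_bdVertex hP]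

theorem mk_inr_eq_inl (hP : P.Along M) (κ : Coloring N H) {i j : Fin N}
    {s : {s // (P.left κ).Sep i j s}} {s' : {s // (P.right κ).Sep i j s}} {w : M.V}
    (h : G.vertex (.thin s'.1 false) = G.bdVertex M.rev P.bG w)
    (h' : F.vertex (.thick s.1) = F.bdVertex M P.bF w) :
    Quot.mk (κ.sepRel i j) ⟨P.seam (.inr s'.1), (P.sep_inr κ).2 s'.2⟩ =
      Quot.mk _ ⟨P.seam (.inl s.1), (P.sep_inl κ).2 s.2⟩ := by
  apply Quot.sound
  change H.vertex _ = H.vertex _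
  rw [P.vertex_thin_inr, P.vertex_thick_inl, h, h', vertexL_bdVertex hP]

end Pasting

/-! ### Gluing -/

section Glue

variable (F : Foam Γ₀ Γ₁) (G : Foam Γ₁ Γ₂)

theorem cutSide_glueSide {R S R' S' E₀ E₁ E₂ : Type} (z : Side R S E₀ E₁ ⊕ Side R' S' E₁ E₂) :
    cutSide (glueSide z) = z := by
  rcases z with (_ | _ | _ | _ | _) | (_ | _ | _ | _ | _) <;> rfl

theorem glueSide_cutSide {R S R' S' E₀ E₁ E₂ : Type}
    (z : Side (R ⊕ R' ⊕ E₁) (S ⊕ S') E₀ E₂) : glueSide (cutSide z) = z := by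
  rcases z with ⟨(_ | _ | _), (_ | _)⟩ | ⟨(_ | _), _⟩ | (_ | _) | _ | _ <;> rfl

theorem opp_glueSide {R S R' S' E₀ E₁ E₂ : Type} (z z' : Side R S E₀ E₁ ⊕ Side R' S' E₁ E₂) :
    Side.Opp (glueSide z) (glueSide z') ↔ match z, z' with
      | .inl d, .inl d' => d.Opp d'
      | .inr d, .inr d' => d.Opp d'
      | .inl d, .inr d' => ∃ e, d = .top e ∧ d' = .bot e
      | .inr d, .inl d' => ∃ e, d = .bot e ∧ d' = .top e := by
  rcases z with (⟨_, _⟩ | ⟨_, _⟩ | _ | _ | _) | (⟨_, _⟩ | ⟨_, _⟩ | _ | _ | _) <;>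
  rcases z' with (⟨_, _⟩ | ⟨_, _⟩ | _ | _ | _) | (⟨_, _⟩ | ⟨_, _⟩ | _ | _ | _) <;>
  simp [glueSide, Side.opp_reg_iff, Side.opp_thin_iff, Side.opp_thick_iff, Side.not_opp_top,
    Side.not_opp_bot]
  all_goals exact eq_comm

/-- Gluing as a pasting. -/
def gluing : Pasting F G (F.glue G) where
  E := Γ₁.E
  bF := .top
  bG := .bot
  side := ⟨glueSide, cutSide, cutSide_glueSide, glueSide_cutSide⟩
  seam := Equiv.refl _
  next_inl := fun d => by
    change glueSide (Sum.map F.next G.next (cutSide (glueSide (.inl d)))) = glueSide (.inl (F.next d))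
    rw [cutSide_glueSide]; rfl
  next_inr := fun d => by
    change glueSide (Sum.map F.next G.next (cutSide (glueSide (.inr d)))) = glueSide (.inr (G.next d))
    rw [cutSide_glueSide]; rfl
  opp_inl_inl := fun d d' => opp_glueSide (.inl d) (.inl d')
  opp_inr_inr := fun d d' => opp_glueSide (.inr d) (.inr d')
  opp_inl_inr := fun d d' => opp_glueSide (.inl d) (.inr d')
  opp_inr_inl := fun d d' => opp_glueSide (.inr d) (.inl d')
  thin_inl := fun _ _ => rfl
  thin_inr := fun _ _ => rfl
  thick_inl := fun _ => rfl
  thick_inr := fun _ => rfl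
  reg_inl := fun _ _ => ⟨_, rfl⟩
  reg_inr := fun _ _ => ⟨_, rfl⟩
  wt_inl := fun d => by
    change Sum.elim F.wt G.wt (cutSide (glueSide (.inl d))) = F.wt d
    rw [cutSide_glueSide]; rfl
  wt_inr := fun d => by
    change Sum.elim F.wt G.wt (cutSide (glueSide (.inr d))) = G.wt d
    rw [cutSide_glueSide]; rfl
  dot_inl := by rintro (⟨_, _⟩ | ⟨_, _⟩ | _ | _ | _) <;> exact HEq.rfl
  dot_inr := by rintro (⟨_, _⟩ | ⟨_, _⟩ | _ | _ | _) <;> exact HEq.rfl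

variable {F G}

theorem along_glue (hF : F.IsFoam N) (hG : G.IsFoam N) {M : VertexModel Γ₁.E}
    (hM : Γ₁.Models M) : (gluing F G).Along (M := M) :=
  ⟨hF.isBoundary_top hM, hG.isBoundary_bot hM, hF.bij, hG.bij⟩

/-- The coloring of a glued foam by two compatible colorings. -/
def Coloring.glue (κ : Coloring N F) (κ' : Coloring N G) (h : ∀ e, κ.c (.top e) = κ'.c (.bot e)) :
    Coloring N (F.glue G) where
  c := fun d => Sum.elim κ.c κ'.c (cutSide d)
  card := fun d => (cutSide d).rec
    (motive := fun z => (Sum.elim κ.c κ'.c z).card = Sum.elim F.wt G.wt z) κ.card κ'.card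
  next := fun d => by
    change Sum.elim κ.c κ'.c (cutSide (glueSide (Sum.map F.next G.next (cutSide d)))) = _
    rw [cutSide_glueSide]
    exact (cutSide d).rec κ.next κ'.next
  reg := by
    rintro (r | r | e)
    exacts [κ.reg r, κ'.reg r, h e]
  disj := Sum.rec κ.disj κ'.disj
  seam := Sum.rec κ.seam κ'.seam

theorem Coloring.ext_c {F : Foam Γ₀ Γ₁} {κ κ' : Coloring N F} (h : ∀ d, κ.c d = κ'.c d) :
    κ = κ' := by
  obtain ⟨c, _⟩ := κ
  obtain ⟨c', _⟩ := κ'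
  obtain rfl : c = c' := funext h
  rfl

instance {F : Foam Γ₀ Γ₁} : Finite (Coloring N F) :=
  Finite.of_injective (fun κ : Coloring N F => κ.c) fun _ _ h => Coloring.ext_c (congrFun h)

theorem left_glue (κ : Coloring N F) (κ' : Coloring N G) (h) :
    (gluing F G).left (κ.glue κ' h) = κ := Coloring.ext_c fun d => by
  change Sum.elim κ.c κ'.c (cutSide (glueSide (.inl d))) = _
  rw [cutSide_glueSide]
  rfl

theorem right_glue (κ : Coloring N F) (κ' : Coloring N G) (h) :
    (gluing F G).right (κ.glue κ' h) = κ' := Coloring.ext_c fun d => by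
  change Sum.elim κ.c κ'.c (cutSide (glueSide (.inr d))) = _
  rw [cutSide_glueSide]
  rfl

/-- Colorings of a glued foam are pairs of compatible colorings. -/
def glueColoringEquiv : Coloring N (F.glue G) ≃
    {p : Coloring N F × Coloring N G // ∀ e, p.1.c (.top e) = p.2.c (.bot e)} where
  toFun := fun κ => ⟨((gluing F G).left κ, (gluing F G).right κ),
    (gluing F G).compat κ⟩
  invFun := fun p => p.1.1.glue p.1.2 p.2
  left_inv := fun κ => Coloring.ext_c fun d => by
    obtain ⟨d | d, rfl⟩ := (gluing F G).side.surjective d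
    exacts [congrFun (congrArg Coloring.c (left_glue _ _ ((gluing F G).compat κ))) d,
      congrFun (congrArg Coloring.c (right_glue _ _ ((gluing F G).compat κ))) d]
  right_inv := fun p => Subtype.ext (Prod.ext (left_glue _ _ _) (right_glue _ _ _))

theorem reach_glue_top {x : (F.glue G).Sd} {e : Γ₁.E} {y : (F.glue G).Sd}
    (h1 : (F.glue G).Arc x ((gluing F G).side (.inl (.top e))))
    (h2 : (F.glue G).Arc ((gluing F G).side (.inr (.bot e))) y) : (F.glue G).Arc x y := by
  obtain ⟨d, h, hd⟩ := h1
  obtain ⟨d', h', rfl⟩ := h2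
  exact ⟨d', (h.tail ⟨_, true, hd, rfl⟩).trans h', rfl⟩

theorem reach_glue_bot {x : (F.glue G).Sd} {e : Γ₁.E} {y : (F.glue G).Sd}
    (h1 : (F.glue G).Arc x ((gluing F G).side (.inr (.bot e))))
    (h2 : (F.glue G).Arc ((gluing F G).side (.inl (.top e))) y) : (F.glue G).Arc x y := by
  obtain ⟨d, h, hd⟩ := h1
  obtain ⟨d', h', rfl⟩ := h2
  exact ⟨d', (h.tail ⟨_, false, hd, rfl⟩).trans h', rfl⟩

theorem theta_topSplit {s : F.S} {s' : G.S} {e e₀ e₁ : Γ₁.E} (h : F.TopSplit s e e₀ e₁)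
    (h' : G.BotSplit s' e e₀ e₁) : (F.glue G).Theta (.inl s) (.inr s') := by
  obtain ⟨h0, h1, h2⟩ := h
  obtain ⟨h0', h1', h2'⟩ := h'
  refine ⟨fun b => ?_, ?_⟩
  · cases b
    exacts [reach_glue_top ((gluing F G).arc_inl h0) ((gluing F G).arc_inr h0'),
      reach_glue_top ((gluing F G).arc_inl h1) ((gluing F G).arc_inr h1')]
  · exact reach_glue_bot ((gluing F G).arc_inr h2') ((gluing F G).arc_inl h2)

theorem theta_botMerge {s : F.S} {s' : G.S} {e e₀ e₁ : Γ₁.E} (h : F.TopMerge s e₀ e₁ e)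
    (h' : G.BotMerge s' e₀ e₁ e) : (F.glue G).Theta (.inr s') (.inl s) := by
  obtain ⟨h0, h1, h2⟩ := h
  obtain ⟨h0', h1', h2'⟩ := h'
  refine ⟨fun b => ?_, ?_⟩
  · cases b
    exacts [reach_glue_bot ((gluing F G).arc_inr h0') ((gluing F G).arc_inl h0),
      reach_glue_bot ((gluing F G).arc_inr h1') ((gluing F G).arc_inl h1)]
  · exact reach_glue_top ((gluing F G).arc_inl h2) ((gluing F G).arc_inr h2')

theorem IsFoam.glue (hF : F.IsFoam N) (hG : G.IsFoam N) : (F.glue G).IsFoam N where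
  bij := (gluing F G).bijective_next hF.bij hG.bij
  wt_pos := fun d => (cutSide d).rec (motive := fun z => 0 < Sum.elim F.wt G.wt z) hF.wt_pos hG.wt_pos
  wt_le := fun d => (cutSide d).rec (motive := fun z => Sum.elim F.wt G.wt z ≤ N) hF.wt_le hG.wt_le
  wt_next := fun d => by
    change Sum.elim F.wt G.wt (cutSide (glueSide (Sum.map F.next G.next (cutSide d)))) =
      Sum.elim F.wt G.wt (cutSide d)
    rw [cutSide_glueSide]
    exact (cutSide d).rec hF.wt_next hG.wt_next
  wt_reg := by
    rintro (r | r | e)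
    exacts [hF.wt_reg r, hG.wt_reg r, (hF.wt_top e).trans (hG.wt_bot e).symm]
  wt_seam := Sum.rec hF.wt_seam hG.wt_seam
  wt_bot := hF.wt_bot
  wt_top := hG.wt_top
  seam_end := by
    rintro (s | s)
    · rcases or_assoc.2 (hF.seam_end s) with h | ⟨e, e₀, e₁, h, h'⟩ | ⟨e₀, e₁, e, h, h'⟩
      · exact or_assoc.1 (.inl ((gluing F G).innerEnd_inl h))
      · obtain ⟨s', hs⟩ := hG.bot_split _ _ _ h
        exact .inl ⟨_, theta_topSplit h' hs⟩
      · exact .inr (.inr (.inr ⟨_, _, _, h, (gluing F G).arcs_inl h'⟩))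
    · rcases or_assoc.2 (hG.seam_end s) with h | ⟨e, e₀, e₁, h, h'⟩ | ⟨e₀, e₁, e, h, h'⟩
      · exact or_assoc.1 (.inl ((gluing F G).innerEnd_inr h))
      · exact .inr (.inr (.inl ⟨_, _, _, h, (gluing F G).arcs_inr h'⟩))
      · obtain ⟨s', hs⟩ := hF.top_merge _ _ _ h
        exact .inl ⟨_, theta_botMerge hs h'⟩
  seam_start := by
    rintro (s | s)
    · rcases or_assoc.2 (hF.seam_start s) with h | ⟨e₀, e₁, e, h, h'⟩ | ⟨e, e₀, e₁, h, h'⟩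
      · exact or_assoc.1 (.inl ((gluing F G).innerStart_inl h))
      · obtain ⟨s', hs⟩ := hG.bot_merge _ _ _ h
        exact .inl ⟨_, theta_botMerge h' hs⟩
      · exact .inr (.inr (.inr ⟨_, _, _, h, (gluing F G).arcs_inl h'⟩))
    · rcases or_assoc.2 (hG.seam_start s) with h | ⟨e₀, e₁, e, h, h'⟩ | ⟨e, e₀, e₁, h, h'⟩
      · exact or_assoc.1 (.inl ((gluing F G).innerStart_inr h))
      · exact .inr (.inr (.inl ⟨_, _, _, h, (gluing F G).arcs_inr h'⟩))
      · obtain ⟨s', hs⟩ := hF.top_split _ _ _ h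
        exact .inl ⟨_, theta_topSplit hs h'⟩
  top_pass := fun e e' h => (gluing F G).arc_inr (hG.top_pass e e' h)
  top_merge := fun e₀ e₁ e h => (hG.top_merge _ _ _ h).elim fun s h =>
    ⟨.inr s, (gluing F G).arcs_inr h⟩
  top_split := fun e₀ e₁ e h => (hG.top_split _ _ _ h).elim fun s h =>
    ⟨.inr s, (gluing F G).arcs_inr h⟩
  bot_pass := fun e e' h => (gluing F G).arc_inl (hF.bot_pass e e' h)
  bot_merge := fun e₀ e₁ e h => (hF.bot_merge _ _ _ h).elim fun s h =>
    ⟨.inl s, (gluing F G).arcs_inl h⟩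
  bot_split := fun e₀ e₁ e h => (hF.bot_split _ _ _ h).elim fun s h =>
    ⟨.inl s, (gluing F G).arcs_inl h⟩

end Glue

/-! ### Disjoint union -/

section Union

variable {Γ Γ' : Web} (F : Foam Web.empty Γ) (G : Foam Web.empty Γ')

theorem ununionSide_unionSide {R S R' S' E E' : Type}
    (z : Side R S Empty E ⊕ Side R' S' Empty E') : ununionSide (unionSide z) = z := by
  rcases z with (_ | _ | _ | e | _) | (_ | _ | _ | e | _) <;> first | rfl | exact e.elim

theorem unionSide_ununionSide {R S R' S' E E' : Type}
    (z : Side (R ⊕ R') (S ⊕ S') Empty (E ⊕ E')) : unionSide (ununionSide z) = z := by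
  rcases z with ⟨(_ | _), _⟩ | ⟨(_ | _), _⟩ | (_ | _) | e | (_ | _) <;>
    first | rfl | exact e.elim

theorem opp_unionSide {R S R' S' E E' : Type} (z z' : Side R S Empty E ⊕ Side R' S' Empty E') :
    Side.Opp (unionSide z) (unionSide z') ↔ match z, z' with
      | .inl d, .inl d' => d.Opp d'
      | .inr d, .inr d' => d.Opp d'
      | _, _ => False := by
  rcases z with (⟨_, _⟩ | ⟨_, _⟩ | _ | e | _) | (⟨_, _⟩ | ⟨_, _⟩ | _ | e | _) <;>
  rcases z' with (⟨_, _⟩ | ⟨_, _⟩ | _ | e | _) | (⟨_, _⟩ | ⟨_, _⟩ | _ | e | _) <;>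
  first
  | exact e.elim
  | simp [unionSide, Side.opp_reg_iff, Side.opp_thin_iff, Side.opp_thick_iff, Side.not_opp_top]

/-- The disjoint union as a pasting. -/
def unionP : Pasting F G (F.union G) where
  E := Empty
  bF := Empty.elim
  bG := Empty.elim
  side := ⟨unionSide, ununionSide, ununionSide_unionSide, unionSide_ununionSide⟩
  seam := Equiv.refl _
  next_inl := fun d => by
    change unionSide (Sum.map F.next G.next (ununionSide (unionSide (.inl d)))) = unionSide (.inl (F.next d))
    rw [ununionSide_unionSide]; rfl
  next_inr := fun d => by
    change unionSide (Sum.map F.next G.next (ununionSide (unionSide (.inr d)))) = unionSide (.inr (G.next d))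
    rw [ununionSide_unionSide]; rfl
  opp_inl_inl := fun d d' => opp_unionSide (.inl d) (.inl d')
  opp_inr_inr := fun d d' => opp_unionSide (.inr d) (.inr d')
  opp_inl_inr := fun d d' => (opp_unionSide (.inl d) (.inr d')).trans (by simp)
  opp_inr_inl := fun d d' => (opp_unionSide (.inr d) (.inl d')).trans (by simp)
  thin_inl := fun _ _ => rfl
  thin_inr := fun _ _ => rfl
  thick_inl := fun _ => rfl
  thick_inr := fun _ => rfl
  reg_inl := fun _ _ => ⟨_, rfl⟩
  reg_inr := fun _ _ => ⟨_, rfl⟩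
  wt_inl := fun d => by
    change Sum.elim F.wt G.wt (ununionSide (unionSide (.inl d))) = F.wt d
    rw [ununionSide_unionSide]; rfl
  wt_inr := fun d => by
    change Sum.elim F.wt G.wt (ununionSide (unionSide (.inr d))) = G.wt d
    rw [ununionSide_unionSide]; rfl
  dot_inl := by rintro (⟨_, _⟩ | ⟨_, _⟩ | _ | e | _) <;> first | exact HEq.rfl | exact e.elim
  dot_inr := by rintro (⟨_, _⟩ | ⟨_, _⟩ | _ | e | _) <;> first | exact HEq.rfl | exact e.elim

variable {F G}

theorem along_union (hF : F.IsFoam N) (hG : G.IsFoam N) :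
    (unionP F G).Along (M := VertexModel.empty) :=
  ⟨⟨fun e => e.elim, fun e => e.elim, fun e => e.elim, fun e => e.elim, fun e => e.elim⟩,
    ⟨fun e => e.elim, fun e => e.elim, fun e => e.elim, fun e => e.elim, fun e => e.elim⟩,
    hF.bij, hG.bij⟩

/-- The coloring of a disjoint union. -/
def Coloring.union (κ : Coloring N F) (κ' : Coloring N G) : Coloring N (F.union G) where
  c := fun d => Sum.elim κ.c κ'.c (ununionSide d)
  card := fun d => (ununionSide d).rec
    (motive := fun z => (Sum.elim κ.c κ'.c z).card = Sum.elim F.wt G.wt z) κ.card κ'.card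
  next := fun d => by
    change Sum.elim κ.c κ'.c (ununionSide (unionSide (Sum.map F.next G.next (ununionSide d)))) = _
    rw [ununionSide_unionSide]
    exact (ununionSide d).rec κ.next κ'.next
  reg := Sum.rec κ.reg κ'.reg
  disj := Sum.rec κ.disj κ'.disj
  seam := Sum.rec κ.seam κ'.seam

/-- Colorings of a disjoint union are pairs of colorings. -/
def unionColoringEquiv : Coloring N (F.union G) ≃ Coloring N F × Coloring N G where
  toFun := fun κ => ((unionP F G).left κ, (unionP F G).right κ)
  invFun := fun p => p.1.union p.2
  left_inv := fun κ => Coloring.ext_c fun d => by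
    obtain ⟨d | d, rfl⟩ := (unionP F G).side.surjective d
    · change Sum.elim _ _ (ununionSide (unionSide (.inl d))) = _
      rw [ununionSide_unionSide]; rfl
    · change Sum.elim _ _ (ununionSide (unionSide (.inr d))) = _
      rw [ununionSide_unionSide]; rfl
  right_inv := fun p => Prod.ext
    (Coloring.ext_c fun d => by
      change Sum.elim p.1.c p.2.c (ununionSide (unionSide (.inl d))) = _
      rw [ununionSide_unionSide]; rfl)
    (Coloring.ext_c fun d => by
      change Sum.elim p.1.c p.2.c (ununionSide (unionSide (.inr d))) = _
      rw [ununionSide_unionSide]; rfl)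

theorem IsFoam.union (hF : F.IsFoam N) (hG : G.IsFoam N) : (F.union G).IsFoam N where
  bij := (unionP F G).bijective_next hF.bij hG.bij
  wt_pos := fun d => (ununionSide d).rec (motive := fun z => 0 < Sum.elim F.wt G.wt z)
    hF.wt_pos hG.wt_pos
  wt_le := fun d => (ununionSide d).rec (motive := fun z => Sum.elim F.wt G.wt z ≤ N)
    hF.wt_le hG.wt_le
  wt_next := fun d => by
    change Sum.elim F.wt G.wt (ununionSide (unionSide (Sum.map F.next G.next (ununionSide d)))) =
      Sum.elim F.wt G.wt (ununionSide d)
    rw [ununionSide_unionSide]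
    exact (ununionSide d).rec hF.wt_next hG.wt_next
  wt_reg := Sum.rec hF.wt_reg hG.wt_reg
  wt_seam := Sum.rec hF.wt_seam hG.wt_seam
  wt_bot := fun e => e.elim
  wt_top := Sum.rec hF.wt_top hG.wt_top
  seam_end := by
    rintro (s | s)
    · rcases or_assoc.2 (hF.seam_end s) with h | ⟨e, e₀, e₁, h, h'⟩ | ⟨e, -⟩
      · exact or_assoc.1 (.inl ((unionP F G).innerEnd_inl h))
      · exact .inr (.inr (.inl ⟨.inl e, .inl e₀, .inl e₁, .inl ⟨_, _, _, rfl, rfl, rfl, h⟩,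
          (unionP F G).arcs_inl h'⟩))
      · exact e.elim
    · rcases or_assoc.2 (hG.seam_end s) with h | ⟨e, e₀, e₁, h, h'⟩ | ⟨e, -⟩
      · exact or_assoc.1 (.inl ((unionP F G).innerEnd_inr h))
      · exact .inr (.inr (.inl ⟨.inr e, .inr e₀, .inr e₁, .inr ⟨_, _, _, rfl, rfl, rfl, h⟩,
          (unionP F G).arcs_inr h'⟩))
      · exact e.elim
  seam_start := by
    rintro (s | s)
    · rcases or_assoc.2 (hF.seam_start s) with h | ⟨e, e₀, e₁, h, h'⟩ | ⟨e, -⟩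
      · exact or_assoc.1 (.inl ((unionP F G).innerStart_inl h))
      · exact .inr (.inr (.inl ⟨.inl e, .inl e₀, .inl e₁, .inl ⟨_, _, _, rfl, rfl, rfl, h⟩,
          (unionP F G).arcs_inl h'⟩))
      · exact e.elim
    · rcases or_assoc.2 (hG.seam_start s) with h | ⟨e, e₀, e₁, h, h'⟩ | ⟨e, -⟩
      · exact or_assoc.1 (.inl ((unionP F G).innerStart_inr h))
      · exact .inr (.inr (.inl ⟨.inr e, .inr e₀, .inr e₁, .inr ⟨_, _, _, rfl, rfl, rfl, h⟩,
          (unionP F G).arcs_inr h'⟩))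
      · exact e.elim
  top_pass := by
    rintro e e' (⟨e, e', rfl, rfl, h⟩ | ⟨e, e', rfl, rfl, h⟩)
    exacts [(unionP F G).arc_inl (hF.top_pass e e' h),
      (unionP F G).arc_inr (hG.top_pass e e' h)]
  top_merge := by
    rintro _ _ _ (⟨_, _, _, rfl, rfl, rfl, h⟩ | ⟨_, _, _, rfl, rfl, rfl, h⟩)
    exacts [(hF.top_merge _ _ _ h).elim fun s h => ⟨.inl s, (unionP F G).arcs_inl h⟩,
      (hG.top_merge _ _ _ h).elim fun s h => ⟨.inr s, (unionP F G).arcs_inr h⟩]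
  top_split := by
    rintro _ _ _ (⟨_, _, _, rfl, rfl, rfl, h⟩ | ⟨_, _, _, rfl, rfl, rfl, h⟩)
    exacts [(hF.top_split _ _ _ h).elim fun s h => ⟨.inl s, (unionP F G).arcs_inl h⟩,
      (hG.top_split _ _ _ h).elim fun s h => ⟨.inr s, (unionP F G).arcs_inr h⟩]
  bot_pass := fun e => e.elim
  bot_merge := fun e => e.elim
  bot_split := fun e => e.elim

end Union

end Foam

namespace MergeTree

@[elab_as_elim]
theorem pos_cases {l r : MergeTree} {P : (node l r).Pos → Prop} (h : P none)
    (hl : ∀ p, P (posL p)) (hr : ∀ p, P (posR p)) (p) : P p := by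
  rcases p with _ | ⟨_ | q | q, b⟩
  · exact h
  · cases b
    exacts [hl none, hr none]
  exacts [hl (some (q, b)), hr (some (q, b))]

/-- All leaves have positive weights. -/
abbrev Positive (τ : MergeTree) : Prop := ∀ a ∈ τ.leaves, 0 < a

/-- The number of leaves to the left of the leaves below an edge. -/
def lo : (τ : MergeTree) → τ.Pos → ℕ
  | _, none => 0
  | leaf _, some (q, _) => nomatch q
  | node _ _, some (none, false) => 0
  | node l _, some (none, true) => l.leaves.length
  | node l _, some (some (.inl q), b) => l.lo (some (q, b))
  | node l r, some (some (.inr q), b) => l.leaves.length + r.lo (some (q, b))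

/-- The number of leaves below an edge or to the left of these. -/
def hi : (τ : MergeTree) → τ.Pos → ℕ
  | τ, none => τ.leaves.length
  | leaf _, some (q, _) => nomatch q
  | node l _, some (none, false) => l.leaves.length
  | node l r, some (none, true) => l.leaves.length + r.leaves.length
  | node l _, some (some (.inl q), b) => l.hi (some (q, b))
  | node l r, some (some (.inr q), b) => l.leaves.length + r.hi (some (q, b))

section

variable {l r : MergeTree}

theorem length_node : (node l r).leaves.length = l.leaves.length + r.leaves.length := by
  simp [leaves]

theorem length_leaf (a : ℕ) : (leaf a).leaves.length = 1 := rfl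

theorem lo_none (τ : MergeTree) : τ.lo none = 0 := by cases τ <;> rfl

theorem hi_none (τ : MergeTree) : τ.hi none = τ.leaves.length := by cases τ <;> rfl

theorem wt_none (τ : MergeTree) : τ.wt none = τ.size := by cases τ <;> rfl

theorem lo_posL (p : l.Pos) : (node l r).lo (posL p) = l.lo p := by
  rcases p with _ | ⟨q, b⟩
  · exact (lo_none l).symm
  · rfl

theorem hi_posL (p : l.Pos) : (node l r).hi (posL p) = l.hi p := by
  rcases p with _ | ⟨q, b⟩
  · exact (hi_none l).symm
  · rfl

theorem wt_posL (p : l.Pos) : (node l r).wt (posL p) = l.wt p := by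
  rcases p with _ | ⟨q, b⟩
  · exact (wt_none l).symm
  · rfl

theorem under_posL (p : l.Pos) :
    (node l r).under (posL p) = (l.under p).map fun q => some (.inl q) := by
  rcases p with _ | ⟨q, b⟩ <;> rfl

theorem lo_posR (p : r.Pos) : (node l r).lo (posR p) = l.leaves.length + r.lo p := by
  rcases p with _ | ⟨q, b⟩
  · rw [lo_none]; rfl
  · rfl

theorem hi_posR (p : r.Pos) : (node l r).hi (posR p) = l.leaves.length + r.hi p := by
  rcases p with _ | ⟨q, b⟩
  · rw [hi_none]; rfl
  · rfl

theorem wt_posR (p : r.Pos) : (node l r).wt (posR p) = r.wt p := by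
  rcases p with _ | ⟨q, b⟩
  · exact (wt_none r).symm
  · rfl

theorem under_posR (p : r.Pos) :
    (node l r).under (posR p) = (r.under p).map fun q => some (.inr q) := by
  rcases p with _ | ⟨q, b⟩ <;> rfl

theorem under_posL_eq_none {p : l.Pos} :
    (node l r).under (posL p) = none ↔ l.under p = none := by
  rw [under_posL]
  exact Option.map_eq_none_iff

theorem under_posL_eq_some {p : l.Pos} {q : (node l r).Inner} :
    (node l r).under (posL p) = some q ↔ ∃ q', l.under p = some q' ∧ some (.inl q') = q := by
  rw [under_posL]
  exact Option.map_eq_some_iff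

theorem under_posR_eq_none {p : r.Pos} :
    (node l r).under (posR p) = none ↔ r.under p = none := by
  rw [under_posR]
  exact Option.map_eq_none_iff

theorem under_posR_eq_some {p : r.Pos} {q : (node l r).Inner} :
    (node l r).under (posR p) = some q ↔ ∃ q', r.under p = some q' ∧ some (.inr q') = q := by
  rw [under_posR]
  exact Option.map_eq_some_iff

end

theorem under_above : ∀ (τ : MergeTree) (q : τ.Inner), τ.under (τ.above q) = some q
  | leaf _, q => nomatch q
  | node _ _, none => rfl
  | node l _, some (.inl q) => by
    change (node l _).under (posL (l.above q)) = _
    rw [under_posL, under_above l q]; rfl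
  | node _ r, some (.inr q) => by
    change (node _ r).under (posR (r.above q)) = _
    rw [under_posR, under_above r q]; rfl

theorem above_of_under : ∀ (τ : MergeTree) (p : τ.Pos) (q : τ.Inner), τ.under p = some q →
    τ.above q = p
  | leaf _, _, q, _ => nomatch q
  | node l r, p, q, h => by
    induction p using pos_cases with
    | h =>
      obtain rfl : none = q := Option.some.inj h
      rfl
    | hl p =>
      rw [under_posL_eq_some] at h
      obtain ⟨q', h, rfl⟩ := h
      change posL (l.above q') = _
      rw [above_of_under l p q' h]
    | hr p =>
      rw [under_posR_eq_some] at h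
      obtain ⟨q', h, rfl⟩ := h
      change posR (r.above q') = _
      rw [above_of_under r p q' h]

theorem above_injective (τ : MergeTree) : τ.above.Injective := fun q q' h => by
  have := τ.under_above q
  rw [h, under_above] at this
  exact (Option.some.inj this).symm

theorem pos_induct : ∀ (τ : MergeTree) {P : τ.Pos → Prop} (h : ∀ p, τ.under p = none → P p)
    (hn : ∀ q, P (some (q, false)) → P (some (q, true)) → P (τ.above q)) (p : τ.Pos), P p
  | leaf _, _, h, _, p => h p rfl
  | node l r, P, h, hn, p => by
    have hl : ∀ p : l.Pos, P (posL p) := fun p => by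
      refine pos_induct l (P := fun p => P (posL p)) (fun p hp => h _ ?_) (fun q h0 h1 => ?_) p
      · rw [under_posL, hp]; rfl
      · exact hn (some (.inl q)) h0 h1
    have hr : ∀ p : r.Pos, P (posR p) := fun p => by
      refine pos_induct r (P := fun p => P (posR p)) (fun p hp => h _ ?_) (fun q h0 h1 => ?_) p
      · rw [under_posR, hp]; rfl
      · exact hn (some (.inr q)) h0 h1
    exact pos_cases (hn none (hl none) (hr none)) hl hr p

@[elab_as_elim]
theorem pos_induction {τ : MergeTree} {P : τ.Pos → Prop} (h : ∀ p, τ.under p = none → P p)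
    (hn : ∀ q, P (some (q, false)) → P (some (q, true)) → P (τ.above q)) (p : τ.Pos) : P p :=
  pos_induct τ h hn p

theorem span_above : ∀ (τ : MergeTree) (q : τ.Inner), τ.lo (τ.above q) = τ.lo (some (q, false)) ∧
    τ.hi (some (q, false)) = τ.lo (some (q, true)) ∧ τ.hi (some (q, true)) = τ.hi (τ.above q)
  | leaf _, q => nomatch q
  | node l r, none => ⟨rfl, rfl, (length_node (l := l) (r := r)).symm⟩
  | node l r, some (.inl q) => by
    change (node l r).lo (posL (l.above q)) = l.lo (some (q, false)) ∧ _ ∧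
      l.hi (some (q, true)) = (node l r).hi (posL (l.above q))
    rw [lo_posL, hi_posL]
    exact span_above l q
  | node l r, some (.inr q) => by
    change (node l r).lo (posR (r.above q)) = _ + r.lo (some (q, false)) ∧
      _ + r.hi (some (q, false)) = _ + r.lo (some (q, true)) ∧
      _ + r.hi (some (q, true)) = (node l r).hi (posR (r.above q))
    rw [lo_posR, hi_posR]
    have := span_above r q
    omega

theorem hi_of_under : ∀ (τ : MergeTree) (p : τ.Pos), τ.under p = none → τ.hi p = τ.lo p + 1
  | leaf _, none, _ => rfl
  | leaf _, some (q, _), _ => nomatch q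
  | node l r, p, h => by
    induction p using pos_cases with
    | h => cases h
    | hl p =>
      rw [under_posL_eq_none] at h
      rw [lo_posL, hi_posL, hi_of_under l p h]
    | hr p =>
      rw [under_posR_eq_none] at h
      rw [lo_posR, hi_posR, hi_of_under r p h, add_assoc]

theorem lo_lt_hi (τ : MergeTree) (p : τ.Pos) : τ.lo p < τ.hi p := by
  induction p using pos_induction with
  | h p h => rw [τ.hi_of_under p h]; omega
  | hn q h0 h1 => have := τ.span_above q; omega

theorem hi_le : ∀ (τ : MergeTree) (p : τ.Pos), τ.hi p ≤ τ.leaves.length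
  | τ, none => (hi_none τ).le
  | leaf _, some (q, _) => nomatch q
  | node l r, p => by
    rw [length_node]
    induction p using pos_cases with
    | h => exact (length_node (l := l) (r := r)).le
    | hl p => have := hi_le l p; rw [hi_posL]; omega
    | hr p => have := hi_le r p; rw [hi_posR]; omega

/-- The leaf number `t` lies below the edge `p`. -/
def Over (τ : MergeTree) (t : ℕ) (p : τ.Pos) : Prop := τ.lo p ≤ t ∧ t < τ.hi p

theorem over_none {τ : MergeTree} {t : ℕ} : τ.Over t none ↔ t < τ.leaves.length := by
  simp [Over, lo_none, hi_none]

theorem Over.lt {τ : MergeTree} {t : ℕ} {p : τ.Pos} (h : τ.Over t p) : t < τ.leaves.length :=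
  h.2.trans_le (τ.hi_le p)

theorem over_above {τ : MergeTree} {t : ℕ} {q : τ.Inner} :
    τ.Over t (τ.above q) ↔ τ.Over t (some (q, false)) ∨ τ.Over t (some (q, true)) := by
  have := τ.span_above q
  have := τ.lo_lt_hi (some (q, false))
  have := τ.lo_lt_hi (some (q, true))
  unfold Over
  omega

theorem not_over_both {τ : MergeTree} {t t' : ℕ} {q : τ.Inner} (h : τ.Over t (some (q, false)))
    (h' : τ.Over t' (some (q, true))) : t < t' := by
  have := τ.span_above q
  unfold Over at *
  omega

theorem over_leaf {τ : MergeTree} {t : ℕ} {p : τ.Pos} (hp : τ.under p = none) :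
    τ.Over t p ↔ t = τ.lo p := by
  unfold Over
  rw [τ.hi_of_under p hp]
  omega

section

variable {l r : MergeTree} {t : ℕ}

theorem over_posL {p : l.Pos} : (node l r).Over t (posL p) ↔ l.Over t p := by
  simp [Over, lo_posL, hi_posL]

theorem over_posR {p : r.Pos} :
    (node l r).Over t (posR p) ↔ l.leaves.length ≤ t ∧ r.Over (t - l.leaves.length) p := by
  simp only [Over, lo_posR, hi_posR]
  omega

theorem over_inl {q : l.Inner} {b : Bool} :
    (node l r).Over t (some (some (.inl q), b)) ↔ l.Over t (some (q, b)) := Iff.rfl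

theorem over_inr {q : r.Inner} {b : Bool} : (node l r).Over t (some (some (.inr q), b)) ↔
    l.leaves.length ≤ t ∧ r.Over (t - l.leaves.length) (some (q, b)) :=
  over_posR (p := some (q, b))

end

theorem exists_leaf : ∀ (τ : MergeTree) (t : ℕ), t < τ.leaves.length →
    ∃ p, τ.under p = none ∧ τ.lo p = t
  | leaf _, t, h => ⟨none, rfl, by rw [length_leaf] at h; rw [lo_none]; omega⟩
  | node l r, t, h => by
    rw [length_node] at h
    by_cases ht : t < l.leaves.length
    · obtain ⟨p, hp, h⟩ := exists_leaf l t ht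
      exact ⟨posL p, by rw [under_posL, hp]; rfl, by rw [lo_posL, h]⟩
    · obtain ⟨p, hp, h⟩ := exists_leaf r (t - l.leaves.length) (by omega)
      exact ⟨posR p, by rw [under_posR, hp]; rfl, by rw [lo_posR, h]; omega⟩

theorem leaf_unique : ∀ (τ : MergeTree) (p p' : τ.Pos), τ.under p = none → τ.under p' = none →
    τ.lo p = τ.lo p' → p = p'
  | leaf _, none, none, _, _, _ => rfl
  | leaf _, some (q, _), _, _, _, _ => nomatch q
  | leaf _, _, some (q, _), _, _, _ => nomatch q
  | node l r, p, p', h, h', he => by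
    have key : ∀ (p : l.Pos) (p' : r.Pos), l.under p = none →
        (node l r).lo (posL p) ≠ (node l r).lo (posR p') := by
      intro p p' hp
      rw [lo_posL, lo_posR]
      have := l.lo_lt_hi p
      have := l.hi_le p
      omega
    induction p using pos_cases with
    | h => cases h
    | hl p =>
      rw [under_posL_eq_none] at h
      induction p' using pos_cases with
      | h => cases h'
      | hl p' =>
        rw [under_posL_eq_none] at h'
        rw [lo_posL, lo_posL] at he
        rw [leaf_unique l p p' h h' he]
      | hr p' => exact absurd he (key p p' h)
    | hr p =>
      rw [under_posR_eq_none] at h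
      induction p' using pos_cases with
      | h => cases h'
      | hl p' =>
        rw [under_posL_eq_none] at h'
        exact absurd he.symm (key p' p h')
      | hr p' =>
        rw [under_posR_eq_none] at h'
        rw [lo_posR, lo_posR] at he
        rw [leaf_unique r p p' h h' (by omega)]

theorem exists_sep : ∀ (τ : MergeTree) (t t' : ℕ), t < t' → t' < τ.leaves.length →
    ∃ q, τ.Over t (some (q, false)) ∧ τ.Over t' (some (q, true))
  | leaf _, t, t', h, h' => by rw [length_leaf] at h'; omega
  | node l r, t, t', h, h' => by
    rw [length_node] at h'
    by_cases h1 : t' < l.leaves.length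
    · obtain ⟨q, hq⟩ := exists_sep l t t' h h1
      exact ⟨some (.inl q), hq⟩
    · by_cases h2 : t < l.leaves.length
      · exact ⟨none, ⟨Nat.zero_le _, h2⟩, not_lt.1 h1, h'⟩
      · obtain ⟨q, hq, hq'⟩ := exists_sep r (t - l.leaves.length) (t' - l.leaves.length)
          (by omega) (by omega)
        exact ⟨some (.inr q), over_posR.2 ⟨by omega, hq⟩, over_posR.2 ⟨by omega, hq'⟩⟩

theorem sep_unique : ∀ (τ : MergeTree) (t t' : ℕ) (q q' : τ.Inner), τ.Over t (some (q, false)) →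
    τ.Over t' (some (q, true)) → τ.Over t (some (q', false)) → τ.Over t' (some (q', true)) → q = q'
  | leaf _, _, _, q, _, _, _, _, _ => nomatch q
  | node l r, t, t', q, q', h1, h2, h3, h4 => by
    have hroot : (node l r).Over t (posL none) → t < l.leaves.length :=
      fun h => (over_posL.1 h).lt
    have hroot' : (node l r).Over t' (posR none) → l.leaves.length ≤ t' :=
      fun h => (over_posR.1 h).1
    rcases q with _ | q | q <;> rcases q' with _ | q' | q' <;>
      try simp only [over_inl, over_inr] at h1 h2 h3 h4
    · rfl
    · have := hroot' h2; have := h4.lt; omega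
    · have := hroot h1; omega
    · have := hroot' h4; have := h2.lt; omega
    · rw [sep_unique l t t' q q' h1 h2 h3 h4]
    · have := h1.lt; omega
    · have := hroot h3; omega
    · have := h3.lt; omega
    · rw [sep_unique r _ _ q q' h1.2 h2.2 h3.2 h4.2]

theorem wt_above : ∀ (τ : MergeTree) (q : τ.Inner),
    τ.wt (τ.above q) = τ.wt (some (q, false)) + τ.wt (some (q, true))
  | leaf _, q => nomatch q
  | node l r, none => rfl
  | node l r, some (.inl q) => (wt_posL _).trans (wt_above l q)
  | node l r, some (.inr q) => (wt_posR _).trans (wt_above r q)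

theorem wt_leaf : ∀ (τ : MergeTree) (p : τ.Pos), τ.under p = none →
    τ.leaves[τ.lo p]? = some (τ.wt p)
  | leaf _, none, _ => rfl
  | leaf _, some (q, _), _ => nomatch q
  | node l r, p, h => by
    induction p using pos_cases with
    | h => cases h
    | hl p =>
      rw [under_posL_eq_none] at h
      have := (l.lo_lt_hi p).trans_le (l.hi_le p)
      rw [lo_posL, wt_posL, ← wt_leaf l p h, leaves, List.getElem?_append_left this]
    | hr p =>
      rw [under_posR_eq_none] at h
      rw [lo_posR, wt_posR, ← wt_leaf r p h, leaves, List.getElem?_append_right (by omega)]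
      congr 1
      omega

theorem size_eq_sum : ∀ τ : MergeTree, τ.size = τ.leaves.sum
  | leaf a => by simp [size, leaves]
  | node l r => by simp [size, leaves, size_eq_sum l, size_eq_sum r]

theorem wt_le : ∀ (τ : MergeTree) (p : τ.Pos), τ.wt p ≤ τ.size
  | τ, none => (wt_none τ).le
  | leaf _, some (q, _) => nomatch q
  | node l r, p => by
    induction p using pos_cases with
    | h => exact le_rfl
    | hl p => have := wt_le l p; rw [wt_posL]; exact this.trans (Nat.le_add_right _ _)
    | hr p => have := wt_le r p; rw [wt_posR]; exact this.trans (Nat.le_add_left _ _)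

theorem wt_pos (τ : MergeTree) (h : ∀ a ∈ τ.leaves, 0 < a) (p : τ.Pos) : 0 < τ.wt p := by
  induction p using pos_induction with
  | h p hp => exact h _ (List.mem_of_getElem? (τ.wt_leaf p hp))
  | hn q h0 h1 => rw [wt_above]; omega

theorem exists_leaf_of_split : ∀ (τ : MergeTree) (M : τ.Pos → Prop)
    (_ : ∀ q, M (τ.above q) ↔ M (some (q, false)) ∨ M (some (q, true)))
    (_ : ∀ q, ¬ (M (some (q, false)) ∧ M (some (q, true)))),
    (¬ M none → ∀ p, ¬ M p) ∧ (M none → ∃ t < τ.leaves.length, ∀ p, M p ↔ τ.Over t p)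
  | leaf _, M, _, _ => by
    refine ⟨?_, fun h => ⟨0, Nat.one_pos, ?_⟩⟩
    · rintro h (_ | ⟨q, _⟩)
      exacts [h, nomatch q]
    · rintro (_ | ⟨q, _⟩)
      exacts [iff_of_true h ⟨le_rfl, Nat.one_pos⟩, nomatch q]
  | node l r, M, h, h' => by
    have hl := exists_leaf_of_split l (fun p => M (posL p)) (fun q => h (some (.inl q)))
      (fun q => h' (some (.inl q)))
    have hr := exists_leaf_of_split r (fun p => M (posR p)) (fun q => h (some (.inr q)))
      (fun q => h' (some (.inr q)))
    have h0 : M none ↔ M (posL none) ∨ M (posR none) := h none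
    have h1 : ¬ (M (posL none) ∧ M (posR none)) := h' none
    constructor
    · intro hM
      rw [h0, not_or] at hM
      intro p
      induction p using pos_cases with
      | h => rw [h0, not_or]; exact hM
      | hl p => exact hl.1 hM.1 p
      | hr p => exact hr.1 hM.2 p
    · intro hM
      rcases h0.1 hM with hL | hR
      · have hR : ¬ M (posR none) := fun h => h1 ⟨hL, h⟩
        obtain ⟨t, ht, hp⟩ := hl.2 hL
        refine ⟨t, by rw [length_node]; omega, fun p => ?_⟩
        induction p using pos_cases with
        | h => exact iff_of_true hM (over_none.2 (by rw [length_node]; omega))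
        | hl p => rw [over_posL]; exact hp p
        | hr p =>
          rw [over_posR]
          exact iff_of_false (hr.1 hR p) fun h => by omega
      · have hL : ¬ M (posL none) := fun h => h1 ⟨h, hR⟩
        obtain ⟨t, ht, hp⟩ := hr.2 hR
        refine ⟨l.leaves.length + t, by rw [length_node]; omega, fun p => ?_⟩
        induction p using pos_cases with
        | h => exact iff_of_true hM (over_none.2 (by rw [length_node]; omega))
        | hl p =>
          rw [over_posL]
          exact iff_of_false (hl.1 hL p) fun h => by have := h.lt; omega
        | hr p =>
          rw [over_posR, Nat.add_sub_cancel_left]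
          exact (hp p).trans ⟨fun h => ⟨by omega, h⟩, fun h => h.2⟩

theorem over_injective {τ : MergeTree} {t t' : ℕ} (ht : t < τ.leaves.length)
    (h : ∀ p, τ.under p = none → (τ.Over t p → τ.Over t' p)) : t' = t := by
  obtain ⟨p, hp, rfl⟩ := τ.exists_leaf t ht
  exact (over_leaf hp).1 (h p hp ((over_leaf hp).2 rfl))

theorem ncard_path (τ : MergeTree) (A : Set τ.Pos)
    (hA : ∀ q, τ.above q ∈ A ↔ Xor (some (q, false) ∈ A) (some (q, true) ∈ A)) :
    2 * A.ncard = 2 * {q | some (q, false) ∈ A ∨ some (q, true) ∈ A}.ncard +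
      {p | τ.under p = none ∧ p ∈ A}.ncard + {p | p = none ∧ p ∈ A}.ncard := by
  classical
  have h1 : A.ncard = {p | p = none ∧ p ∈ A}.ncard + {q | some (q, false) ∈ A}.ncard +
      {q | some (q, true) ∈ A}.ncard := by
    have e : A = ({p | p = none ∧ p ∈ A} ∪ (fun q => some (q, false)) '' {q | some (q, false) ∈ A}) ∪
        (fun q => some (q, true)) '' {q | some (q, true) ∈ A} := by
      ext (_ | ⟨q, _ | _⟩) <;> simp
    conv_lhs => rw [e]
    rw [Set.ncard_union_eq _ (Set.toFinite _) (Set.toFinite _),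
      Set.ncard_union_eq _ (Set.toFinite _) (Set.toFinite _),
      Set.ncard_image_of_injective _ (fun q q' h => by simpa using h),
      Set.ncard_image_of_injective _ (fun q q' h => by simpa using h)]
    · rw [Set.disjoint_left]
      rintro _ ⟨rfl, _⟩ ⟨q, _, h⟩
      cases h
    · rw [Set.disjoint_left]
      rintro _ (⟨rfl, _⟩ | ⟨q', _, rfl⟩) ⟨q, _, h⟩ <;> cases h
  have h2 : A.ncard = {p | τ.under p = none ∧ p ∈ A}.ncard + {q | τ.above q ∈ A}.ncard := by
    have e : A = {p | τ.under p = none ∧ p ∈ A} ∪ τ.above '' {q | τ.above q ∈ A} := by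
      ext p
      constructor
      · intro h
        cases hp : τ.under p with
        | none => exact .inl ⟨hp, h⟩
        | some q =>
          have := τ.above_of_under p q hp
          exact .inr ⟨q, by rw [Set.mem_ofPred_eq, this]; exact h, this⟩
      · rintro (h | ⟨q, h, rfl⟩)
        exacts [h.2, h]
    conv_lhs => rw [e]
    rw [Set.ncard_union_eq _ (Set.toFinite _) (Set.toFinite _),
      Set.ncard_image_of_injective _ τ.above_injective]
    rw [Set.disjoint_left]
    rintro _ ⟨hp, _⟩ ⟨q, _, rfl⟩
    rw [under_above] at hp
    cases hp
  have h3 : {q | τ.above q ∈ A}.ncard + 2 * ({q | some (q, false) ∈ A} ∩ {q | some (q, true) ∈ A}).ncard =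
      {q | some (q, false) ∈ A}.ncard + {q | some (q, true) ∈ A}.ncard := by
    have e : {q | τ.above q ∈ A} = ({q | some (q, false) ∈ A} ∪ {q | some (q, true) ∈ A}) \
        ({q | some (q, false) ∈ A} ∩ {q | some (q, true) ∈ A}) := by
      ext q
      simp only [Set.mem_ofPred_eq, hA, Set.mem_sdiff, Set.mem_union, Set.mem_inter_iff, Xor]
      tauto
    have := Set.ncard_union_add_ncard_inter {q | some (q, false) ∈ A} {q | some (q, true) ∈ A}
    have h4 := Set.ncard_sdiff_add_ncard_of_subset (s := {q | some (q, false) ∈ A} ∩ {q | some (q, true) ∈ A})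
      (t := {q | some (q, false) ∈ A} ∪ {q | some (q, true) ∈ A}) (fun q h => .inl h.1) (Set.toFinite _)
    rw [← e] at h4
    omega
  have h5 := Set.ncard_union_add_ncard_inter {q | some (q, false) ∈ A} {q | some (q, true) ∈ A}
  change {q | some (q, false) ∈ A ∨ some (q, true) ∈ A}.ncard + _ = _ at h5
  omega

theorem ncard_leaf_over {τ : MergeTree} {t : ℕ} (ht : t < τ.leaves.length) :
    {p | τ.under p = none ∧ τ.Over t p}.ncard = 1 := by
  rw [Set.ncard_eq_one]
  obtain ⟨p, hp, rfl⟩ := τ.exists_leaf t ht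
  refine ⟨p, Set.ext fun p' => ⟨fun ⟨h, h'⟩ => ?_, ?_⟩⟩
  · exact (τ.leaf_unique _ _ hp h ((over_leaf h).1 h')).symm
  · rintro rfl
    exact ⟨hp, (over_leaf hp).2 rfl⟩

theorem ncard_leaf_xor {τ : MergeTree} {t t' : ℕ} (ht : t < τ.leaves.length)
    (ht' : t' < τ.leaves.length) (h : t ≠ t') :
    {p | τ.under p = none ∧ Xor (τ.Over t p) (τ.Over t' p)}.ncard = 2 := by
  have e : {p | τ.under p = none ∧ Xor (τ.Over t p) (τ.Over t' p)} =
      {p | τ.under p = none ∧ τ.Over t p} ∪ {p | τ.under p = none ∧ τ.Over t' p} := by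
    ext p
    simp only [Set.mem_ofPred_eq, Set.mem_union, Xor]
    constructor
    · tauto
    · rintro (⟨hp, h'⟩ | ⟨hp, h'⟩) <;> rw [over_leaf hp, over_leaf hp] <;>
        rw [over_leaf hp] at h' <;> refine ⟨hp, ?_⟩ <;> omega
  rw [e, Set.ncard_union_eq _ (Set.toFinite _) (Set.toFinite _), ncard_leaf_over ht,
    ncard_leaf_over ht']
  rw [Set.disjoint_left]
  rintro p ⟨hp, h1⟩ ⟨_, h2⟩
  rw [over_leaf hp] at h1 h2
  omega

/-- The vertices of the web of a tree: an inner node of each half, a bivalent vertex for every leaf,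
and a bivalent vertex at the root. -/
abbrev WebVertex (τ : MergeTree) : Type := (τ.Inner × Bool) ⊕ {p : τ.Pos // τ.under p = none} ⊕ Unit

/-- The vertex below an edge of the tree, in one of the two halves of the web. -/
def lower (τ : MergeTree) (u : Bool) (p : τ.Pos) : τ.WebVertex :=
  match h : τ.under p with
  | none => .inr (.inl ⟨p, h⟩)
  | some q => .inl (q, u)

theorem lower_of_none {τ : MergeTree} {p : τ.Pos} (h : τ.under p = none) (u : Bool) :
    τ.lower u p = .inr (.inl ⟨p, h⟩) := by
  unfold lower
  split
  · rfl
  · simp_all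

theorem lower_above (τ : MergeTree) (u : Bool) (q : τ.Inner) :
    τ.lower u (τ.above q) = .inl (q, u) := by
  have := τ.under_above q
  unfold lower
  split <;> simp_all

theorem under_cases {τ : MergeTree} (p : τ.Pos) : τ.under p = none ∨ ∃ q, τ.above q = p := by
  cases h : τ.under p with
  | none => exact .inl rfl
  | some q => exact .inr ⟨q, τ.above_of_under p q h⟩

theorem above_ne {τ : MergeTree} {p : τ.Pos} (h : τ.under p = none) (q : τ.Inner) :
    τ.above q ≠ p := by
  rintro rfl
  rw [under_above] at h
  cases h

/-- The vertex above an edge of the tree, in one of the two halves of the web. -/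
def upper (τ : MergeTree) (u : Bool) : τ.Pos → τ.WebVertex
  | none => .inr (.inr ())
  | some (q, _) => .inl (q, u)

/-- The vertices of the web of a tree. -/
def model (τ : MergeTree) : VertexModel τ.web.E where
  V := τ.WebVertex
  kind
    | .inl (q, true) => .merge (some (q, false), true) (some (q, true), true) (τ.above q, true)
    | .inl (q, false) => .split (τ.above q, false) (some (q, false), false) (some (q, true), false)
    | .inr (.inl p) => .pass (p.1, false) (p.1, true)
    | .inr (.inr _) => .pass (none, true) (none, false)
  src := fun e => cond e.2 (τ.lower true e.1) (τ.upper false e.1)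
  tgt := fun e => cond e.2 (τ.upper true e.1) (τ.lower false e.1)
  mem_ins := by
    rintro ⟨p, _ | _⟩ w
    · rcases under_cases p with h | ⟨q, rfl⟩
      · have := fun q => (above_ne h q).symm
        rw [cond_false, lower_of_none h]
        rcases w with ⟨q', _ | _⟩ | p' | _ <;> simp [VertexKind.ins, Subtype.ext_iff, this]
      · have := fun p' : {p : τ.Pos // τ.under p = none} => above_ne p'.2 q
        rw [cond_false, lower_above]
        rcases w with ⟨q', _ | _⟩ | p' | _ <;>
          simp [VertexKind.ins, τ.above_injective.eq_iff, this]
    · rcases p with _ | ⟨q, b⟩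
      · rcases w with ⟨q', _ | _⟩ | p' | _ <;> simp [VertexKind.ins, upper]
      · rcases w with ⟨q', _ | _⟩ | p' | _ <;> simp [VertexKind.ins, upper]
        cases b <;> simp
  mem_outs := by
    rintro ⟨p, _ | _⟩ w
    · rcases p with _ | ⟨q, b⟩
      · rcases w with ⟨q', _ | _⟩ | p' | _ <;> simp [VertexKind.outs, upper]
      · rcases w with ⟨q', _ | _⟩ | p' | _ <;> simp [VertexKind.outs, upper]
        cases b <;> simp
    · rcases under_cases p with h | ⟨q, rfl⟩
      · have := fun q => (above_ne h q).symm
        rw [cond_true, lower_of_none h]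
        rcases w with ⟨q', _ | _⟩ | p' | _ <;> simp [VertexKind.outs, Subtype.ext_iff, this]
      · have := fun p' : {p : τ.Pos // τ.under p = none} => above_ne p'.2 q
        rw [cond_true, lower_above]
        rcases w with ⟨q', _ | _⟩ | p' | _ <;>
          simp [VertexKind.outs, τ.above_injective.eq_iff, this]

theorem models_web (τ : MergeTree) : τ.web.Models τ.model where
  kind := by
    rintro (⟨q, _ | _⟩ | p | _)
    exacts [⟨q, rfl, rfl, rfl⟩, ⟨q, rfl, rfl, rfl⟩, .inl ⟨p.1, p.2, rfl, rfl⟩, .inr ⟨rfl, rfl⟩]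
  pass := by
    rintro e e' (⟨p, h, rfl, rfl⟩ | ⟨rfl, rfl⟩)
    exacts [⟨.inr (.inl ⟨p, h⟩), rfl⟩, ⟨.inr (.inr ()), rfl⟩]
  merge := by
    rintro _ _ _ ⟨q, rfl, rfl, rfl⟩
    exact ⟨.inl (q, true), rfl⟩
  split := by
    rintro _ _ _ ⟨q, rfl, rfl, rfl⟩
    exact ⟨.inl (q, false), rfl⟩

end MergeTree

theorem Web.Models.sum {Γ Γ' : Web} {M : VertexModel Γ.E} {M' : VertexModel Γ'.E}
    (h : Γ.Models M) (h' : Γ'.Models M') : (Γ.sum Γ').Models (M.sum M') := by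
  have hl : ∀ {k}, (∃ w, M.kind w = k) → ∃ w, (M.sum M').kind w = k.map .inl :=
    fun ⟨w, hw⟩ => ⟨.inl w, congrArg (VertexKind.map Sum.inl) hw⟩
  have hr : ∀ {k}, (∃ w, M'.kind w = k) → ∃ w, (M.sum M').kind w = k.map .inr :=
    fun ⟨w, hw⟩ => ⟨.inr w, congrArg (VertexKind.map Sum.inr) hw⟩
  constructor
  · rintro (w | w)
    · have := h.kind w
      rw [show (M.sum M').kind (.inl w) = (M.kind w).map .inl from rfl]
      cases hk : M.kind w <;> rw [hk] at this
      exacts [.inl ⟨_, _, rfl, rfl, this⟩, .inl ⟨_, _, _, rfl, rfl, rfl, this⟩,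
        .inl ⟨_, _, _, rfl, rfl, rfl, this⟩]
    · have := h'.kind w
      rw [show (M.sum M').kind (.inr w) = (M'.kind w).map .inr from rfl]
      cases hk : M'.kind w <;> rw [hk] at this
      exacts [.inr ⟨_, _, rfl, rfl, this⟩, .inr ⟨_, _, _, rfl, rfl, rfl, this⟩,
        .inr ⟨_, _, _, rfl, rfl, rfl, this⟩]
  · rintro _ _ (⟨_, _, rfl, rfl, hp⟩ | ⟨_, _, rfl, rfl, hp⟩)
    exacts [hl (h.pass _ _ hp), hr (h'.pass _ _ hp)]
  · rintro _ _ _ (⟨_, _, _, rfl, rfl, rfl, hp⟩ | ⟨_, _, _, rfl, rfl, rfl, hp⟩)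
    exacts [hl (h.merge _ _ _ hp), hr (h'.merge _ _ _ hp)]
  · rintro _ _ _ (⟨_, _, _, rfl, rfl, rfl, hp⟩ | ⟨_, _, _, rfl, rfl, rfl, hp⟩)
    exacts [hl (h.split _ _ _ hp), hr (h'.split _ _ _ hp)]

/-- A coloring of a web. -/
structure Web.IsColoring {N : ℕ} (Γ : Web) (c : Γ.E → Finset (Fin N)) : Prop where
  card : ∀ e, (c e).card = Γ.wt e
  pass : ∀ e e', Γ.pass e e' → c e = c e'
  merge : ∀ e₀ e₁ e, Γ.merge e₀ e₁ e → Disjoint (c e₀) (c e₁) ∧ c e = c e₀ ∪ c e₁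
  split : ∀ e e₀ e₁, Γ.split e e₀ e₁ → Disjoint (c e₀) (c e₁) ∧ c e = c e₀ ∪ c e₁

/-- A property of sets of pigments that holds for none or two of three facets at a seam. -/
def Additive {N : ℕ} (p : Finset (Fin N) → Prop) : Prop :=
  ∀ s t, Disjoint s t → (p (s ∪ t) ↔ Xor (p s) (p t))

theorem additive_mem {N : ℕ} (i : Fin N) : Additive fun s => i ∈ s := fun s t h => by
  have h1 : i ∈ s → i ∉ t := fun h1 => Finset.disjoint_left.1 h h1
  change i ∈ s ∪ t ↔ _
  simp only [Finset.mem_union, Xor]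
  tauto

theorem additive_xor {N : ℕ} (i j : Fin N) : Additive fun s => Xor (i ∈ s) (j ∈ s) :=
  fun s t h => by
  have h1 : i ∈ s → i ∉ t := fun h1 => Finset.disjoint_left.1 h h1
  have h2 : j ∈ s → j ∉ t := fun h1 => Finset.disjoint_left.1 h h1
  change Xor (i ∈ s ∪ t) (j ∈ s ∪ t) ↔ _
  simp only [Finset.mem_union, Xor]
  tauto

/-- The property to contain `i`, or exactly one of `i` and `j`. -/
def IsTest {N : ℕ} (p : Finset (Fin N) → Prop) : Prop :=
  (∃ i, p = fun s => i ∈ s) ∨ ∃ i j, p = fun s => Xor (i ∈ s) (j ∈ s)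

theorem IsTest.additive {N : ℕ} {p : Finset (Fin N) → Prop} : IsTest p → Additive p := by
  rintro (⟨i, rfl⟩ | ⟨i, j, rfl⟩)
  exacts [additive_mem i, additive_xor i j]

theorem Additive.not_empty {N : ℕ} {p : Finset (Fin N) → Prop} (hp : Additive p) : ¬ p ∅ := by
  have := hp ∅ ∅ (Finset.disjoint_empty_left _)
  rw [Finset.union_empty] at this
  simp only [Xor] at this
  tauto

section

variable {E : Type} {A : Set E}

open Classical in
theorem ncard_singleton_inter (a : E) : ({a} ∩ A).ncard = if a ∈ A then 1 else 0 := by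
  split_ifs with h
  · rw [Set.inter_eq_left.2 (Set.singleton_subset_iff.2 h), Set.ncard_singleton]
  · rw [Set.singleton_inter_eq_empty.2 h, Set.ncard_empty]

open Classical in
theorem ncard_pair_inter {a b : E} (h : a = b → a ∉ A) :
    ({a, b} ∩ A).ncard = (if a ∈ A then 1 else 0) + if b ∈ A then 1 else 0 := by
  rw [Set.insert_eq, Set.union_inter_distrib_right,
    Set.ncard_union_eq _ ((Set.finite_singleton a).inter_of_left A)
    ((Set.finite_singleton b).inter_of_left A), ncard_singleton_inter, ncard_singleton_inter]
  rw [Set.disjoint_left]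
  rintro x ⟨rfl, hx⟩ ⟨hb, _⟩
  exact h hb hx

theorem VertexModel.ncard_touch_of [Finite E] (M : VertexModel E)
    (hA : ∀ w, ((M.kind w).ins ∩ A).ncard + ((M.kind w).outs ∩ A).ncard = 0 ∨
      ((M.kind w).ins ∩ A).ncard + ((M.kind w).outs ∩ A).ncard = 2) :
    (M.touch A).ncard = A.ncard := by
  classical
  have := M.finite
  have := Fintype.ofFinite E
  have := Fintype.ofFinite M.V
  have h1 : ∀ f : E → M.V, A.ncard = ∑ w, ({e | f e = w} ∩ A).ncard := fun f => by
    rw [Set.ncard_eq_toFinset_card', Finset.card_eq_sum_card_fiberwise (f := f) (t := Finset.univ)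
      (fun _ _ => Finset.mem_univ _)]
    refine Finset.sum_congr rfl fun w _ => ?_
    rw [Set.ncard_eq_toFinset_card']
    congr 1
    ext e
    simp [and_comm]
  have h2 : ∀ w, {e | M.tgt e = w} = (M.kind w).ins := fun w => Set.ext fun e => (M.mem_ins e w).symm
  have h3 : ∀ w, {e | M.src e = w} = (M.kind w).outs :=
    fun w => Set.ext fun e => (M.mem_outs e w).symm
  have h4 : 2 * A.ncard = ∑ w, if w ∈ M.touch A then 2 else 0 := by
    rw [two_mul]
    nth_rewrite 1 [h1 M.tgt]
    rw [h1 M.src, ← Finset.sum_add_distrib]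
    refine Finset.sum_congr rfl fun w _ => ?_
    rw [h2, h3]
    have key : w ∈ M.touch A ↔
        ((M.kind w).ins ∩ A).ncard + ((M.kind w).outs ∩ A).ncard ≠ 0 := by
      rw [Ne, Nat.add_eq_zero_iff, Set.ncard_eq_zero, Set.ncard_eq_zero, not_and_or, ← Ne, ← Ne,
        ← Set.nonempty_iff_ne_empty, ← Set.nonempty_iff_ne_empty]
      constructor
      · rintro ⟨e, he, h | h⟩
        exacts [.inl ⟨e, (M.mem_ins e w).2 h, he⟩, .inr ⟨e, (M.mem_outs e w).2 h, he⟩]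
      · rintro (⟨e, h, he⟩ | ⟨e, h, he⟩)
        exacts [⟨e, he, .inl ((M.mem_ins e w).1 h)⟩, ⟨e, he, .inr ((M.mem_outs e w).1 h)⟩]
    split_ifs with h
    exacts [(hA w).resolve_left (key.1 h), not_not.1 fun h' => h (key.2 h')]
  rw [← Finset.sum_filter, Finset.sum_const, smul_eq_mul] at h4
  rw [Set.ncard_eq_toFinset_card']
  have : (M.touch A).toFinset = Finset.univ.filter (· ∈ M.touch A) := by ext; simp
  rw [this]
  omega

end

theorem Web.IsColoring.ncard_touch {N : ℕ} {Γ : Web} {M : VertexModel Γ.E} (hM : Γ.Models M)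
    {c : Γ.E → Finset (Fin N)} (hc : Γ.IsColoring c) {p : Finset (Fin N) → Prop}
    (hp : Additive p) : (M.touch {e | p (c e)}).ncard = {e | p (c e)}.ncard := by
  classical
  have := Γ.finE
  have key : ∀ e₀ e₁, Disjoint (c e₀) (c e₁) → e₀ = e₁ → e₀ ∉ {e | p (c e)} := by
    rintro e _ h rfl h'
    rw [disjoint_self, Finset.bot_eq_empty] at h
    rw [Set.mem_ofPred_eq, h] at h'
    exact hp.not_empty h'
  refine M.ncard_touch_of fun w => ?_
  have hk := hM.kind w
  generalize M.kind w = v at *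
  cases v with
  | pass e e' =>
    have := hc.pass _ _ hk
    rw [VertexKind.ins, VertexKind.outs, ncard_singleton_inter, ncard_singleton_inter,
      Set.mem_ofPred_eq, Set.mem_ofPred_eq, this]
    split_ifs <;> simp
  | merge e₀ e₁ e =>
    obtain ⟨h, h'⟩ := hc.merge _ _ _ hk
    rw [VertexKind.ins, VertexKind.outs, ncard_singleton_inter, ncard_pair_inter (key _ _ h),
      Set.mem_ofPred_eq, Set.mem_ofPred_eq, Set.mem_ofPred_eq, h', hp _ _ h]
    by_cases h0 : p (c e₀) <;> by_cases h1 : p (c e₁) <;> simp [h0, h1, Xor]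
  | split e e₀ e₁ =>
    obtain ⟨h, h'⟩ := hc.split _ _ _ hk
    rw [VertexKind.ins, VertexKind.outs, ncard_singleton_inter, ncard_pair_inter (key _ _ h),
      Set.mem_ofPred_eq, Set.mem_ofPred_eq, Set.mem_ofPred_eq, h', hp _ _ h]
    by_cases h0 : p (c e₀) <;> by_cases h1 : p (c e₁) <;> simp [h0, h1, Xor]

theorem ncard_of_isEmpty {X : Type*} [IsEmpty X] (A : Set X) : A.ncard = 0 := by
  rw [Set.eq_empty_of_isEmpty A, Set.ncard_empty]

theorem ncard_sum {X Y : Type*} [Finite X] [Finite Y] (A : Set (X ⊕ Y)) :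
    A.ncard = (Sum.inl ⁻¹' A).ncard + (Sum.inr ⁻¹' A).ncard := by
  have e : A = Sum.inl '' (Sum.inl ⁻¹' A) ∪ Sum.inr '' (Sum.inr ⁻¹' A) := by
    ext (w | w) <;> simp
  conv_lhs => rw [e]
  rw [Set.ncard_union_eq _ (Set.toFinite _) (Set.toFinite _),
    Set.ncard_image_of_injective _ Sum.inl_injective,
    Set.ncard_image_of_injective _ Sum.inr_injective]
  rw [Set.disjoint_left]
  rintro _ ⟨w, -, rfl⟩ ⟨w', -, h⟩
  cases h

theorem VertexModel.ncard_touch_sum {E E' : Type} (M : VertexModel E) (M' : VertexModel E')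
    [Finite E] [Finite E'] (A : Set (E ⊕ E')) : ((M.sum M').touch A).ncard =
      (M.touch (Sum.inl ⁻¹' A)).ncard + (M'.touch (Sum.inr ⁻¹' A)).ncard := by
  have := M.finite
  have := M'.finite
  refine (ncard_sum (X := M.V) (Y := M'.V) _).trans ?_
  congr 2 <;> ext w <;> constructor
  · rintro ⟨e | e, he, h | h⟩ <;> cases h
    exacts [⟨e, he, .inl rfl⟩, ⟨e, he, .inr rfl⟩]
  · rintro ⟨e, he, rfl | rfl⟩
    exacts [⟨.inl e, he, .inl rfl⟩, ⟨.inl e, he, .inr rfl⟩]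
  · rintro ⟨e | e, he, h | h⟩ <;> cases h
    exacts [⟨e, he, .inl rfl⟩, ⟨e, he, .inr rfl⟩]
  · rintro ⟨e, he, rfl | rfl⟩
    exacts [⟨.inr e, he, .inl rfl⟩, ⟨.inr e, he, .inr rfl⟩]

namespace Foam

variable {Γ₀ Γ₁ Γ₂ Γ₃ Γ₄ Γ₅ : Web} {N : ℕ}

namespace Coloring

variable {F : Foam Γ₀ Γ₁} (κ : Coloring N F)

theorem isColoring_top (hF : F.IsFoam N) : Γ₁.IsColoring fun e => κ.c (.top e) where
  card := fun e => (κ.card _).trans (hF.wt_top e)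
  pass := fun e e' h => (κ.arc (hF.top_pass _ _ h)).symm
  merge := fun e₀ e₁ e h => by
    obtain ⟨s, h0, h1, h2⟩ := hF.top_merge _ _ _ h
    rw [← κ.arc h0, ← κ.arc h1, κ.arc h2]
    exact ⟨κ.disj s, κ.seam s⟩
  split := fun e e₀ e₁ h => by
    obtain ⟨s, h0, h1, h2⟩ := hF.top_split _ _ _ h
    rw [κ.arc h0, κ.arc h1, ← κ.arc h2]
    exact ⟨κ.disj s, κ.seam s⟩

theorem isColoring_bot (hF : F.IsFoam N) : Γ₀.IsColoring fun e => κ.c (.bot e) where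
  card := fun e => (κ.card _).trans (hF.wt_bot e)
  pass := fun e e' h => κ.arc (hF.bot_pass _ _ h)
  merge := fun e₀ e₁ e h => by
    obtain ⟨s, h0, h1, h2⟩ := hF.bot_merge _ _ _ h
    rw [κ.arc h0, κ.arc h1, ← κ.arc h2]
    exact ⟨κ.disj s, κ.seam s⟩
  split := fun e e₀ e₁ h => by
    obtain ⟨s, h0, h1, h2⟩ := hF.bot_split _ _ _ h
    rw [← κ.arc h0, ← κ.arc h1, κ.arc h2]
    exact ⟨κ.disj s, κ.seam s⟩

theorem chi_glue {G : Foam Γ₁ Γ₂} (hF : F.IsFoam N) (hG : G.IsFoam N) {M : VertexModel Γ₁.E}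
    (hM : Γ₁.Models M) (κ : Coloring N (F.glue G)) {p : Finset (Fin N) → Prop} (hp : Additive p) :
    κ.chi p = ((gluing F G).left κ).chi p + ((gluing F G).right κ).chi p := by
  have h := Pasting.chi_eq (along_glue hF hG hM) κ p
  have ht := (((gluing F G).left κ).isColoring_top hF).ncard_touch hM hp
  change κ.chi p = _ + _ - (((M.touch {e | p (((gluing F G).left κ).c (.top e))}).ncard : ℤ) -
    ({e | p (((gluing F G).left κ).c (.top e))}.ncard : ℤ)) at h
  rw [h, ht]
  ring

theorem chi_union {Γ Γ' : Web} {F : Foam Web.empty Γ} {G : Foam Web.empty Γ'} (hF : F.IsFoam N)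
    (hG : G.IsFoam N) (κ : Coloring N (F.union G)) (p : Finset (Fin N) → Prop) :
    κ.chi p = ((unionP F G).left κ).chi p + ((unionP F G).right κ).chi p := by
  have h := Pasting.chi_eq (along_union hF hG) κ p
  rw [h]
  exact sub_eq_self.2 (sub_eq_zero.2 (congrArg _ ((ncard_of_isEmpty (X := Empty) _).trans
    (ncard_of_isEmpty (X := Empty) _).symm)))

end Coloring

section Boundary

variable {F : Foam Γ₀ Γ₁} {E E' : Type} {M : VertexModel E} {M' : VertexModel E'} {bd : E → F.Sd}
  {bd' : E' → F.Sd}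

theorem IsBoundary.sum (h : F.IsBoundary M bd) (h' : F.IsBoundary M' bd')
    (hne : ∀ e e', bd e ≠ bd' e') : F.IsBoundary (M.sum M') (Sum.elim bd bd') where
  not_reg := by rintro (e | e); exacts [h.not_reg e, h'.not_reg e]
  not_opp := by rintro (e | e); exacts [h.not_opp e, h'.not_opp e]
  opp_not := by rintro (e | e); exacts [h.opp_not e, h'.opp_not e]
  inj := Sum.elim_injective.2 ⟨h.inj, h'.inj, hne⟩
  hasVertex := by
    rintro (w | w)
    · have := h.hasVertex w
      rw [show (M.sum M').kind (.inl w) = (M.kind w).map .inl from rfl]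
      cases hk : M.kind w <;> rw [hk] at this <;> exact this
    · have := h'.hasVertex w
      rw [show (M.sum M').kind (.inr w) = (M'.kind w).map .inr from rfl]
      cases hk : M'.kind w <;> rw [hk] at this <;> exact this

theorem IsBoundary.vertex_thin (h : F.IsBoundary M bd) (hF : F.next.Bijective) {s : F.S} {b : Bool}
    {e : E} (ha : F.Arc (.thin s b) (bd e)) (b' : Bool) :
    F.vertex (.thin s b') = F.bdVertex M bd (M.src e) := by
  obtain ⟨d, hd, hv⟩ := ha.exists_pred
  rw [Foam.vertex_thin hF, ← Foam.vertex_thin hF s b, ← hv, h.vertex_src hF.1 hd]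

theorem IsBoundary.vertex_thick (h : F.IsBoundary M bd) {s : F.S} {b : Bool}
    {e : E} (ha : F.Arc (bd e) (.thin s b)) :
    F.vertex (.thick s) = F.bdVertex M bd (M.tgt e) :=
  (ha.vertex_eq_of_opp (.thickThin s b)).trans (h.vertex_tgt e)

theorem Coloring.chi_of_boundary (hF : F.IsFoam N) {M₀ : VertexModel Γ₀.E} {M₁ : VertexModel Γ₁.E}
    (h₀ : Γ₀.Models M₀) (h₁ : Γ₁.Models M₁) (κ : Coloring N F)
    (hV : ∀ d, ∃ w, F.vertex d = F.bdVertex (M₁.sum M₀.rev) (Sum.elim .top .bot) w)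
    {p : Finset (Fin N) → Prop} (hp : Additive p) :
    κ.chi p = (F.face '' {d | p (κ.c d)}).ncard - {r | p (κ.c (.reg r true))}.ncard -
      {s | p (κ.c (.thin s false)) ∨ p (κ.c (.thin s true))}.ncard := by
  have := Γ₀.finE
  have := Γ₁.finE
  have := F.finR
  have := F.finS
  have hB := (hF.isBoundary_top h₁).sum (hF.isBoundary_bot h₀) (by simp)
  have hv : (F.vertex '' {d | p (κ.c d)}).ncard =
      {e | p (κ.c (.top e))}.ncard + {e | p (κ.c (.bot e))}.ncard := by
    have e : F.vertex '' {d | p (κ.c d)} = F.bdVertex (M₁.sum M₀.rev) (Sum.elim .top .bot) ''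
        (M₁.sum M₀.rev).touch {e | p (κ.c (Sum.elim .top .bot e : F.Sd))} := by
      ext v
      constructor
      · rintro ⟨d, hd, rfl⟩
        obtain ⟨w, hw⟩ := hV d
        exact ⟨w, (hB.mem_image_iff hF.bij κ p w).1 ⟨d, hd, hw⟩, hw.symm⟩
      · rintro ⟨w, hw, rfl⟩
        exact (hB.mem_image_iff hF.bij κ p w).2 hw
    rw [e, Set.ncard_image_of_injective _ (hB.injective hF.bij.1), VertexModel.ncard_touch_sum,
      VertexModel.touch_rev]
    exact congrArg₂ _ ((κ.isColoring_top hF).ncard_touch h₁ hp)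
      ((κ.isColoring_bot hF).ncard_touch h₀ hp)
  have he : (F.edge '' {d | p (κ.c d)}).ncard = {r | p (κ.c (.reg r true))}.ncard +
      ({s | p (κ.c (.thin s false)) ∨ p (κ.c (.thin s true))}.ncard +
      ({e | p (κ.c (.bot e))}.ncard + {e | p (κ.c (.top e))}.ncard)) := by
    rw [ncard_edge_image, ncard_sum, ncard_sum, ncard_sum]
    refine congrArg₂ _ (congrArg _ ?_) (congrArg₂ _ (congrArg _ ?_) (congrArg₂ _ (congrArg _ ?_)
      (congrArg _ ?_)))
    · ext r
      constructor
      · rintro ⟨d, hd, h⟩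
        rcases d with ⟨r, b⟩ | _ | _ | _ | _ <;> cases h
        rwa [Set.mem_ofPred_eq, κ.reg_eq r true b]
      · intro h
        exact ⟨.reg r true, h, rfl⟩
    · ext s
      constructor
      · rintro ⟨d, hd, h⟩
        rcases d with _ | ⟨s, b⟩ | s | _ | _ <;> cases h
        · cases b
          exacts [.inl hd, .inr hd]
        · rw [Set.mem_ofPred_eq, κ.seam, hp _ _ (κ.disj s)] at hd
          exact hd.imp And.left And.left
      · rintro (h | h)
        exacts [⟨.thin s false, h, rfl⟩, ⟨.thin s true, h, rfl⟩]
    all_goals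
      ext e
      constructor
      · rintro ⟨d, hd, h⟩
        rcases d with _ | _ | _ | _ | _ <;> cases h
        exact hd
      · exact fun h => ⟨_, h, rfl⟩
  unfold Coloring.chi euler
  rw [hv, he]
  push_cast
  ring

/-! ### Circles and arcs at which two pigments merge -/

/-- The seams at which `i` and `j` merge have a single boundary arc, from `s₀` to `t₀`. -/
structure BdArc (F : Foam Γ₀ Γ₁) (κ : Coloring N F) (M : VertexModel E) (bd : E → F.Sd)
    (i j : Fin N) (w₀ w₁ : M.V) (s₀ t₀ : F.S) : Prop where
  sep₀ : κ.Sep i j s₀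
  sep₁ : κ.Sep i j t₀
  start : F.vertex (.thick s₀) = F.bdVertex M bd w₀
  fin : F.vertex (.thin t₀ false) = F.bdVertex M bd w₁
  conn : Quot.mk (κ.sepRel i j) ⟨s₀, sep₀⟩ = Quot.mk _ ⟨t₀, sep₁⟩
  start_unique : ∀ s w, κ.Sep i j s → F.vertex (.thick s) = F.bdVertex M bd w → s = s₀
  stop_unique : ∀ s w, κ.Sep i j s → F.vertex (.thin s false) = F.bdVertex M bd w → s = t₀

/-- No seam at which `i` and `j` merge meets the boundary. -/
def NoArc (F : Foam Γ₀ Γ₁) (κ : Coloring N F) (M : VertexModel E) (bd : E → F.Sd)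
    (i j : Fin N) : Prop :=
  ∀ s w, κ.Sep i j s → F.vertex (.thick s) ≠ F.bdVertex M bd w ∧
    F.vertex (.thin s false) ≠ F.bdVertex M bd w

/-- The seams in the same circle or arc as `s₀`. -/
def Coloring.Class (κ : Coloring N F) {i j : Fin N} (s₀ : {s // κ.Sep i j s}) (s : F.S) : Prop :=
  ∃ h : κ.Sep i j s, Quot.mk (κ.sepRel i j) ⟨s, h⟩ = Quot.mk _ s₀

theorem Coloring.class_iff {κ : Coloring N F} {i j : Fin N} {s₀ : {s // κ.Sep i j s}} {s s' : F.S}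
    (hs : κ.Sep i j s) (hs' : κ.Sep i j s')
    (h : F.vertex (.thin s false) = F.vertex (.thick s')) : κ.Class s₀ s ↔ κ.Class s₀ s' := by
  have : Quot.mk (κ.sepRel i j) ⟨s, hs⟩ = Quot.mk _ ⟨s', hs'⟩ := Quot.sound h
  constructor
  · rintro ⟨_, h⟩
    exact ⟨hs', this ▸ h⟩
  · rintro ⟨_, h⟩
    exact ⟨hs, this ▸ h⟩

theorem Coloring.theta_eq_class (κ : Coloring N F) {i j : Fin N} (s₀ : {s // κ.Sep i j s}) :
    κ.theta i j = κ.thetaFree i j (κ.Class s₀) + 1 :=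
  κ.theta_eq_thetaFree_add_one s₀.2 ⟨s₀.2, rfl⟩ (fun _ _ h h' hv => Coloring.class_iff h h' hv)
    fun _ _ h => h.2

theorem BdArc.mem_class {κ : Coloring N F} {i j : Fin N} {w₀ w₁ w : M.V} {s₀ t₀ s : F.S}
    (h : F.BdArc κ M bd i j w₀ w₁ s₀ t₀) (hs : κ.Sep i j s)
    (hw : F.vertex (.thick s) = F.bdVertex M bd w ∨ F.vertex (.thin s false) = F.bdVertex M bd w) :
    κ.Class ⟨s₀, h.sep₀⟩ s := by
  rcases hw with hw | hw
  · obtain rfl := h.start_unique s w hs hw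
    exact ⟨hs, rfl⟩
  · obtain rfl := h.stop_unique s w hs hw
    exact ⟨hs, h.conn.symm⟩

theorem BdArc.of_next {κ : Coloring N F} (hF : F.IsFoam N) (hB : F.IsBoundary M bd) {i j : Fin N}
    {w₀ w₁ : M.V} {s₀ t₀ : F.S} (h₀ : κ.Sep i j s₀) (h₁ : κ.Sep i j t₀)
    (start : F.vertex (.thick s₀) = F.bdVertex M bd w₀)
    (fin : F.vertex (.thin t₀ false) = F.bdVertex M bd w₁)
    (hw₀ : ∀ s w, κ.Sep i j s → F.vertex (.thick s) = F.bdVertex M bd w → w = w₀)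
    (hw₁ : ∀ s w, κ.Sep i j s → F.vertex (.thin s false) = F.bdVertex M bd w → w = w₁)
    (hnext : ∀ s, κ.Sep i j s → (∃ m, κ.Sep i j m ∧ F.vertex (.thin s false) = F.vertex (.thick m)) ∨
      ∃ w, F.vertex (.thin s false) = F.bdVertex M bd w) :
    F.BdArc κ M bd i j w₀ w₁ s₀ t₀ := by
  have hu : ∀ s w, κ.Sep i j s → F.vertex (.thin s false) = F.bdVertex M bd w → s = t₀ :=
    fun s w hs h => IsFoam.prev_unique κ hF (.inl h₁) (.inl hs)
      (by rw [h, hw₁ s w hs h, fin])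
  have hu' : ∀ s w, κ.Sep i j s → F.vertex (.thick s) = F.bdVertex M bd w → s = s₀ := by
    intro s w hs h
    have h := h.trans (congrArg _ (hw₀ s w hs h))
    obtain ⟨e₀, e₁, e, hk, ha, -, -⟩ := hB.seam_start hF.bij.1 start
    obtain ⟨e₀', e₁', e', hk', ha', -, -⟩ := hB.seam_start hF.bij.1 h
    rw [hk] at hk'
    cases hk'
    obtain ⟨d, hd, h1⟩ := ha
    obtain ⟨d', hd', h1'⟩ := ha'
    have : ∀ {x y y' : F.Sd}, ReflTransGen F.Step x y → ReflTransGen F.Step x y' →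
        ¬ (F.next y).IsReg → ¬ (F.next y').IsReg → y = y' := by
      intro x y y' hy hy' hn hn'
      rcases ReflTransGen.total_of_right_unique step_right_unique hy hy' with h | h <;>
        rcases h.cases_head with h | ⟨z, ⟨r, b, hr, -⟩, -⟩
      exacts [h, absurd (hr ▸ trivial) hn, h.symm, absurd (hr ▸ trivial) hn']
    have hdd := this hd hd' (by rw [h1]; exact id) (by rw [h1']; exact id)
    rw [← hdd, h1] at h1'
    cases h1'
    rfl
  refine ⟨h₀, h₁, start, fin, ?_, hu', hu⟩
  refine quot_mk_eq_of_reflTransGen (reflTransGen_of_unique_ends (X := {s // κ.Sep i j s})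
    (r := κ.sepRel i j) (fun x x' m h h' => Subtype.ext ?_) (fun x hx => ?_) (fun x hx => ?_))
  · exact (IsFoam.prev_unique κ hF (.inl x.2) (.inl x'.2) (h'.trans h.symm)).symm
  · rcases hnext x.1 x.2 with ⟨m, hm, h⟩ | ⟨w, hw⟩
    exacts [⟨⟨m, hm⟩, h⟩, absurd (Subtype.ext (hu _ _ x.2 hw)) hx]
  · have hx : F.vertex (.thin x.1 false) = F.vertex (.thick s₀) := hx
    obtain ⟨e₀, e₁, e, hk, -⟩ := hB.seam_start hF.bij.1 start
    obtain ⟨e₀', e₁', e', hk', -⟩ := hB.seam_end hF.bij.1 (hx.trans start)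
    rw [hk] at hk'
    cases hk'

end Boundary

namespace Pasting

variable {F : Foam Γ₀ Γ₁} {G : Foam Γ₂ Γ₃} {H : Foam Γ₄ Γ₅} {P : Pasting F G H}
  {M : VertexModel P.E}

theorem theta_of_noArc (hP : P.Along M) (κ : Coloring N H) {i j : Fin N}
    (hF : F.NoArc (P.left κ) M P.bF i j) :
    κ.theta i j = (P.left κ).theta i j + (P.right κ).theta i j := by
  have h := thetaFree_add hP κ (i := i) (j := j) (TF := fun _ => False) (TG := fun _ => False)
    (fun w s s' h _ hw _ => absurd hw (hF s w h).2) (fun w s s' h _ _ hw => absurd hw (hF s w h).1)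
  rw [κ.theta_eq_thetaFree (T := fun s => Sum.elim (fun _ => False) (fun _ => False) (P.seam.symm s)),
    h, (P.left κ).theta_eq_thetaFree (fun _ _ => id), (P.right κ).theta_eq_thetaFree (fun _ _ => id)]
  intro s _
  rcases P.seam.symm s with s | s <;> exact id

theorem theta_of_connected (hP : P.Along M) (κ : Coloring N H) {i j : Fin N} {TF : F.S → Prop}
    {TG : G.S → Prop} {s₀ : H.S} (h₀ : κ.Sep i j s₀) (hT₀ : Sum.elim TF TG (P.seam.symm s₀))
    (satF : ∀ s s', (P.left κ).Sep i j s → (P.left κ).Sep i j s' →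
      F.vertex (.thin s false) = F.vertex (.thick s') → (TF s ↔ TF s'))
    (satG : ∀ s s', (P.right κ).Sep i j s → (P.right κ).Sep i j s' →
      G.vertex (.thin s false) = G.vertex (.thick s') → (TG s ↔ TG s'))
    (bF : ∀ s w, (P.left κ).Sep i j s → (F.vertex (.thick s) = F.bdVertex M P.bF w ∨
      F.vertex (.thin s false) = F.bdVertex M P.bF w) → TF s)
    (bG : ∀ s w, (P.right κ).Sep i j s → (G.vertex (.thick s) = G.bdVertex M.rev P.bG w ∨
      G.vertex (.thin s false) = G.bdVertex M.rev P.bG w) → TG s)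
    (connF : ∀ s hs, TF s → Quot.mk (κ.sepRel i j) ⟨P.seam (.inl s), hs⟩ = Quot.mk _ ⟨s₀, h₀⟩)
    (connG : ∀ s hs, TG s → Quot.mk (κ.sepRel i j) ⟨P.seam (.inr s), hs⟩ = Quot.mk _ ⟨s₀, h₀⟩) :
    κ.theta i j = (P.left κ).thetaFree i j TF + (P.right κ).thetaFree i j TG + 1 := by
  rw [← thetaFree_add hP κ (fun w s s' h _ hw _ => .inl (bF s w h (.inr hw)))
    (fun w s s' h _ _ hw => .inl (bF s w h (.inl hw)))]
  refine κ.theta_eq_thetaFree_add_one h₀ hT₀ ?_ ?_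
  · intro s s' hs hs' hv
    obtain ⟨s | s, rfl⟩ := P.seam.surjective s <;> obtain ⟨s' | s', rfl⟩ := P.seam.surjective s' <;>
      simp only [Equiv.symm_apply_apply, Sum.elim_inl, Sum.elim_inr] <;>
      simp only [sep_inl, sep_inr] at hs hs' <;>
      simp only [vertex_thin_inl, vertex_thin_inr, vertex_thick_inl, vertex_thick_inr] at hv
    · exact satF _ _ hs hs' (vertexL_injective hP hv)
    · obtain ⟨w, h, h'⟩ := (vertexL_eq_vertexR hP _ _).1 hv
      exact iff_of_true (bF _ w hs (.inr h)) (bG _ w hs' (.inl h'))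
    · obtain ⟨w, h, h'⟩ := (vertexL_eq_vertexR hP _ _).1 hv.symm
      exact iff_of_true (bG _ w hs (.inr h')) (bF _ w hs' (.inl h))
    · exact satG _ _ hs hs' (vertexR_injective hP hv)
  · intro s hs hT
    obtain ⟨s | s, rfl⟩ := P.seam.surjective s
    exacts [connF s hs (by simpa using hT), connG s hs (by simpa using hT)]

theorem theta_of_bdArc (hP : P.Along M) (κ : Coloring N H) {i j : Fin N} {w₀ w₁ : M.V}
    {s₀ t₀ : F.S} {s₁ t₁ : G.S} (hF : F.BdArc (P.left κ) M P.bF i j w₀ w₁ s₀ t₀)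
    (hG : G.BdArc (P.right κ) M.rev P.bG i j w₁ w₀ s₁ t₁) :
    κ.theta i j + 1 = (P.left κ).theta i j + (P.right κ).theta i j := by
  have h0 := (P.sep_inl κ).2 hF.sep₀
  have hc : Quot.mk (κ.sepRel i j) ⟨P.seam (.inr s₁), (P.sep_inr κ).2 hG.sep₀⟩ =
      Quot.mk _ ⟨P.seam (.inl s₀), h0⟩ := by
    rw [P.mk_inl_eq κ hF.conn]
    exact (mk_inl_eq_inr hP κ (s := ⟨t₀, hF.sep₁⟩) (s' := ⟨s₁, hG.sep₀⟩) hF.fin hG.start).symm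
  rw [theta_of_connected hP κ (TF := (P.left κ).Class ⟨s₀, hF.sep₀⟩)
    (TG := (P.right κ).Class ⟨s₁, hG.sep₀⟩) h0 (by simpa using ⟨hF.sep₀, rfl⟩)
    (fun _ _ h h' hv => Coloring.class_iff h h' hv) (fun _ _ h h' hv => Coloring.class_iff h h' hv)
    (fun s w => hF.mem_class) (fun s w => hG.mem_class) ?_ ?_,
    (P.left κ).theta_eq_class ⟨s₀, hF.sep₀⟩, (P.right κ).theta_eq_class ⟨s₁, hG.sep₀⟩]
  · ring
  · rintro s hs ⟨hs', h⟩
    exact P.mk_inl_eq κ h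
  · rintro s hs ⟨hs', h⟩
    exact (P.mk_inr_eq κ h).trans hc

end Pasting

end Foam

namespace MergeTree

instance (τ : MergeTree) (t : ℕ) (p : τ.Pos) : Decidable (τ.Over t p) :=
  inferInstanceAs (Decidable (_ ∧ _))

/-- Colorings of a tree: every pigment is assigned to a leaf. -/
def Lab (τ : MergeTree) (N : ℕ) : Type :=
  {ν : Fin N → ℕ // ∀ p, (Finset.univ.filter fun i => τ.Over (ν i) p).card = τ.wt p}

namespace Lab

variable {τ : MergeTree} {N : ℕ} (ν : τ.Lab N)

/-- The pigments of an edge. -/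
def set (p : τ.Pos) : Finset (Fin N) := Finset.univ.filter fun i => τ.Over (ν.1 i) p

theorem mem_set {p : τ.Pos} {i : Fin N} : i ∈ ν.set p ↔ τ.Over (ν.1 i) p := by simp [set]

theorem card_set (p : τ.Pos) : (ν.set p).card = τ.wt p := ν.2 p

theorem disjoint (q : τ.Inner) : Disjoint (ν.set (some (q, false))) (ν.set (some (q, true))) := by
  rw [Finset.disjoint_left]
  intro i h h'
  exact (not_over_both (ν.mem_set.1 h) (ν.mem_set.1 h')).false

theorem set_above (q : τ.Inner) :
    ν.set (τ.above q) = ν.set (some (q, false)) ∪ ν.set (some (q, true)) := by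
  ext i
  rw [Finset.mem_union, mem_set, mem_set, mem_set, over_above]

theorem set_none (hN : τ.size = N) : ν.set none = Finset.univ := by
  rw [← Finset.card_eq_iff_eq_univ, ν.card_set, wt_none, hN, Fintype.card_fin]

theorem lt_length (hN : τ.size = N) (i : Fin N) : ν.1 i < τ.leaves.length := by
  have : i ∈ ν.set none := by rw [ν.set_none hN]; exact Finset.mem_univ _
  exact over_none.1 (ν.mem_set.1 this)

theorem ext_set {ν ν' : τ.Lab N} (hN : τ.size = N)
    (h : ∀ p, τ.under p = none → ν.set p = ν'.set p) : ν = ν' := by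
  refine Subtype.ext (funext fun i => (over_injective (ν.lt_length hN i) fun p hp hi => ?_).symm)
  rw [← ν'.mem_set, ← h p hp, ν.mem_set]
  exact hi

theorem finite (hN : τ.size = N) : Finite (τ.Lab N) := by
  refine Finite.of_injective (fun ν : τ.Lab N => fun i =>
    (⟨ν.1 i, ν.lt_length hN i⟩ : Fin τ.leaves.length)) fun ν ν' h => Subtype.ext (funext fun i => ?_)
  exact congrArg Fin.val (congrFun h i)

theorem additive {p : Finset (Fin N) → Prop} (hp : Additive p) (q : τ.Inner) :
    p (ν.set (τ.above q)) ↔ Xor (p (ν.set (some (q, false)))) (p (ν.set (some (q, true)))) := by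
  rw [ν.set_above, hp _ _ (ν.disjoint q)]

/-- `1` if the pigments belong to different leaves, `0` otherwise. -/
def sep (i j : Fin N) : ℤ := if ν.1 i = ν.1 j then 0 else 1

/-- `p` holds for the edges of a path (if `h = 1`) or for no edge (if `h = 0`). -/
structure Path (p : Finset (Fin N) → Prop) (h : ℤ) : Prop where
  edges : ({e | p (ν.set e)}.ncard : ℤ) =
    {q | p (ν.set (some (q, false))) ∨ p (ν.set (some (q, true)))}.ncard + h
  ends : ({e | τ.under e = none ∧ p (ν.set e)}.ncard : ℤ) + {e | e = none ∧ p (ν.set e)}.ncard = 2 * h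

theorem Path.of_ends {p : Finset (Fin N) → Prop} (hp : Additive p) {h : ℤ}
    (he : ({e | τ.under e = none ∧ p (ν.set e)}.ncard : ℤ) + {e | e = none ∧ p (ν.set e)}.ncard =
      2 * h) : ν.Path p h := by
  have := τ.ncard_path {e | p (ν.set e)} (ν.additive hp)
  refine ⟨?_, he⟩
  simp only [Set.mem_ofPred_eq] at this
  omega

theorem path_mem (hN : τ.size = N) (i : Fin N) : ν.Path (fun s => i ∈ s) 1 := by
  refine Path.of_ends ν (additive_mem i) ?_
  have h1 : {e | e = none ∧ i ∈ ν.set e} = {none} := by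
    ext e
    constructor
    · exact fun h => h.1
    · rintro rfl
      exact ⟨rfl, by rw [ν.set_none hN]; exact Finset.mem_univ _⟩
  have h2 := ncard_leaf_over (ν.lt_length hN i)
  simp only [← ν.mem_set] at h2
  rw [h1, h2, Set.ncard_singleton]
  rfl

theorem path_xor (hN : τ.size = N) (i j : Fin N) :
    ν.Path (fun s => Xor (i ∈ s) (j ∈ s)) (ν.sep i j) := by
  refine Path.of_ends ν (additive_xor i j) ?_
  have h1 : {e | e = none ∧ Xor (i ∈ ν.set e) (j ∈ ν.set e)} = ∅ := by
    ext e
    constructor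
    · rintro ⟨rfl, h⟩
      rw [ν.set_none hN] at h
      simp [Xor] at h
    · exact False.elim
  rw [h1, Set.ncard_empty]
  unfold sep
  split_ifs with h
  · have : {e | τ.under e = none ∧ Xor (i ∈ ν.set e) (j ∈ ν.set e)} = ∅ := by
      ext e
      simp [ν.mem_set, h, Xor]
    rw [this, Set.ncard_empty]
    rfl
  · have h2 := ncard_leaf_xor (ν.lt_length hN i) (ν.lt_length hN j) h
    simp only [← ν.mem_set] at h2
    rw [h2]
    rfl

theorem exists_path (hN : τ.size = N) {p : Finset (Fin N) → Prop} :
    IsTest p → ∃ h, ν.Path p h := by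
  rintro (⟨i, rfl⟩ | ⟨i, j, rfl⟩)
  exacts [⟨_, ν.path_mem hN i⟩, ⟨_, ν.path_xor hN i j⟩]

theorem exists_sep (hN : τ.size = N) {i j : Fin N} (h : ν.1 i < ν.1 j) :
    ∃ q, i ∈ ν.set (some (q, false)) ∧ j ∈ ν.set (some (q, true)) := by
  obtain ⟨q, hq⟩ := τ.exists_sep _ _ h (ν.lt_length hN j)
  exact ⟨q, ν.mem_set.2 hq.1, ν.mem_set.2 hq.2⟩

theorem sep_unique {i j : Fin N} {q q' : τ.Inner} (h1 : i ∈ ν.set (some (q, false)))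
    (h2 : j ∈ ν.set (some (q, true))) (h3 : i ∈ ν.set (some (q', false)))
    (h4 : j ∈ ν.set (some (q', true))) : q = q' :=
  τ.sep_unique _ _ q q' (ν.mem_set.1 h1) (ν.mem_set.1 h2) (ν.mem_set.1 h3) (ν.mem_set.1 h4)

theorem lt_of_sep {i j : Fin N} {q : τ.Inner} (h1 : i ∈ ν.set (some (q, false)))
    (h2 : j ∈ ν.set (some (q, true))) : ν.1 i < ν.1 j :=
  not_over_both (ν.mem_set.1 h1) (ν.mem_set.1 h2)

end Lab

theorem exists_label {τ : MergeTree} {N : ℕ} (hN : τ.size = N) {c : τ.web.E → Finset (Fin N)}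
    (hc : τ.web.IsColoring c) : ∃ ν : τ.Lab N, ∀ e, c e = ν.set e.1 := by
  have h0 : ∀ u i, i ∈ c (none, u) := fun u i => by
    have : c (none, u) = Finset.univ := by
      rw [← Finset.card_eq_iff_eq_univ, hc.card]
      change τ.wt none = _
      rw [wt_none, hN, Fintype.card_fin]
    rw [this]
    exact Finset.mem_univ _
  have hs : ∀ u q, Disjoint (c (some (q, false), u)) (c (some (q, true), u)) ∧
      c (τ.above q, u) = c (some (q, false), u) ∪ c (some (q, true), u) := by
    rintro (_ | _) q
    exacts [hc.split _ _ _ ⟨q, rfl, rfl, rfl⟩, hc.merge _ _ _ ⟨q, rfl, rfl, rfl⟩]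
  have key : ∀ u i, ∃ t < τ.leaves.length, ∀ p, i ∈ c (p, u) ↔ τ.Over t p := fun u i =>
    (τ.exists_leaf_of_split (fun p => i ∈ c (p, u)) (fun q => by rw [(hs u q).2, Finset.mem_union])
      (fun q h => Finset.disjoint_left.1 (hs u q).1 h.1 h.2)).2 (h0 u i)
  choose t ht h using key
  have htt : ∀ i, t false i = t true i := fun i => over_injective (ht true i) fun p hp hi => by
    rw [← h false i p, hc.pass _ _ (.inl ⟨p, hp, rfl, rfl⟩), h true i p]
    exact hi
  have h' : ∀ e, c e = Finset.univ.filter fun i => τ.Over (t true i) e.1 := by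
    rintro ⟨p, _ | _⟩ <;> ext i
    · simp [h, htt]
    · simp [h]
  refine ⟨⟨t true, fun p => ?_⟩, h'⟩
  rw [← h' (p, true), hc.card]

theorem kind_merge {τ : MergeTree} {w : τ.WebVertex} {e₀ e₁ e : τ.web.E}
    (h : τ.model.kind w = .merge e₀ e₁ e) : ∃ q, w = .inl (q, true) ∧
      e₀ = (some (q, false), true) ∧ e₁ = (some (q, true), true) ∧ e = (τ.above q, true) := by
  rcases w with ⟨q, _ | _⟩ | p | _ <;> cases h
  exact ⟨q, rfl, rfl, rfl, rfl⟩

theorem kind_split {τ : MergeTree} {w : τ.WebVertex} {e₀ e₁ e : τ.web.E}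
    (h : τ.model.kind w = .split e e₀ e₁) : ∃ q, w = .inl (q, false) ∧
      e₀ = (some (q, false), false) ∧ e₁ = (some (q, true), false) ∧ e = (τ.above q, false) := by
  rcases w with ⟨q, _ | _⟩ | p | _ <;> cases h
  exact ⟨q, rfl, rfl, rfl, rfl⟩

theorem kind_rev {E : Type} {M : VertexModel E} {w : M.V} {e₀ e₁ e : E} :
    (M.rev.kind w = .merge e₀ e₁ e ↔ M.kind w = .split e e₀ e₁) ∧
    (M.rev.kind w = .split e e₀ e₁ ↔ M.kind w = .merge e₀ e₁ e) := by
  change ((M.kind w).rev = _ ↔ _) ∧ ((M.kind w).rev = _ ↔ _)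
  cases M.kind w <;> simp [VertexKind.rev] <;> tauto

end MergeTree

namespace Foam

variable {Γ₀ Γ₁ Γ₂ : Web} {N : ℕ}

theorem Arc.of_next {F : Foam Γ₀ Γ₁} {x y : F.Sd} (h : F.next x = y) : F.Arc x y := ⟨x, .refl, h⟩

theorem IsBoundary.sep_start {F : Foam Γ₀ Γ₁} {E : Type} {M : VertexModel E} {bd : E → F.Sd}
    (hB : F.IsBoundary M bd) (hF : F.next.Injective) {κ : Coloring N F} {i j : Fin N} {s : F.S}
    (hs : κ.Sep i j s) {w : M.V} (h : F.vertex (.thick s) = F.bdVertex M bd w) :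
    ∃ e₀ e₁ e, M.kind w = .merge e₀ e₁ e ∧ i ∈ κ.c (bd e₀) ∧ j ∈ κ.c (bd e₁) := by
  obtain ⟨e₀, e₁, e, hk, h0, h1, -⟩ := hB.seam_start hF h
  exact ⟨e₀, e₁, e, hk, κ.arc h0 ▸ hs.1, κ.arc h1 ▸ hs.2⟩

theorem IsBoundary.sep_end {F : Foam Γ₀ Γ₁} {E : Type} {M : VertexModel E} {bd : E → F.Sd}
    (hB : F.IsBoundary M bd) (hF : F.next.Injective) {κ : Coloring N F} {i j : Fin N} {s : F.S}
    (hs : κ.Sep i j s) {w : M.V} (h : F.vertex (.thin s false) = F.bdVertex M bd w) :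
    ∃ e e₀ e₁, M.kind w = .split e e₀ e₁ ∧ i ∈ κ.c (bd e₀) ∧ j ∈ κ.c (bd e₁) := by
  obtain ⟨e, e₀, e₁, hk, h0, h1, -⟩ := hB.seam_end hF h
  exact ⟨e, e₀, e₁, hk, (κ.arc h0).symm ▸ hs.1, (κ.arc h1).symm ▸ hs.2⟩

section Tree

variable {τ : MergeTree} {ν : τ.Lab N} {i j : Fin N}

theorem noArc_top {F : Foam Γ₀ τ.web} (hF : F.IsFoam N) {κ : Coloring N F}
    (hν : ∀ e, κ.c (.top e) = ν.set e.1) (h : ¬ ν.1 i < ν.1 j) :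
    F.NoArc κ τ.model .top i j := by
  refine fun s w hs => ⟨fun hw => h ?_, fun hw => h ?_⟩
  · obtain ⟨e₀, e₁, e, hk, hi, hj⟩ := (hF.isBoundary_top τ.models_web).sep_start hF.bij.1 hs hw
    rw [hν] at hi hj
    obtain ⟨q, -, rfl, rfl, -⟩ := MergeTree.kind_merge hk
    exact ν.lt_of_sep hi hj
  · obtain ⟨e, e₀, e₁, hk, hi, hj⟩ := (hF.isBoundary_top τ.models_web).sep_end hF.bij.1 hs hw
    rw [hν] at hi hj
    obtain ⟨q, -, rfl, rfl, -⟩ := MergeTree.kind_split hk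
    exact ν.lt_of_sep hi hj

theorem bdArc_top {F : Foam Web.empty τ.web} (hF : F.IsFoam N) {κ : Coloring N F}
    (hν : ∀ e, κ.c (.top e) = ν.set e.1) {q : τ.Inner} (hi : i ∈ ν.set (some (q, false)))
    (hj : j ∈ ν.set (some (q, true))) :
    ∃ s₀ t₀, F.BdArc κ τ.model .top i j (.inl (q, true)) (.inl (q, false)) s₀ t₀ := by
  have hB := hF.isBoundary_top τ.models_web
  obtain ⟨s₀, h0, h1, -⟩ := hF.top_merge _ _ _ ⟨q, rfl, rfl, rfl⟩
  obtain ⟨t₀, h0', h1', -⟩ := hF.top_split _ _ _ ⟨q, rfl, rfl, rfl⟩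
  refine ⟨s₀, t₀, BdArc.of_next hF hB ?_ ?_ (hB.vertex_thick h0) (hB.vertex_thin hF.bij h0' _)
    ?_ ?_ ?_⟩
  · exact ⟨by rw [κ.arc h0, hν]; exact hi, by rw [κ.arc h1, hν]; exact hj⟩
  · exact ⟨by rw [← κ.arc h0', hν]; exact hi, by rw [← κ.arc h1', hν]; exact hj⟩
  · intro s w hs hw
    obtain ⟨e₀, e₁, e, hk, hi', hj'⟩ := hB.sep_start hF.bij.1 hs hw
    rw [hν] at hi' hj'
    obtain ⟨q', rfl, rfl, rfl, -⟩ := MergeTree.kind_merge hk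
    rw [ν.sep_unique hi hj hi' hj']
  · intro s w hs hw
    obtain ⟨e, e₀, e₁, hk, hi', hj'⟩ := hB.sep_end hF.bij.1 hs hw
    rw [hν] at hi' hj'
    obtain ⟨q', rfl, rfl, rfl, -⟩ := MergeTree.kind_split hk
    rw [ν.sep_unique hi hj hi' hj']
  · intro s hs
    rcases IsFoam.exists_next κ hF hs with h | ⟨e, e₀, e₁, -, h⟩ | ⟨e, -⟩
    exacts [.inl h, .inr ⟨_, hB.vertex_thin hF.bij h.1 _⟩, e.elim]

theorem bdArc_bot {G : Foam τ.web Web.empty} (hG : G.IsFoam N) {κ : Coloring N G}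
    (hν : ∀ e, κ.c (.bot e) = ν.set e.1) {q : τ.Inner} (hi : i ∈ ν.set (some (q, false)))
    (hj : j ∈ ν.set (some (q, true))) :
    ∃ s₀ t₀, G.BdArc κ τ.model.rev .bot i j (.inl (q, false)) (.inl (q, true)) s₀ t₀ := by
  have hB := hG.isBoundary_bot τ.models_web
  obtain ⟨s₀, h0, h1, -⟩ := hG.bot_split _ _ _ ⟨q, rfl, rfl, rfl⟩
  obtain ⟨t₀, h0', h1', -⟩ := hG.bot_merge _ _ _ ⟨q, rfl, rfl, rfl⟩
  refine ⟨s₀, t₀, BdArc.of_next hG hB ?_ ?_ (hB.vertex_thick h0) (hB.vertex_thin hG.bij h0' _)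
    ?_ ?_ ?_⟩
  · exact ⟨by rw [κ.arc h0, hν]; exact hi, by rw [κ.arc h1, hν]; exact hj⟩
  · exact ⟨by rw [← κ.arc h0', hν]; exact hi, by rw [← κ.arc h1', hν]; exact hj⟩
  · intro s w hs hw
    obtain ⟨e₀, e₁, e, hk, hi', hj'⟩ := hB.sep_start hG.bij.1 hs hw
    rw [hν] at hi' hj'
    obtain ⟨q', rfl, rfl, rfl, -⟩ := MergeTree.kind_split (MergeTree.kind_rev.1.1 hk)
    rw [ν.sep_unique hi hj hi' hj']
  · intro s w hs hw
    obtain ⟨e, e₀, e₁, hk, hi', hj'⟩ := hB.sep_end hG.bij.1 hs hw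
    rw [hν] at hi' hj'
    obtain ⟨q', rfl, rfl, rfl, -⟩ := MergeTree.kind_merge (MergeTree.kind_rev.2.1 hk)
    rw [ν.sep_unique hi hj hi' hj']
  · intro s hs
    rcases IsFoam.exists_next κ hG hs with h | ⟨e, -⟩ | ⟨e₀, e₁, e, -, h⟩
    exacts [.inl h, e.elim, .inr ⟨_, hB.vertex_thin hG.bij h.1 _⟩]

theorem theta_glue {F : Foam Web.empty τ.web} {G : Foam τ.web Web.empty} (hF : F.IsFoam N)
    (hG : G.IsFoam N) (hN : τ.size = N) (κ : Coloring N (F.glue G))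
    (hν : ∀ e, ((gluing F G).left κ).c (.top e) = ν.set e.1) (i j : Fin N) :
    (κ.theta i j : ℤ) = ((gluing F G).left κ).theta i j +
      ((gluing F G).right κ).theta i j - if ν.1 i < ν.1 j then 1 else 0 := by
  have hP := along_glue hF hG τ.models_web
  have hν' : ∀ e, ((gluing F G).right κ).c (.bot e) = ν.set e.1 := fun e =>
    ((gluing F G).compat κ e).symm.trans (hν e)
  split_ifs with h
  · obtain ⟨q, hi, hj⟩ := ν.exists_sep hN h
    obtain ⟨s₀, t₀, ha⟩ := bdArc_top hF hν hi hj
    obtain ⟨s₁, t₁, hb⟩ := bdArc_bot hG hν' hi hj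
    have := Pasting.theta_of_bdArc hP κ ha hb
    omega
  · have := Pasting.theta_of_noArc hP κ (noArc_top hF hν h)
    omega

/-- A foam that is built from copies of a tree. -/
structure Shape (W : Foam Γ₀ Γ₁) (τ : MergeTree) where
  pos : W.Sd → τ.Pos
  node : W.S → τ.Inner
  next : ∀ d, pos (W.next d) = pos d
  reg : ∀ r, pos (.reg r true) = pos (.reg r false)
  thin : ∀ s b, pos (.thin s b) = some (node s, b)
  thick : ∀ s, pos (.thick s) = τ.above (node s)
  wt : ∀ d, W.wt d = τ.wt (pos d)

namespace Shape

variable {W : Foam Γ₀ Γ₁} (sh : W.Shape τ) (ν)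

/-- The coloring that comes from a coloring of the tree. -/
def coloring : Coloring N W where
  c := fun d => ν.set (sh.pos d)
  card := fun d => by rw [ν.card_set, sh.wt]
  next := fun d => by rw [sh.next]
  reg := fun r => by rw [sh.reg]
  disj := fun s => by rw [sh.thin, sh.thin]; exact ν.disjoint _
  seam := fun s => by rw [sh.thin, sh.thin, sh.thick, ν.set_above]

theorem sep_iff {s : W.S} : (sh.coloring ν).Sep i j s ↔
    i ∈ ν.set (some (sh.node s, false)) ∧ j ∈ ν.set (some (sh.node s, true)) := by
  unfold Coloring.Sep
  change i ∈ ν.set _ ∧ j ∈ ν.set _ ↔ _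
  rw [sh.thin, sh.thin]

theorem not_sep (h : ¬ ν.1 i < ν.1 j) (s : W.S) : ¬ (sh.coloring ν).Sep i j s := by
  rw [sh.sep_iff]
  exact fun hs => h (ν.lt_of_sep hs.1 hs.2)

/-- A description of the polygons. -/
structure Faces {X : Type} (f : W.Sd → X) : Prop where
  next : ∀ d, f (W.next d) = f d
  face_eq : ∀ d d', f d = f d' → W.face d = W.face d'

theorem Faces.ncard {X : Type} {f : W.Sd → X} (hf : Faces f) (A : Set W.Sd) :
    (W.face '' A).ncard = (f '' A).ncard := by
  let g : W.Face → X := Quot.lift f fun d d' h => by rw [← h, hf.next]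
  have hg : g.Injective := by
    rintro ⟨d⟩ ⟨d'⟩ h
    exact hf.face_eq d d' h
  rw [← Set.ncard_image_of_injective _ hg, Set.image_image]
  rfl

end Shape

end Tree

end Foam

theorem ncard_prod {X Y : Type*} [Finite X] [Fintype Y] (A : Set (X × Y)) :
    A.ncard = ∑ y, {x | (x, y) ∈ A}.ncard := by
  classical
  have := Fintype.ofFinite X
  rw [Set.ncard_eq_toFinset_card', Finset.card_eq_sum_card_fiberwise (f := Prod.snd)
    (t := Finset.univ) (fun _ _ => Finset.mem_univ _)]
  refine Finset.sum_congr rfl fun y _ => ?_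
  rw [← Set.ncard_image_of_injective (f := fun x => (x, y)) _ (fun x x' h => congrArg Prod.fst h),
    Set.ncard_eq_toFinset_card']
  congr 1
  ext ⟨x, y'⟩
  simp only [Finset.mem_filter, Set.mem_toFinset, Set.mem_image, Set.mem_ofPred_eq, Prod.mk.injEq]
  constructor
  · rintro ⟨h, rfl⟩
    exact ⟨x, h, rfl, rfl⟩
  · rintro ⟨x, h, rfl, rfl⟩
    exact ⟨h, rfl⟩

theorem ncard_option {X : Type*} [Finite X] (A : Set (Option X)) :
    A.ncard = {o | o = none ∧ o ∈ A}.ncard + (some ⁻¹' A).ncard := by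
  have e : A = {o | o = none ∧ o ∈ A} ∪ some '' (some ⁻¹' A) := by
    ext (_ | x) <;> simp
  conv_lhs => rw [e]
  rw [Set.ncard_union_eq _ (Set.toFinite _) (Set.toFinite _),
    Set.ncard_image_of_injective _ (Option.some_injective X)]
  rw [Set.disjoint_left]
  rintro _ ⟨rfl, _⟩ ⟨x, _, h⟩
  cases h

theorem ncard_none {X Y : Type*} {P : Option X → Prop} {Q : Option Y → Prop}
    (h : P none ↔ Q none) : {o | o = none ∧ P o}.ncard = {o | o = none ∧ Q o}.ncard := by
  have e1 : {o | o = none ∧ P o} = {o | o = none ∧ P none} := by ext o; simp +contextual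
  have e2 : {o | o = none ∧ Q o} = {o | o = none ∧ Q none} := by ext o; simp +contextual
  rw [e1, e2]
  by_cases hQ : Q none
  · simp [h.2 hQ, hQ]
  · simp [mt h.1 hQ, hQ]

namespace Foam

variable {Γ₀ Γ₁ : Web} {N : ℕ} {F : Foam Γ₀ Γ₁}

theorem exists_bdVertex (hF : F.IsFoam N) {M₀ : VertexModel Γ₀.E} {M₁ : VertexModel Γ₁.E}
    (h₀ : Γ₀.Models M₀) (h₁ : Γ₁.Models M₁) {d : F.Sd}
    (h : ∃ e : Γ₁.E ⊕ Γ₀.E, d = Sum.elim .top .bot e ∨ F.next d = Sum.elim .top .bot e) :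
    ∃ w, F.vertex d = F.bdVertex (M₁.sum M₀.rev) (Sum.elim .top .bot) w := by
  have hB := (hF.isBoundary_top h₁).sum (hF.isBoundary_bot h₀) (by simp)
  obtain ⟨e, rfl | h⟩ := h
  exacts [⟨_, hB.vertex_tgt e⟩, ⟨_, hB.vertex_src hF.bij.1 h⟩]

theorem face_eq_next {d d' : F.Sd} (h : F.next d = d') : F.face d = F.face d' := h ▸ (face_next d).symm

theorem models_empty : Web.empty.Models VertexModel.empty :=
  ⟨fun e => e.elim, fun e => e.elim, fun e => e.elim, fun e => e.elim⟩

end Foam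

namespace MergeTree

open Foam

variable (τ : MergeTree) {N : ℕ}

/-- The unit foam with a dot on each polygon. -/
def dottedUnit (m : ∀ p, SymPoly (τ.wt p)) :
    Foam Web.empty τ.web :=
  { τ.unit with
    dot := fun
      | .top (p, true) => m p
      | _ => 1 }

theorem unit_eq_dottedUnit : τ.unit = τ.dottedUnit fun _ => 1 := by
  have h : τ.unit.dot = (τ.dottedUnit fun _ => 1).dot := by
    funext d
    rcases d with r | s | s | e | ⟨p, _ | _⟩ <;> rfl
  exact congrArg (fun f => ({ τ.unit with dot := f } : Foam Web.empty τ.web)) h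

variable {τ} {m : ∀ p, SymPoly (τ.wt p)}

section Unit

theorem unit_next_leaf {p : τ.Pos} (h : τ.under p = none) :
    (τ.dottedUnit m).next (.top (p, false)) = .top (p, true) := by
  rcases p with _ | ⟨q, b⟩ <;> simp [dottedUnit, unit, h]

theorem unit_next_above (q : τ.Inner) :
    (τ.dottedUnit m).next (.top (τ.above q, false)) = .thick q := by
  have h := τ.under_above q
  generalize τ.above q = p at *
  rcases p with _ | ⟨q, b⟩ <;> simp [dottedUnit, unit, h]

theorem unit_surjective : (τ.dottedUnit m).next.Surjective := by
  rintro (r | ⟨q, b⟩ | q | e | ⟨p, _ | _⟩)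
  · exact r.elim
  · exact ⟨.top (some (q, b), true), rfl⟩
  · exact ⟨_, unit_next_above q⟩
  · exact e.elim
  · rcases p with _ | ⟨q, b⟩
    exacts [⟨.top (none, true), rfl⟩, ⟨.thin q b, rfl⟩]
  · rcases under_cases p with h | ⟨q, rfl⟩
    exacts [⟨_, unit_next_leaf h⟩, ⟨.thick q, rfl⟩]

/-- The unit foam is built from copies of the tree. -/
def unitShape : (τ.dottedUnit m).Shape τ where
  pos
    | .top e => e.1
    | .thin q b => some (q, b)
    | .thick q => τ.above q
  node := id
  next := by
    rintro (r | ⟨q, b⟩ | q | e | ⟨p, _ | _⟩)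
    · exact r.elim
    · rfl
    · rfl
    · exact e.elim
    · rcases under_cases p with h | ⟨q, rfl⟩
      · rw [unit_next_leaf h]
      · rw [unit_next_above]
    · rcases p with _ | ⟨q, b⟩ <;> rfl
  reg := fun r => r.elim
  thin := fun _ _ => rfl
  thick := fun _ => rfl
  wt := by
    rintro (r | ⟨q, b⟩ | q | e | e)
    · exact r.elim
    · rfl
    · rfl
    · exact e.elim
    · rfl

theorem isFoam_of_shape_wt {Γ₀ Γ₁ : Web} {W : Foam Γ₀ Γ₁} (sh : W.Shape τ)
    (hpos : τ.Positive) (hN : τ.size ≤ N) (d : W.Sd) : 0 < W.wt d ∧ W.wt d ≤ N := by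
  rw [sh.wt]
  exact ⟨τ.wt_pos hpos _, (τ.wt_le _).trans hN⟩

theorem unit_isFoam (hpos : τ.Positive) (hN : τ.size ≤ N) :
    (τ.dottedUnit m).IsFoam N where
  bij := ⟨Finite.injective_iff_surjective.2 unit_surjective, unit_surjective⟩
  wt_pos := fun d => (isFoam_of_shape_wt unitShape hpos hN d).1
  wt_le := fun d => (isFoam_of_shape_wt unitShape hpos hN d).2
  wt_next := fun d => by rw [unitShape.wt, unitShape.wt, unitShape.next]
  wt_reg := fun r => r.elim
  wt_seam := fun s => τ.wt_above s
  wt_bot := fun e => e.elim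
  wt_top := fun e => rfl
  seam_end := fun q => .inr (.inr (.inl ⟨_, _, _, ⟨q, rfl, rfl, rfl⟩, .of_next rfl, .of_next rfl,
    .of_next (unit_next_above q)⟩))
  seam_start := fun q => .inr (.inr (.inl ⟨_, _, _, ⟨q, rfl, rfl, rfl⟩, .of_next rfl, .of_next rfl,
    .of_next rfl⟩))
  top_pass := by
    rintro _ _ (⟨p, h, rfl, rfl⟩ | ⟨rfl, rfl⟩)
    exacts [.of_next (unit_next_leaf h), .of_next rfl]
  top_merge := by
    rintro _ _ _ ⟨q, rfl, rfl, rfl⟩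
    exact ⟨q, .of_next rfl, .of_next rfl, .of_next rfl⟩
  top_split := by
    rintro _ _ _ ⟨q, rfl, rfl, rfl⟩
    exact ⟨q, .of_next rfl, .of_next rfl, .of_next (unit_next_above q)⟩
  bot_pass := fun e => e.elim
  bot_merge := fun e => e.elim
  bot_split := fun e => e.elim

theorem unit_face (d : (τ.dottedUnit m).Sd) :
    (τ.dottedUnit m).face d = (τ.dottedUnit m).face (.top (unitShape.pos d, true)) := by
  have h : ∀ p, (τ.dottedUnit m).face (.top (p, false)) = (τ.dottedUnit m).face (.top (p, true)) := by
    intro p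
    rcases under_cases p with h | ⟨q, rfl⟩
    exacts [face_eq_next (unit_next_leaf h),
      (face_eq_next (unit_next_above q)).trans (face_eq_next rfl)]
  rcases d with r | ⟨q, b⟩ | q | e | ⟨p, _ | _⟩
  · exact r.elim
  · exact (face_eq_next rfl).trans (h _)
  · exact face_eq_next rfl
  · exact e.elim
  · exact h p
  · rfl

theorem unit_coloring_eq {κ : Coloring N (τ.dottedUnit m)} {ν : τ.Lab N}
    (h : ∀ e, κ.c (.top e) = ν.set e.1) : κ = unitShape.coloring ν :=
  Coloring.ext_c fun d => (κ.face_eq (unit_face d)).trans (h _)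

theorem unit_chi (hpos : τ.Positive) (hN : τ.size = N) (ν : τ.Lab N)
    {p : Finset (Fin N) → Prop} (hp : Additive p) {h : ℤ} (hν : ν.Path p h) :
    (unitShape (m := m).coloring ν).chi p = h := by
  have hU := unit_isFoam (m := m) hpos hN.le
  rw [Coloring.chi_of_boundary hU models_empty τ.models_web _ ?_ hp]
  · have e1 : ((τ.dottedUnit m).face '' {d | p ((unitShape.coloring ν).c d)}).ncard =
        {e | p (ν.set e)}.ncard := by
      rw [Shape.Faces.ncard (f := unitShape.pos) ⟨unitShape.next, fun d d' h => by
        rw [unit_face d, unit_face d', h]⟩]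
      congr 1
      ext e
      constructor
      · rintro ⟨d, hd, rfl⟩
        exact hd
      · exact fun h => ⟨.top (e, true), h, rfl⟩
    have e2 : {r : (τ.dottedUnit m).R | p ((unitShape.coloring ν).c (.reg r true))}.ncard = 0 :=
      ncard_of_isEmpty (X := Empty) _
    rw [e1, e2, hν.edges]
    change _ + _ - _ - (_ : ℤ) = _
    simp only [Nat.cast_zero, sub_zero]
    exact add_sub_cancel_left _ _
  · rintro (r | ⟨q, b⟩ | q | e | e)
    exacts [r.elim, exists_bdVertex hU models_empty τ.models_web ⟨.inl _, .inr rfl⟩,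
      exists_bdVertex hU models_empty τ.models_web ⟨.inl _, .inr rfl⟩, e.elim,
      exists_bdVertex hU models_empty τ.models_web ⟨.inl _, .inl rfl⟩]

theorem unit_theta (hN : τ.size = N) (ν : τ.Lab N) (i j : Fin N) :
    ((unitShape (m := m).coloring ν).theta i j : ℤ) = if ν.1 i < ν.1 j then 1 else 0 := by
  split_ifs with h
  · obtain ⟨q, hi, hj⟩ := ν.exists_sep hN h
    have := (unitShape (m := m).coloring ν).theta_eq_thetaFree_add_one (i := i) (j := j)
      (T := fun _ => True) (s₀ := q) ((unitShape.sep_iff ν).2 ⟨hi, hj⟩) trivial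
      (fun _ _ _ _ _ => Iff.rfl) (fun s hs _ => congrArg _ (Subtype.ext
        (ν.sep_unique ((unitShape.sep_iff ν).1 hs).1 ((unitShape.sep_iff ν).1 hs).2 hi hj)))
    rw [Coloring.thetaFree_eq_zero _ fun _ _ => trivial] at this
    rw [this]
    rfl
  · have := (unitShape (m := m).coloring ν).theta_eq_thetaFree (i := i) (j := j)
      (T := fun _ => True) (fun s hs => absurd hs (unitShape.not_sep ν h s))
    rw [this, Coloring.thetaFree_eq_zero _ fun _ _ => trivial]
    rfl

theorem unit_decor {L : Type*} [Field L] (x : Fin N → L) (ν : τ.Lab N) :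
    (unitShape (m := m).coloring ν).decor x =
      ∏ᶠ p, decoration x (m p) (ν.set p) (ν.card_set p) := by
  let f : (τ.dottedUnit m).Sd → L := fun d => decoration x ((τ.dottedUnit m).dot d)
    ((unitShape.coloring ν).c d) ((unitShape.coloring ν).card d)
  let g : τ.Pos → (τ.dottedUnit m).Sd := fun p => .top (p, true)
  have hg : g.Injective := fun p p' h => by cases h; rfl
  have h1 : ∏ᶠ d, f d = ∏ᶠ d ∈ Set.range g, f d := by
    rw [← finprod_mem_univ f]
    refine finprod_mem_inter_mulSupport_eq' f _ _ fun d hd => iff_of_true trivial ?_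
    by_contra h
    refine hd ?_
    rcases d with r | s | s | e | ⟨p, _ | _⟩
    exacts [r.elim, map_one _, map_one _, e.elim, map_one _, absurd ⟨p, rfl⟩ h]
  exact h1.trans (finprod_mem_range hg)

end Unit

end MergeTree

namespace MergeTree

open Foam

variable {τ : MergeTree} {N : ℕ}

theorem nxt_prv (j : Option Bool) : nxt (prv j) = j := by rcases j with _ | _ | _ <;> rfl

theorem prv_nxt (j : Option Bool) : prv (nxt j) = j := by rcases j with _ | _ | _ <;> rfl

theorem mul_next_up (j : Option Bool) (p : τ.Pos) :
    τ.mul.next (upSide τ j p) = afterUp τ j p := by rcases j with _ | _ | _ <;> rfl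

theorem mul_next_down (j : Option Bool) (p : τ.Pos) :
    τ.mul.next (downSide τ j p) = afterDown τ j p := by rcases j with _ | _ | _ <;> rfl

theorem mul_next_down_leaf (j : Option Bool) {p : τ.Pos} (h : τ.under p = none) :
    τ.mul.next (downSide τ j p) = upSide τ j p := by
  rw [mul_next_down, afterDown, h]

theorem mul_next_down_above (j : Option Bool) (q : τ.Inner) :
    τ.mul.next (downSide τ j (τ.above q)) = .thick (q, nxt j) := by
  rw [mul_next_down, afterDown, under_above]; rfl

theorem mul_next_up_some (j : Option Bool) (q : τ.Inner) (b : Bool) :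
    τ.mul.next (upSide τ j (some (q, b))) = .thin (q, j) b := mul_next_up j _

theorem mul_next_up_none (j : Option Bool) : τ.mul.next (upSide τ j none) = .reg j true :=
  mul_next_up j _

theorem mul_next_thin (q : τ.Inner) (j : Option Bool) (b : Bool) :
    τ.mul.next (.thin (q, j) b) = downSide τ (prv j) (some (q, b)) := rfl

theorem mul_next_thick (q : τ.Inner) (j : Option Bool) :
    τ.mul.next (.thick (q, j)) = upSide τ j (τ.above q) := rfl

theorem mul_next_reg_true (j : Option Bool) :
    τ.mul.next (.reg j true) = downSide τ (prv j) none := rfl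

theorem mul_next_reg_false (j : Option Bool) : τ.mul.next (.reg j false) = .reg (nxt j) false := rfl

theorem mul_cases {P : τ.mul.Sd → Prop} (h1 : ∀ j p, P (upSide τ j p))
    (h2 : ∀ j p, P (downSide τ j p)) (h3 : ∀ j : Option Bool, P (.reg j true))
    (h4 : ∀ j : Option Bool, P (.reg j false))
    (h5 : ∀ (q : τ.Inner) (j : Option Bool) (b : Bool), P (.thin (q, j) b))
    (h6 : ∀ (q : τ.Inner) (j : Option Bool), P (.thick (q, j))) (d : τ.mul.Sd) : P d := by
  rcases d with ⟨j, _ | _⟩ | ⟨⟨q, j⟩, b⟩ | ⟨q, j⟩ | (⟨p, _ | _⟩ | ⟨p, _ | _⟩) | ⟨p, _ | _⟩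
  exacts [h4 j, h3 j, h5 q j b, h6 q j, h1 (some false) p, h2 (some false) p, h1 (some true) p,
    h2 (some true) p, h2 none p, h1 none p]

theorem mul_surjective (τ : MergeTree) : τ.mul.next.Surjective := by
  refine mul_cases ?_ ?_ ?_ ?_ ?_ ?_
  · intro j p
    rcases under_cases p with h | ⟨q, rfl⟩
    exacts [⟨_, mul_next_down_leaf j h⟩, ⟨_, mul_next_thick q j⟩]
  · rintro j (_ | ⟨q, b⟩)
    exacts [⟨.reg (nxt j) true, by rw [mul_next_reg_true, prv_nxt]⟩,
      ⟨.thin (q, nxt j) b, by rw [mul_next_thin, prv_nxt]⟩]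
  exacts [fun j => ⟨_, mul_next_up_none j⟩,
    fun j => ⟨.reg (prv j) false, by rw [mul_next_reg_false, nxt_prv]⟩,
    fun q j b => ⟨_, mul_next_up_some j q b⟩,
    fun q j => ⟨downSide τ (prv j) (τ.above q), by rw [mul_next_down_above, nxt_prv]⟩]

/-- The position of a side of the multiplication foam. -/
def mulPos (τ : MergeTree) : τ.mul.Sd → τ.Pos
  | .reg _ _ => none
  | .thin (q, _) b => some (q, b)
  | .thick (q, _) => τ.above q
  | .bot (.inl e) => e.1
  | .bot (.inr e) => e.1
  | .top e => e.1

theorem mulPos_up (j : Option Bool) (p : τ.Pos) : τ.mulPos (upSide τ j p) = p := by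
  rcases j with _ | _ | _ <;> rfl

theorem mulPos_down (j : Option Bool) (p : τ.Pos) : τ.mulPos (downSide τ j p) = p := by
  rcases j with _ | _ | _ <;> rfl

/-- The multiplication foam is built from copies of the tree. -/
def mulShape (τ : MergeTree) : τ.mul.Shape τ where
  pos := τ.mulPos
  node := Prod.fst
  next := by
    refine mul_cases ?_ ?_ ?_ ?_ ?_ ?_
    · rintro j (_ | ⟨q, b⟩)
      · rw [mul_next_up_none, mulPos_up]; rfl
      · rw [mul_next_up_some, mulPos_up]; rfl
    · intro j p
      rcases under_cases p with h | ⟨q, rfl⟩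
      · rw [mul_next_down_leaf j h, mulPos_up, mulPos_down]
      · rw [mul_next_down_above, mulPos_down]; rfl
    · intro j
      rw [mul_next_reg_true, mulPos_down]; rfl
    · intro j
      rfl
    · intro q j b
      rw [mul_next_thin, mulPos_down]; rfl
    · intro q j
      rw [mul_next_thick, mulPos_up]; rfl
  reg := fun _ => rfl
  thin := fun _ _ => rfl
  thick := fun _ => rfl
  wt := by
    rintro (_ | ⟨⟨q, j⟩, b⟩ | ⟨q, j⟩ | (_ | _) | _)
    · exact (wt_none τ).symm
    all_goals rfl

theorem mul_arc_leaf (j : Option Bool) {p : τ.Pos} (h : τ.under p = none) :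
    τ.mul.Arc (downSide τ j p) (upSide τ j p) := .of_next (mul_next_down_leaf j h)

theorem mul_arc_root (j : Option Bool) : τ.mul.Arc (upSide τ j none) (downSide τ j none) := by
  refine ⟨.reg (nxt j) true, ?_, by rw [mul_next_reg_true, prv_nxt]⟩
  exact (ReflTransGen.single ⟨j, true, mul_next_up_none j, rfl⟩).tail
    ⟨nxt j, false, mul_next_reg_false j, rfl⟩

theorem mul_arc_start (j : Option Bool) (q : τ.Inner) (b : Bool) :
    τ.mul.Arc (upSide τ j (some (q, b))) (.thin (q, j) b) := .of_next (mul_next_up_some j q b)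

theorem mul_arc_start' (j : Option Bool) (q : τ.Inner) :
    τ.mul.Arc (.thick (q, j)) (upSide τ j (τ.above q)) := .of_next (mul_next_thick q j)

theorem mul_arc_stop (j : Option Bool) (q : τ.Inner) (b : Bool) :
    τ.mul.Arc (.thin (q, nxt j) b) (downSide τ j (some (q, b))) :=
  .of_next (by rw [mul_next_thin, prv_nxt])

theorem mul_arc_stop' (j : Option Bool) (q : τ.Inner) :
    τ.mul.Arc (downSide τ j (τ.above q)) (.thick (q, nxt j)) := .of_next (mul_next_down_above j q)

theorem mul_start (j : Option Bool) (q : τ.Inner) :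
    τ.mul.Arc (upSide τ j (some (q, false))) (.thin (q, j) false) ∧
      τ.mul.Arc (upSide τ j (some (q, true))) (.thin (q, j) true) ∧
      τ.mul.Arc (.thick (q, j)) (upSide τ j (τ.above q)) :=
  ⟨mul_arc_start j q _, mul_arc_start j q _, mul_arc_start' j q⟩

theorem mul_stop (j : Option Bool) (q : τ.Inner) :
    τ.mul.Arc (.thin (q, nxt j) false) (downSide τ j (some (q, false))) ∧
      τ.mul.Arc (.thin (q, nxt j) true) (downSide τ j (some (q, true))) ∧
      τ.mul.Arc (downSide τ j (τ.above q)) (.thick (q, nxt j)) :=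
  ⟨mul_arc_stop j q _, mul_arc_stop j q _, mul_arc_stop' j q⟩

theorem mul_isFoam (hpos : τ.Positive) (hN : τ.size ≤ N) : τ.mul.IsFoam N where
  bij := ⟨Finite.injective_iff_surjective.2 τ.mul_surjective, τ.mul_surjective⟩
  wt_pos := fun d => (isFoam_of_shape_wt τ.mulShape hpos hN d).1
  wt_le := fun d => (isFoam_of_shape_wt τ.mulShape hpos hN d).2
  wt_next := fun d => by rw [τ.mulShape.wt, τ.mulShape.wt, τ.mulShape.next]
  wt_reg := fun r => rfl
  wt_seam := fun s => τ.wt_above s.1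
  wt_bot := by rintro (e | e) <;> rfl
  wt_top := fun e => rfl
  seam_end := by
    rintro ⟨q, _ | _ | _⟩
    · exact .inr (.inr (.inr ⟨.inl _, .inl _, .inl _, .inl ⟨_, _, _, rfl, rfl, rfl, q, rfl, rfl, rfl⟩, mul_stop (some false) q⟩))
    · exact .inr (.inr (.inr ⟨.inr _, .inr _, .inr _, .inr ⟨_, _, _, rfl, rfl, rfl, q, rfl, rfl, rfl⟩, mul_stop (some true) q⟩))
    · exact .inr (.inr (.inl ⟨_, _, _, ⟨q, rfl, rfl, rfl⟩, mul_stop none q⟩))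
  seam_start := by
    rintro ⟨q, _ | _ | _⟩
    · exact .inr (.inr (.inl ⟨_, _, _, ⟨q, rfl, rfl, rfl⟩, mul_start none q⟩))
    · exact .inr (.inr (.inr ⟨.inl _, .inl _, .inl _, .inl ⟨_, _, _, rfl, rfl, rfl, q, rfl, rfl, rfl⟩, mul_start (some false) q⟩))
    · exact .inr (.inr (.inr ⟨.inr _, .inr _, .inr _, .inr ⟨_, _, _, rfl, rfl, rfl, q, rfl, rfl, rfl⟩, mul_start (some true) q⟩))
  top_pass := by
    rintro _ _ (⟨p, h, rfl, rfl⟩ | ⟨rfl, rfl⟩)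
    exacts [mul_arc_leaf none h, mul_arc_root none]
  top_merge := by
    rintro _ _ _ ⟨q, rfl, rfl, rfl⟩
    exact ⟨_, mul_start none q⟩
  top_split := by
    rintro _ _ _ ⟨q, rfl, rfl, rfl⟩
    exact ⟨_, mul_stop none q⟩
  bot_pass := by
    rintro _ _ (⟨_, _, rfl, rfl, ⟨p, h, rfl, rfl⟩ | ⟨rfl, rfl⟩⟩ |
      ⟨_, _, rfl, rfl, ⟨p, h, rfl, rfl⟩ | ⟨rfl, rfl⟩⟩)
    exacts [mul_arc_leaf (some false) h, mul_arc_root (some false), mul_arc_leaf (some true) h,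
      mul_arc_root (some true)]
  bot_merge := by
    rintro _ _ _ (⟨_, _, _, rfl, rfl, rfl, q, rfl, rfl, rfl⟩ |
      ⟨_, _, _, rfl, rfl, rfl, q, rfl, rfl, rfl⟩)
    · exact ⟨_, mul_stop (some false) q⟩
    · exact ⟨_, mul_stop (some true) q⟩
  bot_split := by
    rintro _ _ _ (⟨_, _, _, rfl, rfl, rfl, q, rfl, rfl, rfl⟩ |
      ⟨_, _, _, rfl, rfl, rfl, q, rfl, rfl, rfl⟩)
    · exact ⟨_, mul_start (some false) q⟩
    · exact ⟨_, mul_start (some true) q⟩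

/-- The strip number `j` over the edge `p` of the tree. -/
def mulCell (τ : MergeTree) (j : Option Bool) (p : τ.Pos) :
    Option (τ.Pos × Option Bool) :=
  some (p, if τ.under p = none then none else j)

/-- The polygon of a side of the multiplication foam; `none` is the triangle at the root. -/
def mulFace (τ : MergeTree) : τ.mul.Sd → Option (τ.Pos × Option Bool)
  | .reg j true => τ.mulCell j none
  | .reg _ false => none
  | .thin (q, j) b => τ.mulCell j (some (q, b))
  | .thick (q, j) => τ.mulCell j (τ.above q)
  | .bot (.inl (p, false)) => τ.mulCell (some false) p
  | .bot (.inl (p, true)) => τ.mulCell none p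
  | .bot (.inr (p, false)) => τ.mulCell (some true) p
  | .bot (.inr (p, true)) => τ.mulCell (some false) p
  | .top (p, true) => τ.mulCell none p
  | .top (p, false) => τ.mulCell (some true) p

theorem mulFace_up (j : Option Bool) (p : τ.Pos) : τ.mulFace (upSide τ j p) = τ.mulCell j p := by
  rcases j with _ | _ | _ <;> rfl

theorem mulFace_down (j : Option Bool) (p : τ.Pos) :
    τ.mulFace (downSide τ j p) = τ.mulCell (nxt j) p := by
  rcases j with _ | _ | _ <;> rfl

theorem mulCell_leaf (j j' : Option Bool) {p : τ.Pos} (h : τ.under p = none) :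
    τ.mulCell j p = τ.mulCell j' p := by
  simp [mulCell, h]

theorem mul_face_up (j : Option Bool) (p : τ.Pos) :
    τ.mul.face (upSide τ j p) = τ.mul.face (downSide τ (prv j) p) := by
  rcases p with _ | ⟨q, b⟩
  exacts [(face_eq_next (mul_next_up_none j)).trans (face_eq_next (mul_next_reg_true j)),
    (face_eq_next (mul_next_up_some j q b)).trans (face_eq_next (mul_next_thin q j b))]

theorem mul_face_leaf (j : Option Bool) {p : τ.Pos} (h : τ.under p = none) :
    τ.mul.face (upSide τ j p) = τ.mul.face (upSide τ none p) := by
  have key : ∀ j, τ.mul.face (upSide τ j p) = τ.mul.face (upSide τ (prv j) p) := fun j =>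
    (mul_face_up j p).trans (face_eq_next (mul_next_down_leaf _ h))
  rcases j with _ | _ | _
  · rfl
  exacts [(key none).symm, key (some true)]

theorem mul_face_down (j : Option Bool) (p : τ.Pos) :
    τ.mul.face (downSide τ j p) = τ.mul.face (upSide τ (nxt j) p) := by
  rw [mul_face_up, prv_nxt]

theorem mul_face_eq (d : τ.mul.Sd) : τ.mul.face d =
    (τ.mulFace d).elim (τ.mul.face (.reg none false)) fun x => τ.mul.face (upSide τ x.2 x.1) := by
  have h : ∀ j p, τ.mul.face (upSide τ j p) = (τ.mulCell j p).elim (τ.mul.face (.reg none false))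
      fun x => τ.mul.face (upSide τ x.2 x.1) := by
    intro j p
    simp only [mulCell, Option.elim_some]
    split_ifs with h
    · exact mul_face_leaf j h
    · rfl
  revert d
  refine mul_cases ?_ ?_ ?_ ?_ ?_ ?_
  · intro j p
    rw [mulFace_up, h]
  · intro j p
    rw [mulFace_down, ← h, mul_face_down]
  · intro j
    change _ = (τ.mulCell j none).elim _ _
    rw [← h, mul_face_up]
    exact face_eq_next (mul_next_reg_true j)
  · intro j
    change _ = τ.mul.face (.reg none false)
    rcases j with _ | _ | _
    · rfl
    exacts [face_eq_next rfl, (face_eq_next rfl).trans (face_eq_next rfl)]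
  · intro q j b
    change _ = (τ.mulCell j _).elim _ _
    rw [← h, mul_face_up]
    exact face_eq_next (mul_next_thin q j b)
  · intro q j
    change _ = (τ.mulCell j _).elim _ _
    rw [← h]
    exact face_eq_next (mul_next_thick q j)

theorem mul_faces (τ : MergeTree) : Shape.Faces τ.mulFace where
  next := by
    refine mul_cases ?_ ?_ ?_ ?_ ?_ ?_
    · rintro j (_ | ⟨q, b⟩)
      · rw [mul_next_up_none, mulFace_up]; rfl
      · rw [mul_next_up_some, mulFace_up]; rfl
    · intro j p
      rcases under_cases p with h | ⟨q, rfl⟩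
      · rw [mul_next_down_leaf j h, mulFace_up, mulFace_down]
        exact mulCell_leaf _ _ h
      · rw [mul_next_down_above, mulFace_down]; rfl
    · intro j
      rw [mul_next_reg_true, mulFace_down, nxt_prv]; rfl
    · intro j
      rfl
    · intro q j b
      rw [mul_next_thin, mulFace_down, nxt_prv]; rfl
    · intro q j
      rw [mul_next_thick, mulFace_up]; rfl
  face_eq := fun d d' h => by rw [mul_face_eq, mul_face_eq d', h]

theorem mul_coloring_eq {κ : Coloring N τ.mul} {ν : τ.Lab N}
    (h : ∀ e, κ.c (.top e) = ν.set e.1) : κ = τ.mulShape.coloring ν := by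
  have hd : ∀ p, κ.c (downSide τ none p) = ν.set p := fun p => h (p, false)
  have hu : ∀ j p, κ.c (upSide τ j p) = κ.c (downSide τ (prv j) p) :=
    fun j p => κ.face_eq (mul_face_up j p)
  have hup : ∀ p j, κ.c (upSide τ j p) = ν.set p ∧ κ.c (downSide τ j p) = ν.set p := by
    have key : ∀ p, (∀ j, κ.c (upSide τ j p) = κ.c (downSide τ j p)) →
        ∀ j, κ.c (upSide τ j p) = ν.set p ∧ κ.c (downSide τ j p) = ν.set p := by
      intro p hp
      have h1 : κ.c (upSide τ (some true) p) = ν.set p := (hu (some true) p).trans (hd p)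
      have h2 : κ.c (upSide τ (some false) p) = ν.set p :=
        (hu (some false) p).trans ((hp _).symm.trans h1)
      rintro (_ | _ | _)
      exacts [⟨h (p, true), hd p⟩, ⟨h2, (hp _).symm.trans h2⟩, ⟨h1, (hp _).symm.trans h1⟩]
    intro p
    refine key p ?_
    induction p using pos_induction with
    | h p hp => exact fun j => κ.arc (mul_arc_leaf j hp)
    | hn q h0 h1 =>
      intro j
      have e1 := key _ h0 j
      have e2 := key _ h1 j
      have s := κ.seam (q, j)
      have s' := κ.seam (q, nxt j)
      rw [κ.arc (mul_arc_start' j q), ← κ.arc (mul_arc_stop' j q), s, s',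
        κ.arc (mul_arc_start j q false), κ.arc (mul_arc_start j q true),
        ← κ.arc (mul_arc_stop j q false), ← κ.arc (mul_arc_stop j q true), e1.1, e1.2, e2.1, e2.2]
  refine Coloring.ext_c (mul_cases ?_ ?_ ?_ ?_ ?_ ?_)
  · intro j p
    rw [(hup p j).1]
    exact (congrArg ν.set (mulPos_up j p)).symm
  · intro j p
    rw [(hup p j).2]
    exact (congrArg ν.set (mulPos_down j p)).symm
  · intro j
    rw [κ.arc (.of_next (mul_next_up_none j)), (hup _ j).1]
    rfl
  · intro j
    have e : κ.c (.reg j true) = κ.c (.reg j false) := κ.reg j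
    rw [← e, κ.arc (.of_next (mul_next_up_none j)), (hup _ j).1]
    rfl
  · intro q j b
    rw [κ.arc (mul_arc_start j q b), (hup _ j).1]
    rfl
  · intro q j
    rw [← κ.arc (mul_arc_start' j q), (hup _ j).1]
    rfl

theorem mul_chi (hpos : τ.Positive) (hN : τ.size = N) (ν : τ.Lab N)
    {p : Finset (Fin N) → Prop} (hp : Additive p) {h : ℤ} (hν : ν.Path p h) :
    (τ.mulShape.coloring ν).chi p = -h := by
  have hM := mul_isFoam hpos hN.le
  have m2 := τ.models_web.sum τ.models_web
  rw [Coloring.chi_of_boundary hM m2 τ.models_web _ ?_ hp]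
  · obtain ⟨z, hz⟩ : ∃ z, z = {e : τ.Pos | e = none ∧ p (ν.set e)}.ncard := ⟨_, rfl⟩
    have e1 : (τ.mul.face '' {d | p ((τ.mulShape.coloring ν).c d)}).ncard = z +
        ({e | p (ν.set e)}.ncard + ({e | p (ν.set e) ∧ τ.under e ≠ none}.ncard +
          {e | p (ν.set e) ∧ τ.under e ≠ none}.ncard)) := by
      rw [τ.mul_faces.ncard]
      have e : τ.mulFace '' {d | p ((τ.mulShape.coloring ν).c d)} =
          {o | o.elim (p (ν.set none)) fun x => p (ν.set x.1) ∧ (x.2 = none ∨ τ.under x.1 ≠ none)} := by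
        have hc : ∀ j x, p (ν.set x) → τ.mulCell j x ∈ {o : Option (τ.Pos × Option Bool) |
            o.elim (p (ν.set none)) fun x => p (ν.set x.1) ∧ (x.2 = none ∨ τ.under x.1 ≠ none)} := by
          intro j x hx
          refine ⟨hx, ?_⟩
          dsimp only
          split_ifs with hu
          exacts [.inl rfl, .inr hu]
        ext o
        constructor
        · rintro ⟨d, hd, rfl⟩
          revert d
          refine mul_cases ?_ ?_ ?_ ?_ ?_ ?_
          · intro j x hd
            rw [mulFace_up]
            exact hc j x (by rw [← mulPos_up j x]; exact hd)
          · intro j x hd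
            rw [mulFace_down]
            exact hc _ x (by rw [← mulPos_down j x]; exact hd)
          exacts [fun j hd => hc j none hd, fun j hd => hd, fun q j b hd => hc j _ hd,
            fun q j hd => hc j _ hd]
        · rcases o with _ | ⟨x, j⟩
          · exact fun ho => ⟨.reg none false, ho, rfl⟩
          · rintro ⟨hx, hj⟩
            refine ⟨upSide τ j x, ?_, ?_⟩
            · change p (ν.set (τ.mulPos _))
              rw [mulPos_up]
              exact hx
            · rw [mulFace_up, mulCell]
              split_ifs with hu
              · rw [show j = none from hj.resolve_right (not_not.2 hu)]
              · rfl
      rw [e, ncard_option, ncard_prod, Fintype.sum_option, Fintype.sum_bool]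
      congr 1
      · exact (ncard_none (P := (· ∈ {o : Option (τ.Pos × Option Bool) | o.elim (p (ν.set none))
          fun x => p (ν.set x.1) ∧ (x.2 = none ∨ τ.under x.1 ≠ none)})) (Q := fun e => p (ν.set e))
          Iff.rfl).trans hz.symm
      · have hs : ∀ b : Bool, {x : τ.Pos | p (ν.set x) ∧ (some b = none ∨ τ.under x ≠ none)} =
            {x | p (ν.set x) ∧ τ.under x ≠ none} := fun b => by simp
        exact congrArg₂ _ (congrArg _ (by ext x; exact ⟨And.left, fun hx => ⟨hx, .inl rfl⟩⟩))
          (congrArg₂ _ (congrArg _ (hs true)) (congrArg _ (hs false)))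
    have e2 : {r : Option Bool | p ((τ.mulShape.coloring ν).c (.reg r true))}.ncard =
        3 * z := by
      change {r : Option Bool | p (ν.set none)}.ncard = _
      rw [hz, ncard_none (P := fun e => p (ν.set e)) (Q := fun _ : Option Empty => p (ν.set none))
        Iff.rfl]
      by_cases h0 : p (ν.set none) <;> simp [h0, Set.ncard_univ]
    have e3 : {s : τ.Inner × Option Bool | p ((τ.mulShape.coloring ν).c (.thin s false)) ∨
        p ((τ.mulShape.coloring ν).c (.thin s true))}.ncard =
        3 * {q | p (ν.set (some (q, false))) ∨ p (ν.set (some (q, true)))}.ncard := by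
      rw [ncard_prod, Fintype.sum_option, Fintype.sum_bool]
      change {q | p (ν.set (some (q, false))) ∨ p (ν.set (some (q, true)))}.ncard +
        ({q | p (ν.set (some (q, false))) ∨ p (ν.set (some (q, true)))}.ncard +
        {q | p (ν.set (some (q, false))) ∨ p (ν.set (some (q, true)))}.ncard) = _
      ring
    have e4 : {e | p (ν.set e)}.ncard = {e | p (ν.set e) ∧ τ.under e ≠ none}.ncard +
        {e | τ.under e = none ∧ p (ν.set e)}.ncard := by
      rw [← Set.ncard_union_eq _ (Set.toFinite _) (Set.toFinite _)]
      · congr 1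
        ext e
        simp only [Set.mem_ofPred_eq, Set.mem_union]
        tauto
      · rw [Set.disjoint_left]
        exact fun e he he' => he.2 he'.1
    have h1 := hν.edges
    have h2 : ({e | τ.under e = none ∧ p (ν.set e)}.ncard : ℤ) + z = 2 * h := hz ▸ hν.ends
    rw [e1]
    erw [e2, e3]
    push_cast
    omega
  · have hb : ∀ j x, ∃ e : τ.web.E ⊕ (τ.web.sum τ.web).E,
        upSide τ j x = Sum.elim .top .bot e := by
      rintro (_ | _ | _) x
      exacts [⟨.inl _, rfl⟩, ⟨.inr _, rfl⟩, ⟨.inr _, rfl⟩]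
    have hb' : ∀ j x, ∃ e : τ.web.E ⊕ (τ.web.sum τ.web).E,
        downSide τ j x = Sum.elim .top .bot e := by
      rintro (_ | _ | _) x
      exacts [⟨.inl _, rfl⟩, ⟨.inr _, rfl⟩, ⟨.inr _, rfl⟩]
    have X := @fun d h => exists_bdVertex hM m2 τ.models_web (d := d) h
    refine mul_cases (fun j x => X _ ((hb j x).imp fun _ => .inl))
      (fun j x => X _ ((hb' j x).imp fun _ => .inl))
      (fun j => X _ ((hb' (prv j) none).imp fun _ => .inr)) (fun j => ?_)
      (fun q j b => X _ ((hb' (prv j) (some (q, b))).imp fun _ => .inr))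
      (fun q j => X _ ((hb j (τ.above q)).imp fun _ => .inr))
    have hv : τ.mul.vertex (.reg (nxt j) true) = τ.mul.vertex (.reg j false) :=
      vertex_eq_of_opp (Side.Opp.reg _ _)
    exact hv ▸ X _ ((hb' (prv (nxt j)) none).imp fun _ => .inr)

theorem mul_decor {L : Type*} [Field L] (x : Fin N → L) (κ : Coloring N τ.mul) : κ.decor x = 1 := by
  refine finprod_eq_one_of_forall_eq_one fun d => ?_
  exact map_one _

end MergeTree

namespace MergeTree

open Foam

variable {σ τ : MergeTree} {N : ℕ}

namespace Refine

theorem back_old : ∀ {σ τ : MergeTree} (ρ : Refine σ τ) (q), ρ.back (ρ.old q) = some q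
  | _, _, here _ _, q => nomatch q
  | _, _, left _ _, none => rfl
  | _, _, left ρ _, some (.inl q) => by
    change (ρ.back (ρ.old q)).map _ = _
    rw [back_old]; rfl
  | _, _, left _ _, some (.inr _) => rfl
  | _, _, right _ _, none => rfl
  | _, _, right _ _, some (.inl _) => rfl
  | _, _, right _ ρ, some (.inr q) => by
    change (ρ.back (ρ.old q)).map _ = _
    rw [back_old]; rfl

theorem back_new : ∀ {σ τ : MergeTree} (ρ : Refine σ τ), ρ.back ρ.new = none
  | _, _, here _ _ => rfl
  | _, _, left ρ _ => by
    change (ρ.back ρ.new).map _ = _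
    rw [back_new]; rfl
  | _, _, right _ ρ => by
    change (ρ.back ρ.new).map _ = _
    rw [back_new]; rfl

theorem eq_old_or_new : ∀ {σ τ : MergeTree} (ρ : Refine σ τ) (q), (∃ q', q = ρ.old q') ∨ q = ρ.new
  | _, _, here _ _, none => .inr rfl
  | _, _, left _ _, none => .inl ⟨none, rfl⟩
  | _, _, left ρ _, some (.inl q) => by
    rcases eq_old_or_new ρ q with ⟨q', rfl⟩ | rfl
    exacts [.inl ⟨some (.inl q'), rfl⟩, .inr rfl]
  | _, _, left _ _, some (.inr q) => .inl ⟨some (.inr q), rfl⟩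
  | _, _, right _ _, none => .inl ⟨none, rfl⟩
  | _, _, right _ _, some (.inl q) => .inl ⟨some (.inl q), rfl⟩
  | _, _, right _ ρ, some (.inr q) => by
    rcases eq_old_or_new ρ q with ⟨q', rfl⟩ | rfl
    exacts [.inl ⟨some (.inr q'), rfl⟩, .inr rfl]

theorem old_injective (ρ : Refine σ τ) : ρ.old.Injective := fun q q' h =>
  Option.some.inj ((ρ.back_old q).symm.trans ((congrArg ρ.back h).trans (ρ.back_old q')))

theorem old_ne_new (ρ : Refine σ τ) (q) : ρ.old q ≠ ρ.new := fun h => by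
  have := ρ.back_old q
  rw [h, back_new] at this
  cases this

/-- The edges of the tree before the refinement, as edges after the refinement. -/
def oldPos (ρ : Refine σ τ) : σ.Pos → τ.Pos
  | none => none
  | some (q, b) => some (ρ.old q, b)

theorem oldPos_injective (ρ : Refine σ τ) : ρ.oldPos.Injective := by
  rintro (_ | ⟨q, b⟩) (_ | ⟨q', b'⟩) h <;> simp only [oldPos, reduceCtorEq, Option.some.injEq,
    Prod.mk.injEq] at h ⊢
  exact ⟨ρ.old_injective h.1, h.2⟩

theorem pos_cases (ρ : Refine σ τ) (p : τ.Pos) :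
    (∃ p', p = ρ.oldPos p') ∨ ∃ b, p = some (ρ.new, b) := by
  rcases p with _ | ⟨q, b⟩
  · exact .inl ⟨none, rfl⟩
  · rcases ρ.eq_old_or_new q with ⟨q', rfl⟩ | rfl
    exacts [.inl ⟨some (q', b), rfl⟩, .inr ⟨b, rfl⟩]

theorem oldPos_left {l l' r : MergeTree} (ρ : Refine l l') (p) :
    (left ρ r).oldPos (posL p) = posL (ρ.oldPos p) ∧ ∀ p, (left ρ r).oldPos (posR p) = posR p := by
  rcases p with _ | ⟨q, b⟩ <;> exact ⟨rfl, by rintro (_ | ⟨q, b⟩) <;> rfl⟩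

theorem oldPos_right {l r r' : MergeTree} (ρ : Refine r r') (p) :
    (right l ρ).oldPos (posR p) = posR (ρ.oldPos p) ∧
      ∀ p, (right l ρ).oldPos (posL p) = posL p := by
  rcases p with _ | ⟨q, b⟩ <;> exact ⟨rfl, by rintro (_ | ⟨q, b⟩) <;> rfl⟩

theorem above_old : ∀ {σ τ : MergeTree} (ρ : Refine σ τ) (q),
    τ.above (ρ.old q) = ρ.oldPos (σ.above q)
  | _, _, here _ _, q => nomatch q
  | _, _, left _ _, none => rfl
  | _, _, left ρ _, some (.inl q) =>
    (congrArg posL (above_old ρ q)).trans (oldPos_left ρ _).1.symm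
  | _, _, left ρ _, some (.inr _) => ((oldPos_left ρ none).2 _).symm
  | _, _, right _ _, none => rfl
  | _, _, right _ ρ, some (.inl _) => ((oldPos_right ρ none).2 _).symm
  | _, _, right _ ρ, some (.inr q) =>
    (congrArg posR (above_old ρ q)).trans (oldPos_right ρ _).1.symm

theorem under_new : ∀ {σ τ : MergeTree} (ρ : Refine σ τ) (b), τ.under (some (ρ.new, b)) = none
  | _, _, here _ _, b => by cases b <;> rfl
  | _, _, left ρ _, b => under_posL_eq_none.2 (under_new ρ b)
  | _, _, right _ ρ, b => under_posR_eq_none.2 (under_new ρ b)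

theorem under_oldPos (ρ : Refine σ τ) {p : σ.Pos} (h : σ.under p = none) :
    τ.under (ρ.oldPos p) = none ∨ τ.above ρ.new = ρ.oldPos p := by
  rcases under_cases (ρ.oldPos p) with hp | ⟨q, hq⟩
  · exact .inl hp
  · rcases ρ.eq_old_or_new q with ⟨q, rfl⟩ | rfl
    · rw [above_old] at hq
      exact absurd (ρ.oldPos_injective hq) (above_ne h q)
    · exact .inr hq

theorem idx_lt : ∀ {σ τ : MergeTree} (ρ : Refine σ τ), ρ.idx < σ.leaves.length
  | _, _, here _ _ => Nat.one_pos
  | _, _, left ρ _ => by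
    rw [length_node]
    exact Nat.lt_add_right _ (idx_lt ρ)
  | _, _, right _ ρ => by
    rw [length_node]
    exact Nat.add_lt_add_left (idx_lt ρ) _

theorem length_leaves : ∀ {σ τ : MergeTree} (_ : Refine σ τ),
    τ.leaves.length = σ.leaves.length + 1
  | _, _, here _ _ => rfl
  | _, _, left ρ _ => by
    rw [length_node, length_node, length_leaves ρ]; omega
  | _, _, right _ ρ => by
    rw [length_node, length_node, length_leaves ρ]; omega

theorem size_eq : ∀ {σ τ : MergeTree} (_ : Refine σ τ), τ.size = σ.size
  | _, _, here _ _ => rfl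
  | _, _, left ρ _ => by rw [size, size, size_eq ρ]
  | _, _, right _ ρ => by rw [size, size, size_eq ρ]

theorem lo_new : ∀ {σ τ : MergeTree} (ρ : Refine σ τ), τ.lo (some (ρ.new, false)) = ρ.idx
  | _, _, here _ _ => rfl
  | _, _, left ρ _ => (lo_posL _).trans (lo_new ρ)
  | _, _, right _ ρ => (lo_posR _).trans (congrArg _ (lo_new ρ))

theorem over_new (ρ : Refine σ τ) (t : ℕ) (b : Bool) :
    τ.Over t (some (ρ.new, b)) ↔ t = ρ.idx + b.toNat := by
  rw [over_leaf (ρ.under_new b)]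
  cases b
  · rw [lo_new]; rfl
  · rw [← (τ.span_above ρ.new).2.1, τ.hi_of_under _ (ρ.under_new false), lo_new]; rfl

/-- The numbering of the leaves before the refinement. -/
def collapse (ρ : Refine σ τ) (t : ℕ) : ℕ := if t ≤ ρ.idx then t else t - 1

theorem over_oldPos : ∀ {σ τ : MergeTree} (ρ : Refine σ τ) (t : ℕ) (p : σ.Pos),
    τ.Over t (ρ.oldPos p) ↔ σ.Over (ρ.collapse t) p
  | _, _, here _ _, t, none => by
    change _ ↔ Over _ (if t ≤ 0 then t else t - 1) _
    simp only [oldPos, over_none, leaves, List.cons_append, List.nil_append, List.length_cons,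
      List.length_nil]
    split_ifs <;> omega
  | _, _, here _ _, _, some (q, _) => nomatch q
  | _, _, left (l := l) (l' := l') ρ r, t, p => by
    have hl := length_leaves ρ
    have hi := idx_lt ρ
    have hc : (left ρ r).collapse t = ρ.collapse t := rfl
    rw [hc]
    induction p using MergeTree.pos_cases with
    | h =>
      simp only [oldPos, over_none, length_node, collapse]
      split_ifs <;> omega
    | hl p => rw [(oldPos_left ρ p).1, over_posL, over_posL, over_oldPos ρ]
    | hr p =>
      rw [(oldPos_left ρ none).2, over_posR, over_posR, collapse]
      split_ifs
      · exact iff_of_false (by omega) (by omega)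
      · rw [show t - 1 - l.leaves.length = t - l'.leaves.length by omega]
        exact and_congr_left fun _ => by omega
  | _, _, right (r := r) (r' := r') l ρ, t, p => by
    have hl := length_leaves ρ
    have hi := idx_lt ρ
    have hc : (right l ρ).collapse t = if t ≤ l.leaves.length + ρ.idx then t else t - 1 := rfl
    rw [hc]
    induction p using MergeTree.pos_cases with
    | h =>
      simp only [oldPos, over_none, length_node]
      split_ifs <;> omega
    | hl p =>
      rw [(oldPos_right ρ none).2, over_posL, over_posL]
      split_ifs
      · rfl
      · have := l.hi_le p
        unfold Over
        omega
    | hr p =>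
      rw [(oldPos_right ρ p).1, over_posR, over_posR, over_oldPos ρ, collapse]
      split_ifs
      · rfl
      · omega
      · omega
      · rw [show t - l.leaves.length - 1 = t - 1 - l.leaves.length by omega]
        exact and_congr_left fun _ => by omega

theorem wt_oldPos : ∀ {σ τ : MergeTree} (ρ : Refine σ τ) (p : σ.Pos),
    τ.wt (ρ.oldPos p) = σ.wt p
  | _, _, here _ _, none => rfl
  | _, _, here _ _, some (q, _) => nomatch q
  | _, _, left ρ r, p => by
    induction p using MergeTree.pos_cases with
    | h => exact (size_eq (left ρ r))
    | hl p => rw [(oldPos_left ρ p).1, wt_posL, wt_posL, wt_oldPos ρ]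
    | hr p => rw [(oldPos_left ρ none).2, wt_posR, wt_posR]
  | _, _, right l ρ, p => by
    induction p using MergeTree.pos_cases with
    | h => exact (size_eq (right l ρ))
    | hl p => rw [(oldPos_right ρ none).2, wt_posL, wt_posL]
    | hr p => rw [(oldPos_right ρ p).1, wt_posR, wt_posR, wt_oldPos ρ]

/-- The labelling of the leaves before the refinement. -/
def lab (ρ : Refine σ τ) (ν : τ.Lab N) : σ.Lab N :=
  ⟨fun i => ρ.collapse (ν.1 i), fun p => by
    simp only [← ρ.over_oldPos, ← ρ.wt_oldPos]
    exact ν.2 _⟩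

theorem lab_set (ρ : Refine σ τ) (ν : τ.Lab N) (p : σ.Pos) :
    (ρ.lab ν).set p = ν.set (ρ.oldPos p) := by
  ext i
  rw [Lab.mem_set, Lab.mem_set, over_oldPos]
  rfl

variable (ρ : Refine σ τ)

section Next

theorem opening_top_old (q : σ.Inner) (b : Bool) :
    ρ.opening.next (.top (some (ρ.old q, b), true)) = .thin (.inl (q, true)) b := by
  simp [opening, back_old]

theorem opening_top_new (b : Bool) :
    ρ.opening.next (.top (some (ρ.new, b), true)) = .thin (.inr ()) b := by
  simp [opening, back_new]

theorem opening_top_leaf {p : τ.Pos} (h : τ.under p = none) :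
    ρ.opening.next (.top (p, false)) = .top (p, true) := by
  rcases p with _ | ⟨q, b⟩ <;> simp [opening, h]

theorem opening_top_above_old (q : σ.Inner) :
    ρ.opening.next (.top (ρ.oldPos (σ.above q), false)) = .thick (.inl (q, false)) := by
  rw [← above_old]
  have h := τ.under_above (ρ.old q)
  generalize τ.above (ρ.old q) = p at *
  rcases p with _ | ⟨q, b⟩ <;> simp [opening, h, back_old]

theorem opening_top_above_new :
    ρ.opening.next (.top (τ.above ρ.new, false)) = .thick (.inr ()) := by
  have h := τ.under_above ρ.new
  generalize τ.above ρ.new = p at *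
  rcases p with _ | ⟨q, b⟩ <;> simp [opening, h, back_new]

theorem opening_bot_leaf {p : σ.Pos} (h : σ.under p = none) :
    ρ.opening.next (.bot (p, true)) = .bot (p, false) := by
  rcases p with _ | ⟨q, b⟩ <;> simp [opening, h]

theorem opening_bot_above (q : σ.Inner) :
    ρ.opening.next (.bot (σ.above q, true)) = .thick (.inl (q, true)) := by
  have h := σ.under_above q
  generalize σ.above q = p at *
  rcases p with _ | ⟨q, b⟩ <;> simp [opening, h]

theorem opening_thick_true (q : σ.Inner) :
    ρ.opening.next (.thick (.inl (q, true))) = .top (ρ.oldPos (σ.above q), true) :=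
  congrArg (fun p => Side.top (p, true)) (ρ.above_old q)

end Next

theorem opening_surjective : ρ.opening.next.Surjective := by
  rintro (⟨_, _ | _⟩ | ⟨⟨q, _ | _⟩ | _, b⟩ | (⟨q, _ | _⟩ | _) | ⟨p, _ | _⟩ | ⟨p, _ | _⟩)
  · exact ⟨.bot (none, false), rfl⟩
  · exact ⟨.top (none, true), rfl⟩
  · exact ⟨.bot (some (q, b), false), rfl⟩
  · exact ⟨_, ρ.opening_top_old q b⟩
  · exact ⟨_, ρ.opening_top_new b⟩
  · exact ⟨_, ρ.opening_top_above_old q⟩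
  · exact ⟨_, ρ.opening_bot_above q⟩
  · exact ⟨_, ρ.opening_top_above_new⟩
  · rcases under_cases p with h | ⟨q, rfl⟩
    exacts [⟨_, ρ.opening_bot_leaf h⟩, ⟨.thick (.inl (q, false)), rfl⟩]
  · rcases p with _ | ⟨q, b⟩
    exacts [⟨.reg () true, rfl⟩, ⟨.thin (.inl (q, true)) b, rfl⟩]
  · rcases ρ.pos_cases p with ⟨_ | ⟨q, b⟩, rfl⟩ | ⟨b, rfl⟩
    exacts [⟨.reg () false, rfl⟩, ⟨.thin (.inl (q, false)) b, rfl⟩, ⟨.thin (.inr ()) b, rfl⟩]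
  · rcases under_cases p with h | ⟨q, rfl⟩
    · exact ⟨_, ρ.opening_top_leaf h⟩
    · rcases ρ.eq_old_or_new q with ⟨q, rfl⟩ | rfl
      exacts [⟨.thick (.inl (q, true)), rfl⟩, ⟨.thick (.inr ()), rfl⟩]

/-- The position of a side of the opening foam. -/
def openPos : ρ.opening.Sd → τ.Pos
  | .reg _ _ => none
  | .thin (.inl (q, _)) b => some (ρ.old q, b)
  | .thin (.inr _) b => some (ρ.new, b)
  | .thick (.inl (q, _)) => ρ.oldPos (σ.above q)
  | .thick (.inr _) => τ.above ρ.new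
  | .bot e => ρ.oldPos e.1
  | .top e => e.1

/-- The half of the foam to which a side belongs. -/
def openHalf : ρ.opening.Sd → Bool
  | .reg _ b => b
  | .thin (.inl (_, u)) _ => u
  | .thin (.inr _) _ => true
  | .thick (.inl (_, u)) => u
  | .thick (.inr _) => true
  | .bot e => e.2
  | .top e => e.2

/-- The edges where both halves of the opening foam belong to the same polygon. -/
def Joined (p : τ.Pos) : Prop := τ.under p = none ∨ p = τ.above ρ.new

theorem joined_oldPos {p : σ.Pos} (h : σ.under p = none) : ρ.Joined (ρ.oldPos p) :=
  (ρ.under_oldPos h).imp_right Eq.symm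

theorem opening_next (d : ρ.opening.Sd) : ρ.openPos (ρ.opening.next d) = ρ.openPos d ∧
    (ρ.openHalf (ρ.opening.next d) = ρ.openHalf d ∨ ρ.Joined (ρ.openPos d)) := by
  rcases d with ⟨_, _ | _⟩ | ⟨⟨q, _ | _⟩ | _, b⟩ | (⟨q, _ | _⟩ | _) | ⟨p, _ | _⟩ | ⟨p, _ | _⟩
  · exact ⟨rfl, .inl rfl⟩
  · exact ⟨rfl, .inl rfl⟩
  · exact ⟨rfl, .inl rfl⟩
  · exact ⟨rfl, .inl rfl⟩
  · exact ⟨rfl, .inr (.inl (ρ.under_new b))⟩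
  · exact ⟨rfl, .inl rfl⟩
  · rw [opening_thick_true]
    exact ⟨rfl, .inl rfl⟩
  · exact ⟨rfl, .inl rfl⟩
  · rcases p with _ | ⟨q, b⟩ <;> exact ⟨rfl, .inl rfl⟩
  · rcases under_cases p with h | ⟨q, rfl⟩
    · rw [opening_bot_leaf ρ h]
      exact ⟨rfl, .inr (ρ.joined_oldPos h)⟩
    · rw [opening_bot_above]
      exact ⟨rfl, .inl rfl⟩
  · rcases under_cases p with h | ⟨q, rfl⟩
    · rw [opening_top_leaf ρ h]
      exact ⟨rfl, .inr (.inl h)⟩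
    · rcases ρ.eq_old_or_new q with ⟨q, rfl⟩ | rfl
      · rw [above_old, opening_top_above_old]
        exact ⟨rfl, .inl rfl⟩
      · rw [opening_top_above_new]
        exact ⟨rfl, .inr (.inr rfl)⟩
  · rcases ρ.pos_cases p with ⟨_ | ⟨q, b⟩, rfl⟩ | ⟨b, rfl⟩
    · exact ⟨rfl, .inl rfl⟩
    · rw [oldPos, opening_top_old]
      exact ⟨rfl, .inl rfl⟩
    · rw [opening_top_new]
      exact ⟨rfl, .inl rfl⟩

/-- The opening foam is built from copies of the tree. -/
def openShape : ρ.opening.Shape τ where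
  pos := ρ.openPos
  node := Sum.elim (fun s => ρ.old s.1) fun _ => ρ.new
  next := fun d => (ρ.opening_next d).1
  reg := fun _ => rfl
  thin := by rintro (s | s) b <;> rfl
  thick := by
    rintro (s | s)
    · exact (ρ.above_old s.1).symm
    · rfl
  wt := by
    rintro (_ | ⟨⟨q, u⟩ | s, b⟩ | (⟨q, u⟩ | s) | _ | _)
    · exact (ρ.size_eq).symm.trans (wt_none τ).symm
    · exact (ρ.wt_oldPos (some (q, b))).symm
    · rfl
    · exact (ρ.wt_oldPos _).symm
    · rfl
    · exact (ρ.wt_oldPos _).symm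
    · rfl

theorem opening_isFoam (hpos : τ.Positive) (hN : τ.size ≤ N) :
    ρ.opening.IsFoam N where
  bij :=
    have : Finite ρ.opening.R := ρ.opening.finR
    have : Finite ρ.opening.S := ρ.opening.finS
    ⟨Finite.injective_iff_surjective.2 ρ.opening_surjective, ρ.opening_surjective⟩
  wt_pos := fun d => (isFoam_of_shape_wt ρ.openShape hpos hN d).1
  wt_le := fun d => (isFoam_of_shape_wt ρ.openShape hpos hN d).2
  wt_next := fun d => by rw [ρ.openShape.wt, ρ.openShape.wt, ρ.openShape.next]
  wt_reg := fun r => rfl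
  wt_seam := by
    rintro (s | s)
    exacts [σ.wt_above s.1, τ.wt_above _]
  wt_bot := fun e => rfl
  wt_top := fun e => rfl
  seam_end := by
    rintro (⟨q, _ | _⟩ | _)
    · exact .inr (.inr (.inl ⟨_, _, _, ⟨ρ.old q, rfl, rfl, rfl⟩, .of_next rfl, .of_next rfl,
        .of_next (by rw [above_old]; exact ρ.opening_top_above_old q)⟩))
    · exact .inr (.inr (.inr ⟨_, _, _, ⟨q, rfl, rfl, rfl⟩, .of_next rfl, .of_next rfl,
        .of_next (ρ.opening_bot_above q)⟩))
    · exact .inr (.inr (.inl ⟨_, _, _, ⟨ρ.new, rfl, rfl, rfl⟩, .of_next rfl, .of_next rfl,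
        .of_next ρ.opening_top_above_new⟩))
  seam_start := by
    rintro (⟨q, _ | _⟩ | _)
    · exact .inr (.inr (.inr ⟨_, _, _, ⟨q, rfl, rfl, rfl⟩, .of_next rfl, .of_next rfl,
        .of_next rfl⟩))
    · exact .inr (.inr (.inl ⟨_, _, _, ⟨ρ.old q, rfl, rfl, rfl⟩, .of_next (ρ.opening_top_old q _),
        .of_next (ρ.opening_top_old q _), .of_next rfl⟩))
    · exact .inr (.inr (.inl ⟨_, _, _, ⟨ρ.new, rfl, rfl, rfl⟩, .of_next (ρ.opening_top_new _),
        .of_next (ρ.opening_top_new _), .of_next rfl⟩))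
  top_pass := by
    rintro _ _ (⟨p, h, rfl, rfl⟩ | ⟨rfl, rfl⟩)
    exacts [.of_next (ρ.opening_top_leaf h), ⟨.reg () false, .single ⟨(), true, rfl, rfl⟩, rfl⟩]
  top_merge := by
    rintro _ _ _ ⟨q, rfl, rfl, rfl⟩
    rcases ρ.eq_old_or_new q with ⟨q, rfl⟩ | rfl
    · exact ⟨.inl (q, true), .of_next (ρ.opening_top_old q _),
        .of_next (ρ.opening_top_old q _), .of_next rfl⟩
    · exact ⟨.inr (), .of_next (ρ.opening_top_new _), .of_next (ρ.opening_top_new _), .of_next rfl⟩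
  top_split := by
    rintro _ _ _ ⟨q, rfl, rfl, rfl⟩
    rcases ρ.eq_old_or_new q with ⟨q, rfl⟩ | rfl
    · exact ⟨.inl (q, false), .of_next rfl, .of_next rfl,
        .of_next (by rw [above_old]; exact ρ.opening_top_above_old q)⟩
    · exact ⟨.inr (), .of_next rfl, .of_next rfl, .of_next ρ.opening_top_above_new⟩
  bot_pass := by
    rintro _ _ (⟨p, h, rfl, rfl⟩ | ⟨rfl, rfl⟩)
    exacts [.of_next (ρ.opening_bot_leaf h), ⟨.reg () true, .single ⟨(), false, rfl, rfl⟩, rfl⟩]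
  bot_merge := by
    rintro _ _ _ ⟨q, rfl, rfl, rfl⟩
    exact ⟨.inl (q, true), .of_next rfl, .of_next rfl, .of_next (ρ.opening_bot_above q)⟩
  bot_split := by
    rintro _ _ _ ⟨q, rfl, rfl, rfl⟩
    exact ⟨.inl (q, false), .of_next rfl, .of_next rfl, .of_next rfl⟩

open Classical in
/-- The polygon of a side of the opening foam. -/
def openFace (d : ρ.opening.Sd) : τ.Pos × Bool :=
  (ρ.openPos d, if ρ.Joined (ρ.openPos d) then true else ρ.openHalf d)

theorem opening_face_bot (p : σ.Pos) (u : Bool) :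
    ρ.opening.face (.bot (p, u)) = ρ.opening.face (.top (ρ.oldPos p, u)) := by
  rcases p with _ | ⟨q, b⟩ <;> cases u
  exacts [(face_eq_next rfl).trans (face_eq_next rfl),
    ((face_eq_next (F := ρ.opening) (d := .top (none, true)) rfl).trans (face_eq_next rfl)).symm,
    (face_eq_next rfl).trans (face_eq_next rfl),
    ((face_eq_next (ρ.opening_top_old q b)).trans (face_eq_next rfl)).symm]

theorem opening_face_top (d : ρ.opening.Sd) :
    ρ.opening.face d = ρ.opening.face (.top (ρ.openPos d, ρ.openHalf d)) ∨
      ρ.Joined (ρ.openPos d) ∧ ρ.opening.face d = ρ.opening.face (.top (ρ.openPos d, false)) := by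
  rcases d with ⟨_, _ | _⟩ | ⟨⟨q, _ | _⟩ | _, b⟩ | (⟨q, _ | _⟩ | _) | ⟨p, u⟩ | ⟨p, u⟩
  exacts [.inl (face_eq_next rfl), .inl ((face_eq_next rfl).trans (ρ.opening_face_bot none true)),
    .inl (face_eq_next rfl),
    .inl ((face_eq_next rfl).trans (ρ.opening_face_bot (some (q, b)) true)),
    .inr ⟨.inl (ρ.under_new b), face_eq_next rfl⟩,
    .inl ((face_eq_next rfl).trans (ρ.opening_face_bot _ false)),
    .inl (face_eq_next (ρ.opening_thick_true q)), .inl (face_eq_next rfl),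
    .inl (ρ.opening_face_bot p u), .inl rfl]

theorem opening_face (d : ρ.opening.Sd) :
    ρ.opening.face d = ρ.opening.face (.top (ρ.openFace d)) := by
  have h : ∀ p, ρ.Joined p →
      ρ.opening.face (.top (p, false)) = ρ.opening.face (.top (p, true)) := by
    rintro p (h | rfl)
    exacts [face_eq_next (ρ.opening_top_leaf h),
      (face_eq_next ρ.opening_top_above_new).trans (face_eq_next rfl)]
  unfold openFace
  split_ifs with hj
  · rcases ρ.opening_face_top d with hd | ⟨-, hd⟩
    · rw [hd]
      cases ρ.openHalf d
      exacts [h _ hj, rfl]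
    · rw [hd, h _ hj]
  · exact (ρ.opening_face_top d).resolve_right fun h => hj h.1

theorem opening_faces : Shape.Faces ρ.openFace where
  next := fun d => by
    have := ρ.opening_next d
    unfold openFace
    rw [this.1]
    split_ifs with h
    · rfl
    · rw [this.2.resolve_right h]
  face_eq := fun d d' h => by rw [opening_face, opening_face ρ d', h]

theorem opening_coloring_eq {κ : Coloring N ρ.opening} {ν : τ.Lab N}
    (h : ∀ e, κ.c (.top e) = ν.set e.1) : κ = ρ.openShape.coloring ν :=
  Coloring.ext_c fun d => (κ.face_eq (ρ.opening_face d)).trans (h _)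

/-- The inner nodes after the refinement. -/
def innerEquiv : Option σ.Inner ≃ τ.Inner :=
  Equiv.ofBijective (fun o => o.elim ρ.new ρ.old) ⟨by
    rintro (_ | q) (_ | q') h
    · rfl
    · exact absurd h.symm (ρ.old_ne_new q')
    · exact absurd h (ρ.old_ne_new q)
    · exact congrArg some (ρ.old_injective h), fun q => by
    rcases ρ.eq_old_or_new q with ⟨q, rfl⟩ | rfl
    exacts [⟨some q, rfl⟩, ⟨none, rfl⟩]⟩

open Classical in
theorem ncard_inner (P : τ.Inner → Prop) :
    {q | P q}.ncard = {q | P (ρ.old q)}.ncard + if P ρ.new then 1 else 0 := by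
  rw [← Set.ncard_image_of_injective _ ρ.innerEquiv.symm.injective, ncard_option, add_comm]
  congr 1
  · congr 1
    ext q
    simp only [Set.mem_preimage, Set.mem_image, Set.mem_ofPred_eq]
    constructor
    · rintro ⟨q', h, h'⟩
      rwa [(Equiv.symm_apply_eq _).1 h'] at h
    · exact fun h => ⟨_, h, (Equiv.symm_apply_eq _).2 rfl⟩
  · have hn : none ∈ ρ.innerEquiv.symm '' {q | P q} ↔ P ρ.new := by
      constructor
      · rintro ⟨q', h, h'⟩
        rwa [(Equiv.symm_apply_eq _).1 h'] at h
      · exact fun h => ⟨_, h, (Equiv.symm_apply_eq _).2 rfl⟩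
    rw [ncard_none (P := (· ∈ ρ.innerEquiv.symm '' {q | P q}))
      (Q := fun _ : Option Unit => P ρ.new) hn]
    split_ifs with h <;> simp [h]

open Classical in
theorem opening_chi (hpos : τ.Positive) (hN : τ.size = N) (ν : τ.Lab N)
    {p : Finset (Fin N) → Prop} (hp : Additive p) {h : ℤ} (hν : ν.Path p h) :
    (ρ.openShape.coloring ν).chi p =
      (if p (ν.set (some (ρ.new, false))) ∨ p (ν.set (some (ρ.new, true))) then 1 else 0) -
        if p (ν.set (τ.above ρ.new)) then 1 else 0 := by
  have hO := ρ.opening_isFoam hpos hN.le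
  rw [Coloring.chi_of_boundary hO σ.models_web τ.models_web _ ?_ hp]
  · have e1 : (ρ.opening.face '' {d | p ((ρ.openShape.coloring ν).c d)}).ncard =
        {e | p (ν.set e)}.ncard + {e | p (ν.set e) ∧ ¬ ρ.Joined e}.ncard := by
      rw [ρ.opening_faces.ncard]
      have e : ρ.openFace '' {d | p ((ρ.openShape.coloring ν).c d)} =
          {x | p (ν.set x.1) ∧ (x.2 = true ∨ ¬ ρ.Joined x.1)} := by
        ext x
        constructor
        · rintro ⟨d, hd, rfl⟩
          refine ⟨hd, ?_⟩
          unfold openFace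
          split_ifs with hj
          exacts [.inl rfl, .inr hj]
        · rintro ⟨hx, hj⟩
          refine ⟨.top x, hx, ?_⟩
          unfold openFace
          split_ifs with hj'
          · exact Prod.ext rfl (hj.resolve_right (not_not.2 hj')).symm
          · rfl
      rw [e, ncard_prod, Fintype.sum_bool]
      simp
    have e2 : {e | p (ν.set e)}.ncard = {e | p (ν.set e) ∧ ¬ ρ.Joined e}.ncard +
        ({e | τ.under e = none ∧ p (ν.set e)}.ncard +
          if p (ν.set (τ.above ρ.new)) then 1 else 0) := by
      have e3 : (if p (ν.set (τ.above ρ.new)) then 1 else 0) =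
          {e | e = τ.above ρ.new ∧ p (ν.set e)}.ncard := by
        split_ifs with h
        · exact ((Set.ncard_eq_one.2 ⟨τ.above ρ.new, by ext; simp +contextual [h]⟩)).symm
        · exact ((Set.ncard_eq_zero (Set.toFinite _)).2 (by ext; simp +contextual [h])).symm
      rw [e3, ← Set.ncard_union_eq _ (Set.toFinite _) (Set.toFinite _),
        ← Set.ncard_union_eq _ (Set.toFinite _) (Set.toFinite _)]
      · congr 1
        ext e
        simp only [Set.mem_ofPred_eq, Set.mem_union, Joined]
        tauto
      · rw [Set.disjoint_left]
        rintro e he (he' | he')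
        exacts [he.2 (.inl he'.1), he.2 (.inr he'.1)]
      · rw [Set.disjoint_left]
        rintro e he ⟨rfl, -⟩
        exact above_ne he.1 _ rfl
    have e4 : {r : Unit | p ((ρ.openShape.coloring ν).c (.reg r true))}.ncard =
        {e : τ.Pos | e = none ∧ p (ν.set e)}.ncard := by
      rw [ncard_none (P := fun e => p (ν.set e)) (Q := fun _ : Option Empty => p (ν.set none)) Iff.rfl]
      change {r : Unit | p (ν.set none)}.ncard = _
      by_cases h0 : p (ν.set none) <;> simp [h0]
    have e5 : {s : σ.Inner × Bool ⊕ Unit | p ((ρ.openShape.coloring ν).c (.thin s false)) ∨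
        p ((ρ.openShape.coloring ν).c (.thin s true))}.ncard =
        2 * {q | p (ν.set (some (ρ.old q, false))) ∨ p (ν.set (some (ρ.old q, true)))}.ncard +
        if p (ν.set (some (ρ.new, false))) ∨ p (ν.set (some (ρ.new, true))) then 1 else 0 := by
      rw [ncard_sum, two_mul]
      refine congrArg₂ _ ?_ ?_
      · rw [ncard_prod, Fintype.sum_bool]
        rfl
      · change {s : Unit | p (ν.set (some (ρ.new, false))) ∨ p (ν.set (some (ρ.new, true)))}.ncard = _
        split_ifs with h <;> simp [h]
    have e6 := ρ.ncard_inner fun q => p (ν.set (some (q, false))) ∨ p (ν.set (some (q, true)))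
    have h1 := hν.edges
    have h2 := hν.ends
    rw [e6] at h1
    rw [e1]
    erw [e4, e5]
    rw [e2] at h1 ⊢
    push_cast at *
    linear_combination 2 * h1 - h2
  · rintro (⟨_, _ | _⟩ | ⟨⟨q, _ | _⟩ | _, b⟩ | (⟨q, _ | _⟩ | _) | e | e)
    all_goals refine exists_bdVertex hO σ.models_web τ.models_web ?_
    exacts [⟨.inl _, .inr rfl⟩, ⟨.inr _, .inr rfl⟩, ⟨.inl _, .inr rfl⟩, ⟨.inr _, .inr rfl⟩, ⟨.inl _, .inr rfl⟩,
      ⟨.inr _, .inr rfl⟩, ⟨.inl _, .inr rfl⟩, ⟨.inl _, .inr rfl⟩, ⟨.inr _, .inl rfl⟩, ⟨.inl _, .inl rfl⟩]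

theorem exists_opening_chi (hpos : τ.Positive) (hN : τ.size = N) (ν : τ.Lab N)
    {p : Finset (Fin N) → Prop} : IsTest p → ∃ h h', ν.Path p h ∧ (ρ.lab ν).Path p h' ∧
      (ρ.openShape.coloring ν).chi p = h - h' := by
  have hNσ : σ.size = N := ρ.size_eq ▸ hN
  rintro (⟨i, rfl⟩ | ⟨i, j, rfl⟩)
  · refine ⟨_, _, ν.path_mem hN i, Lab.path_mem _ hNσ i, ?_⟩
    rw [ρ.opening_chi hpos hN ν (additive_mem i) (ν.path_mem hN i)]
    simp only [ν.set_above, Finset.mem_union]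
    split_ifs <;> rfl
  · refine ⟨_, _, ν.path_xor hN i j, Lab.path_xor _ hNσ i j, ?_⟩
    rw [ρ.opening_chi hpos hN ν (additive_xor i j) (ν.path_xor hN i j)]
    unfold Lab.sep lab
    simp only [Lab.mem_set, over_above, over_new, collapse, Bool.toNat_true, Bool.toNat_false, Xor]
    split_ifs <;> omega

end Refine
end MergeTree

/-- Two webs which differ by a rotation by 180 degrees. -/
structure Web.Reversal (Γ Γ' : Web) where
  e : Γ.E ≃ Γ'.E
  wt : ∀ a, Γ'.wt (e a) = Γ.wt a
  pass : ∀ a b, Γ'.pass (e a) (e b) ↔ Γ.pass b a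
  merge : ∀ a b c, Γ'.merge (e a) (e b) (e c) ↔ Γ.split c a b
  split : ∀ a b c, Γ'.split (e c) (e a) (e b) ↔ Γ.merge a b c

namespace Foam

variable {Γ₀ Γ₁ Γ₂ Γ₃ : Web} {N : ℕ}

/-- Two foams which differ by a rotation that exchanges the bottom and the top. -/
structure Reversal (F : Foam Γ₀ Γ₁) (F' : Foam Γ₂ Γ₃) where
  bot : Γ₀.Reversal Γ₃
  top : Γ₁.Reversal Γ₂
  side : F.Sd ≃ F'.Sd
  seam : F.S ≃ F'.S
  next : ∀ d, F'.next (side d) = side (F.next d)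
  side_reg : ∀ r b, ∃ r', side (.reg r b) = .reg r' b
  side_reg' : ∀ r b, ∃ r', side.symm (.reg r b) = .reg r' b
  opp : ∀ d d', Side.Opp (side d) (side d') ↔ Side.Opp d d'
  side_thin : ∀ s b, side (.thin s b) = .thin (seam s) b
  side_thick : ∀ s, side (.thick s) = .thick (seam s)
  side_bot : ∀ e, side (.bot e) = .top (bot.e e)
  side_top : ∀ e, side (.top e) = .bot (top.e e)
  wt : ∀ d, F'.wt (side d) = F.wt d
  dot : ∀ d, HEq (F'.dot (side d)) (F.dot d)

namespace Reversal

variable {F : Foam Γ₀ Γ₁} {F' : Foam Γ₂ Γ₃} (φ : F.Reversal F')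

theorem side_reg_not {r : F.R} {b : Bool} {r' : F'.R} (h : φ.side (.reg r b) = .reg r' b) :
    φ.side (.reg r (!b)) = .reg r' (!b) := by
  have := (φ.opp (.reg r b) (.reg r (!b))).2 (.reg r b)
  rw [h, Side.reg_opp_iff] at this
  exact this

theorem arc {x y : F.Sd} (h : F.Arc x y) : F'.Arc (φ.side x) (φ.side y) := by
  obtain ⟨d, h, rfl⟩ := h
  refine ⟨φ.side d, ?_, φ.next d⟩
  refine h.lift φ.side ?_
  rintro d d' ⟨r, b, h, rfl⟩
  obtain ⟨r', hr⟩ := φ.side_reg r b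
  exact ⟨r', b, by rw [φ.next, h, hr], φ.side_reg_not hr⟩

theorem theta {s m : F.S} (h : F.Theta s m) : F'.Theta (φ.seam s) (φ.seam m) := by
  simp only [Theta, ← φ.side_thin, ← φ.side_thick]
  exact ⟨fun b => φ.arc (h.1 b), φ.arc h.2⟩

theorem tetra {b : Bool} {s s' m m' : F.S} (h : F.Tetra b s s' m m') :
    F'.Tetra b (φ.seam s) (φ.seam s') (φ.seam m) (φ.seam m') := by
  simp only [Tetra, ← φ.side_thin, ← φ.side_thick]
  exact ⟨φ.arc h.1, φ.arc h.2.1, φ.arc h.2.2.1, φ.arc h.2.2.2.1, φ.arc h.2.2.2.2.1,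
    φ.arc h.2.2.2.2.2⟩

theorem botSplit {s : F.S} {e₀ e₁ e} (h : F.TopMerge s e₀ e₁ e) :
    F'.BotSplit (φ.seam s) (φ.top.e e) (φ.top.e e₀) (φ.top.e e₁) := by
  simp only [BotSplit, ← φ.side_thin, ← φ.side_thick, ← φ.side_top]
  exact ⟨φ.arc h.1, φ.arc h.2.1, φ.arc h.2.2⟩

theorem botMerge {s : F.S} {e₀ e₁ e} (h : F.TopSplit s e e₀ e₁) :
    F'.BotMerge (φ.seam s) (φ.top.e e₀) (φ.top.e e₁) (φ.top.e e) := by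
  simp only [BotMerge, ← φ.side_thin, ← φ.side_thick, ← φ.side_top]
  exact ⟨φ.arc h.1, φ.arc h.2.1, φ.arc h.2.2⟩

theorem topSplit {s : F.S} {e₀ e₁ e} (h : F.BotMerge s e₀ e₁ e) :
    F'.TopSplit (φ.seam s) (φ.bot.e e) (φ.bot.e e₀) (φ.bot.e e₁) := by
  simp only [TopSplit, ← φ.side_thin, ← φ.side_thick, ← φ.side_bot]
  exact ⟨φ.arc h.1, φ.arc h.2.1, φ.arc h.2.2⟩

theorem topMerge {s : F.S} {e₀ e₁ e} (h : F.BotSplit s e e₀ e₁) :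
    F'.TopMerge (φ.seam s) (φ.bot.e e₀) (φ.bot.e e₁) (φ.bot.e e) := by
  simp only [TopMerge, ← φ.side_thin, ← φ.side_thick, ← φ.side_bot]
  exact ⟨φ.arc h.1, φ.arc h.2.1, φ.arc h.2.2⟩

theorem isFoam (φ : F.Reversal F') (hF : F.IsFoam N) : F'.IsFoam N where
  bij := by
    have : F'.next = φ.side ∘ F.next ∘ φ.side.symm := by
      funext d
      rw [Function.comp_apply, Function.comp_apply, ← φ.next, Equiv.apply_symm_apply]
    rw [this]
    exact φ.side.bijective.comp (hF.bij.comp φ.side.symm.bijective)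
  wt_pos := φ.side.surjective.forall.2 fun d => by rw [φ.wt]; exact hF.wt_pos d
  wt_le := φ.side.surjective.forall.2 fun d => by rw [φ.wt]; exact hF.wt_le d
  wt_next := φ.side.surjective.forall.2 fun d => by rw [φ.next, φ.wt, φ.wt, hF.wt_next]
  wt_reg := fun r => by
    obtain ⟨r', h⟩ := φ.side_reg' r true
    have h := ((Equiv.symm_apply_eq _).1 h).symm
    rw [← h, φ.wt, show Side.reg r false = _ from (φ.side_reg_not h).symm, φ.wt]
    exact hF.wt_reg r'
  wt_seam := φ.seam.surjective.forall.2 fun s => by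
    rw [← φ.side_thin, ← φ.side_thin, ← φ.side_thick, φ.wt, φ.wt, φ.wt, hF.wt_seam]
  wt_bot := φ.top.e.surjective.forall.2 fun e => by
    rw [← φ.side_top, φ.wt, φ.top.wt, hF.wt_top]
  wt_top := φ.bot.e.surjective.forall.2 fun e => by
    rw [← φ.side_bot, φ.wt, φ.bot.wt, hF.wt_bot]
  seam_end := φ.seam.surjective.forall.2 fun s => by
    rcases hF.seam_end s with ⟨m, h⟩ | ⟨b, s', m₁, m₂, h⟩ | ⟨e, e₀, e₁, h, h'⟩ | ⟨e₀, e₁, e, h, h'⟩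
    exacts [.inl ⟨_, φ.theta h⟩, .inr (.inl ⟨b, _, _, _, h.imp φ.tetra φ.tetra⟩),
      .inr (.inr (.inr ⟨_, _, _, (φ.top.merge _ _ _).2 h, φ.botMerge h'⟩)),
      .inr (.inr (.inl ⟨_, _, _, (φ.bot.split _ _ _).2 h, φ.topSplit h'⟩))]
  seam_start := φ.seam.surjective.forall.2 fun s => by
    rcases hF.seam_start s with ⟨m, h⟩ | ⟨b, s', m₁, m₂, h⟩ | ⟨e₀, e₁, e, h, h'⟩ | ⟨e, e₀, e₁, h, h'⟩
    exacts [.inl ⟨_, φ.theta h⟩, .inr (.inl ⟨b, _, _, _, h.imp φ.tetra φ.tetra⟩),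
      .inr (.inr (.inr ⟨_, _, _, (φ.top.split _ _ _).2 h, φ.botSplit h'⟩)),
      .inr (.inr (.inl ⟨_, _, _, (φ.bot.merge _ _ _).2 h, φ.topMerge h'⟩))]
  top_pass := by
    simp only [φ.bot.e.surjective.forall]
    intro e e' h
    rw [← φ.side_bot, ← φ.side_bot]
    exact φ.arc (hF.bot_pass _ _ ((φ.bot.pass _ _).1 h))
  top_merge := by
    simp only [φ.bot.e.surjective.forall]
    intro e₀ e₁ e h
    exact (hF.bot_split _ _ _ ((φ.bot.merge _ _ _).1 h)).imp' _ fun _ => φ.topMerge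
  top_split := by
    simp only [φ.bot.e.surjective.forall]
    intro e e₀ e₁ h
    exact (hF.bot_merge _ _ _ ((φ.bot.split _ _ _).1 h)).imp' _ fun _ => φ.topSplit
  bot_pass := by
    simp only [φ.top.e.surjective.forall]
    intro e e' h
    rw [← φ.side_top, ← φ.side_top]
    exact φ.arc (hF.top_pass _ _ ((φ.top.pass _ _).1 h))
  bot_merge := by
    simp only [φ.top.e.surjective.forall]
    intro e₀ e₁ e h
    exact (hF.top_split _ _ _ ((φ.top.merge _ _ _).1 h)).imp' _ fun _ => φ.botMerge
  bot_split := by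
    simp only [φ.top.e.surjective.forall]
    intro e e₀ e₁ h
    exact (hF.top_merge _ _ _ ((φ.top.split _ _ _).1 h)).imp' _ fun _ => φ.botSplit

/-- The colorings of two foams which differ by a rotation. -/
def coloring : Coloring N F ≃ Coloring N F' where
  toFun κ :=
    { c := fun d => κ.c (φ.side.symm d)
      card := fun d => by rw [κ.card, ← φ.wt, Equiv.apply_symm_apply]
      next := φ.side.surjective.forall.2 fun d => by
        rw [φ.next, Equiv.symm_apply_apply, Equiv.symm_apply_apply, κ.next]
      reg := fun r => by
        obtain ⟨r', h⟩ := φ.side_reg' r true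
        have h' := φ.side_reg_not ((Equiv.symm_apply_eq _).1 h).symm
        rw [h, show Side.reg r false = _ from h'.symm, Equiv.symm_apply_apply]
        exact κ.reg r'
      disj := φ.seam.surjective.forall.2 fun s => by
        rw [← φ.side_thin, ← φ.side_thin, Equiv.symm_apply_apply, Equiv.symm_apply_apply]
        exact κ.disj s
      seam := φ.seam.surjective.forall.2 fun s => by
        rw [← φ.side_thin, ← φ.side_thin, ← φ.side_thick, Equiv.symm_apply_apply,
          Equiv.symm_apply_apply, Equiv.symm_apply_apply, κ.seam] }
  invFun κ :=
    { c := fun d => κ.c (φ.side d)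
      card := fun d => by rw [κ.card, φ.wt]
      next := fun d => by rw [← φ.next, κ.next]
      reg := fun r => by
        obtain ⟨r', h⟩ := φ.side_reg r true
        rw [h, show φ.side (.reg r false) = _ from φ.side_reg_not h]
        exact κ.reg r'
      disj := fun s => by
        rw [φ.side_thin, φ.side_thin]
        exact κ.disj _
      seam := fun s => by rw [φ.side_thin, φ.side_thin, φ.side_thick, κ.seam] }
  left_inv κ := Coloring.ext_c fun d => congrArg κ.c (φ.side.symm_apply_apply d)
  right_inv κ := Coloring.ext_c fun d => congrArg κ.c (φ.side.apply_symm_apply d)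

theorem coloring_side (κ : Coloring N F) (d : F.Sd) : (φ.coloring κ).c (φ.side d) = κ.c d :=
  congrArg κ.c (φ.side.symm_apply_apply d)

theorem sep_iff (κ : Coloring N F) {i j : Fin N} {s : F.S} :
    (φ.coloring κ).Sep i j (φ.seam s) ↔ κ.Sep i j s := by
  unfold Coloring.Sep
  rw [← φ.side_thin, ← φ.side_thin, coloring_side, coloring_side]

theorem ncard_quot {X Y : Type*} {r : X → X → Prop} {r' : Y → Y → Prop} (e : X ≃ Y)
    (h : ∀ x x', r x x' ↔ r' (e x) (e x')) (A : Set X) (B : Set Y) (hA : ∀ x, x ∈ A ↔ e x ∈ B) :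
    (Quot.mk r' '' B).ncard = (Quot.mk r '' A).ncard := by
  rw [← Set.ncard_image_of_injective _ (Quot.congr e h).injective, Set.image_image,
    show B = e '' A from ?_, Set.image_image]
  · rfl
  · ext y
    obtain ⟨x, rfl⟩ := e.surjective y
    rw [e.injective.mem_set_image, hA]

theorem chi_eq (κ : Coloring N F) (p : Finset (Fin N) → Prop) :
    (φ.coloring κ).chi p = κ.chi p := by
  have hA : ∀ d, d ∈ {d | p (κ.c d)} ↔ φ.side d ∈ {d | p ((φ.coloring κ).c d)} := fun d => by
    rw [Set.mem_ofPred_eq, Set.mem_ofPred_eq, coloring_side]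
  unfold Coloring.chi euler
  refine congrArg₂ _ (congrArg₂ _ (congrArg _ ?_) (congrArg _ ?_)) (congrArg _ ?_)
  exacts [ncard_quot φ.side (fun d d' => by rw [φ.next, φ.opp]) _ _ hA,
    ncard_quot φ.side (fun d d' => (φ.opp d d').symm) _ _ hA,
    ncard_quot φ.side (fun d d' => by rw [φ.next, φ.side.injective.eq_iff]) _ _ hA]

theorem vertex_eq_iff {d d' : F.Sd} :
    F'.vertex (φ.side d) = F'.vertex (φ.side d') ↔ F.vertex d = F.vertex d' :=
  (Quot.congr φ.side fun d d' => by rw [φ.next, φ.opp] :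
    F.Vertex ≃ F'.Vertex).injective.eq_iff (a := F.vertex d) (b := F.vertex d')

theorem theta_eq (κ : Coloring N F) (i j : Fin N) : (φ.coloring κ).theta i j = κ.theta i j := by
  refine (Nat.card_congr (Quot.congr (φ.seam.subtypeEquiv fun s => (φ.sep_iff κ).symm) ?_)).symm
  intro s s'
  rw [← φ.vertex_eq_iff, φ.side_thin, φ.side_thick]
  rfl

theorem decor_eq {L : Type*} [Field L] (x : Fin N → L) (κ : Coloring N F) :
    (φ.coloring κ).decor x = κ.decor x := by
  unfold Coloring.decor
  rw [← finprod_comp_equiv φ.side]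
  exact finprod_congr fun d => decoration_congr x (φ.wt d) (φ.dot d) (φ.coloring_side κ d)

end Reversal

/-- Rotation of sides. -/
def rotSide {R S A B A' B' : Type} (f : A → A') (g : B → B') : Side R S A B → Side R S B' A'
  | .reg r b => .reg r b
  | .thin s b => .thin s b
  | .thick s => .thick s
  | .bot e => .top (f e)
  | .top e => .bot (g e)

end Foam

namespace MergeTree

open Foam

variable {σ τ : MergeTree} {N : ℕ}

/-- The rotation of the web of a tree. -/
def flip (τ : MergeTree) : τ.web.E ≃ τ.web.E where
  toFun e := (e.1, !e.2)
  invFun e := (e.1, !e.2)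
  left_inv := by rintro ⟨p, _ | _⟩ <;> rfl
  right_inv := by rintro ⟨p, _ | _⟩ <;> rfl

/-- The web of a tree is symmetric. -/
def webReversal (τ : MergeTree) : τ.web.Reversal τ.web where
  e := τ.flip
  wt _ := rfl
  pass := by
    rintro ⟨p, u⟩ ⟨p', u'⟩
    change (∃ x, _ ∧ (p, !u) = _ ∧ (p', !u') = _) ∨ ((p, !u) = _ ∧ (p', !u') = _) ↔
      (∃ x, _ ∧ (p', u') = _ ∧ (p, u) = _) ∨ ((p', u') = _ ∧ (p, u) = _)
    simp only [Prod.mk.injEq, Bool.not_eq_false', Bool.not_eq_true']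
    refine or_congr (exists_congr fun x => ?_) ?_ <;> tauto
  merge := by
    rintro ⟨p, u⟩ ⟨p', u'⟩ ⟨p'', u''⟩
    change (∃ q, (p, !u) = _ ∧ (p', !u') = _ ∧ (p'', !u'') = _) ↔
      ∃ q, (p'', u'') = _ ∧ (p, u) = _ ∧ (p', u') = _
    simp only [Prod.mk.injEq, Bool.not_eq_true']
    exact exists_congr fun x => by tauto
  split := by
    rintro ⟨p, u⟩ ⟨p', u'⟩ ⟨p'', u''⟩
    change (∃ q, (p'', !u'') = _ ∧ (p, !u) = _ ∧ (p', !u') = _) ↔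
      ∃ q, (p, u) = _ ∧ (p', u') = _ ∧ (p'', u'') = _
    simp only [Prod.mk.injEq, Bool.not_eq_false']
    exact exists_congr fun x => by tauto

/-- The empty web is symmetric. -/
def emptyReversal : Web.empty.Reversal Web.empty where
  e := Equiv.refl _
  wt e := e.elim
  pass e := e.elim
  merge e := e.elim
  split e := e.elim

/-- The dotted unit foam, rotated. -/
def dottedCounit (τ : MergeTree)
    (m : ∀ p, SymPoly (τ.wt p)) : Foam τ.web Web.empty where
  R := Empty
  S := τ.Inner
  finR := inferInstance
  finS := inferInstance
  next := fun d => rotSide id τ.flip ((τ.dottedUnit m).next (rotSide τ.flip id d))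
  wt := fun d => (τ.dottedUnit m).wt (rotSide τ.flip id d)
  dot := fun d => (τ.dottedUnit m).dot (rotSide τ.flip id d)

theorem rotSide_rotSide {R S A B A' B' : Type} {f : A → A'} {g : B → B'} {f' : A' → A}
    {g' : B' → B} (hf : ∀ a, f' (f a) = a) (hg : ∀ b, g' (g b) = b) (d : Side R S A B) :
    rotSide g' f' (rotSide f g d) = d := by
  rcases d with _ | _ | _ | e | e
  exacts [rfl, rfl, rfl, congrArg Side.bot (hf e), congrArg Side.top (hg e)]

theorem opp_rotSide {R S A B A' B' : Type} {f : A → A'} {g : B → B'} {d d' : Side R S A B} :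
    Side.Opp (rotSide f g d) (rotSide f g d') ↔ Side.Opp d d' := by
  constructor
  · intro h
    rcases d with _ | _ | _ | _ | _ <;> rcases d' with _ | _ | _ | _ | _ <;> cases h <;> constructor
  · rintro (_ | _ | _) <;> constructor

/-- The rotation of the dotted unit foam. -/
def counitReversal (τ : MergeTree)
    (m : ∀ p, SymPoly (τ.wt p)) :
    (τ.dottedUnit m).Reversal (τ.dottedCounit m) where
  bot := emptyReversal
  top := τ.webReversal
  side :=
    { toFun := rotSide id τ.flip
      invFun := rotSide τ.flip id
      left_inv := rotSide_rotSide (fun _ => rfl) τ.flip.left_inv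
      right_inv := rotSide_rotSide τ.flip.left_inv fun _ => rfl }
  seam := Equiv.refl _
  next := fun d => congrArg (fun x => rotSide id τ.flip ((τ.dottedUnit m).next x))
    (rotSide_rotSide (fun _ => rfl) τ.flip.left_inv d)
  side_reg := fun r b => ⟨r, rfl⟩
  side_reg' := fun r b => ⟨r, rfl⟩
  opp := fun _ _ => opp_rotSide
  side_thin := fun _ _ => rfl
  side_thick := fun _ => rfl
  side_bot := fun _ => rfl
  side_top := fun _ => rfl
  wt := fun d => congrArg (τ.dottedUnit m).wt (rotSide_rotSide (fun _ => rfl) τ.flip.left_inv d)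
  dot := fun d => by
    have := rotSide_rotSide (f := id) (f' := id) (fun _ => rfl) τ.flip.left_inv d
    exact congr_arg_heq (τ.dottedUnit m).dot this

namespace Refine

variable (ρ : Refine σ τ)

theorem flipSide_flipSide {R S A B : Type} (d : Side R S (A × Bool) (B × Bool)) :
    flipSide (flipSide d) = d := by
  rcases d with _ | _ | _ | ⟨p, _ | _⟩ | ⟨p, _ | _⟩ <;> rfl

theorem flipSide_eq (d : ρ.opening.Sd) : flipSide d = rotSide σ.flip τ.flip d := by
  rcases d with _ | _ | _ | ⟨p, _ | _⟩ | ⟨p, _ | _⟩ <;> rfl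

/-- The closing foam is the rotation of the opening foam. -/
def closingReversal : ρ.opening.Reversal ρ.closing where
  bot := σ.webReversal
  top := τ.webReversal
  side :=
    { toFun := flipSide
      invFun := flipSide
      left_inv := flipSide_flipSide
      right_inv := flipSide_flipSide }
  seam := Equiv.refl _
  next := fun d => congrArg (fun x => flipSide (ρ.opening.next x)) (flipSide_flipSide d)
  side_reg := fun r b => ⟨r, rfl⟩
  side_reg' := fun r b => ⟨r, rfl⟩
  opp := fun d d' => by
    change Side.Opp (flipSide d) (flipSide d') ↔ _
    rw [flipSide_eq, flipSide_eq]
    exact opp_rotSide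
  side_thin := fun _ _ => rfl
  side_thick := fun _ => rfl
  side_bot := fun _ => rfl
  side_top := fun _ => rfl
  wt := fun d => congrArg ρ.opening.wt (flipSide_flipSide d)
  dot := fun d => congr_arg_heq ρ.opening.dot (flipSide_flipSide d)

end Refine
end MergeTree

namespace Foam

variable {Γ₀ Γ₁ Γ₂ Γ₃ Γ₄ Γ₅ Γ Γ' : Web} {N : ℕ} {i j : Fin N}

namespace Pasting

theorem theta_of_not_sep {F : Foam Γ₀ Γ₁} {G : Foam Γ₂ Γ₃} {H : Foam Γ₄ Γ₅} {P : Pasting F G H}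
    {M : VertexModel P.E} (hP : P.Along M) (κ : Coloring N H)
    (h : ∀ s, ¬ (P.right κ).Sep i j s) : κ.theta i j = (P.left κ).theta i j := by
  have h' := thetaFree_add hP κ (i := i) (j := j) (TF := fun _ => False) (TG := fun _ => False)
    (fun _ _ _ _ hs => absurd hs (h _)) (fun _ _ _ _ hs => absurd hs (h _))
  rw [κ.theta_eq_thetaFree (T := fun s => Sum.elim (fun _ => False) (fun _ => False) (P.seam.symm s)),
    h', (P.left κ).theta_eq_thetaFree (fun _ _ => id), (P.right κ).thetaFree_eq_zero fun s hs =>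
      absurd hs (h s), add_zero]
  intro s _
  rcases P.seam.symm s with s | s <;> exact id

theorem class_sum_iff {F : Foam Γ₀ Γ₁} {G : Foam Γ₂ Γ₃} {H : Foam Γ₄ Γ₅} {P : Pasting F G H}
    {M : VertexModel P.E} (hP : P.Along M) [IsEmpty M.V] (κ : Coloring N H)
    {s₀ : {s // (P.left κ).Sep i j s}} {s₁ : {s // (P.right κ).Sep i j s}} {s s' : H.S}
    (hs : κ.Sep i j s) (hs' : κ.Sep i j s') (hv : H.vertex (.thin s false) = H.vertex (.thick s')) :
    Sum.elim ((P.left κ).Class s₀) ((P.right κ).Class s₁) (P.seam.symm s) ↔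
      Sum.elim ((P.left κ).Class s₀) ((P.right κ).Class s₁) (P.seam.symm s') := by
  obtain ⟨s | s, rfl⟩ := P.seam.surjective s <;> obtain ⟨s' | s', rfl⟩ := P.seam.surjective s' <;>
    simp only [Equiv.symm_apply_apply, Sum.elim_inl, Sum.elim_inr] <;>
    simp only [sep_inl, sep_inr] at hs hs' <;>
    simp only [vertex_thin_inl, vertex_thin_inr, vertex_thick_inl, vertex_thick_inr] at hv
  · exact Coloring.class_iff hs hs' (vertexL_injective hP hv)
  · obtain ⟨w, -⟩ := (vertexL_eq_vertexR hP _ _).1 hv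
    exact isEmptyElim w
  · obtain ⟨w, -⟩ := (vertexL_eq_vertexR hP _ _).1 hv.symm
    exact isEmptyElim w
  · exact Coloring.class_iff hs hs' (vertexR_injective hP hv)

end Pasting

theorem theta_union {F : Foam Web.empty Γ} {G : Foam Web.empty Γ'} (hF : F.IsFoam N)
    (hG : G.IsFoam N) (κ : Coloring N (F.union G)) : κ.theta i j =
      ((unionP F G).left κ).theta i j + ((unionP F G).right κ).theta i j :=
  Pasting.theta_of_noArc (along_union hF hG) κ fun _ w => (w : Empty).elim

theorem bdVertex_union_inl {F : Foam Web.empty Γ} {G : Foam Web.empty Γ'} {M : VertexModel Γ.E}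
    {M' : VertexModel Γ'.E} (w : M.V) : (F.union G).bdVertex (M.sum M') .top (.inl w) =
      (unionP F G).vertexL (F.bdVertex M .top w) := by
  unfold bdVertex
  rw [show (M.sum M').kind (.inl w) = (M.kind w).map .inl from rfl]
  cases M.kind w <;> rfl

theorem bdVertex_union_inr {F : Foam Web.empty Γ} {G : Foam Web.empty Γ'} {M : VertexModel Γ.E}
    {M' : VertexModel Γ'.E} (w : M'.V) : (F.union G).bdVertex (M.sum M') .top (.inr w) =
      (unionP F G).vertexR (G.bdVertex M' .top w) := by
  unfold bdVertex
  rw [show (M.sum M').kind (.inr w) = (M'.kind w).map .inr from rfl]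
  cases M'.kind w <;> rfl

section Tree

variable {τ : MergeTree} {ν : τ.Lab N}

theorem theta_of_extend {F : Foam Web.empty τ.web} {G : Foam τ.web Γ₂} (hF : F.IsFoam N)
    (hG : G.IsFoam N) (κ : Coloring N (F.glue G))
    (hν : ∀ e, ((gluing F G).left κ).c (.top e) = ν.set e.1) {q : τ.Inner}
    (hi : i ∈ ν.set (some (q, false))) (hj : j ∈ ν.set (some (q, true))) {s₁ t₁ : G.S}
    (h₁ : G.BotMerge s₁ (some (q, false), true) (some (q, true), true) (τ.above q, true))
    (h₂ : G.BotSplit t₁ (τ.above q, false) (some (q, false), false) (some (q, true), false))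
    (hsep : ∀ s, ((gluing F G).right κ).Sep i j s → s = s₁ ∨ s = t₁) :
    κ.theta i j = ((gluing F G).left κ).theta i j := by
  have hP := along_glue hF hG τ.models_web
  have hν' : ∀ e, ((gluing F G).right κ).c (.bot e) = ν.set e.1 := fun e =>
    ((gluing F G).compat κ e).symm.trans (hν e)
  obtain ⟨s₀, t₀, ha⟩ := bdArc_top hF hν hi hj
  have hB := hG.isBoundary_bot τ.models_web
  have hs₁ : ((gluing F G).right κ).Sep i j s₁ :=
    ⟨by rw [← Coloring.arc _ h₁.1, hν']; exact hi, by rw [← Coloring.arc _ h₁.2.1, hν']; exact hj⟩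
  have ht₁ : ((gluing F G).right κ).Sep i j t₁ :=
    ⟨by rw [Coloring.arc _ h₂.1, hν']; exact hi, by rw [Coloring.arc _ h₂.2.1, hν']; exact hj⟩
  have c0 := (gluing F G).mk_inl_eq κ ha.conn
  have c1 := Pasting.mk_inr_eq_inl hP κ (s := ⟨s₀, ha.sep₀⟩) (s' := ⟨s₁, hs₁⟩)
    (hB.vertex_thin hG.bij h₁.1 false) ha.start
  have c2 := Pasting.mk_inl_eq_inr hP κ (s := ⟨t₀, ha.sep₁⟩) (s' := ⟨t₁, ht₁⟩)
    ha.fin (hB.vertex_thick h₂.1)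
  rw [Pasting.theta_of_connected hP κ
    (TF := ((gluing F G).left κ).Class ⟨s₀, ha.sep₀⟩) (TG := fun _ => True)
    (((gluing F G).sep_inl κ).2 ha.sep₀) (by simpa using ⟨ha.sep₀, rfl⟩)
    (fun _ _ h h' hv => Coloring.class_iff h h' hv) (fun _ _ _ _ _ => Iff.rfl)
    (fun s w => ha.mem_class) (fun _ _ _ _ => trivial) ?_ ?_, Coloring.theta_eq_class _ ⟨s₀, ha.sep₀⟩,
    ((gluing F G).right κ).thetaFree_eq_zero fun _ _ => trivial, add_zero]
  · rintro s hs ⟨hs', h⟩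
    exact (gluing F G).mk_inl_eq κ h
  · intro s hs _
    rcases hsep s (((gluing F G).sep_inr κ).1 hs) with rfl | rfl
    exacts [c1, (c0.trans c2).symm]

open MergeTree in
theorem theta_glue_mul {F F' : Foam Web.empty τ.web} (hF : F.IsFoam N) (hF' : F'.IsFoam N)
    (hpos : τ.Positive) (hN : τ.size = N) (κ : Coloring N ((F.union F').glue τ.mul))
    (hν : ∀ e, ((gluing (F.union F') τ.mul).right κ).c (.top e) = ν.set e.1) (i j : Fin N) :
    (κ.theta i j : ℤ) =
      ((unionP F F').left ((gluing (F.union F') τ.mul).left κ)).theta i j +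
      ((unionP F F').right ((gluing (F.union F') τ.mul).left κ)).theta i j -
      if ν.1 i < ν.1 j then 1 else 0 := by
  have hU := hF.union hF'
  have hM := τ.mul_isFoam hpos hN.le
  have hP := along_glue hU hM (τ.models_web.sum τ.models_web)
  have hPU := along_union hF hF'
  have hκ := mul_coloring_eq hν
  set P := gluing (F.union F') τ.mul
  set Q := unionP F F'
  have hb : ∀ e, (P.left κ).c (.top e) = ν.set (Sum.elim Prod.fst Prod.fst e) := fun e => by
    rw [show (P.left κ).c (.top e) = (P.right κ).c (.bot e) from P.compat κ e, hκ]
    rcases e with e | e <;> rfl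
  split_ifs with h
  · obtain ⟨q, hi, hj⟩ := ν.exists_sep hN h
    obtain ⟨s₀, t₀, ha⟩ := bdArc_top hF (κ := Q.left (P.left κ)) (fun e => hb (.inl e)) hi hj
    obtain ⟨s₁, t₁, ha'⟩ := bdArc_top hF' (κ := Q.right (P.left κ)) (fun e => hb (.inr e)) hi hj
    have hB := hM.isBoundary_bot (τ.models_web.sum τ.models_web)
    have hsep : ∀ s : τ.Inner × Option Bool, (P.right κ).Sep i j s ↔ s.1 = q := fun s => by
      rw [hκ]
      refine (τ.mulShape.sep_iff ν (s := s)).trans ⟨fun hs => ν.sep_unique hs.1 hs.2 hi hj, fun hs => ?_⟩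
      · change i ∈ ν.set (some (s.1, _)) ∧ j ∈ ν.set (some (s.1, _))
        rw [hs]
        exact ⟨hi, hj⟩
    have c0 := P.mk_inl_eq κ (Q.mk_inl_eq _ ha.conn)
    have c0' := P.mk_inl_eq κ (Q.mk_inr_eq _ ha'.conn)
    have n0 : (P.left κ).Sep i j (Q.seam (.inl s₀)) := (Q.sep_inl _).2 ha.sep₀
    have n1 : (P.left κ).Sep i j (Q.seam (.inl t₀)) := (Q.sep_inl _).2 ha.sep₁
    have n0' : (P.left κ).Sep i j (Q.seam (.inr s₁)) := (Q.sep_inr _).2 ha'.sep₀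
    have n1' : (P.left κ).Sep i j (Q.seam (.inr t₁)) := (Q.sep_inr _).2 ha'.sep₁
    have m : ∀ u, (P.right κ).Sep i j ((q, u) : τ.Inner × Option Bool) := fun u => (hsep _).2 rfl
    have c1 := Pasting.mk_inr_eq_inl hP κ (s := ⟨_, n0⟩) (s' := ⟨_, m none⟩)
      (hB.vertex_thin hM.bij (mul_arc_stop (some false) q false) false)
        (Q.vertex_thick_inl _ ▸ (congrArg _ ha.start).trans (bdVertex_union_inl _).symm)
    have c2 := Pasting.mk_inl_eq_inr hP κ (s := ⟨_, n1⟩) (s' := ⟨_, m (some false)⟩)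
      (Q.vertex_thin_inl _ _ ▸ (congrArg _ ha.fin).trans (bdVertex_union_inl _).symm)
        (hB.vertex_thick (mul_arc_start (some false) q false))
    have c3 := Pasting.mk_inr_eq_inl hP κ (s := ⟨_, n0'⟩) (s' := ⟨_, m (some false)⟩)
      (hB.vertex_thin hM.bij (mul_arc_stop (some true) q false) false)
        (Q.vertex_thick_inr _ ▸ (congrArg _ ha'.start).trans (bdVertex_union_inr _).symm)
    have c4 := Pasting.mk_inl_eq_inr hP κ (s := ⟨_, n1'⟩) (s' := ⟨_, m (some true)⟩)
      (Q.vertex_thin_inr _ _ ▸ (congrArg _ ha'.fin).trans (bdVertex_union_inr _).symm)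
        (hB.vertex_thick (mul_arc_start (some true) q false))
    have e1 := Pasting.thetaFree_add hPU (P.left κ) (i := i) (j := j)
      (TF := (Q.left (P.left κ)).Class ⟨s₀, ha.sep₀⟩)
      (TG := (Q.right (P.left κ)).Class ⟨s₁, ha'.sep₀⟩)
      (fun w => (w : Empty).elim) (fun w => (w : Empty).elim)
    have e2 := Pasting.theta_of_connected hP κ (i := i) (j := j)
      (TF := fun s => Sum.elim ((Q.left (P.left κ)).Class ⟨s₀, ha.sep₀⟩)
        ((Q.right (P.left κ)).Class ⟨s₁, ha'.sep₀⟩) (Q.seam.symm s)) (TG := fun _ => True)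
      ((P.sep_inl κ).2 n0) (by simpa using ⟨ha.sep₀, rfl⟩) ?_ (fun _ _ _ _ _ => Iff.rfl)
      ?_ (fun _ _ _ _ => trivial) ?_ ?_
    · rw [e1, (P.right κ).thetaFree_eq_zero fun _ _ => trivial] at e2
      have e3 := (Q.left (P.left κ)).theta_eq_class ⟨s₀, ha.sep₀⟩
      have e4 := (Q.right (P.left κ)).theta_eq_class ⟨s₁, ha'.sep₀⟩
      change (κ.theta i j) = ((Q.left (P.left κ)).thetaFree i j _ +
        (Q.right (P.left κ)).thetaFree i j _) + 0 + 1 at e2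
      rw [e2, e3, e4]
      push_cast
      ring
    · exact fun s s' hs hs' hv =>
        have : IsEmpty (VertexModel.empty).V := inferInstanceAs (IsEmpty Empty)
        Pasting.class_sum_iff hPU _ hs hs' hv
    · intro s w hs hw
      have lr : ∀ {x y}, Q.vertexL x ≠ Q.vertexR y := fun h => by
        obtain ⟨w, -⟩ := (Pasting.vertexL_eq_vertexR hPU _ _).1 h
        exact (w : Empty).elim
      change (F.union F').vertex _ = (F.union F').bdVertex (τ.model.sum τ.model) .top w ∨
        (F.union F').vertex _ = (F.union F').bdVertex (τ.model.sum τ.model) .top w at hw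
      rcases s with s | s <;> rcases w with w | w
      · exact ha.mem_class hs (hw.imp
          (fun h => Pasting.vertexL_injective hPU (h.trans (bdVertex_union_inl w)))
          fun h => Pasting.vertexL_injective hPU (h.trans (bdVertex_union_inl w)))
      · exact (hw.elim (fun h => lr (x := F.vertex (.thick s)) (h.trans (bdVertex_union_inr w)))
          fun h => lr (x := F.vertex (.thin s false)) (h.trans (bdVertex_union_inr w))).elim
      · exact (hw.elim (fun h => lr (y := F'.vertex (.thick s)) (h.trans (bdVertex_union_inl w)).symm)
          fun h => lr (y := F'.vertex (.thin s false)) (h.trans (bdVertex_union_inl w)).symm).elim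
      · exact ha'.mem_class hs (hw.imp
          (fun h => Pasting.vertexR_injective hPU (h.trans (bdVertex_union_inr w)))
          fun h => Pasting.vertexR_injective hPU (h.trans (bdVertex_union_inr w)))
    · intro s hs hT
      obtain ⟨s | s, rfl⟩ := Q.seam.surjective s <;>
        simp only [Equiv.symm_apply_apply, Sum.elim_inl, Sum.elim_inr] at hT
      · obtain ⟨hs', h⟩ := hT
        exact P.mk_inl_eq κ (Q.mk_inl_eq _ h)
      · obtain ⟨hs', h⟩ := hT
        exact (P.mk_inl_eq κ (Q.mk_inr_eq _ h)).trans (c3.symm.trans (c0.trans c2).symm)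
    · rintro ⟨q', u⟩ hs _
      obtain rfl : q' = q := (hsep _).1 ((P.sep_inr κ).1 hs)
      rcases u with _ | _ | _
      exacts [c1, (c0.trans c2).symm, (c0'.trans c4).symm.trans (c3.symm.trans (c0.trans c2).symm)]
  · rw [Pasting.theta_of_not_sep hP κ fun s => by rw [hκ]; exact τ.mulShape.not_sep ν h s,
      theta_union hF hF']
    push_cast
    ring

end Tree

end Foam

namespace MergeTree

open Foam

variable {σ τ : MergeTree} {N : ℕ}

namespace Refine

variable (ρ : Refine σ τ) {ν : τ.Lab N} {i j : Fin N}

theorem lab_lt (h : (ρ.lab ν).1 i < (ρ.lab ν).1 j) : ν.1 i < ν.1 j := by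
  simp only [lab, collapse] at h
  split_ifs at h <;> omega

theorem mem_old {p : σ.Pos} (h : i ∈ (ρ.lab ν).set p) : i ∈ ν.set (ρ.oldPos p) :=
  ρ.lab_set ν p ▸ h

theorem openShape_sep_iff {q : τ.Inner} (hi : i ∈ ν.set (some (q, false)))
    (hj : j ∈ ν.set (some (q, true))) {s : ρ.opening.S} :
    (ρ.openShape.coloring ν).Sep i j s ↔ ρ.openShape.node s = q := by
  rw [Shape.sep_iff]
  exact ⟨fun hs => ν.sep_unique hs.1 hs.2 hi hj, fun hs => by rw [hs]; exact ⟨hi, hj⟩⟩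

theorem opening_theta (hN : τ.size = N) (ν : τ.Lab N) (h : ¬ (ρ.lab ν).1 i < (ρ.lab ν).1 j) :
    ((ρ.openShape.coloring ν).theta i j : ℤ) = if ν.1 i < ν.1 j then 1 else 0 := by
  split_ifs with h'
  · obtain ⟨q, hi, hj⟩ := ν.exists_sep hN h'
    rcases ρ.eq_old_or_new q with ⟨q, rfl⟩ | rfl
    · refine absurd ((ρ.lab ν).lt_of_sep (q := q) ?_ ?_) h
      · rw [lab_set]; exact hi
      · rw [lab_set]; exact hj
    have := (ρ.openShape.coloring ν).theta_eq_thetaFree_add_one (i := i) (j := j)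
      (T := fun _ => True) (s₀ := .inr ()) ((ρ.openShape_sep_iff hi hj).2 rfl) trivial
      (fun _ _ _ _ _ => Iff.rfl) (fun s hs _ => congrArg _ (Subtype.ext (by
        have := (ρ.openShape_sep_iff hi hj).1 hs
        rcases s with s | s
        · exact absurd this (ρ.old_ne_new _)
        · rfl)))
    rw [Coloring.thetaFree_eq_zero _ fun _ _ => trivial] at this
    rw [this]
    rfl
  · rw [(ρ.openShape.coloring ν).theta_eq_thetaFree (i := i) (j := j)
      (T := fun _ => True) (fun s hs => absurd hs (ρ.openShape.not_sep ν h' s)),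
      Coloring.thetaFree_eq_zero _ fun _ _ => trivial]
    rfl

theorem theta_glue_opening {F : Foam Web.empty σ.web} (hF : F.IsFoam N)
    (hpos : τ.Positive) (hN : τ.size = N) (κ : Coloring N (F.glue ρ.opening))
    (hν : ∀ e, ((gluing F ρ.opening).right κ).c (.top e) = ν.set e.1) (i j : Fin N) :
    (κ.theta i j : ℤ) = ((gluing F ρ.opening).left κ).theta i j +
      (if ν.1 i < ν.1 j then 1 else 0) - if (ρ.lab ν).1 i < (ρ.lab ν).1 j then 1 else 0 := by
  have hO := ρ.opening_isFoam hpos hN.le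
  have hκ := ρ.opening_coloring_eq hν
  have hl : ∀ e, ((gluing F ρ.opening).left κ).c (.top e) = (ρ.lab ν).set e.1 := fun e => by
    rw [lab_set, show ((gluing F ρ.opening).left κ).c (.top e) =
      ((gluing F ρ.opening).right κ).c (.bot e) from (gluing F ρ.opening).compat κ e, hκ]
    rfl
  by_cases h : (ρ.lab ν).1 i < (ρ.lab ν).1 j
  · obtain ⟨q, hi, hj⟩ := (ρ.lab ν).exists_sep (ρ.size_eq.symm.trans hN) h
    rw [if_pos h, if_pos (ρ.lab_lt h), theta_of_extend hF hO κ hl hi hj (s₁ := .inl (q, true))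
      (t₁ := .inl (q, false)) ⟨.of_next rfl, .of_next rfl, .of_next (ρ.opening_bot_above q)⟩
      ⟨.of_next rfl, .of_next rfl, .of_next rfl⟩ ?_]
    · ring
    · intro s hs
      rw [hκ] at hs
      have := (ρ.openShape_sep_iff (q := ρ.old q) (ρ.mem_old hi) (ρ.mem_old hj)).1 hs
      rcases s with ⟨q', _ | _⟩ | s
      exacts [.inr (congrArg (fun x => Sum.inl (x, false)) (ρ.old_injective this)),
        .inl (congrArg (fun x => Sum.inl (x, true)) (ρ.old_injective this)),
        absurd this.symm (ρ.old_ne_new q)]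
  · rw [if_neg h, Pasting.theta_of_noArc (along_glue hF hO σ.models_web) κ (noArc_top hF hl h), hκ]
    push_cast
    rw [ρ.opening_theta hN ν h]
    ring

/-- The coloring of the closing foam that comes from a coloring of the tree. -/
def closeColoring (ν : τ.Lab N) : Coloring N ρ.closing :=
  ρ.closingReversal.coloring (ρ.openShape.coloring ν)

theorem closing_isFoam (hpos : τ.Positive) (hN : τ.size ≤ N) : ρ.closing.IsFoam N :=
  ρ.closingReversal.isFoam (ρ.opening_isFoam hpos hN)

theorem closing_coloring_eq {κ : Coloring N ρ.closing} (h : ∀ e, κ.c (.bot e) = ν.set e.1) :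
    κ = ρ.closeColoring ν := by
  rw [closeColoring, ← Equiv.symm_apply_eq]
  exact ρ.opening_coloring_eq fun e => h (τ.flip e)

theorem closeColoring_top (ν : τ.Lab N) (e : σ.web.E) :
    (ρ.closeColoring ν).c (.top e) = (ρ.lab ν).set e.1 := (ρ.lab_set ν e.1).symm

theorem theta_glue_closing {F : Foam Web.empty τ.web} (hF : F.IsFoam N)
    (hpos : τ.Positive) (hN : τ.size = N) (κ : Coloring N (F.glue ρ.closing))
    (hν : ∀ e, ((gluing F ρ.closing).left κ).c (.top e) = ν.set e.1) (i j : Fin N) :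
    κ.theta i j = ((gluing F ρ.closing).left κ).theta i j := by
  have hC := ρ.closing_isFoam hpos hN.le
  have hκ : (gluing F ρ.closing).right κ = ρ.closeColoring ν :=
    ρ.closing_coloring_eq fun e => ((gluing F ρ.closing).compat κ e).symm.trans (hν e)
  have hs : ∀ s : ρ.opening.S, ((gluing F ρ.closing).right κ).Sep i j s ↔
      (ρ.openShape.coloring ν).Sep i j s := fun s => by
    rw [hκ]
    exact ρ.closingReversal.sep_iff _
  by_cases h : ν.1 i < ν.1 j
  · obtain ⟨q, hi, hj⟩ := ν.exists_sep hN h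
    have h1 := fun s => (hs s).trans (ρ.openShape_sep_iff hi hj)
    rcases ρ.eq_old_or_new q with ⟨q, rfl⟩ | rfl
    · refine theta_of_extend hF hC κ hν hi hj (s₁ := .inl (q, false)) (t₁ := .inl (q, true))
        (ρ.closingReversal.botMerge (e₀ := (some (ρ.old q, false), false))
          (e₁ := (some (ρ.old q, true), false)) (e := (τ.above (ρ.old q), false))
          ⟨.of_next rfl, .of_next rfl, .of_next (by rw [above_old]; exact ρ.opening_top_above_old q)⟩)
        (ρ.closingReversal.botSplit (e₀ := (some (ρ.old q, false), true))
          (e₁ := (some (ρ.old q, true), true)) (e := (τ.above (ρ.old q), true))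
          ⟨.of_next (ρ.opening_top_old q _), .of_next (ρ.opening_top_old q _), .of_next rfl⟩) ?_
      intro s hs
      have := (h1 s).1 hs
      rcases s with ⟨q', _ | _⟩ | s
      exacts [.inl (congrArg (fun x => Sum.inl (x, false)) (ρ.old_injective this)),
        .inr (congrArg (fun x => Sum.inl (x, true)) (ρ.old_injective this)),
        absurd this.symm (ρ.old_ne_new q)]
    · refine theta_of_extend hF hC κ hν hi hj (s₁ := .inr ()) (t₁ := .inr ())
        (ρ.closingReversal.botMerge (e₀ := (some (ρ.new, false), false))
          (e₁ := (some (ρ.new, true), false)) (e := (τ.above ρ.new, false))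
          ⟨.of_next rfl, .of_next rfl, .of_next ρ.opening_top_above_new⟩)
        (ρ.closingReversal.botSplit (e₀ := (some (ρ.new, false), true))
          (e₁ := (some (ρ.new, true), true)) (e := (τ.above ρ.new, true))
          ⟨.of_next (ρ.opening_top_new _), .of_next (ρ.opening_top_new _), .of_next rfl⟩) ?_
      intro s hs
      have := (h1 s).1 hs
      rcases s with s | s
      exacts [absurd this (ρ.old_ne_new _), .inl rfl]
  · exact Pasting.theta_of_not_sep (along_glue hF hC τ.models_web) κ fun s h' =>
      ρ.openShape.not_sep ν h s ((hs s).1 h')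

end Refine
end MergeTree

open Equiv Foam MergeTree

variable {N : ℕ} {L : Type*} [Field L] {x : Fin N → L} {σ τ : MergeTree}

/-- The sign and the denominator of the contribution of a coloring. -/
def weight (x : Fin N → L) (m : Fin N → ℤ) (b t : Fin N → Fin N → ℤ) : L :=
  (-1) ^ (∑ i : Fin N, ((i : ℤ) + 1) * m i + ∑ i : Fin N, ∑ j ∈ Finset.Ioi i, t i j) /
    ∏ i : Fin N, ∏ j ∈ Finset.Ioi i, (x i - x j) ^ b i j

theorem weight_ne_zero (hx : x.Injective) (m b t) : weight x m b t ≠ 0 := by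
  refine div_ne_zero (zpow_ne_zero _ (by simp)) (Finset.prod_ne_zero_iff.2 fun i _ =>
    Finset.prod_ne_zero_iff.2 fun j hj => zpow_ne_zero _ (sub_ne_zero.2 fun h => ?_))
  exact (Finset.mem_Ioi.1 hj).ne (hx h)

theorem weight_mul (hx : x.Injective) {m m' m'' : Fin N → ℤ} {b b' b'' t t' t'' : Fin N → Fin N → ℤ}
    (hm : ∀ i, m'' i = m i + m' i) (hb : ∀ i j, b'' i j = b i j + b' i j)
    (ht : ∀ i j, t'' i j = t i j + t' i j) :
    weight x m'' b'' t'' = weight x m b t * weight x m' b' t' := by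
  unfold weight
  rw [div_mul_div_comm, ← zpow_add₀ (by simp), ← Finset.prod_mul_distrib]
  congr 1
  · congr 1
    simp only [hm, ht, mul_add, Finset.sum_add_distrib]
    ring
  · refine Finset.prod_congr rfl fun i _ => ?_
    rw [← Finset.prod_mul_distrib]
    refine Finset.prod_congr rfl fun j hj => ?_
    rw [hb, zpow_add₀ (sub_ne_zero.2 fun h => (Finset.mem_Ioi.1 hj).ne (hx h))]

namespace Foam

theorem Coloring.value_eq {Γ₀ Γ₁ : Web} {F : Foam Γ₀ Γ₁} (κ : Coloring N F) :
    κ.value x = weight x (fun i => κ.mono i / 2) (fun i j => κ.bi i j / 2)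
      (fun i j => κ.theta i j) * κ.decor x := by
  unfold Coloring.value weight Coloring.sgn Coloring.decor decoration
  rw [div_mul_eq_mul_div]

theorem IsFoam.even_bi {F : Foam Web.empty Web.empty} (hF : F.IsFoam N) (κ : Coloring N F)
    (i j : Fin N) : Even (κ.bi i j) := by
  rw [hF.bi_eq]
  exact ((hF.even_mono κ i).add (hF.even_mono κ j)).sub (even_two_mul _)

theorem value_eq_of_eq {F F' : Foam Web.empty Web.empty} {κ : Coloring N F} {κ' : Coloring N F'}
    (hχ : ∀ p, IsTest p → κ.chi p = κ'.chi p)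
    (ht : ∀ i j, (κ.theta i j : ℤ) = κ'.theta i j) (hd : κ.decor x = κ'.decor x) :
    κ.value x = κ'.value x := by
  simp only [Coloring.value_eq, Coloring.mono_eq_chi, Coloring.bi_eq_chi, hχ _ (.inl ⟨_, rfl⟩),
    hχ _ (.inr ⟨_, _, rfl⟩), ht, hd]

theorem value_mul_value (hx : x.Injective) {F₁ F₂ F₃ F₄ : Foam Web.empty Web.empty}
    (h₁ : F₁.IsFoam N) (h₂ : F₂.IsFoam N) (h₃ : F₃.IsFoam N) (h₄ : F₄.IsFoam N)
    {κ₁ : Coloring N F₁} {κ₂ : Coloring N F₂} {κ₃ : Coloring N F₃} {κ₄ : Coloring N F₄}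
    (hχ : ∀ p, IsTest p → κ₁.chi p + κ₂.chi p = κ₃.chi p + κ₄.chi p)
    (ht : ∀ i j, (κ₁.theta i j : ℤ) + κ₂.theta i j = κ₃.theta i j + κ₄.theta i j)
    (hd : κ₁.decor x * κ₂.decor x = κ₃.decor x * κ₄.decor x) :
    κ₁.value x * κ₂.value x = κ₃.value x * κ₄.value x := by
  have hm : ∀ i, κ₁.mono i + κ₂.mono i = κ₃.mono i + κ₄.mono i := fun i => by
    simpa only [Coloring.mono_eq_chi] using hχ _ (.inl ⟨i, rfl⟩)
  have hb : ∀ i j, κ₁.bi i j + κ₂.bi i j = κ₃.bi i j + κ₄.bi i j := fun i j => by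
    simpa only [Coloring.bi_eq_chi] using hχ _ (.inr ⟨i, j, rfl⟩)
  have half : ∀ {a b c d : ℤ}, Even a → Even b → Even c → Even d → a + b = c + d →
      a / 2 + b / 2 = c / 2 + d / 2 := by
    rintro _ _ _ _ ⟨a, rfl⟩ ⟨b, rfl⟩ ⟨c, rfl⟩ ⟨d, rfl⟩ h
    omega
  simp only [Coloring.value_eq]
  rw [mul_mul_mul_comm, hd, mul_mul_mul_comm (weight x _ _ _) (κ₃.decor x), ← weight_mul hx
    (m'' := fun i => κ₁.mono i / 2 + κ₂.mono i / 2) (b'' := fun i j => κ₁.bi i j / 2 + κ₂.bi i j / 2)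
    (t'' := fun i j => κ₁.theta i j + κ₂.theta i j) (fun _ => rfl) (fun _ _ => rfl) fun _ _ => rfl]
  congr 1
  refine weight_mul hx (fun i => ?_) (fun i j => ?_) ht
  exacts [half (h₁.even_mono _ i) (h₂.even_mono _ i) (h₃.even_mono _ i) (h₄.even_mono _ i) (hm i),
    half (h₁.even_bi _ i j) (h₂.even_bi _ i j) (h₃.even_bi _ i j) (h₄.even_bi _ i j) (hb i j)]

end Foam

section Cap

variable {ν : τ.Lab N}

/-- The colorings of a foam that restrict to a given coloring of the top web. -/
def ColTop (F : Foam Web.empty τ.web) (ν : τ.Lab N) : Type :=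
  {κ : Coloring N F // ∀ e, κ.c (.top e) = ν.set e.1}

/-- The colorings of a foam that restrict to a given coloring of the bottom web. -/
def ColBot (G : Foam τ.web Web.empty) (ν : τ.Lab N) : Type :=
  {κ : Coloring N G // ∀ e, κ.c (.bot e) = ν.set e.1}

instance (F : Foam Web.empty τ.web) : Finite (ColTop F ν) := inferInstanceAs (Finite (Subtype _))

instance (G : Foam τ.web Web.empty) : Finite (ColBot G ν) := inferInstanceAs (Finite (Subtype _))

/-- Two colorings glued along a web. -/
def join {F : Foam Web.empty τ.web} {G : Foam τ.web Web.empty} (κ : ColTop F ν) (κ' : ColBot G ν) :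
    Coloring N (F.glue G) :=
  κ.1.glue κ'.1 fun e => (κ.2 e).trans (κ'.2 e).symm

variable {F : Foam Web.empty τ.web} {G : Foam τ.web Web.empty}

theorem join_chi (hF : F.IsFoam N) (hG : G.IsFoam N) (κ : ColTop F ν) (κ' : ColBot G ν)
    {p : Finset (Fin N) → Prop} (hp : Additive p) :
    (join κ κ').chi p = κ.1.chi p + κ'.1.chi p := by
  have := (join κ κ').chi_glue hF hG τ.models_web hp
  rwa [join, left_glue, right_glue] at this

/-- `1` if `i` is on the left of `j`. -/
def MergeTree.Lab.ltn (ν : τ.Lab N) (i j : Fin N) : ℤ := if ν.1 i < ν.1 j then 1 else 0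

theorem join_theta (hF : F.IsFoam N) (hG : G.IsFoam N) (hN : τ.size = N) (κ : ColTop F ν)
    (κ' : ColBot G ν) (i j) :
    ((join κ κ').theta i j : ℤ) = κ.1.theta i j + κ'.1.theta i j - ν.ltn i j := by
  have := theta_glue hF hG hN (join κ κ') (ν := ν) (by rw [join, left_glue]; exact κ.2) i j
  rwa [join, left_glue, right_glue] at this

theorem join_decor (κ : ColTop F ν) (κ' : ColBot G ν) :
    (join κ κ').decor x = κ.1.decor x * κ'.1.decor x := by
  have := (gluing F G).decor_eq x (join κ κ')
  rwa [join, left_glue, right_glue] at this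

/-- The coloring of the unit foam that extends a coloring of its boundary. -/
def unitCol (ν : τ.Lab N) (m) : ColTop (τ.dottedUnit m) ν :=
  ⟨unitShape.coloring ν, fun _ => rfl⟩

/-- The coloring of the counit foam that extends a coloring of its boundary. -/
def counitCol (ν : τ.Lab N) (m) : ColBot (τ.dottedCounit m) ν :=
  ⟨(τ.counitReversal m).coloring (unitShape.coloring ν), fun _ => rfl⟩

theorem counit_isFoam {m} (hpos : τ.Positive) (hN : τ.size ≤ N) :
    (τ.dottedCounit m).IsFoam N := (τ.counitReversal m).isFoam (unit_isFoam hpos hN)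

instance (ν : τ.Lab N) (m) : Unique (ColTop (τ.dottedUnit m) ν) where
  default := unitCol ν m
  uniq κ := Subtype.ext (unit_coloring_eq κ.2)

instance (ν : τ.Lab N) (m) : Unique (ColBot (τ.dottedCounit m) ν) where
  default := counitCol ν m
  uniq κ := Subtype.ext <| by
    change _ = (τ.counitReversal m).coloring (unitShape.coloring ν)
    rw [← Equiv.symm_apply_eq]
    exact unit_coloring_eq fun e => κ.2 (τ.flip e)

section

variable {m : ∀ p, SymPoly (τ.wt p)}

theorem unitCol_chi (hpos : τ.Positive) (hN : τ.size = N) {p : Finset (Fin N) → Prop}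
    (hp : Additive p) {h : ℤ} (hν : ν.Path p h) : (unitCol ν m).1.chi p = h :=
  unit_chi hpos hN ν hp hν

theorem unitCol_theta (hN : τ.size = N) (i j) :
    ((unitCol ν m).1.theta i j : ℤ) = ν.ltn i j := unit_theta hN ν i j

theorem counitCol_chi (hpos : τ.Positive) (hN : τ.size = N) {p : Finset (Fin N) → Prop}
    (hp : Additive p) {h : ℤ} (hν : ν.Path p h) : (counitCol ν m).1.chi p = h :=
  ((τ.counitReversal m).chi_eq _ p).trans (unitCol_chi hpos hN hp hν)

theorem counitCol_theta (hN : τ.size = N) (i j) :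
    ((counitCol ν m).1.theta i j : ℤ) = ν.ltn i j :=
  (congrArg Nat.cast ((τ.counitReversal m).theta_eq _ i j)).trans (unitCol_theta (m := m) hN i j)

theorem counitCol_decor : (counitCol ν m).1.decor x = (unitCol ν m).1.decor x :=
  (τ.counitReversal m).decor_eq x _

theorem unitCol_decor_one : (unitCol ν (τ := τ) fun _ => 1).1.decor x = 1 := by
  refine (unit_decor x ν).trans (finprod_eq_one_of_forall_eq_one fun p => ?_)
  exact map_one _

end

/-- The contribution of a coloring of the union of the unit and the counit. -/
def capWeight (x : Fin N → L) (ν : τ.Lab N) : L :=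
  weight x (fun _ => 1) ν.sep ν.ltn

/-- The contribution of a coloring, after gluing with the counit. -/
def capValue (x : Fin N → L) (κ : ColTop F ν) : L :=
  (join κ (counitCol ν fun _ => 1)).value x

/-- The contribution of a coloring, after gluing with the unit. -/
def cupValue (x : Fin N → L) (κ : ColBot G ν) : L :=
  (join (unitCol ν fun _ => 1) κ).value x

section Values

theorem cap_chi (hpos : τ.Positive) (hN : τ.size = N) (hF : F.IsFoam N) (κ : ColTop F ν)
    {p : Finset (Fin N) → Prop} (hp : Additive p) {h : ℤ} (hν : ν.Path p h) :
    (join κ (counitCol ν fun _ => 1)).chi p = κ.1.chi p + h := by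
  rw [join_chi hF (counit_isFoam hpos hN.le) _ _ hp, counitCol_chi hpos hN hp hν]

theorem cap_theta (hpos : τ.Positive) (hN : τ.size = N) (hF : F.IsFoam N)
    (κ : ColTop F ν) (i j) :
    ((join κ (counitCol ν fun _ => 1)).theta i j : ℤ) = κ.1.theta i j := by
  rw [join_theta hF (counit_isFoam hpos hN.le) hN, counitCol_theta hN]
  ring

theorem cap_decor (κ : ColTop F ν) : (join κ (counitCol ν fun _ => 1)).decor x = κ.1.decor x := by
  rw [join_decor, counitCol_decor, unitCol_decor_one, mul_one]

theorem unit_counit_value (hpos : τ.Positive) (hN : τ.size = N) (m m') :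
    (join (unitCol ν m) (counitCol ν m')).value x =
      capWeight x ν * ((unitCol ν m).1.decor x * (unitCol ν m').1.decor x) := by
  have hU := unit_isFoam (m := m) hpos hN.le
  have hC := counit_isFoam (m := m') hpos hN.le
  have key : ∀ {p : Finset (Fin N) → Prop} {h}, Additive p → ν.Path p h →
      (join (unitCol ν m) (counitCol ν m')).chi p / 2 = h := fun hp hν => by
    rw [join_chi hU hC _ _ hp, unitCol_chi hpos hN hp hν, counitCol_chi hpos hN hp hν, ← two_mul,
      Int.mul_ediv_cancel_left _ two_ne_zero]
  rw [Coloring.value_eq, join_decor, counitCol_decor]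
  simp only [Coloring.mono_eq_chi, Coloring.bi_eq_chi, key (additive_mem _) (ν.path_mem hN _),
    key (additive_xor _ _) (ν.path_xor hN _ _), join_theta hU hC hN, unitCol_theta hN,
    counitCol_theta hN, add_sub_cancel_right]
  rfl

theorem capWeight_eq (hpos : τ.Positive) (hN : τ.size = N) :
    capWeight x ν = capValue x (unitCol ν fun _ => 1) := by
  rw [capValue, unit_counit_value hpos hN, unitCol_decor_one, mul_one, mul_one]

theorem capWeight_ne_zero (hx : x.Injective) (ν : τ.Lab N) : capWeight x ν ≠ 0 :=
  weight_ne_zero hx _ _ _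

theorem join_value (hx : x.Injective) (hpos : τ.Positive) (hN : τ.size = N)
    (hF : F.IsFoam N) (hG : G.IsFoam N) (κ : ColTop F ν) (κ' : ColBot G ν) :
    (join κ κ').value x * capWeight x ν = capValue x κ * cupValue x κ' := by
  have hU := unit_isFoam (τ := τ) (m := fun _ => 1) hpos hN.le
  have hC := counit_isFoam (τ := τ) (m := fun _ => 1) hpos hN.le
  rw [capWeight_eq hpos hN]
  refine value_mul_value hx (hF.glue hG) (hU.glue hC) (hF.glue hC) (hU.glue hG) (fun p hp => ?_)
    (fun i j => ?_) ?_
  · have hp := hp.additive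
    simp only [join_chi hF hG _ _ hp, join_chi hU hC _ _ hp, join_chi hF hC _ _ hp,
      join_chi hU hG _ _ hp]
    ring
  · simp only [join_theta hF hG hN, join_theta hU hC hN, join_theta hF hC hN, join_theta hU hG hN]
    ring
  · simp only [join_decor]
    ring

end Values

/-! ### The components of foams -/

/-- The component of a foam below the web at a coloring of the web. -/
def comp (x : Fin N → L) (ν : τ.Lab N) (F : Foam Web.empty τ.web) : L :=
  (∑ᶠ κ : ColTop F ν, capValue x κ) / capWeight x ν

/-- The component of a foam above the web at a coloring of the web. -/
def cocomp (x : Fin N → L) (ν : τ.Lab N) (G : Foam τ.web Web.empty) : L :=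
  (∑ᶠ κ : ColBot G ν, cupValue x κ) / capWeight x ν

theorem comp_dottedUnit (hx : x.Injective) (hpos : τ.Positive) (hN : τ.size = N)
    (ν : τ.Lab N) (m) :
    comp x ν (τ.dottedUnit m) = ∏ᶠ p, decoration x (m p) (ν.set p) (ν.card_set p) := by
  rw [comp, finsum_unique, ← unit_decor x ν]
  change capValue x (unitCol ν m) / _ = _
  rw [capValue, unit_counit_value hpos hN, unitCol_decor_one, mul_one,
    mul_div_cancel_left₀ _ (capWeight_ne_zero hx ν)]
  rfl

theorem cocomp_dottedCounit (hx : x.Injective) (hpos : τ.Positive) (hN : τ.size = N)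
    (ν : τ.Lab N) (m) :
    cocomp x ν (τ.dottedCounit m) = ∏ᶠ p, decoration x (m p) (ν.set p) (ν.card_set p) := by
  rw [cocomp, finsum_unique, ← unit_decor x ν]
  change cupValue x (counitCol ν m) / _ = _
  rw [cupValue, unit_counit_value hpos hN, unitCol_decor_one, one_mul,
    mul_div_cancel_left₀ _ (capWeight_ne_zero hx ν)]
  rfl

theorem finsum_sigma' {X : Type*} {Y : X → Type*} [Finite X] [∀ a, Finite (Y a)]
    (f : (Σ a, Y a) → L) : ∑ᶠ z, f z = ∑ᶠ a, ∑ᶠ y, f ⟨a, y⟩ := by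
  have := Fintype.ofFinite X
  have := fun a => Fintype.ofFinite (Y a)
  simp only [finsum_eq_sum_of_fintype]
  exact Fintype.sum_sigma f

theorem finsum_mul_finsum {X Y : Type*} [Finite X] [Finite Y] (f : X → L) (g : Y → L) :
    (∑ᶠ a, f a) * ∑ᶠ b, g b = ∑ᶠ z : X × Y, f z.1 * g z.2 := by
  have := Fintype.ofFinite X
  have := Fintype.ofFinite Y
  simp only [finsum_eq_sum_of_fintype]
  rw [Fintype.sum_mul_sum, Fintype.sum_prod_type]

theorem Lab_eq_of_set (hN : τ.size = N) {ν ν' : τ.Lab N} {c : τ.web.E → Finset (Fin N)}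
    (h : ∀ e, c e = ν.set e.1) (h' : ∀ e, c e = ν'.set e.1) : ν = ν' :=
  Lab.ext_set hN fun p _ => (h (p, true)).symm.trans (h' (p, true))

theorem eval_glue (hx : x.Injective) (hpos : τ.Positive) (hN : τ.size = N)
    (hF : F.IsFoam N) (hG : G.IsFoam N) :
    (F.glue G).eval x = ∑ᶠ ν : τ.Lab N, capWeight x ν * comp x ν F * cocomp x ν G := by
  have := Lab.finite (N := N) hN
  have hb : Function.Bijective fun z : Σ ν : τ.Lab N, ColTop F ν × ColBot G ν =>
      join z.2.1 z.2.2 := by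
    constructor
    · rintro ⟨ν, κ, κ'⟩ ⟨ν', ξ, ξ'⟩ h
      have h1 := congrArg (gluing F G).left h
      have h2 := congrArg (gluing F G).right h
      simp only [join, left_glue, right_glue] at h1 h2
      obtain rfl := Lab_eq_of_set hN κ.2 (by rw [h1]; exact ξ.2)
      obtain rfl := Subtype.ext h1
      obtain rfl := Subtype.ext h2
      rfl
    · intro κ
      obtain ⟨p, rfl⟩ := glueColoringEquiv.symm.surjective κ
      obtain ⟨ν, hν⟩ := exists_label hN (p.1.1.isColoring_top hF)
      exact ⟨⟨ν, ⟨p.1.1, hν⟩, ⟨p.1.2, fun e => (p.2 e).symm.trans (hν e)⟩⟩, rfl⟩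
  unfold Foam.eval
  rw [← finsum_eq_of_bijective _ hb fun _ => rfl, finsum_sigma']
  refine finsum_congr fun ν => ?_
  have h0 := capWeight_ne_zero hx ν
  rw [comp, cocomp, mul_div_cancel₀ _ h0, mul_div_assoc', finsum_mul_finsum, eq_div_iff h0,
    finsum_mul' _ _ (Set.toFinite _)]
  exact finsum_congr fun z => join_value hx hpos hN hF hG z.1 z.2

end Cap

namespace Foam

variable {Γ₀ Γ₁ Γ₂ Γ Γ' : Web}

theorem left_union {F : Foam Web.empty Γ} {G : Foam Web.empty Γ'} (κ : Coloring N F)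
    (κ' : Coloring N G) : (unionP F G).left (κ.union κ') = κ :=
  congrArg Prod.fst (unionColoringEquiv.apply_symm_apply (κ, κ'))

theorem right_union {F : Foam Web.empty Γ} {G : Foam Web.empty Γ'} (κ : Coloring N F)
    (κ' : Coloring N G) : (unionP F G).right (κ.union κ') = κ' :=
  congrArg Prod.snd (unionColoringEquiv.apply_symm_apply (κ, κ'))

theorem glue_left_right {F : Foam Γ₀ Γ₁} {G : Foam Γ₁ Γ₂} (κ : Coloring N (F.glue G)) :
    ((gluing F G).left κ).glue ((gluing F G).right κ) ((gluing F G).compat κ) = κ :=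
  glueColoringEquiv.symm_apply_apply κ

theorem union_left_right {F : Foam Web.empty Γ} {G : Foam Web.empty Γ'}
    (κ : Coloring N (F.union G)) :
    ((unionP F G).left κ).union ((unionP F G).right κ) = κ :=
  unionColoringEquiv.symm_apply_apply κ

end Foam

section Mul

variable {F F' : Foam Web.empty τ.web} {ν : τ.Lab N}

/-- The product of two colorings. -/
def mulCol (κ : ColTop F ν) (κ' : ColTop F' ν) :
    ColTop ((F.union F').glue τ.mul) ν :=
  ⟨(κ.1.union κ'.1).glue (τ.mulShape.coloring ν) (by rintro (e | e); exacts [κ.2 e, κ'.2 e]),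
    fun _ => rfl⟩

theorem mulCol_chi (hpos : τ.Positive) (hN : τ.size = N) (hF : F.IsFoam N)
    (hF' : F'.IsFoam N) (κ : ColTop F ν) (κ' : ColTop F' ν) {p : Finset (Fin N) → Prop}
    (hp : Additive p) {h : ℤ} (hν : ν.Path p h) :
    (mulCol κ κ').1.chi p = κ.1.chi p + κ'.1.chi p - h := by
  have := (mulCol κ κ').1.chi_glue (hF.union hF') (mul_isFoam hpos hN.le)
    (τ.models_web.sum τ.models_web) hp
  rw [mulCol, left_glue, right_glue, Coloring.chi_union hF hF', left_union, right_union,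
    mul_chi hpos hN ν hp hν] at this
  exact this

theorem mulCol_theta (hpos : τ.Positive) (hN : τ.size = N) (hF : F.IsFoam N)
    (hF' : F'.IsFoam N) (κ : ColTop F ν) (κ' : ColTop F' ν) (i j) :
    ((mulCol κ κ').1.theta i j : ℤ) = κ.1.theta i j + κ'.1.theta i j - ν.ltn i j := by
  have := theta_glue_mul hF hF' hpos hN (mulCol κ κ').1 (ν := ν)
    (by rw [mulCol, right_glue]; exact fun _ => rfl) i j
  rw [mulCol, left_glue, left_union, right_union] at this
  exact this

theorem mulCol_decor (κ : ColTop F ν) (κ' : ColTop F' ν) :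
    (mulCol κ κ').1.decor x = κ.1.decor x * κ'.1.decor x := by
  rw [(gluing _ _).decor_eq x, mul_decor, mul_one, (unionP _ _).decor_eq x, mulCol,
    left_glue, left_union, right_union]

theorem capValue_mulCol (hx : x.Injective) (hpos : τ.Positive) (hN : τ.size = N)
    (hF : F.IsFoam N) (hF' : F'.IsFoam N) (κ : ColTop F ν) (κ' : ColTop F' ν) :
    capValue x (mulCol κ κ') * capWeight x ν = capValue x κ * capValue x κ' := by
  have hU := unit_isFoam (τ := τ) (m := fun _ => 1) hpos hN.le
  have hC := counit_isFoam (τ := τ) (m := fun _ => 1) hpos hN.le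
  have hM := (hF.union hF').glue (mul_isFoam hpos hN.le)
  rw [capWeight_eq hpos hN]
  refine value_mul_value hx (hM.glue hC) (hU.glue hC) (hF.glue hC) (hF'.glue hC) (fun p hp => ?_)
    (fun i j => ?_) ?_
  · obtain ⟨h, hν⟩ := ν.exists_path hN hp
    have hp := hp.additive
    rw [cap_chi hpos hN hM _ hp hν, cap_chi hpos hN hU _ hp hν, cap_chi hpos hN hF _ hp hν,
      cap_chi hpos hN hF' _ hp hν, unitCol_chi hpos hN hp hν, mulCol_chi hpos hN hF hF' κ κ' hp hν]
    ring
  · rw [cap_theta hpos hN hM, cap_theta hpos hN hU, cap_theta hpos hN hF, cap_theta hpos hN hF',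
      unitCol_theta hN, mulCol_theta hpos hN hF hF']
    ring
  · rw [cap_decor, cap_decor, cap_decor, cap_decor, mulCol_decor, unitCol_decor_one, mul_one]

theorem mulCol_bijective : Function.Bijective fun z : ColTop F ν × ColTop F' ν => mulCol z.1 z.2 := by
  constructor
  · rintro ⟨κ, κ'⟩ ⟨ξ, ξ'⟩ h
    have h := congrArg (fun η => (gluing (F.union F') τ.mul).left η.1) h
    simp only [mulCol, left_glue] at h
    have h1 := congrArg (unionP F F').left h
    have h2 := congrArg (unionP F F').right h
    simp only [left_union, right_union] at h1 h2
    exact Prod.ext (Subtype.ext h1) (Subtype.ext h2)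
  · rintro ⟨κ, hκ⟩
    have hr : (gluing (F.union F') τ.mul).right κ = τ.mulShape.coloring ν := mul_coloring_eq hκ
    have hl : ∀ e, ((gluing (F.union F') τ.mul).left κ).c (.top e) =
        (τ.mulShape.coloring ν).c (.bot e) := fun e => hr ▸ (gluing (F.union F') τ.mul).compat κ e
    refine ⟨⟨⟨(unionP F F').left ((gluing (F.union F') τ.mul).left κ),
      fun e => hl (.inl e)⟩, ⟨(unionP F F').right ((gluing (F.union F') τ.mul).left κ),
      fun e => hl (.inr e)⟩⟩, Subtype.ext ?_⟩
    refine Eq.trans ?_ (glue_left_right κ)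
    simp only [mulCol, union_left_right, hr]

theorem comp_mul (hx : x.Injective) (hpos : τ.Positive) (hN : τ.size = N)
    (hF : F.IsFoam N) (hF' : F'.IsFoam N) :
    comp x ν ((F.union F').glue τ.mul) = comp x ν F * comp x ν F' := by
  have h0 := capWeight_ne_zero hx ν
  rw [comp, comp, comp, div_mul_div_comm, finsum_mul_finsum, div_eq_div_iff h0 (mul_ne_zero h0 h0),
    ← finsum_eq_of_bijective _ mulCol_bijective fun _ => rfl, ← mul_assoc,
    finsum_mul' _ _ (Set.toFinite _)]
  congr 1
  exact finsum_congr fun z => capValue_mulCol hx hpos hN hF hF' z.1 z.2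

end Mul

namespace MergeTree.Refine

variable (ρ : Refine σ τ) {ν : τ.Lab N}

theorem leaves_pos (ρ : Refine σ τ) (h : τ.Positive) : σ.Positive := by
  induction ρ with
  | here a b =>
    intro c hc
    obtain rfl := List.mem_singleton.1 hc
    exact Nat.add_pos_left (h a (by simp [leaves])) _
  | left ρ r ih =>
    simp only [Positive, leaves, List.mem_append] at h ⊢
    exact fun a ha => ha.elim (ih (fun a ha => h a (.inl ha)) a) fun ha => h a (.inr ha)
  | right l ρ ih =>
    simp only [Positive, leaves, List.mem_append] at h ⊢
    exact fun a ha => ha.elim (fun ha => h a (.inl ha)) (ih (fun a ha => h a (.inr ha)) a)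

theorem opening_decor (κ : Coloring N ρ.opening) : κ.decor x = 1 :=
  finprod_eq_one_of_forall_eq_one fun _ => map_one _

theorem closing_decor (κ : Coloring N ρ.closing) : κ.decor x = 1 :=
  finprod_eq_one_of_forall_eq_one fun _ => map_one _

section Opening

variable {F : Foam Web.empty σ.web}

/-- The continuation of a coloring to the opening foam. -/
def openCol (κ : ColTop F (ρ.lab ν)) : ColTop (F.glue ρ.opening) ν :=
  ⟨κ.1.glue (ρ.openShape.coloring ν) fun e => (κ.2 e).trans (ρ.lab_set ν e.1), fun _ => rfl⟩

theorem openCol_bijective : Function.Bijective (ρ.openCol (F := F) (ν := ν)) := by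
  constructor
  · intro κ κ' h
    have h := congrArg (fun η => (gluing F ρ.opening).left η.1) h
    simp only [openCol, left_glue] at h
    exact Subtype.ext h
  · rintro ⟨κ, hκ⟩
    have hr : (gluing F ρ.opening).right κ = ρ.openShape.coloring ν := ρ.opening_coloring_eq hκ
    refine ⟨⟨(gluing F ρ.opening).left κ, fun e => ?_⟩, Subtype.ext ?_⟩
    · rw [lab_set]
      exact ((gluing F ρ.opening).compat κ e).trans (by rw [hr]; rfl)
    · refine Eq.trans ?_ (glue_left_right κ)
      simp only [openCol, hr]

theorem capValue_openCol (hx : x.Injective) (hpos : τ.Positive) (hN : τ.size = N)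
    (hF : F.IsFoam N) (κ : ColTop F (ρ.lab ν)) :
    capValue x (ρ.openCol κ) * capWeight x (ρ.lab ν) = capValue x κ * capWeight x ν := by
  have hposσ := ρ.leaves_pos hpos
  have hNσ : σ.size = N := ρ.size_eq ▸ hN
  have hO := ρ.opening_isFoam hpos hN.le
  have hU := unit_isFoam (τ := τ) (m := fun _ => 1) hpos hN.le
  have hC := counit_isFoam (τ := τ) (m := fun _ => 1) hpos hN.le
  have hU' := unit_isFoam (τ := σ) (m := fun _ => 1) hposσ hNσ.le
  have hC' := counit_isFoam (τ := σ) (m := fun _ => 1) hposσ hNσ.le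
  rw [capWeight_eq hpos hN, capWeight_eq hposσ hNσ]
  refine value_mul_value hx ((hF.glue hO).glue hC) (hU'.glue hC') (hF.glue hC') (hU.glue hC)
    (fun p hp => ?_) (fun i j => ?_) ?_
  · obtain ⟨h, h', hν, hν', e⟩ := ρ.exists_opening_chi hpos hN ν hp
    have hp := hp.additive
    have := (ρ.openCol κ).1.chi_glue hF hO σ.models_web hp
    rw [openCol, left_glue, right_glue, e] at this
    rw [cap_chi hpos hN (hF.glue hO) _ hp hν, cap_chi hposσ hNσ hU' _ hp hν',
      cap_chi hposσ hNσ hF _ hp hν', cap_chi hpos hN hU _ hp hν, unitCol_chi hpos hN hp hν,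
      unitCol_chi hposσ hNσ hp hν', openCol, this]
    ring
  · have := ρ.theta_glue_opening hF hpos hN (ρ.openCol κ).1 (ν := ν)
      (by rw [openCol, right_glue]; exact fun _ => rfl) i j
    rw [openCol, left_glue] at this
    rw [cap_theta hpos hN (hF.glue hO), cap_theta hposσ hNσ hU', cap_theta hposσ hNσ hF,
      cap_theta hpos hN hU, unitCol_theta hN, unitCol_theta hNσ, openCol, this]
    unfold Lab.ltn
    ring
  · rw [cap_decor, cap_decor, cap_decor, cap_decor, unitCol_decor_one, unitCol_decor_one,
      (gluing _ _).decor_eq x, opening_decor, openCol, left_glue, mul_one]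

theorem comp_opening (hx : x.Injective) (hpos : τ.Positive) (hN : τ.size = N)
    (hF : F.IsFoam N) : comp x ν (F.glue ρ.opening) = comp x (ρ.lab ν) F := by
  rw [comp, comp, div_eq_div_iff (capWeight_ne_zero hx ν) (capWeight_ne_zero hx _),
    ← finsum_eq_of_bijective _ ρ.openCol_bijective fun _ => rfl, finsum_mul' _ _ (Set.toFinite _),
    finsum_mul' _ _ (Set.toFinite _)]
  exact finsum_congr fun κ => ρ.capValue_openCol hx hpos hN hF κ

end Opening

section Closing

variable {F : Foam Web.empty τ.web} {ν' : σ.Lab N}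

/-- The continuation of a coloring to the closing foam. -/
def closeCol (hν : ρ.lab ν = ν') (κ : ColTop F ν) : ColTop (F.glue ρ.closing) ν' :=
  ⟨κ.1.glue (ρ.closeColoring ν) κ.2, fun e => (ρ.closeColoring_top ν e).trans (by rw [hν])⟩

theorem left_closeCol (hν : ρ.lab ν = ν') (κ : ColTop F ν) :
    (gluing F ρ.closing).left (ρ.closeCol hν κ).1 = κ.1 := left_glue _ _ κ.2

theorem right_closeCol (hν : ρ.lab ν = ν') (κ : ColTop F ν) :
    (gluing F ρ.closing).right (ρ.closeCol hν κ).1 = ρ.closeColoring ν := right_glue _ _ κ.2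

theorem closeCol_bijective (hF : F.IsFoam N) (hN : τ.size = N) :
    Function.Bijective fun z : Σ ν : {ν : τ.Lab N // ρ.lab ν = ν'}, ColTop F ν.1 =>
      ρ.closeCol z.1.2 z.2 := by
  constructor
  · rintro ⟨⟨ν, hν⟩, κ⟩ ⟨⟨ξ, hξ⟩, κ'⟩ h
    have h : κ.1 = κ'.1 := (ρ.left_closeCol hν κ).symm.trans
      ((congrArg (fun η => (gluing F ρ.closing).left η.1) h).trans (ρ.left_closeCol hξ κ'))
    obtain rfl := Lab_eq_of_set (ν := ν) (ν' := ξ) hN κ.2 (by rw [h]; exact κ'.2)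
    obtain rfl := Subtype.ext h
    rfl
  · rintro ⟨κ, hκ⟩
    obtain ⟨ν, hν⟩ := exists_label hN (((gluing F ρ.closing).left κ).isColoring_top hF)
    have hr : (gluing F ρ.closing).right κ = ρ.closeColoring ν :=
      ρ.closing_coloring_eq fun e => ((gluing F ρ.closing).compat κ e).symm.trans (hν e)
    have hl : ρ.lab ν = ν' := by
      refine Lab_eq_of_set (ρ.size_eq ▸ hN) (fun e => ?_) hκ
      exact (congrArg (fun η => Coloring.c η (.top e)) hr).trans (ρ.closeColoring_top ν e)
    refine ⟨⟨⟨ν, hl⟩, (gluing F ρ.closing).left κ, hν⟩, Subtype.ext ?_⟩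
    refine Eq.trans ?_ (glue_left_right κ)
    simp only [closeCol, hr]

theorem capValue_closeCol (hpos : τ.Positive) (hN : τ.size = N) (hF : F.IsFoam N)
    (hν : ρ.lab ν = ν') (κ : ColTop F ν) : capValue x (ρ.closeCol hν κ) = capValue x κ := by
  subst hν
  have hposσ := ρ.leaves_pos hpos
  have hNσ : σ.size = N := ρ.size_eq ▸ hN
  have hC := ρ.closing_isFoam hpos hN.le
  refine value_eq_of_eq (fun p hp => ?_) (fun i j => ?_) ?_
  · obtain ⟨h, h', hν, hν', e⟩ := ρ.exists_opening_chi hpos hN ν hp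
    have hp := hp.additive
    have := (ρ.closeCol rfl κ).1.chi_glue hF hC τ.models_web hp
    rw [left_closeCol, right_closeCol, closeColoring, ρ.closingReversal.chi_eq, e] at this
    rw [cap_chi hposσ hNσ (hF.glue hC) _ hp hν', cap_chi hpos hN hF _ hp hν, this]
    ring
  · have := ρ.theta_glue_closing hF hpos hN (ρ.closeCol rfl κ).1 (ν := ν)
      (by rw [left_closeCol]; exact κ.2) i j
    rw [left_closeCol] at this
    rw [cap_theta hposσ hNσ (hF.glue hC), cap_theta hpos hN hF, this]
  · rw [cap_decor, cap_decor, (gluing _ _).decor_eq x, closing_decor, left_closeCol,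
      mul_one]

theorem comp_closing (hx : x.Injective) (hpos : τ.Positive) (hN : τ.size = N)
    (hF : F.IsFoam N) : comp x ν' (F.glue ρ.closing) =
      ∑ᶠ ν : {ν : τ.Lab N // ρ.lab ν = ν'}, comp x ν.1 F * (capWeight x ν.1 / capWeight x ν') := by
  have := Lab.finite (N := N) hN
  rw [comp, ← finsum_eq_of_bijective _ (ρ.closeCol_bijective hF hN) fun _ => rfl,
    finsum_sigma', div_eq_mul_inv, finsum_mul' _ _ (Set.toFinite _)]
  refine finsum_congr fun ν => ?_
  rw [comp, div_mul_div_cancel₀ (capWeight_ne_zero hx ν.1), div_eq_mul_inv]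
  congr 1
  exact finsum_congr fun κ => ρ.capValue_closeCol hpos hN hF ν.2 κ

end Closing

/-- The product of the differences of the variables on the two sides of the new node. -/
def euler (x : Fin N → L) (ν : τ.Lab N) : L :=
  ∏ i : Fin N, ∏ j : Fin N, if ν.1 i = ρ.idx ∧ ν.1 j = ρ.idx + 1 then x j - x i else 1

end MergeTree.Refine

theorem prod_Ioi_mul {n : ℕ} {g : Fin n → Fin n → L} (hg : ∀ i, g i i = 1) :
    ∏ i, ∏ j ∈ Finset.Ioi i, g i j * g j i = ∏ i, ∏ j, g i j := by
  simp only [Finset.prod_mul_distrib]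
  have h : ∏ i, ∏ j ∈ Finset.Ioi i, g j i = ∏ i, ∏ j ∈ Finset.Iio i, g i j :=
    Finset.prod_comm' fun i j => by simp
  rw [h, ← Finset.prod_mul_distrib]
  refine Finset.prod_congr rfl fun i _ => ?_
  rw [← Finset.prod_union (Finset.disjoint_left.2 fun j h h' =>
    ((Finset.mem_Ioi.1 h).trans (Finset.mem_Iio.1 h')).false)]
  refine Finset.prod_subset (Finset.subset_univ _) fun j _ hj => ?_
  obtain rfl : i = j := by
    simp only [Finset.mem_union, Finset.mem_Ioi, Finset.mem_Iio, not_or, not_lt] at hj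
    exact le_antisymm hj.2 hj.1
  exact hg i

theorem neg_one_zpow_sum (s : Finset (Fin N)) (f : Fin N → ℤ) :
    (-1 : L) ^ ∑ i ∈ s, f i = ∏ i ∈ s, (-1 : L) ^ f i := by
  induction s using Finset.cons_induction with
  | empty => simp
  | cons a s ha ih => rw [Finset.sum_cons, Finset.prod_cons, zpow_add₀ (by simp), ih]

theorem capWeight_eq_prod (x : Fin N → L) (ν : τ.Lab N) :
    capWeight x ν = (-1) ^ (∑ i : Fin N, ((i : ℤ) + 1)) *
      (∏ i, ∏ j, if ν.1 i < ν.1 j then x j - x i else 1)⁻¹ := by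
  rw [← prod_Ioi_mul fun i => by simp, capWeight, weight, zpow_add₀ (by simp), mul_div_assoc]
  simp only [mul_one]
  congr 1
  rw [← inv_div, inv_inj]
  rw [div_eq_mul_inv, neg_one_zpow_sum, ← Finset.prod_inv_distrib, ← Finset.prod_mul_distrib]
  refine Finset.prod_congr rfl fun i _ => ?_
  rw [neg_one_zpow_sum, ← Finset.prod_inv_distrib, ← Finset.prod_mul_distrib]
  refine Finset.prod_congr rfl fun j _ => ?_
  unfold Lab.sep Lab.ltn
  rcases lt_trichotomy (ν.1 i) (ν.1 j) with h | h | h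
  · simp [h, h.ne, h.not_gt]
  · simp [h]
  · simp [h, h.ne', h.not_gt]

theorem MergeTree.Refine.capWeight_lab (ρ : Refine σ τ) (hx : x.Injective) (ν : τ.Lab N) :
    capWeight x ν / capWeight x (ρ.lab ν) = (ρ.euler x ν)⁻¹ := by
  have h0 : ∀ i j, x i = x j → i = j := fun i j => @hx i j
  rw [div_eq_iff (capWeight_ne_zero hx _), capWeight_eq_prod, capWeight_eq_prod, mul_left_comm,
    ← mul_inv, euler, ← Finset.prod_mul_distrib]
  congr 2
  refine Finset.prod_congr rfl fun i _ => ?_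
  rw [← Finset.prod_mul_distrib]
  refine Finset.prod_congr rfl fun j _ => ?_
  simp only [lab, collapse]
  split_ifs <;> first | omega | simp

theorem prod_Ioi_perm {n : ℕ} (π : Equiv.Perm (Fin n)) {g : Fin n → Fin n → L}
    (hg : ∀ i j, i ≠ j → g i j = g j i) :
    ∏ i, ∏ j ∈ Finset.Ioi i, g (π i) (π j) = ∏ i, ∏ j ∈ Finset.Ioi i, g i j := by
  rw [Finset.prod_sigma', Finset.prod_sigma']
  refine Finset.prod_nbij' (fun z => ⟨π z.1 ⊓ π z.2, π z.1 ⊔ π z.2⟩)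
    (fun z => ⟨π.symm z.1 ⊓ π.symm z.2, π.symm z.1 ⊔ π.symm z.2⟩) ?_ ?_ ?_ ?_ ?_
  · rintro ⟨i, j⟩ h
    have h : i < j := by simpa using h
    simp [h.ne']
  · rintro ⟨i, j⟩ h
    have h : i < j := by simpa using h
    simp [h.ne']
  · rintro ⟨i, j⟩ h
    have h : i < j := by simpa using h
    rcases le_total (π i) (π j) with h' | h' <;> simp [h', h.le]
  · rintro ⟨i, j⟩ h
    have h : i < j := by simpa using h
    rcases le_total (π.symm i) (π.symm j) with h' | h'
    · simp only [inf_eq_left.2 h', sup_eq_right.2 h', Equiv.apply_symm_apply, min_eq_left h.le,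
        max_eq_right h.le]
    · simp only [inf_eq_right.2 h', sup_eq_left.2 h', Equiv.apply_symm_apply, min_eq_right h.le,
        max_eq_left h.le]
  · rintro ⟨i, j⟩ h
    have h : i < j := by simpa using h
    rcases le_total (π i) (π j) with h' | h'
    · simp [h']
    · simp only [inf_eq_right.2 h', sup_eq_left.2 h']
      exact hg _ _ (π.injective.ne h.ne)

theorem weight_eq_prod (m : Fin N → ℤ) (b t : Fin N → Fin N → ℤ) :
    weight x m b t = (∏ i, (-1) ^ m i) *
      ∏ i, ∏ j ∈ Finset.Ioi i, (-1) ^ (t i j + m j) * (x i - x j) ^ (-b i j) := by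
  have hs : ∑ i : Fin N, (i : ℤ) * m i = ∑ i : Fin N, ∑ j ∈ Finset.Ioi i, m j := by
    rw [Finset.sum_comm' (t' := Finset.univ) (s' := fun j => Finset.Iio j) fun i j => by simp]
    simp
  have hs' : ∑ i : Fin N, ((i : ℤ) + 1) * m i + ∑ i : Fin N, ∑ j ∈ Finset.Ioi i, t i j =
      ∑ i, m i + ∑ i : Fin N, ∑ j ∈ Finset.Ioi i, (t i j + m j) := by
    simp only [add_mul, one_mul, Finset.sum_add_distrib, hs]
    ring
  rw [weight, hs', zpow_add₀ (by simp), mul_div_assoc]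
  congr 1
  · rw [neg_one_zpow_sum]
  · rw [neg_one_zpow_sum, ← Finset.prod_div_distrib]
    refine Finset.prod_congr rfl fun i _ => ?_
    rw [neg_one_zpow_sum, ← Finset.prod_div_distrib]
    exact Finset.prod_congr rfl fun j _ => by rw [zpow_neg, div_eq_mul_inv]

theorem weight_perm (π : Perm (Fin N)) {m m' : Fin N → ℤ} {b b' t t' : Fin N → Fin N → ℤ}
    (hm : ∀ i, m' (π i) = m i) (hb : ∀ i j, b' (π i) (π j) = b i j)
    (ht : ∀ i j, t' (π i) (π j) = t i j) (hsymm : ∀ i j, b i j = b j i)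
    (heven : ∀ i j, Even (b i j + m i + m j + t i j + t j i)) :
    weight x m' b' t' = weight (x ∘ π) m b t := by
  rw [weight_eq_prod, weight_eq_prod, ← Equiv.prod_comp π]
  congr 1
  · simp only [hm]
  · rw [← prod_Ioi_perm π]
    · simp only [hm, hb, ht, Function.comp_apply]
    · intro i j _
      obtain ⟨i, rfl⟩ := π.surjective i
      obtain ⟨j, rfl⟩ := π.surjective j
      rw [hm, hm, hb, hb, ht, ht, hsymm j i, ← neg_sub (x (π i)) (x (π j)),
        neg_eq_neg_one_mul (x (π i) - x (π j)), mul_zpow, ← mul_assoc, ← zpow_add₀ (by simp)]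
      congr 1
      have h := heven i j
      rw [← sub_eq_zero, sub_eq_zero]
      have h2 : Even (t i j + m j - (t j i + m i + -b i j)) := by
        obtain ⟨a, ha⟩ := h
        exact ⟨a - t j i - m i, by linarith⟩
      rw [show t i j + m j = (t i j + m j - (t j i + m i + -b i j)) + (t j i + m i + -b i j) by ring,
        zpow_add₀ (by simp), h2.neg_one_zpow, one_mul]

theorem decoration_perm (π : Perm (Fin N)) {w : ℕ}
    (p : SymPoly w) (s : Finset (Fin N)) (h : s.card = w)
    (h' : (s.map π.toEmbedding).card = w) :
    decoration x p (s.map π.toEmbedding) h' = decoration (x ∘ π) p s h := by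
  let e : Fin w ≃ Fin w := (s.orderIsoOfFin h).toEquiv.trans
    ((π.subtypeEquiv fun i => (Finset.mem_map' π.toEmbedding).symm).trans
      ((s.map π.toEmbedding).orderIsoOfFin h').symm.toEquiv)
  have he : ∀ i, (s.map π.toEmbedding).orderEmbOfFin h' (e i) = π (s.orderEmbOfFin h i) := fun i => by
    rw [← Finset.coe_orderIsoOfFin_apply]
    simp [e]
  have hp : MvPolynomial.rename e p.1 = p.1 := p.2 e
  unfold decoration
  conv_lhs => rw [← hp]
  rw [MvPolynomial.aeval_rename]
  congr 2
  funext i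
  exact congrArg x (he i)

theorem map_decoration {L' : Type*} [Field L'] (g : L →+* L') {w : ℕ}
    (p : SymPoly w) (s : Finset (Fin N)) (h : s.card = w) :
    g (decoration x p s h) = decoration (g ∘ x) p s h :=
  MvPolynomial.comp_aeval_apply (φ := g.toIntAlgHom) _ _

theorem map_weight {L' : Type*} [Field L'] (g : L →+* L') (m : Fin N → ℤ) (b t) :
    g (weight x m b t) = weight (g ∘ x) m b t := by
  simp [weight, map_prod]

namespace Foam

variable {Γ₀ Γ₁ Γ₂ : Web}

/-- Renaming the pigments. -/
def Coloring.perm {F : Foam Γ₀ Γ₁} (κ : Coloring N F) (π : Perm (Fin N)) : Coloring N F where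
  c := fun d => (κ.c d).map π.toEmbedding
  card := fun d => (Finset.card_map _).trans (κ.card d)
  next := fun d => congrArg _ (κ.next d)
  reg := fun r => congrArg _ (κ.reg r)
  disj := fun s => (Finset.disjoint_map _).2 (κ.disj s)
  seam := fun s => by rw [κ.seam, Finset.map_union]

theorem Coloring.mem_perm {F : Foam Γ₀ Γ₁} {κ : Coloring N F} {π : Perm (Fin N)} {i : Fin N}
    {d : F.Sd} : π i ∈ (κ.perm π).c d ↔ i ∈ κ.c d := Finset.mem_map' π.toEmbedding

theorem Coloring.perm_perm {F : Foam Γ₀ Γ₁} (κ : Coloring N F) (π π' : Perm (Fin N)) :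
    (κ.perm π).perm π' = κ.perm (π' * π) := Coloring.ext_c fun _ => Finset.map_map _ _ _

theorem Coloring.perm_one {F : Foam Γ₀ Γ₁} (κ : Coloring N F) : κ.perm 1 = κ :=
  Coloring.ext_c fun _ => Finset.map_refl

theorem value_perm {F : Foam Web.empty Web.empty} (hF : F.IsFoam N) (κ : Coloring N F)
    (π : Perm (Fin N)) : (κ.perm π).value x = κ.value (x ∘ π) := by
  rw [Coloring.value_eq, Coloring.value_eq]
  congr 1
  · refine weight_perm π (fun i => ?_) (fun i j => ?_) (fun i j => ?_) (fun i j => ?_) fun i j => ?_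
    · simp only [Coloring.mono, Coloring.mem_perm]
    · simp only [Coloring.bi, Coloring.mem_perm]
    · exact congrArg Nat.cast (Nat.card_congr (Quot.congr (Equiv.subtypeEquivRight fun s =>
        and_congr Coloring.mem_perm Coloring.mem_perm) fun _ _ => Iff.rfl))
    · simp only [Coloring.bi, xor_comm]
    · have h := hF.even_inter_add_theta κ i j
      have hb := hF.bi_eq κ i j
      obtain ⟨a, ha⟩ := hF.even_mono κ i
      obtain ⟨b, hb'⟩ := hF.even_mono κ j
      obtain ⟨c, hc⟩ := h
      exact ⟨a + b - κ.inter i j + c, by omega⟩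
  · exact finprod_congr fun d => decoration_perm π _ _ (κ.card d) _

theorem map_value {L' : Type*} [Field L'] (g : L →+* L') {F : Foam Web.empty Web.empty}
    (κ : Coloring N F) : g (κ.value x) = κ.value (g ∘ x) := by
  have : Finite F.R := F.finR
  have : Finite F.S := F.finS
  rw [Coloring.value_eq, Coloring.value_eq, map_mul, map_weight]
  congr 1
  unfold Coloring.decor
  have : Fintype F.Sd := Fintype.ofFinite _
  rw [finprod_eq_prod_of_fintype, finprod_eq_prod_of_fintype, map_prod]
  exact Finset.prod_congr rfl fun d _ => map_decoration g _ _ _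

end Foam

namespace MergeTree.Lab

variable (ν : τ.Lab N) (π : Perm (Fin N))

/-- Renaming the pigments. -/
def perm : τ.Lab N :=
  ⟨fun i => ν.1 (π.symm i), fun p => by
    rw [← ν.card_set p, ← Finset.card_map (s := ν.set p) π.toEmbedding]
    congr 1
    ext i
    rw [Finset.mem_map_equiv, Lab.mem_set]
    simp⟩

theorem perm_set (p : τ.Pos) : (ν.perm π).set p = (ν.set p).map π.toEmbedding := by
  ext i
  rw [Lab.mem_set, Finset.mem_map_equiv, Lab.mem_set]
  rfl

theorem perm_perm (π' : Perm (Fin N)) : (ν.perm π).perm π' = ν.perm (π' * π) :=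
  rfl

theorem perm_one : ν.perm 1 = ν := rfl

theorem exists_perm_eq (hN : τ.size = N) (ν ν' : τ.Lab N) : ∃ π, ν.perm π = ν' := by
  have h : ∀ t, Nonempty ({i // ν.1 i = t} ≃ {i // ν'.1 i = t}) := fun t => by
    rw [← Fintype.card_eq]
    by_cases ht : t < τ.leaves.length
    · obtain ⟨p, hp, hpt⟩ := τ.exists_leaf t ht
      have key : ∀ ξ : τ.Lab N, Fintype.card {i // ξ.1 i = t} = τ.wt p := fun ξ => by
        rw [← ξ.card_set p, Fintype.card_subtype]
        congr 1
        ext i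
        rw [Lab.mem_set, over_leaf hp, hpt]
        simp
      rw [key, key]
    · have key : ∀ ξ : τ.Lab N, IsEmpty {i // ξ.1 i = t} := fun ξ =>
        ⟨fun i => ht (i.2 ▸ ξ.lt_length hN i.1)⟩
      have := key ν
      have := key ν'
      rw [Fintype.card_eq_zero, Fintype.card_eq_zero]
  refine ⟨Equiv.ofFiberEquiv fun t => (h t).some, Subtype.ext (funext fun i => ?_)⟩
  obtain ⟨i, rfl⟩ := (Equiv.ofFiberEquiv fun t => (h t).some).surjective i
  refine Eq.trans ?_ (Equiv.ofFiberEquiv_map (fun t => (h t).some) i).symm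
  exact congrArg ν.1 (Equiv.symm_apply_apply _ _)

end MergeTree.Lab

section Perm

variable {F : Foam Web.empty τ.web} {ν : τ.Lab N} (π : Perm (Fin N))

/-- Renaming the pigments. -/
def permCol (κ : ColTop F ν) : ColTop F (ν.perm π) :=
  ⟨κ.1.perm π, fun e => (congrArg _ (κ.2 e)).trans (ν.perm_set π e.1).symm⟩

theorem permCol_bijective : Function.Bijective (permCol π (F := F) (ν := ν)) := by
  constructor
  · intro κ κ' h
    have h := congrArg (fun η => Coloring.perm η.1 π⁻¹) h
    simp only [permCol, Coloring.perm_perm, inv_mul_cancel, Coloring.perm_one] at h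
    exact Subtype.ext h
  · rintro ⟨κ, hκ⟩
    refine ⟨⟨κ.perm π⁻¹, fun e => ?_⟩, Subtype.ext ?_⟩
    · change (κ.c _).map _ = _
      rw [hκ, ← Lab.perm_set, Lab.perm_perm, inv_mul_cancel, Lab.perm_one]
    · simp only [permCol, Coloring.perm_perm, mul_inv_cancel, Coloring.perm_one]

theorem left_join {G : Foam τ.web Web.empty} (κ : ColTop F ν) (κ' : ColBot G ν) :
    (gluing F G).left (join κ κ') = κ.1 := left_glue _ _ _

theorem right_join {G : Foam τ.web Web.empty} (κ : ColTop F ν) (κ' : ColBot G ν) :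
    (gluing F G).right (join κ κ') = κ'.1 := right_glue _ _ _

theorem capValue_permCol (hpos : τ.Positive) (hN : τ.size = N) (hF : F.IsFoam N)
    (κ : ColTop F ν) : capValue x (permCol π κ) = capValue (x ∘ π) κ := by
  have hC := counit_isFoam (τ := τ) (m := fun _ => 1) hpos hN.le
  rw [capValue, capValue, ← value_perm (hF.glue hC)]
  congr 1
  refine glueColoringEquiv.injective (Subtype.ext (Prod.ext ?_ ?_))
  · exact (left_join _ _).trans (congrArg (Coloring.perm · π) (left_join κ _)).symm
  · refine (right_join _ _).trans (Eq.trans ?_ (congrArg (Coloring.perm · π) (right_join κ _)).symm)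
    let ξ : ColBot (τ.dottedCounit fun _ => 1) (ν.perm π) := ⟨(counitCol ν fun _ => 1).1.perm π,
      fun e => (congrArg _ ((counitCol ν fun _ => 1).2 e)).trans (ν.perm_set π e.1).symm⟩
    exact congrArg Subtype.val (Unique.default_eq ξ)

theorem capWeight_perm (hpos : τ.Positive) (hN : τ.size = N) :
    capWeight x (ν.perm π) = capWeight (x ∘ π) ν := by
  rw [capWeight_eq hpos hN, capWeight_eq hpos hN,
    ← capValue_permCol π hpos hN (unit_isFoam hpos hN.le)]
  exact congrArg _ (Unique.default_eq _)

theorem comp_perm (hpos : τ.Positive) (hN : τ.size = N) (hF : F.IsFoam N) :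
    comp x (ν.perm π) F = comp (x ∘ π) ν F := by
  rw [comp, comp, capWeight_perm π hpos hN,
    ← finsum_eq_of_bijective _ (permCol_bijective π) fun _ => rfl]
  congr 1
  exact finsum_congr fun κ => capValue_permCol π hpos hN hF κ

theorem map_comp {L' : Type*} [Field L'] (g : L →+* L') : g (comp x ν F) = comp (g ∘ x) ν F := by
  rw [comp, comp, map_div₀, capWeight, map_weight]
  congr 1
  have : Fintype (ColTop F ν) := Fintype.ofFinite _
  rw [finsum_eq_sum_of_fintype, finsum_eq_sum_of_fintype, map_sum]
  exact Finset.sum_congr rfl fun κ _ => map_value g _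

end Perm

theorem MergeTree.Refine.euler_perm (ρ : Refine σ τ) (ν : τ.Lab N) (π : Perm (Fin N)) :
    ρ.euler x (ν.perm π) = ρ.euler (x ∘ π) ν := by
  rw [euler, euler, ← Equiv.prod_comp π]
  refine Finset.prod_congr rfl fun i _ => ?_
  rw [← Equiv.prod_comp π]
  simp [Lab.perm]

theorem MergeTree.Refine.map_euler {L' : Type*} [Field L'] (g : L →+* L') (ρ : Refine σ τ)
    (ν : τ.Lab N) : g (ρ.euler x ν) = ρ.euler (g ∘ x) ν := by
  simp only [euler, map_prod, apply_ite g, map_sub, map_one, Function.comp_apply]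

theorem MergeTree.Refine.lab_perm (ρ : Refine σ τ) (ν : τ.Lab N) (π : Perm (Fin N)) :
    ρ.lab (ν.perm π) = (ρ.lab ν).perm π := rfl

theorem decoration_esymm {w : ℕ} (s : Finset (Fin N)) (h : s.card = w) (n : ℕ) :
    decoration x ⟨MvPolynomial.esymm (Fin w) ℤ n, MvPolynomial.esymm_isSymmetric _ _ n⟩ s h =
      (s.val.map x).esymm n := by
  unfold decoration
  rw [MvPolynomial.aeval_esymm_eq_multiset_esymm]
  congr 1
  have : s.val = Finset.univ.val.map (s.orderEmbOfFin h) := by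
    conv_lhs => rw [← s.map_orderEmbOfFin_univ h]
    rfl
  rw [this, Multiset.map_map]
  rfl

theorem eq_of_decoration_eq (hx : x.Injective) {w : ℕ} {s s' : Finset (Fin N)} {h : s.card = w}
    {h' : s'.card = w} (H : ∀ p, decoration x p s h = decoration x p s' h') : s = s' := by
  have h1 : ∀ n, (s.val.map x).esymm n = (s'.val.map x).esymm n := fun n => by
    rw [← decoration_esymm s h, H, decoration_esymm]
  have h2 := Multiset.prod_X_add_C_eq_sum_esymm (s.val.map x)
  have h3 := Multiset.prod_X_add_C_eq_sum_esymm (s'.val.map x)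
  simp only [Multiset.card_map, Finset.card_val, h, h', h1] at h2 h3
  have h4 := congrArg Polynomial.roots (h2.trans h3.symm)
  have key : ∀ m : Multiset L, (m.map fun r => Polynomial.X + Polynomial.C r).prod.roots =
      m.map fun r => -r := fun m => by
    have := Polynomial.roots_multiset_prod_X_sub_C (m.map fun r => -r)
    rw [Multiset.map_map] at this
    simpa using this
  rw [key, key, Multiset.map_map, Multiset.map_map] at h4
  exact Finset.val_injective (Multiset.map_injective (neg_injective.comp hx) h4)

namespace MergeTree.Lab

/-- The evaluation of dots at a labelling. -/
def char (x : Fin N → L) (ν : τ.Lab N) :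
    (∀ p, SymPoly (τ.wt p)) →* L where
  toFun m := ∏ᶠ p, decoration x (m p) (ν.set p) (ν.card_set p)
  map_one' := finprod_eq_one_of_forall_eq_one fun _ => map_one _
  map_mul' m m' := by
    rw [← finprod_mul_distrib (Set.toFinite _) (Set.toFinite _)]
    exact finprod_congr fun _ => map_mul _ _ _

theorem char_injective (hx : x.Injective) (hN : τ.size = N) :
    Function.Injective (char x : τ.Lab N → _) := fun ν ν' h => by
  classical
  refine ext_set hN fun p _ => eq_of_decoration_eq hx (h := ν.card_set p) (h' := ν'.card_set p)
    fun s => ?_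
  have key : ∀ ξ : τ.Lab N, char x ξ (Function.update 1 p s) =
      decoration x s (ξ.set p) (ξ.card_set p) := fun ξ => by
    refine (finprod_eq_single _ p fun p' hp => ?_).trans ?_
    · rw [Function.update_of_ne hp]
      exact map_one _
    · rw [Function.update_self]
  rw [← key, h, key]

theorem comp_dottedUnit_eq_char (hx : x.Injective) (hpos : τ.Positive) (hN : τ.size = N)
    (ν : τ.Lab N) (m) : comp x ν (τ.dottedUnit m) = ν.char x m := comp_dottedUnit hx hpos hN ν m

variable {a : Composition N}

/-- The labelling by the blocks of a composition. -/
def blockLab (a : Composition N) (ha : τ.leaves = a.blocks) : τ.Lab N :=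
  ⟨fun i => a.index i, fun p => by
    induction p using pos_induction with
    | h p hp =>
      have hw := τ.wt_leaf p hp
      rw [ha, List.getElem?_eq_some_iff] at hw
      obtain ⟨hl, hw⟩ := hw
      have h1 : ∀ i, τ.Over (a.index i) p ↔ i ∈ Set.range (a.embedding ⟨τ.lo p, hl⟩) := fun i => by
        rw [over_leaf hp, a.mem_range_embedding_iff', Fin.ext_iff, eq_comm]
      simp only [h1]
      rw [← hw]
      classical
      refine Eq.trans ?_ (Fintype.card_fin (a.blocksFun ⟨τ.lo p, hl⟩))
      rw [← Set.card_range_of_injective (a.embedding ⟨τ.lo p, hl⟩).injective, Fintype.card_subtype]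
    | hn q h0 h1 =>
      rw [wt_above, ← h0, ← h1, ← Finset.card_union_of_disjoint]
      · congr 1
        ext i
        simp [over_above]
      · rw [Finset.disjoint_left]
        intro i hi hi'
        exact (not_over_both (Finset.mem_filter.1 hi).2 (Finset.mem_filter.1 hi').2).false⟩

theorem monotone_index (a : Composition N) : Monotone fun i => (a.index i : ℕ) := fun i j h => by
  by_contra! hc
  have h1 := a.lt_sizeUpTo_index_succ j
  have h2 := a.sizeUpTo_index_le i
  have h3 := a.monotone_sizeUpTo (show (a.index j : ℕ) + 1 ≤ a.index i from hc)
  exact absurd (Fin.le_def.1 h) (by simp only [Fin.val_succ] at h1; omega)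

theorem lab_blockLab {b a : Composition N} (hb : σ.leaves = b.blocks)
    (ha : τ.leaves = a.blocks) (hN : σ.size = N) (ρ : Refine σ τ) :
    ρ.lab (blockLab a ha) = blockLab b hb := by
  obtain ⟨π, hπ⟩ := exists_perm_eq hN (ρ.lab (blockLab a ha)) (blockLab b hb)
  have h1 : Monotone ((ρ.lab (blockLab a ha)).1 ∘ (1 : Perm (Fin N))) := fun i j h => by
    have : (a.index i : ℕ) ≤ a.index j := monotone_index a h
    change Refine.collapse ρ (a.index i) ≤ Refine.collapse ρ (a.index j)
    unfold Refine.collapse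
    split_ifs <;> omega
  have h2 : Monotone ((ρ.lab (blockLab a ha)).1 ∘ π.symm) :=     (congrArg Monotone (congrArg Subtype.val hπ)).mpr (monotone_index b)
  refine Subtype.ext ((Tuple.unique_monotone h1 h2).trans ?_)
  exact congrArg Subtype.val hπ

theorem perm_blockLab_eq_iff (ha : τ.leaves = a.blocks) {π : Perm (Fin N)} :
    (blockLab a ha).perm π = blockLab a ha ↔ π ∈ parabolic a := by
  constructor
  · intro h i
    have := congrFun (congrArg Subtype.val h) (π i)
    change (a.index (π.symm (π i)) : ℕ) = a.index (π i) at this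
    rw [Equiv.symm_apply_apply] at this
    exact Fin.ext this.symm
  · intro h
    refine Subtype.ext (funext fun i => ?_)
    have := h (π.symm i)
    rw [Equiv.apply_symm_apply] at this
    exact congrArg Fin.val this.symm

theorem parabolic_le {b a : Composition N} (hb : σ.leaves = b.blocks) (ha : τ.leaves = a.blocks)
    (hN : σ.size = N) (ρ : Refine σ τ) : parabolic a ≤ parabolic b := fun π hπ => by
  rw [← perm_blockLab_eq_iff hb, ← lab_blockLab hb ha hN ρ, ← Refine.lab_perm,
    (perm_blockLab_eq_iff ha).2 hπ]

end MergeTree.Lab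

/-! ### The Galois action -/

section Galois

variable {k K : Type*} [Field k] [Field K] [Algebra k K]

/-- The automorphisms are the permutations of the roots. -/
structure SymmetricGalois (k : Type*) {K : Type*} [Field k] [Field K] [Algebra k K]
    (α : Fin N → K) : Prop where
  inj : α.Injective
  exists_perm : ∀ g : K ≃ₐ[k] K, ∃ π : Perm (Fin N), ∀ i, g (α i) = α (π i)
  exists_aut : ∀ π : Perm (Fin N), ∃ g : K ≃ₐ[k] K, ∀ i, g (α i) = α (π i)

open Polynomial in
theorem symmetricGalois {f : k[X]} (hsep : f.Separable) (hsplit : f.IsSplittingField k K)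
    {α : Fin N → K} (hα : f.map (algebraMap k K) = ∏ i, (X - C (α i)))
    (hGal : Nonempty ((K ≃ₐ[k] K) ≃* Perm (Fin N))) : SymmetricGalois k α := by
  have inj : α.Injective := separable_prod_X_sub_C_iff.1 (hα ▸ hsep.map)
  have hroot : ∀ y, (f.map (algebraMap k K)).eval y = 0 ↔ ∃ i, α i = y := fun y => by
    rw [hα, eval_prod, Finset.prod_eq_zero_iff]
    simp [sub_eq_zero, eq_comm]
  have hex : ∀ g : K ≃ₐ[k] K, ∃ π : Perm (Fin N), ∀ i, g (α i) = α (π i) := fun g => by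
    have : ∀ i, ∃ j, α j = g (α i) := fun i => by
      rw [← hroot, eval_map_algebraMap]
      have := (hroot (α i)).2 ⟨i, rfl⟩
      rw [eval_map_algebraMap] at this
      exact (aeval_algHom_apply g.toAlgHom (α i) f).trans ((congrArg g this).trans (map_zero g))
    choose π hπ using this
    have hinj : π.Injective := fun i j h => inj (g.injective (by rw [← hπ, ← hπ, h]))
    exact ⟨Equiv.ofBijective π (Finite.injective_iff_bijective.1 hinj), fun i => (hπ i).symm⟩
  refine ⟨inj, hex, ?_⟩
  choose P hP using hex
  have hP' : P.Injective := fun g g' h => by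
    have htop := hsplit.adjoin_rootSet
    have : (g : K →ₐ[k] K) = g' := by
      refine AlgHom.ext_of_adjoin_eq_top htop fun y hy => ?_
      rw [mem_rootSet'] at hy
      obtain ⟨i, rfl⟩ := (hroot y).1 (by rw [eval_map_algebraMap]; exact hy.2)
      exact (hP g i).trans ((congrArg (fun π : Equiv.Perm _ => α (π i)) h).trans (hP g' i).symm)
    exact AlgEquiv.ext fun y => DFunLike.congr_fun this y
  obtain ⟨e⟩ := hGal
  intro π
  have : Function.Surjective (P ∘ e.symm) :=
    Finite.surjective_of_injective (hP'.comp e.symm.injective)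
  obtain ⟨π', h⟩ := this π
  exact ⟨e.symm π', fun i => h ▸ hP _ i⟩

variable {α : Fin N → K} {ν : τ.Lab N} {F : Foam Web.empty τ.web} {g : K ≃ₐ[k] K}
  {π : Perm (Fin N)}

theorem aut_comp (hpos : τ.Positive) (hN : τ.size = N) (hF : F.IsFoam N)
    (hg : ∀ i, g (α i) = α (π i)) : g (comp α ν F) = comp α (ν.perm π) F := by
  rw [comp_perm π hpos hN hF, ← show (g : K →+* K) ∘ α = α ∘ π from funext hg]
  exact map_comp (g : K →+* K)

theorem aut_char (hα : α.Injective) (hpos : τ.Positive) (hN : τ.size = N)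
    (hg : ∀ i, g (α i) = α (π i)) (m) : g (ν.char α m) = (ν.perm π).char α m := by
  rw [← Lab.comp_dottedUnit_eq_char hα hpos hN, aut_comp hpos hN (unit_isFoam hpos hN.le) hg,
    Lab.comp_dottedUnit_eq_char hα hpos hN]

theorem aut_euler (ρ : Refine σ τ) (hg : ∀ i, g (α i) = α (π i)) :
    g (ρ.euler α ν) = ρ.euler α (ν.perm π) := by
  rw [ρ.euler_perm, ← show (g : K →+* K) ∘ α = α ∘ π from funext hg]
  exact ρ.map_euler (g : K →+* K) ν

theorem mem_parabolicField {a : Composition N} (ha : τ.leaves = a.blocks) {y : K}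
    (h : ∀ (g : K ≃ₐ[k] K) (π : Perm (Fin N)), (∀ i, g (α i) = α (π i)) →
      (Lab.blockLab a ha).perm π = Lab.blockLab a ha → g y = y) :
    y ∈ parabolicField k α a := by
  rintro ⟨g, π, hπ, hg⟩
  exact h g π hg ((Lab.perm_blockLab_eq_iff ha).2 hπ)

theorem comp_mem (hpos : τ.Positive) (hN : τ.size = N) (hF : F.IsFoam N)
    {a : Composition N} (ha : τ.leaves = a.blocks) :
    comp α (Lab.blockLab a ha) F ∈ parabolicField k α a :=
  mem_parabolicField ha fun g π hg h => by rw [aut_comp hpos hN hF hg, h]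

theorem euler_mem (ρ : Refine σ τ) {a : Composition N} (ha : τ.leaves = a.blocks) :
    ρ.euler α (Lab.blockLab a ha) ∈ parabolicField k α a :=
  mem_parabolicField ha fun g π hg h => by rw [aut_euler ρ hg, h]

variable [FiniteDimensional k K] [IsGalois k K]

theorem parabolicField_le_span (hS : SymmetricGalois k α) (hpos : τ.Positive)
    (hN : τ.size = N) {a : Composition N} (ha : τ.leaves = a.blocks) {y : K}
    (hy : y ∈ parabolicField k α a) :
    y ∈ Submodule.span k (Set.range ((Lab.blockLab a ha).char α)) := by
  set s := Set.range ((Lab.blockLab a ha).char α) with hs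
  have h1 : Submodule.span k s = Subalgebra.toSubmodule (IntermediateField.adjoin k s).toSubalgebra := by
    rw [IntermediateField.adjoin_toSubalgebra_of_isAlgebraic fun y _ => Algebra.IsAlgebraic.isAlgebraic y,
      Algebra.adjoin_eq_span]
    congr 2
    exact (Submonoid.closure_eq (MonoidHom.mrange ((Lab.blockLab a ha).char α))).symm ▸ rfl
  rw [h1]
  change y ∈ IntermediateField.adjoin k s
  rw [← IsGalois.fixedField_fixingSubgroup (IntermediateField.adjoin k s)]
  refine IntermediateField.fixedField_antitone (fun g hg => ?_) hy
  obtain ⟨π, hπ⟩ := hS.exists_perm g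
  refine ⟨π, (Lab.perm_blockLab_eq_iff ha).1 (Lab.char_injective hS.inj hN
    (MonoidHom.ext fun m => ?_)), hπ⟩
  rw [← aut_char hS.inj hpos hN hπ]
  exact (IntermediateField.mem_fixingSubgroup_iff _ _).1 hg _
    (IntermediateField.subset_adjoin k s ⟨m, rfl⟩)

end Galois

end Foams

namespace Foams

open Equiv Foam MergeTree IntermediateField

variable {N : ℕ} {σ τ : MergeTree} {k K : Type*} [Field k] [Field K] [Algebra k K] {α : Fin N → K}

/-! ### State spaces as fixed fields -/

/-- The components of linear combinations of foams. -/
def linComp (k : Type*) {K : Type*} [Field k] [Field K] [Algebra k K] (α : Fin N → K)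
    (ν : τ.Lab N) : (Below N τ.web →₀ k) →ₗ[k] K :=
  Finsupp.linearCombination k fun F : Below N τ.web => comp α ν F.1

theorem linComp_single (ν : τ.Lab N) (F : Below N τ.web) (c : k) :
    linComp k α ν (Finsupp.single F c) = c • comp α ν F.1 := Finsupp.linearCombination_single k c F

theorem aut_linComp {ν : τ.Lab N} {g : K ≃ₐ[k] K} {π : Perm (Fin N)}
    (hpos : τ.Positive) (hN : τ.size = N) (hg : ∀ i, g (α i) = α (π i)) (u) :
    g (linComp k α ν u) = linComp k α (ν.perm π) u := by
  refine (Finsupp.apply_linearCombination k g.toLinearMap _ u).trans ?_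
  exact congrArg (fun v => Finsupp.linearCombination k v u)
    (funext fun F => aut_comp hpos hN F.2 hg)

theorem linearCombination_eval (hα : α.Injective) (hpos : τ.Positive) (hN : τ.size = N)
    (G : Above N τ.web) (u : Below N τ.web →₀ k) [Fintype (τ.Lab N)] :
    Finsupp.linearCombination k (fun F : Below N τ.web => (F.1.glue G.1).eval α) u =
      ∑ ν : τ.Lab N, capWeight α ν * linComp k α ν u * cocomp α ν G.1 := by
  induction u using Finsupp.induction_linear with
  | zero => simp
  | add u v hu hv => simp only [map_add, hu, hv, mul_add, add_mul, Finset.sum_add_distrib]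
  | single F c =>
    rw [Finsupp.linearCombination_single, eval_glue hα hpos hN F.2 G.2, finsum_eq_sum_of_fintype,
      Finset.smul_sum]
    refine Finset.sum_congr rfl fun ν _ => ?_
    rw [linComp_single, mul_smul_comm, smul_mul_assoc]

theorem mem_stateKer_iff (hS : SymmetricGalois k α) (hpos : τ.Positive)
    (hN : τ.size = N) (ν : τ.Lab N) {u : Below N τ.web →₀ k} :
    u ∈ stateKer k α τ.web ↔ linComp k α ν u = 0 := by
  have := Lab.finite (N := N) hN
  have := Fintype.ofFinite (τ.Lab N)
  simp only [stateKer, Submodule.mem_iInf, LinearMap.mem_ker,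
    linearCombination_eval hS.inj hpos hN]
  constructor
  · intro h
    have hli := (linearIndependent_monoidHom
      (∀ p, SymPoly (τ.wt p)) K).comp _
        (Lab.char_injective hS.inj hN)
    have := Fintype.linearIndependent_iff.1 hli (fun ν => capWeight α ν * linComp k α ν u)
      (funext fun m => ?_) ν
    · exact (mul_eq_zero.1 this).resolve_left (capWeight_ne_zero hS.inj ν)
    · have := h ⟨τ.dottedCounit m, counit_isFoam hpos hN.le⟩
      simp only [cocomp_dottedCounit hS.inj hpos hN] at this
      simp only [Finset.sum_apply, Pi.smul_apply, smul_eq_mul]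
      exact this
  · intro h G
    refine Finset.sum_eq_zero fun ν' _ => ?_
    obtain ⟨π, rfl⟩ := Lab.exists_perm_eq hN ν ν'
    obtain ⟨g, hg⟩ := hS.exists_aut π
    rw [← aut_linComp hpos hN hg, h, map_zero, mul_zero, zero_mul]

section Iso

variable {a : Composition N}

theorem pos_of_leaves (ha : τ.leaves = a.blocks) : τ.Positive :=
  fun _ hc => a.blocks_pos (ha ▸ hc)

theorem size_of_leaves (ha : τ.leaves = a.blocks) : τ.size = N := by
  rw [size_eq_sum, ha, a.blocks_sum]

/-- The component at the blocks, as an element of the fixed field. -/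
def fieldComp (k : Type*) {K : Type*} [Field k] [Field K] [Algebra k K]
    (α : Fin N → K) (ha : τ.leaves = a.blocks) :
    (Below N τ.web →₀ k) →ₗ[k] parabolicField k α a :=
  Finsupp.linearCombination k fun F : Below N τ.web =>
    ⟨comp α (Lab.blockLab a ha) F.1,
      comp_mem (pos_of_leaves ha) (size_of_leaves ha) F.2 ha⟩

theorem coe_fieldComp (ha : τ.leaves = a.blocks) (u) :
    (fieldComp k α ha u : K) = linComp k α (Lab.blockLab a ha) u :=
  Finsupp.apply_linearCombination k (parabolicField k α a).val.toLinearMap _ u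

variable [FiniteDimensional k K] [IsGalois k K]

theorem fieldComp_surjective (hS : SymmetricGalois k α) (ha : τ.leaves = a.blocks) :
    Function.Surjective (fieldComp k α ha) := by
  have hpos := pos_of_leaves ha
  have hN := size_of_leaves ha
  rintro ⟨y, hy⟩
  have h : Submodule.span k (Set.range ((Lab.blockLab a ha).char α)) ≤
      LinearMap.range (linComp k α (Lab.blockLab a ha)) := by
    rw [Submodule.span_le]
    rintro _ ⟨m, rfl⟩
    refine ⟨Finsupp.single ⟨τ.dottedUnit m, unit_isFoam hpos hN.le⟩ 1, ?_⟩
    exact (linComp_single _ _ _).trans ((one_smul k _).trans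
      (Lab.comp_dottedUnit_eq_char hS.inj hpos hN _ m))
  obtain ⟨u, hu⟩ := h (parabolicField_le_span hS hpos hN ha hy)
  exact ⟨u, Subtype.ext ((coe_fieldComp ha u).trans hu)⟩

/-- The state space of a theta web is the fixed field. -/
def stateIso (hS : SymmetricGalois k α) (ha : τ.leaves = a.blocks) :
    StateSpace k α τ.web ≃ₗ[k] parabolicField k α a :=
  (Submodule.quotEquivOfEq _ _ (Submodule.ext fun u => by
    rw [mem_stateKer_iff hS (pos_of_leaves ha) (size_of_leaves ha) (Lab.blockLab a ha),
      LinearMap.mem_ker, ← coe_fieldComp, ZeroMemClass.coe_eq_zero])).trans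
    ((fieldComp k α ha).quotKerEquivOfSurjective (fieldComp_surjective hS ha))

theorem stateIso_mkQ (hS : SymmetricGalois k α) (ha : τ.leaves = a.blocks) (u) :
    (stateIso hS ha ((stateKer k α τ.web).mkQ u) : K) = linComp k α (Lab.blockLab a ha) u :=
  coe_fieldComp ha u

theorem stateIso_cls (hS : SymmetricGalois k α) (ha : τ.leaves = a.blocks)
    (F : Foam Web.empty τ.web) (h : F.IsFoam N) :
    (stateIso hS ha (cls k α F h) : K) = comp α (Lab.blockLab a ha) F :=
  (stateIso_mkQ hS ha _).trans ((linComp_single _ ⟨F, h⟩ 1).trans (one_smul k _))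

end Iso

/-! ### Traces -/

section Trace

variable {a b : Composition N}

theorem parabolicField_le (hb : σ.leaves = b.blocks) (ha : τ.leaves = a.blocks)
    (ρ : Refine σ τ) : parabolicField k α b ≤ parabolicField k α a := by
  refine fixedField_antitone ?_
  rintro g ⟨π, hπ, hg⟩
  exact ⟨π, Lab.parabolic_le hb ha (size_of_leaves hb) ρ hπ, hg⟩

theorem aut_eq_of_perm_eq (ha : τ.leaves = a.blocks) {g g' : K ≃ₐ[k] K} {π π' : Perm (Fin N)}
    (hg : ∀ i, g (α i) = α (π i)) (hg' : ∀ i, g' (α i) = α (π' i))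
    (h : (Lab.blockLab a ha).perm π = (Lab.blockLab a ha).perm π') {y : K}
    (hy : y ∈ parabolicField k α a) : g y = g' y := by
  have h1 : π'⁻¹ * π ∈ parabolic a := by
    rw [← Lab.perm_blockLab_eq_iff ha, ← Lab.perm_perm, h, Lab.perm_perm, inv_mul_cancel,
      Lab.perm_one]
  have h2 : ∀ i, (g'⁻¹ * g) (α i) = α ((π'⁻¹ * π) i) := fun i => by
    apply g'.injective
    rw [hg', ← AlgEquiv.mul_apply, mul_inv_cancel_left, hg, ← Equiv.Perm.mul_apply,
      mul_inv_cancel_left]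
  have h3 : (g'⁻¹ * g) y = y := hy ⟨_, _, h1, h2⟩
  rw [← mul_inv_cancel_left g' g, AlgEquiv.mul_apply, h3]

variable [FiniteDimensional k K] [IsGalois k K]

theorem trace_eq_finsum (hS : SymmetricGalois k α) (hb : σ.leaves = b.blocks)
    (ha : τ.leaves = a.blocks) (ρ : Refine σ τ)
    (hle : parabolicField k α b ≤ parabolicField k α a) {Z : τ.Lab N → K}
    (hZ : ∀ (g : K ≃ₐ[k] K) (π : Perm (Fin N)) (ν : τ.Lab N), (∀ i, g (α i) = α (π i)) →
      g (Z ν) = Z (ν.perm π))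
    (z : extendScalars hle) (hz : (z : K) = Z (Lab.blockLab a ha)) :
    (Algebra.trace (parabolicField k α b) (extendScalars hle) z : K) =
      ∑ᶠ ν : {ν : τ.Lab N // ρ.lab ν = Lab.blockLab b hb}, Z ν.1 := by
  have hpos := pos_of_leaves ha
  have hN := size_of_leaves ha
  have := Lab.finite (N := N) hN
  have hlab := Lab.lab_blockLab hb ha (size_of_leaves hb) ρ
  let E := AlgebraicClosure K
  have hex : ∀ ν : {ν : τ.Lab N // ρ.lab ν = Lab.blockLab b hb}, ∃ (g : K ≃ₐ[k] K)
      (π : Perm (Fin N)), (∀ i, g (α i) = α (π i)) ∧ (Lab.blockLab a ha).perm π = ν.1 :=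
    fun ν => by
    obtain ⟨π, hπ⟩ := Lab.exists_perm_eq hN (Lab.blockLab a ha) ν.1
    obtain ⟨g, hg⟩ := hS.exists_aut π
    exact ⟨g, π, hg, hπ⟩
  choose g π hg hπ using hex
  have hfix : ∀ ν, ∀ y ∈ parabolicField k α b, g ν y = y := fun ν y hy => by
    refine hy ⟨g ν, π ν, ?_, hg ν⟩
    rw [← Lab.perm_blockLab_eq_iff hb, ← hlab, ← Refine.lab_perm, hπ, ν.2, hlab]
  let φ : {ν : τ.Lab N // ρ.lab ν = Lab.blockLab b hb} →
      (extendScalars hle →ₐ[parabolicField k α b] E) := fun ν =>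
    { (algebraMap K E).comp ((g ν : K →+* K).comp
        (algebraMap (extendScalars hle) K)) with
      commutes' := fun y => congrArg (algebraMap K E) (hfix ν y.1 y.2) }
  have hφ : ∀ ν y, φ ν y = algebraMap K E (g ν y) := fun ν y => rfl
  have hinj := FaithfulSMul.algebraMap_injective K E
  have hbij : Function.Bijective φ := by
    constructor
    · intro ν ν' h
      refine Subtype.ext (Lab.char_injective hS.inj hN (MonoidHom.ext fun m => ?_))
      have hm : (Lab.blockLab a ha).char α m ∈ parabolicField k α a := by
        rw [← Lab.comp_dottedUnit_eq_char hS.inj hpos hN]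
        exact comp_mem hpos hN (unit_isFoam hpos hN.le) ha
      have := hinj (DFunLike.congr_fun h ⟨_, hm⟩)
      rw [← hπ, ← hπ, ← aut_char hS.inj hpos hN (hg ν), ← aut_char hS.inj hpos hN (hg ν')]
      exact this
    · intro ψ
      obtain ⟨ψ', rfl⟩ := IsAlgClosed.surjective_domRestrict_of_isAlgebraic (E := K) ψ
      let g' : K ≃ₐ[k] K := (ψ'.restrictScalars k).restrictNormal' K
      have hg' : ∀ y, algebraMap K E (g' y) = ψ' y :=
        (ψ'.restrictScalars k).restrictNormal_commutes K
      have hmem : g' ∈ parabolicGal k α b := by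
        rw [← IntermediateField.fixingSubgroup_fixedField (parabolicGal k α b),
          IntermediateField.mem_fixingSubgroup_iff]
        exact fun y hy => hinj ((hg' y).trans (ψ'.commutes ⟨y, hy⟩))
      obtain ⟨π', hπ', hgπ⟩ := hmem
      refine ⟨⟨(Lab.blockLab a ha).perm π', ?_⟩, AlgHom.ext fun y => ?_⟩
      · rw [Refine.lab_perm, hlab, Lab.perm_blockLab_eq_iff hb]
        exact hπ'
      · rw [hφ]
        refine Eq.trans ?_ (hg' y)
        exact congrArg _ (aut_eq_of_perm_eq ha (hg _) hgπ (hπ _) y.2)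
  apply hinj
  refine (trace_eq_sum_embeddings (K := parabolicField k α b) E (x := z)).trans ?_
  have := Fintype.ofFinite {ν : τ.Lab N // ρ.lab ν = Lab.blockLab b hb}
  rw [finsum_eq_sum_of_fintype, map_sum, ← hbij.sum_comp]
  refine Finset.sum_congr rfl fun ν _ => ?_
  rw [hφ, hz, hZ _ _ _ (hg ν), hπ]

theorem stateIso_unit (hS : SymmetricGalois k α) (ha : τ.leaves = a.blocks) :
    ∃ h : τ.unit.IsFoam N, stateIso hS ha (cls k α τ.unit h) = 1 := by
  have hpos := pos_of_leaves ha
  have hN := size_of_leaves ha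
  rw [unit_eq_dottedUnit]
  refine ⟨unit_isFoam hpos hN.le, Subtype.ext ?_⟩
  rw [stateIso_cls, Lab.comp_dottedUnit_eq_char hS.inj hpos hN]
  exact map_one _

theorem exists_inducesMul (hS : SymmetricGalois k α) (ha : τ.leaves = a.blocks) :
    ∃ m, InducesMul k α τ.mul m ∧
      ∀ u v, stateIso hS ha (m u v) = stateIso hS ha u * stateIso hS ha v := by
  have hpos := pos_of_leaves ha
  have hN := size_of_leaves ha
  let m := ((LinearMap.mul k (parabolicField k α a)).compl₁₂ (stateIso hS ha).toLinearMap
    (stateIso hS ha).toLinearMap).compr₂ (stateIso hS ha).symm.toLinearMap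
  have hm : ∀ u v, stateIso hS ha (m u v) = stateIso hS ha u * stateIso hS ha v :=
    fun u v => (stateIso hS ha).apply_symm_apply _
  refine ⟨m, fun F G hF hG => ⟨(hF.union hG).glue (mul_isFoam hpos hN.le), ?_⟩, hm⟩
  apply (stateIso hS ha).injective
  refine Subtype.ext ?_
  rw [hm, stateIso_cls, comp_mul hS.inj hpos hN hF hG, ← stateIso_cls hS ha F hF,
    ← stateIso_cls hS ha G hG]
  rfl

theorem exists_induces_opening (hS : SymmetricGalois k α) (hb : σ.leaves = b.blocks)
    (ha : τ.leaves = a.blocks) (ρ : Refine σ τ)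
    (hle : parabolicField k α b ≤ parabolicField k α a) :
    ∃ T, Induces k α ρ.opening T ∧ ∀ u, stateIso hS ha (T u) =
      inclusion hle (stateIso hS hb u) := by
  have hpos := pos_of_leaves ha
  have hN := size_of_leaves ha
  let T := (stateIso hS ha).symm.toLinearMap ∘ₗ
    (inclusion hle).toLinearMap ∘ₗ (stateIso hS hb).toLinearMap
  have hT : ∀ u, stateIso hS ha (T u) = inclusion hle (stateIso hS hb u) :=
    fun u => (stateIso hS ha).apply_symm_apply _
  refine ⟨T, fun F hF => ⟨hF.glue (ρ.opening_isFoam hpos hN.le), ?_⟩, hT⟩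
  apply (stateIso hS ha).injective
  refine Subtype.ext ?_
  rw [hT, stateIso_cls, ρ.comp_opening hS.inj hpos hN hF,
    Lab.lab_blockLab hb ha (size_of_leaves hb), ← stateIso_cls hS hb F hF]
  rfl

theorem exists_induces_closing (hS : SymmetricGalois k α) (hb : σ.leaves = b.blocks)
    (ha : τ.leaves = a.blocks) (ρ : Refine σ τ)
    (hle : parabolicField k α b ≤ parabolicField k α a) :
    ∃ T, Induces k α ρ.closing T ∧ ∀ u, ∃ z : extendScalars hle,
      (z : K) * eulerClass α a ρ.idx = (stateIso hS ha u : K) ∧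
      stateIso hS hb (T u) = Algebra.trace (parabolicField k α b)
        (extendScalars hle) z := by
  have hpos := pos_of_leaves ha
  have hN := size_of_leaves ha
  have he0 : eulerClass α a ρ.idx ≠ 0 := Finset.prod_ne_zero_iff.2 fun i _ =>
    Finset.prod_ne_zero_iff.2 fun j _ => by
    split_ifs with h
    · refine sub_ne_zero.2 fun hij => ?_
      rw [hS.inj hij] at h
      omega
    · exact one_ne_zero
  have he : (eulerClass α a ρ.idx)⁻¹ ∈ parabolicField k α a := inv_mem (euler_mem ρ ha)
  let D : parabolicField k α a →ₗ[k] extendScalars hle :=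
    LinearMap.mulRight k (⟨_, he⟩ : parabolicField k α a)
  let T := (stateIso hS hb).symm.toLinearMap ∘ₗ
    ((Algebra.trace (parabolicField k α b) (extendScalars hle)).restrictScalars k) ∘ₗ
      D ∘ₗ (stateIso hS ha).toLinearMap
  have hT : ∀ u, stateIso hS hb (T u) = Algebra.trace (parabolicField k α b)
      (extendScalars hle) (D (stateIso hS ha u)) :=
    fun u => (stateIso hS hb).apply_symm_apply _
  have hD : ∀ y, (D y : K) = y * (eulerClass α a ρ.idx)⁻¹ := fun y => rfl
  refine ⟨T, fun F hF => ⟨hF.glue (ρ.closing_isFoam hpos hN.le), ?_⟩, fun u =>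
    ⟨D (stateIso hS ha u), by rw [hD, inv_mul_cancel_right₀ he0], hT u⟩⟩
  apply (stateIso hS hb).injective
  refine Subtype.ext ?_
  rw [hT, stateIso_cls, ρ.comp_closing hS.inj hpos hN hF, trace_eq_finsum hS hb ha ρ hle
    (Z := fun ν => comp α ν F * (ρ.euler α ν)⁻¹)]
  · refine finsum_congr fun ν => ?_
    rw [← ρ.capWeight_lab hS.inj, ν.2]
  · intro g π ν hg
    rw [map_mul, map_inv₀, aut_comp hpos hN hF hg, aut_euler ρ hg]
  · rw [hD, stateIso_cls]
    rfl

end Trace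

end Foams

theorem mainTheorem3 {k K : Type*} [Field k] [Field K] [Algebra k K] (N : ℕ)
    (f : Polynomial k) (hmonic : f.Monic) (hdeg : f.natDegree = N)
    (hirr : Irreducible f) (hsep : f.Separable) (hsplit : f.IsSplittingField k K)
    (α : Fin N → K)
    (hα : f.map (algebraMap k K) = ∏ i, (Polynomial.X - Polynomial.C (α i)))
    (hGal : Nonempty ((K ≃ₐ[k] K) ≃* Equiv.Perm (Fin N))) :
    ∃ Φ : ∀ (a : Composition N) (τ : Foams.MergeTree), τ.leaves = a.blocks →
        (Foams.StateSpace k α τ.web ≃ₗ[k] Foams.parabolicField k α a),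
      -- ring isomorphisms
      (∀ (a : Composition N) (τ : Foams.MergeTree) (ha : τ.leaves = a.blocks),
        (∃ h : τ.unit.IsFoam N, Φ a τ ha (Foams.cls k α τ.unit h) = 1) ∧
        (∃ m, Foams.InducesMul k α τ.mul m ∧
          ∀ u v, Φ a τ ha (m u v) = Φ a τ ha u * Φ a τ ha v)) ∧
      -- inclusions and traces
      (∀ (b a : Composition N) (σ τ : Foams.MergeTree) (hb : σ.leaves = b.blocks)
        (ha : τ.leaves = a.blocks) (ρ : Foams.MergeTree.Refine σ τ),
        ∃ hle : Foams.parabolicField k α b ≤ Foams.parabolicField k α a,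
          (∃ T, Foams.Induces k α ρ.opening T ∧
            ∀ u, Φ a τ ha (T u) = IntermediateField.inclusion hle (Φ b σ hb u)) ∧
          (∃ T, Foams.Induces k α ρ.closing T ∧
            ∀ u, ∃ z : IntermediateField.extendScalars hle,
              (z : K) * Foams.eulerClass α a ρ.idx = (Φ a τ ha u : K) ∧
              Φ b σ hb (T u) = Algebra.trace (Foams.parabolicField k α b)
                (IntermediateField.extendScalars hle) z)) := by
  have := Polynomial.IsSplittingField.finiteDimensional K f
  have := IsGalois.of_separable_splitting_field (E := K) hsep
  have hS := Foams.symmetricGalois hsep hsplit hα hGal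
  refine ⟨fun a τ ha => Foams.stateIso hS ha, fun a τ ha =>
    ⟨Foams.stateIso_unit hS ha, Foams.exists_inducesMul hS ha⟩, fun b a σ τ hb ha ρ => ?_⟩
  have hle := Foams.parabolicField_le (k := k) (α := α) hb ha ρ
  exact ⟨hle, Foams.exists_induces_opening hS hb ha ρ hle,
    Foams.exists_induces_closing hS hb ha ρ hle⟩

end
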